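/- Let $N>0$ and let $A=(a_{ij})$ be an $m\times 4$ matrix over $\mathbb Z/N$ whose rows each sum to zero. For $\lambda$ in the upper half-plane $\mathbb H$ let $M_\lambda=M_N(A)$ be the compact Riemann surface with function field $\mathbb C(z)[w_1,\dots,w_m]$, where $w_i^N=z^{\tilde a_{i1}}(z-1)^{\tilde a_{i2}}(z-\lambda)^{\tilde a_{i3}}$ and $\tilde a_{ij}\in[0,N)$ lifts $a_{ij}$; it is an abelian cover of $\mathbb{CP}^1$ with branch points $(z_1,z_2,z_3,z_4)=(0,1,\lambda,\infty)$, and the $w_i$ are chosen continuously in $\lambda$. Let $T_j$ be the deck transformation with $T_j^*w_i=\xi_N^{a_{ij}}w_i$, $\xi_N=e^{2\pi i/N}$, $j=1,\dots,4$. For $\mathbf r\in(\mathbb Z/N)^4$ let $t_j(\mathbf r)$ be the fractional part of $\tilde r_j/N$, where $\tilde r_j\in\mathbb Z$ lifts $r_j$, let $t(\mathbf r)=\sum_{j=1}^4t_j(\mathbf r)$, and let $H^{1,0}_\lambda(\mathbf r)$ be the space of holomorphic one-forms $\eta$ on $M_\lambda$ with $T_j^*\eta=\xi_N^{r_j}\eta$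 for all $j$. Let $\mathbf r\neq 0$ be in the row span of $A$ with $t(-\mathbf r)=2=t(\mathbf r)$, and put $t_j=t_j(-\mathbf r)$. Then there are families of classes $\alpha_\lambda,\beta_\lambda\in H_1(M_\lambda;\mathbb C)$, $\lambda\in\mathbb H$, invariant under parallel transport, such that the period map of $H^1(\mathbf r)$, $$\tau(\lambda)=\frac{\int_{\alpha_\lambda}\eta}{\int_{\beta_\lambda}\eta}\qquad(\lambda\in\mathbb H,\ 0\ne\eta\in H^{1,0}_\lambda(\mathbf r)),$$ is well defined on $\mathbb H$ (the spaces $H^{1,0}_\lambda(\mathbf r)$ are nonzero, the denominators do not vanish, and the quotient does not depend on $\eta$) and has the following properties. (1) $\tau$ is a Schwarz triangle map: it is the quotient of two linearly independent solutions on $\mathbb H$ of the hypergeometric equation $$\lambda(\lambda-1)f''+\big[(a+b+1)\lambda-c\big]f'+abf=0,\qquad a=t_1+t_2+t_3-1,\ b=t_3,\ c=t_1+t_3.$$ (2) $\tau$ maps $\mathbb H$ biholomorphically onto an open hyperbolic triangle in $\mathbb H$ with vertices in $\mathbb H\cup\mathbb R$ (vertices in $\mathbb R$ are ideal). As $\lambda\in\mathbb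 H$ tends to $0$, $1$ and $\infty$, $\tau(\lambda)$ tends to the three vertices $\tau(0)$, $\tau(1)$ and $\tau(\infty)$, where the angles of the triangle are $\pi\kappa$, $\pi\mu$ and $\pi\nu$ respectively, with $$\kappa=|1-t_1-t_3|,\qquad \mu=|1-t_2-t_3|,\qquad \nu=|1-t_1-t_2|.$$ -/

import Mathlib

open scoped BigOperators Topology UpperHalfPlane ComplexConjugate

noncomputable section

namespace AbelianCover

/-! ### Arithmetic data -/

/-- `t_j(r) = {r̃_j / N}`, the fractional part of `1/N` times a lift of `r_j ∈ ℤ/N` to `ℤ`.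
The indices `0, 1, 2, 3` correspond to the branch points `0, 1, λ, ∞`. -/
def tPart {N : ℕ} (r : Fin 4 → ZMod N) (j : Fin 4) : ℝ :=
  Int.fract (((r j).val : ℝ) / (N : ℝ))

/-- `t(r) = t_1(r) + t_2(r) + t_3(r) + t_4(r)`. -/
def tSum {N : ℕ} (r : Fin 4 → ZMod N) : ℝ := ∑ j, tPart r j

/-- The row span of `A` over `ℤ/N`. -/
def rowSpan {N m : ℕ} (A : Matrix (Fin m) (Fin 4) (ZMod N)) :
    Submodule (ZMod N) (Fin 4 → ZMod N) :=
  Submodule.span (ZMod N) (Set.range fun i : Fin m => fun j : Fin 4 => A i j)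

/-! ### The family of abelian covers over the upper half-plane

The branch points are `0, 1, l, ∞`, where `l` ranges over `ℍ`. The fibre
over `l` is the compact Riemann surface with function field `ℂ(z)[w_1, …, w_m]`, where
`w_i ^ N = z ^ a_{i1} (z - 1) ^ a_{i2} (z - l) ^ a_{i3}` (the factor at `∞` is omitted). -/

/-- All `(l, z, w)` with `l ∈ ℍ`, with `z` not a branch point, and with `w` satisfying the equations
`w_i ^ N = z ^ a_{i1} (z - 1) ^ a_{i2} (z - l) ^ a_{i3}`. -/
def equationLocus {N m : ℕ} (A : Matrix (Fin m) (Fin 4) (ZMod N)) :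
    Set (ℂ × ℂ × (Fin m → ℂ)) :=
  {y | 0 < y.1.im ∧ y.2.1 ≠ 0 ∧ y.2.1 ≠ 1 ∧ y.2.1 ≠ y.1 ∧
    ∀ i, y.2.2 i ^ N =
      y.2.1 ^ (A i 0).val * (y.2.1 - 1) ^ (A i 1).val * (y.2.1 - y.1) ^ (A i 2).val}

/-- The complement of the branch points in the cover of the sphere branched over `0, 1, l, ∞`.
The equations may define a disconnected curve; the choice of the algebraic functions
`w_1, …, w_m` is the choice of a connected component. It is made simultaneously for all `l ∈ ℍ`,
as the component through the point `y₀`, so that the fibres vary continuously with `l`. -/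
def openCover {N m : ℕ} (A : Matrix (Fin m) (Fin 4) (ZMod N)) (y₀ : ℂ × ℂ × (Fin m → ℂ)) (l : ℂ) :
    Set (ℂ × (Fin m → ℂ)) :=
  {p | (l, p) ∈ connectedComponentIn (equationLocus A) y₀}

/-- Exponents `(n, k)` of the monomials
`w_1 ^ n_1 ⋯ w_m ^ n_m z ^ k_1 (z - 1) ^ k_2 (z - l) ^ k_3`. -/
abbrev Exponent (m : ℕ) : Type := (Fin m → ℤ) × (Fin 3 → ℤ)

/-- The values at a point of the open curve of all the monomials
`w_1 ^ n_1 ⋯ w_m ^ n_m z ^ k_1 (z - 1) ^ k_2 (z - l) ^ k_3`, as points of `ℂ ∪ {∞}`. -/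
def monomialValues {m : ℕ} (l : ℂ) (p : ℂ × (Fin m → ℂ)) : Exponent m → OnePoint ℂ := fun e =>
  (((∏ i, p.2 i ^ e.1 i) * (p.1 ^ e.2 0 * (p.1 - 1) ^ e.2 1 * (p.1 - l) ^ e.2 2) : ℂ) : OnePoint ℂ)

/-- The compact Riemann surface `M_N(A)` with branch points `0, 1, l, ∞`. The monomials generate
its function field, they are meromorphic functions (holomorphic maps to `ℂ ∪ {∞}`), and they
separate its points, also those over the branch points. So it is homeomorphic to its image in the
product of copies of `ℂ ∪ {∞}`, and this image is the closure of that of the open curve. -/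
def cover {N m : ℕ} (A : Matrix (Fin m) (Fin 4) (ZMod N)) (y₀ : ℂ × ℂ × (Fin m → ℂ)) (l : ℂ) :
    Set (Exponent m → OnePoint ℂ) :=
  closure (monomialValues l '' openCover A y₀ l)

/-- The total space over `ℍ` of the family of compact surfaces `M_N(A)`. -/
def totalSpace {N m : ℕ} (A : Matrix (Fin m) (Fin 4) (ZMod N)) (y₀ : ℂ × ℂ × (Fin m → ℂ)) :
    Set (ℂ × (Exponent m → OnePoint ℂ)) :=
  {q | 0 < q.1.im ∧ q.2 ∈ cover A y₀ q.1}

/-- The inclusion of the fibre over `l ∈ ℍ` into the total space. -/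
def fibreInclusion {N m : ℕ} (A : Matrix (Fin m) (Fin 4) (ZMod N)) (y₀ : ℂ × ℂ × (Fin m → ℂ))
    (l : ℍ) : C(cover A y₀ l, totalSpace A y₀) where
  toFun x := ⟨((l : ℂ), x.1), l.im_pos, x.2⟩
  continuous_toFun := by fun_prop

/-- The inclusion of the complement of the points over `0, 1, l, ∞`. -/
def openInclusion {N m : ℕ} (A : Matrix (Fin m) (Fin 4) (ZMod N)) (y₀ : ℂ × ℂ × (Fin m → ℂ))
    (l : ℂ) (p : openCover A y₀ l) : cover A y₀ l :=
  ⟨monomialValues l p.1, subset_closure (Set.mem_image_of_mem _ p.2)⟩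

/-! ### Holomorphic one-forms and the eigenspaces `H^{1,0}(r)`

A one-form `η = f dz` is given by its coefficient `f` with respect to `dz` on the complement of the
points over the branch points, where `z` is a local coordinate. -/

/-- `F` is a primitive of `η = f dz` on `U`: it is continuous on `U`, and `dF = f dz`
at all points of `U` that do not lie over branch points. -/
def IsPrimitiveOn {N m : ℕ} {A : Matrix (Fin m) (Fin 4) (ZMod N)} {y₀ : ℂ × ℂ × (Fin m → ℂ)}
    {l : ℂ} (f : openCover A y₀ l → ℂ) (U : Set (cover A y₀ l)) (F : cover A y₀ l → ℂ) : Prop :=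
  ContinuousOn F U ∧
    ∀ p : openCover A y₀ l, openInclusion A y₀ l p ∈ U →
      Filter.Tendsto
        (fun q : openCover A y₀ l =>
          (F (openInclusion A y₀ l q) - F (openInclusion A y₀ l p)) / (q.1.1 - p.1.1))
        (𝓝[≠] p) (𝓝 (f p))

/-- `η = f dz` is a holomorphic one-form on the compact surface: near every point, including those
over the branch points, it has a primitive. (A continuous function which is holomorphic away from a
point is holomorphic, so the primitives are holomorphic functions.) -/
def IsHolomorphicForm {N m : ℕ} {A : Matrix (Fin m) (Fin 4) (ZMod N)}
    {y₀ : ℂ × ℂ × (Fin m → ℂ)} {l : ℂ} (f : openCover A y₀ l → ℂ) : Prop :=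
  ∀ x : cover A y₀ l, ∃ U ∈ 𝓝 x, ∃ F : cover A y₀ l → ℂ, IsPrimitiveOn f U F

/-- The primitive `N`-th root of unity `ξ_N = exp (2 π i / N)`. -/
def xi (N : ℕ) : ℂ := Complex.exp (2 * Real.pi * Complex.I / N)

/-- `H^{1,0}(r)`: the holomorphic one-forms `η` with `T_j^* η = ξ_N ^ {r_j} η` for all `j`. Here
`T_j : (z, w_i) ↦ (z, ξ_N ^ {a_{ij}} w_i)` is the deck transformation that corresponds to the
counterclockwise loop about the `j`-th branch point, so `T_j^* (f dz) = (f ∘ T_j) dz`. -/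
def H10 {N m : ℕ} (A : Matrix (Fin m) (Fin 4) (ZMod N)) (y₀ : ℂ × ℂ × (Fin m → ℂ))
    (r : Fin 4 → ZMod N) (l : ℂ) : Set (openCover A y₀ l → ℂ) :=
  {f | IsHolomorphicForm f ∧
    ∀ (j : Fin 4) (p q : openCover A y₀ l), q.1.1 = p.1.1 →
      (∀ i, q.1.2 i = xi N ^ (A i j).val * p.1.2 i) → f q = xi N ^ (r j).val * f p}

/-! ### Homology and periods -/

/-- The singular chain complex of a space with complex coefficients. -/
abbrev chains (X : Type) [TopologicalSpace X] : ChainComplex (ModuleCat.{0} ℂ) ℕ :=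
  ((AlgebraicTopology.singularChainComplexFunctor (ModuleCat.{0} ℂ)).obj
    (ModuleCat.of ℂ ℂ)).obj (TopCat.of X)

/-- The first singular homology `H_1(X; ℂ)`. -/
abbrev H1 (X : Type) [TopologicalSpace X] : ModuleCat.{0} ℂ := (chains X).homology 1

/-- The map in homology induced by a continuous map. -/
abbrev H1map {X Y : Type} [TopologicalSpace X] [TopologicalSpace Y] (φ : C(X, Y)) :
    H1 X ⟶ H1 Y :=
  HomologicalComplex.homologyMap
    (((AlgebraicTopology.singularChainComplexFunctor (ModuleCat.{0} ℂ)).obj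
      (ModuleCat.of ℂ ℂ)).map (TopCat.ofHom φ)) 1

/-- `h` is a primitive of `η = f dz` along the path `σ`: near every parameter, it is the
composition of `σ` with a primitive of `η`. -/
def IsPrimitiveAlong {N m : ℕ} {A : Matrix (Fin m) (Fin 4) (ZMod N)} {y₀ : ℂ × ℂ × (Fin m → ℂ)}
    {l : ℂ} (f : openCover A y₀ l → ℂ) (σ : C(stdSimplex ℝ (Fin 2), cover A y₀ l))
    (h : stdSimplex ℝ (Fin 2) → ℂ) : Prop :=
  ∀ s, ∃ U ∈ 𝓝 (σ s), ∃ F : cover A y₀ l → ℂ, IsPrimitiveOn f U F ∧ ∀ᶠ s' in 𝓝 s, h s' = F (σ s')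

open Classical in
/-- The integral of a holomorphic one-form along a continuous path (a singular `1`-simplex): the
increment of a primitive along the path. -/
def pathIntegral {N m : ℕ} {A : Matrix (Fin m) (Fin 4) (ZMod N)} {y₀ : ℂ × ℂ × (Fin m → ℂ)}
    {l : ℂ} (f : openCover A y₀ l → ℂ) (σ : C(stdSimplex ℝ (Fin 2), cover A y₀ l)) : ℂ :=
  if h : ∃ h, IsPrimitiveAlong f σ h then
    h.choose (stdSimplex.vertex 1) - h.choose (stdSimplex.vertex 0)
  else 0

/-- The linear extension of the path integral to singular `1`-chains. -/
def chainIntegral {N m : ℕ} {A : Matrix (Fin m) (Fin 4) (ZMod N)} {y₀ : ℂ × ℂ × (Fin m → ℂ)}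
    {l : ℂ} (f : openCover A y₀ l → ℂ) : (chains (cover A y₀ l)).X 1 ⟶ ModuleCat.of ℂ ℂ :=
  CategoryTheory.Limits.Sigma.desc fun σ =>
    ModuleCat.ofHom (pathIntegral f (TopCat.toSSetObjEquiv _ _ σ) • (LinearMap.id : ℂ →ₗ[ℂ] ℂ))

/-- `v = ∫_α η`: the number `v` is the integral of `η = f dz` over every singular `1`-cycle that
represents the homology class `α`. -/
def IsPeriod {N m : ℕ} {A : Matrix (Fin m) (Fin 4) (ZMod N)} {y₀ : ℂ × ℂ × (Fin m → ℂ)}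
    {l : ℂ} (f : openCover A y₀ l → ℂ) (α : H1 (cover A y₀ l)) (v : ℂ) : Prop :=
  ∀ c : (chains (cover A y₀ l)).cycles 1,
    (chains (cover A y₀ l)).homologyπ 1 c = α →
      chainIntegral f ((chains (cover A y₀ l)).iCycles 1 c) = v

/-- A fixed homology class, that is, a family of classes in the fibres over `ℍ` that is invariant
under parallel transport. As `ℍ` is contractible, the inclusions of the fibres into the total space
are homotopy equivalences, and parallel transport is the resulting identification. -/
def IsFlat {N m : ℕ} {A : Matrix (Fin m) (Fin 4) (ZMod N)} {y₀ : ℂ × ℂ × (Fin m → ℂ)}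
    (α : ∀ l : ℍ, H1 (cover A y₀ l)) : Prop :=
  ∀ l l' : ℍ, H1map (fibreInclusion A y₀ l) (α l) = H1map (fibreInclusion A y₀ l') (α l')

/-- `τ` is the period map on `ℍ` of `H^1(r)` with respect to the homology classes `α` and `β`:
`τ(l) = ∫_α η / ∫_β η` for every nonzero `η` in the fibre of `H^{1,0}(r)` over `l` (and there is
such an `η`), with nonvanishing denominator. -/
def IsPeriodMap {N m : ℕ} (A : Matrix (Fin m) (Fin 4) (ZMod N)) (y₀ : ℂ × ℂ × (Fin m → ℂ))
    (r : Fin 4 → ZMod N) (α β : ∀ l : ℍ, H1 (cover A y₀ l)) (τ : ℂ → ℂ) : Prop :=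
  ∀ l : ℍ, (∃ η ∈ H10 A y₀ r l, η ≠ 0) ∧
    ∀ η ∈ H10 A y₀ r l, η ≠ 0 →
      ∃ u v : ℂ, IsPeriod η (α l) u ∧ IsPeriod η (β l) v ∧ v ≠ 0 ∧ τ l = u / v

/-! ### Schwarz triangle maps and hyperbolic triangles -/

/-- `f` is a holomorphic solution on the upper half-plane of the hypergeometric differential
equation `x (x - 1) f'' + ((a + b + 1) x - c) f' + a b f = 0`. -/
def IsHypergeometricSolution (a b c : ℝ) (f : ℂ → ℂ) : Prop :=
  DifferentiableOn ℂ f UpperHalfPlane.upperHalfPlaneSet ∧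
    ∀ x ∈ UpperHalfPlane.upperHalfPlaneSet,
      x * (x - 1) * deriv (deriv f) x + ((a + b + 1) * x - c) * deriv f x + a * b * f x = 0

/-- `D` is on the upper half-plane the quotient `f / g` of two linearly independent solutions of the
hypergeometric differential equation (with `g` nowhere zero, so that `D` has values in `ℂ`). -/
def IsSchwarzMap (a b c : ℝ) (D : ℂ → ℂ) : Prop :=
  ∃ f g : ℂ → ℂ, IsHypergeometricSolution a b c f ∧ IsHypergeometricSolution a b c g ∧
    (∀ x y : ℂ, (∀ l ∈ UpperHalfPlane.upperHalfPlaneSet, x * f l + y * g l = 0) →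
      x = 0 ∧ y = 0) ∧
    ∀ l ∈ UpperHalfPlane.upperHalfPlaneSet, g l ≠ 0 ∧ D l = f l / g l

/-- A holomorphic bijection from `U` onto `V` with holomorphic inverse. -/
def IsBiholomorphic (f : ℂ → ℂ) (U V : Set ℂ) : Prop :=
  DifferentiableOn ℂ f U ∧ Set.BijOn f U V ∧
    ∃ g : ℂ → ℂ, DifferentiableOn ℂ g V ∧ Set.InvOn g f U V

/-- For distinct `p, q` in `ℍ ∪ ℝ`, the points `z` of the upper half-plane where this determinant
vanishes form the hyperbolic geodesic through `p` and `q`: the equation is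
`x |z|² + y Re z + w = 0` with real `x, y, w`, a circle centred on `ℝ` or a vertical line. The
determinant is positive on one side of the geodesic and negative on the other. -/
def geodesicForm (p q z : ℂ) : ℝ :=
  Matrix.det !![Complex.normSq z, z.re, 1; Complex.normSq p, p.re, 1; Complex.normSq q, q.re, 1]

/-- The open hyperbolic triangle in `ℍ` with vertices `p, q, s` in `ℍ ∪ ℝ` (a vertex in `ℝ` is
ideal): the points of `ℍ` that lie, for every side, strictly on the same side of the geodesic through
two vertices as the third vertex. It is empty if the vertices lie on one geodesic. -/
def hyperbolicTriangle (p q s : ℂ) : Set ℂ :=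
  {z | 0 < z.im ∧ 0 < geodesicForm q s z * geodesicForm q s p ∧
    0 < geodesicForm s p z * geodesicForm s p q ∧ 0 < geodesicForm p q z * geodesicForm p q s}

/-- The angle at `p` between the hyperbolic geodesics from `p` to `q` and from `p` to `s`. For
`p ∈ ℍ` the conformal map `z ↦ (z - p) / (z - p̄)` sends `ℍ` to the unit disc and `p` to `0`, hence
these geodesics to straight segments. For an ideal vertex `p ∈ ℝ` the angle is `0`. -/
def hyperbolicAngle (p q s : ℂ) : ℝ :=
  InnerProductGeometry.angle ((q - p) / (q - conj p)) ((s - p) / (s - conj p))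

end AbelianCover

end

open AbelianCover

noncomputable section

/-! ### Functionals on singular homology and the class of a circle. -/

namespace AbelianCover

open CategoryTheory Limits

/-! The period map is computed as a quotient of Euler integrals, and its image is found by writing
it in barycentric coordinates of a hyperbolic triangle.

The form. Since t(r) + t(-r) = 4, no r_j vanishes and all t_j = t_j(-r) lie in (0, 1). The form
z^(-t₁) (z-1)^(-t₂) (z-λ)^(-t₃) dz is a constant times a monomial in the w_i and the z - b_j.
Adjoining N-th roots of z, z-1, z-λ gives the Kummer curve X_j^N = X_0^N - b_j X_3^N, which maps
onto the compact surface; every local question is settled in its charts (`exists_chart_param`,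
`eventually_cover`). There the form is seen to be holomorphic (`monomial_mem_H10`). The quotient of
another form with the same character by it is a function of z alone, with singularities weaker than
simple poles and sublinear growth, hence constant (`H10_eq_smul`).

The periods. A locally exact form integrates to zero over the boundary of a singular 2-simplex
(`primIntegral_boundary`, by bisection as in Goursat's theorem), so integration is a functional on
H₁. A path between two branch points, run through on four sheets, closes up to a commutator loop
whose period is a nonzero multiple of the integral along the path (`PathFamily.isPeriod_loop`). The
loops vary continuously with λ, so their classes are flat. The segments from ∞ to 1 and from 0 to 1
give the Euler integrals A and B (`exists_flat_periods`).

Equation and relation. The hypergeometric equation follows by differentiating under the integral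
sign and recognizing an exact derivative (`eulerIntegral_equation`). With C the integral over (-∞,
0), the integrand continued to the lower half-plane has integral zero over the real line, which
yields a linear relation between A, B and C (`Weights.relation`).

The triangle. The quantities y₁ = Im(B Ā), y₂ = Im(C B̄) and y₃ = Im(e^(iπt₃) A C̄) are positive on
ℍ: for y₁ the corresponding double integral has a positive integrand, and λ ↦ 1 - 1/λ permutes the
three cyclically up to a common positive factor (`Weights.y₁_pos`, `Weights.y_rotate`). By the
relation they are Hermitian forms in A and B. For two suitable combinations U₁, U₂ of A and B, the
vector (|U₁|², Re U₁Ū₂, |U₂|²), which represents τ = U₁/U₂ in the Klein model, is a positive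
multiple of y₁f₁ + y₂f₂ + y₃f₃, where f₁, f₂, f₃ are constant vectors with the Gram matrix of a
triangle with the angles πμ, πκ, πν (`Weights.comb_y`, `Weights.frame`). So the y_j are homogeneous
barycentric coordinates of τ, and τ maps ℍ into the triangle.

Bijectivity. When λ tends to a real point, at least one normalized coordinate tends to 0; at 0, 1
and ∞ two of them do (`Weights.exists_tendsto_p_real`, `Weights.tendsto_p_zero`). This gives the
limits of τ at the vertices and shows that τ is proper onto the triangle. Its derivative vanishes
nowhere, because the Wronskian of U₁ and U₂ does not. A proper local biholomorphism from a connected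
set to a simply connected one is a covering with a section, hence biholomorphic
(`isBiholomorphic_of_proper`); the triangle is simply connected since it is convex in the Klein
model. -/

/-- The linear extension to singular `1`-chains of a function of singular `1`-simplices. -/
def cochain {X : Type} [TopologicalSpace X] (I : C(stdSimplex ℝ (Fin 2), X) → ℂ) :
    (chains X).X 1 ⟶ ModuleCat.of ℂ ℂ :=
  Sigma.desc fun σ =>
    ModuleCat.ofHom (I (TopCat.toSSetObjEquiv _ _ σ) • (LinearMap.id : ℂ →ₗ[ℂ] ℂ))

/-- The `i`-th face of the standard `2`-simplex. -/
def simplexFace (i : Fin 3) : C(stdSimplex ℝ (Fin 2), stdSimplex ℝ (Fin 3)) :=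
  ⟨stdSimplex.map (Fin.succAbove i), stdSimplex.continuous_map _⟩

/-- The one-simplex in a space, as an element of the singular simplicial set. -/
def simplexOf {X : Type} [TopologicalSpace X] (σ : C(stdSimplex ℝ (Fin 2), X)) :
    (TopCat.toSSet.obj (TopCat.of X)).obj (Opposite.op (SimplexCategory.mk 1)) :=
  (TopCat.toSSetObjEquiv _ _).symm σ

/-- The inclusion of the summand of the singular chains that corresponds to a simplex. -/
def generator {X : Type} [TopologicalSpace X] {n : ℕ}
    (σ : (TopCat.toSSet.obj (TopCat.of X)).obj (Opposite.op (SimplexCategory.mk n))) :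
    ModuleCat.of ℂ ℂ ⟶ (chains X).X n :=
  SSet.ιChainComplex _ σ

lemma generator_d {X : Type} [TopologicalSpace X] {n : ℕ}
    (σ : (TopCat.toSSet.obj (TopCat.of X)).obj (Opposite.op (SimplexCategory.mk (n + 1)))) :
    generator σ ≫ (chains X).d (n + 1) n =
      ∑ (i : Fin (n + 2)), (-1) ^ i.val • generator ((TopCat.toSSet.obj (TopCat.of X)).δ i σ) :=
  SSet.ιChainComplex_d _ _ _

lemma chains_hom_ext {X : Type} [TopologicalSpace X] {n : ℕ} {T : ModuleCat.{0} ℂ}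
    {f g : (chains X).X n ⟶ T} (h : ∀ σ, generator σ ≫ f = generator σ ≫ g) : f = g :=
  SSet.chainComplex_hom_ext h

lemma ι_cochain {X : Type} [TopologicalSpace X] (I : C(stdSimplex ℝ (Fin 2), X) → ℂ)
    (σ : (TopCat.toSSet.obj (TopCat.of X)).obj (Opposite.op (SimplexCategory.mk 1))) :
    generator σ ≫ cochain I =
      ModuleCat.ofHom (I (TopCat.toSSetObjEquiv _ _ σ) • (LinearMap.id : ℂ →ₗ[ℂ] ℂ)) := by
  exact Sigma.ι_desc _ _

lemma d_cochain {X : Type} [TopologicalSpace X] (I : C(stdSimplex ℝ (Fin 2), X) → ℂ)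
    (hI : ∀ σ : C(stdSimplex ℝ (Fin 3), X), I (σ.comp (simplexFace 0)) -
      I (σ.comp (simplexFace 1)) + I (σ.comp (simplexFace 2)) = 0) :
    (chains X).d 2 1 ≫ cochain I = 0 := by
  refine chains_hom_ext fun σ => ?_
  have h := generator_d (n := 1) σ
  rw [← Category.assoc, h, comp_zero, Preadditive.sum_comp, Fin.sum_univ_three]
  simp only [Preadditive.zsmul_comp, ι_cochain]
  have h2 := hI (TopCat.toSSetObjEquiv _ _ σ)
  have hf : ∀ i : Fin 3, TopCat.toSSetObjEquiv _ _ ((TopCat.toSSet.obj (TopCat.of X)).δ i σ) =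
      ContinuousMap.comp (TopCat.toSSetObjEquiv _ _ σ) (simplexFace i) := fun i => rfl
  rw [hf, hf, hf]
  ext
  simp
  linear_combination h2

/-- A cocycle factors through chains modulo boundaries, and homology is the subobject of cycles in
that quotient. -/
lemma exists_functional {X : Type} [TopologicalSpace X] (I : C(stdSimplex ℝ (Fin 2), X) → ℂ)
    (hI : ∀ σ : C(stdSimplex ℝ (Fin 3), X), I (σ.comp (simplexFace 0)) -
      I (σ.comp (simplexFace 1)) + I (σ.comp (simplexFace 2)) = 0) :
    ∃ Θ : H1 X ⟶ ModuleCat.of ℂ ℂ,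
      (chains X).homologyπ 1 ≫ Θ = (chains X).iCycles 1 ≫ cochain I := by
  refine ⟨(chains X).homologyι 1 ≫ (chains X).descOpcycles (cochain I) 2 (by simp)
    (d_cochain I hI), ?_⟩
  rw [HomologicalComplex.homology_π_ι_assoc, HomologicalComplex.p_descOpcycles]

/-- The singular `1`-simplex that winds once around the circle `ℝ / 4 ℤ`. -/
def circleSimplex : C(stdSimplex ℝ (Fin 2), AddCircle (4 : ℝ)) :=
  ⟨fun x => ((4 * x.1 1 : ℝ) : AddCircle (4 : ℝ)), by
    refine (AddCircle.continuous_mk' (4 : ℝ)).comp ?_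
    exact continuous_const.mul ((continuous_apply 1).comp continuous_subtype_val)⟩

/-- Both faces are the point 0 = 4, so the alternating sum cancels. The circumference is 4 because a
commutator loop consists of four segments of unit length. -/
lemma circleSimplex_closed :
    generator (simplexOf circleSimplex) ≫
      (chains (AddCircle (4 : ℝ))).d 1 0 = 0 := by
  have h := generator_d (n := 0) (simplexOf circleSimplex)
  have hf : ∀ i : Fin 2, TopCat.toSSetObjEquiv _ _
      ((TopCat.toSSet.obj (TopCat.of (AddCircle (4 : ℝ)))).δ i (simplexOf circleSimplex)) =
      ContinuousMap.comp circleSimplex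
        ⟨stdSimplex.map (Fin.succAbove i), stdSimplex.continuous_map _⟩ := fun i => rfl
  have : (TopCat.toSSet.obj (TopCat.of (AddCircle (4 : ℝ)))).δ 0 (simplexOf circleSimplex) =
      (TopCat.toSSet.obj (TopCat.of (AddCircle (4 : ℝ)))).δ 1 (simplexOf circleSimplex) := by
    apply (TopCat.toSSetObjEquiv _ _).injective
    rw [hf, hf]
    ext x
    obtain rfl : x = stdSimplex.vertex 0 := Subsingleton.elim (α := stdSimplex ℝ (Fin 1)) _ _
    simp only [ContinuousMap.comp_apply, ContinuousMap.coe_mk]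
    erw [stdSimplex.map_vertex, stdSimplex.map_vertex]
    change ((4 * (stdSimplex.vertex (S := ℝ) (1 : Fin 2)).1 1 : ℝ) : AddCircle (4 : ℝ)) =
      ((4 * (stdSimplex.vertex (S := ℝ) (0 : Fin 2)).1 1 : ℝ) : AddCircle (4 : ℝ))
    simp [AddCircle.coe_period]
  rw [h, Fin.sum_univ_two, this]
  simp

/-- The fundamental class of the circle `ℝ / 4 ℤ`. -/
def circleClass : H1 (AddCircle (4 : ℝ)) :=
  (chains (AddCircle (4 : ℝ))).homologyπ 1
    ((chains (AddCircle (4 : ℝ))).liftCycles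
      (generator (simplexOf circleSimplex)) 0 (by simp)
      circleSimplex_closed (1 : ℂ))

/-- This reduces a period over a loop to the increment of a primitive along one simplex. -/
lemma functional_circleClass {X : Type} [TopologicalSpace X]
    (I : C(stdSimplex ℝ (Fin 2), X) → ℂ) (Θ : H1 X ⟶ ModuleCat.of ℂ ℂ)
    (hΘ : (chains X).homologyπ 1 ≫ Θ = (chains X).iCycles 1 ≫ cochain I)
    (φ : C(AddCircle (4 : ℝ), X)) :
    Θ (H1map φ circleClass) = I (φ.comp circleSimplex) := by
  have h1 : (chains (AddCircle (4 : ℝ))).liftCycles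
      (generator (simplexOf circleSimplex)) 0 (by simp)
      circleSimplex_closed ≫ (chains (AddCircle (4 : ℝ))).homologyπ 1 ≫ H1map φ ≫ Θ =
      ModuleCat.ofHom (I (φ.comp circleSimplex) • (LinearMap.id : ℂ →ₗ[ℂ] ℂ)) := by
    rw [HomologicalComplex.homologyπ_naturality_assoc, hΘ,
      HomologicalComplex.cyclesMap_i_assoc, HomologicalComplex.liftCycles_i_assoc]
    have h2 : generator (simplexOf circleSimplex) ≫
        (((AlgebraicTopology.singularChainComplexFunctor (ModuleCat.{0} ℂ)).obj
          (ModuleCat.of ℂ ℂ)).map (TopCat.ofHom φ)).f 1 =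
        generator (simplexOf (φ.comp circleSimplex)) :=
      SSet.ι_chainComplexMap_f _ _ (TopCat.toSSet.map (TopCat.ofHom φ)) _ _
    rw [← Category.assoc, h2]
    exact ι_cochain _ _
  -- The class is the value at 1 of a morphism out of the coefficient module, so the equation of
  -- morphisms is evaluated at 1.
  have h3 := congrArg (fun g => g.hom (1 : ℂ)) h1
  simp only [ModuleCat.hom_comp, ModuleCat.hom_ofHom, LinearMap.smul_apply, LinearMap.id_apply,
    LinearMap.comp_apply, smul_eq_mul, mul_one] at h3
  exact h3

lemma H1map_congr {X Y : Type} [TopologicalSpace X] [TopologicalSpace Y] {φ ψ : C(X, Y)}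
    (h : φ.Homotopic ψ) : H1map φ = H1map ψ := by
  obtain ⟨H⟩ := h
  exact TopCat.Homotopy.congr_homologyMap_singularChainComplexFunctor
    (f := TopCat.ofHom φ) (g := TopCat.ofHom ψ) H _ 1

end AbelianCover

namespace AbelianCover

/-! ### Integration of locally exact forms along paths -/

/-- A system of local primitives on a space: `G x F` says that `F` is a primitive near `x`.
Primitives exist locally, and they are unique up to additive constants. -/
structure IsPrimitiveSystem {X : Type} [TopologicalSpace X] (G : X → (X → ℂ) → Prop) : Prop where
  exists_primitive : ∀ x, ∃ F, G x F
  add_const : ∀ x F c, G x F → G x fun y => F y + c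
  isOpen : ∀ F, IsOpen {x | G x F}
  unique : ∀ x F₁ F₂, G x F₁ → G x F₂ → ∀ᶠ y in 𝓝 x, F₁ y - F₂ y = F₁ x - F₂ x

/-- `h` is a primitive along the map `σ`. -/
def PrimAlong {X : Type} (G : X → (X → ℂ) → Prop) {S : Type*} [TopologicalSpace S]
    (σ : S → X) (h : S → ℂ) : Prop :=
  ∀ s, ∃ F, G (σ s) F ∧ ∀ᶠ s' in 𝓝 s, h s' = F (σ s')

namespace PrimAlong

variable {X : Type} {G : X → (X → ℂ) → Prop} {S S' : Type*}
  [TopologicalSpace S] [TopologicalSpace S']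

lemma comp {σ : S → X} {h : S → ℂ} (hh : PrimAlong G σ h) {κ : S' → S} (hκ : Continuous κ) :
    PrimAlong G (σ ∘ κ) (h ∘ κ) := fun s => by
  obtain ⟨F, hF, hs⟩ := hh (κ s)
  exact ⟨F, hF, hκ.continuousAt.eventually hs⟩

variable [TopologicalSpace X]

/-- Local uniqueness makes the difference locally constant, and the parameter space is connected. -/
lemma sub_eq (hG : IsPrimitiveSystem G) [PreconnectedSpace S] {σ : S → X} (hσ : Continuous σ)
    {h₁ h₂ : S → ℂ} (H₁ : PrimAlong G σ h₁) (H₂ : PrimAlong G σ h₂) (s s' : S) :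
    h₁ s - h₂ s = h₁ s' - h₂ s' := by
  have : IsLocallyConstant fun s => h₁ s - h₂ s := by
    rw [IsLocallyConstant.iff_eventually_eq]
    intro s
    obtain ⟨F₁, hF₁, e₁⟩ := H₁ s
    obtain ⟨F₂, hF₂, e₂⟩ := H₂ s
    filter_upwards [e₁, e₂, hσ.continuousAt.eventually (hG.unique _ _ _ hF₁ hF₂)] with y a b c
    rw [a, b, c, e₁.self_of_nhds, e₂.self_of_nhds]
  exact this.apply_eq_of_preconnectedSpace s s'

/-- By compactness the interval is subdivided so that one local primitive serves each piece. The
pieces are joined from left to right after correction by additive constants. -/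
lemma exists_unitInterval (hG : IsPrimitiveSystem G) {σ : unitInterval → X} (hσ : Continuous σ) :
    ∃ h, PrimAlong G σ h := by
  obtain ⟨t, t0, tm, ⟨n₀, hn₀⟩, ht⟩ := exists_monotone_Icc_subset_open_cover_unitInterval
    (c := fun F : X → ℂ => σ ⁻¹' {x | G x F}) (fun F => (hG.isOpen F).preimage hσ)
    (fun s _ => by
      obtain ⟨F, hF⟩ := hG.exists_primitive (σ s)
      exact Set.mem_iUnion.2 ⟨F, hF⟩)
  have key : ∀ n, ∃ h : unitInterval → ℂ, ∀ s ≤ t n, ∃ F, G (σ s) F ∧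
      ∀ᶠ s' in 𝓝 s, h s' = F (σ s') := by
    intro n
    induction n with
    | zero =>
      obtain ⟨F, hF⟩ := hG.exists_primitive (σ 0)
      refine ⟨fun s => F (σ s), fun s hs => ?_⟩
      have : s = 0 := le_antisymm (t0 ▸ hs) unitInterval.nonneg'
      subst this
      exact ⟨F, hF, Filter.Eventually.of_forall fun _ => rfl⟩
    | succ n ih =>
      obtain ⟨h, hh⟩ := ih
      obtain ⟨F, hF⟩ := ht n
      obtain ⟨F', hF', e'⟩ := hh (t n) le_rfl
      -- This constant makes the new primitive agree with the old one at the division point; by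
      -- uniqueness they then agree near it.
      set k : ℂ := h (t n) - F (σ (t n)) with hk
      have ht' : ∀ᶠ s in 𝓝 (t n), h s = F (σ s) + k := by
        have hFt : G (σ (t n)) F := hF ⟨le_rfl, tm (Nat.le_succ n)⟩
        filter_upwards [e', hσ.continuousAt.eventually (hG.unique _ _ _ hF' hFt)] with y a b
        rw [a, hk, e'.self_of_nhds]
        linear_combination b
      refine ⟨fun s => if s ≤ t n then h s else F (σ s) + k, fun s hs => ?_⟩
      rcases lt_trichotomy s (t n) with hlt | heq | hgt
      · obtain ⟨F₁, hF₁, e₁⟩ := hh s hlt.le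
        refine ⟨F₁, hF₁, ?_⟩
        filter_upwards [e₁, eventually_lt_nhds hlt] with y a b
        rw [if_pos b.le, a]
      · obtain ⟨F₁, hF₁, e₁⟩ := hh s heq.le
        refine ⟨F₁, hF₁, ?_⟩
        subst heq
        filter_upwards [e₁, ht'] with y a b
        split_ifs
        · exact a
        · rw [← b, a]
      · have hFs : G (σ s) F := hF ⟨hgt.le, hs⟩
        refine ⟨fun y => F y + k, hG.add_const _ _ _ hFs, ?_⟩
        filter_upwards [eventually_gt_nhds hgt] with y b
        rw [if_neg (not_le.2 b)]
  obtain ⟨h, hh⟩ := key n₀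
  exact ⟨h, fun s => hh s (by rw [hn₀ _ le_rfl]; exact unitInterval.le_one s)⟩

lemma exists_simplex (hG : IsPrimitiveSystem G) {σ : stdSimplex ℝ (Fin 2) → X}
    (hσ : Continuous σ) : ∃ h, PrimAlong G σ h := by
  obtain ⟨h, hh⟩ := exists_unitInterval hG
    (hσ.comp stdSimplexHomeomorphUnitInterval.symm.continuous)
  refine ⟨h ∘ stdSimplexHomeomorphUnitInterval, ?_⟩
  have := hh.comp stdSimplexHomeomorphUnitInterval.continuous
  convert this using 1
  ext s
  simp

end PrimAlong

open Classical in
/-- The increment along a singular `1`-simplex of a primitive. -/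
def primIntegral {X : Type} [TopologicalSpace X] (G : X → (X → ℂ) → Prop)
    (σ : C(stdSimplex ℝ (Fin 2), X)) : ℂ :=
  if h : ∃ h, PrimAlong G σ h then
    h.choose (stdSimplex.vertex 1) - h.choose (stdSimplex.vertex 0)
  else 0

/-! ### Affine paths in a simplex. -/

section Segments

variable {ι : Type*} [Fintype ι]

/-- The affine path in a simplex that joins two points. -/
def simplexSegment (a b : stdSimplex ℝ ι) : C(stdSimplex ℝ (Fin 2), stdSimplex ℝ ι) :=
  ⟨fun x => ⟨x.1 0 • a.1 + x.1 1 • b.1, convex_stdSimplex ℝ ι a.2 b.2 (x.2.1 0) (x.2.1 1)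
    (by simpa using x.2.2)⟩, by
    refine Continuous.subtype_mk ?_ _
    have h : ∀ i : Fin 2, Continuous fun x : stdSimplex ℝ (Fin 2) => x.1 i := fun i =>
      (continuous_apply i).comp continuous_subtype_val
    exact ((h 0).smul continuous_const).add ((h 1).smul continuous_const)⟩

lemma simplexSegment_vertex_zero (a b : stdSimplex ℝ ι) :
    simplexSegment a b (stdSimplex.vertex 0) = a := by
  apply Subtype.ext
  change (stdSimplex.vertex (S := ℝ) (0 : Fin 2)).1 0 • a.1 +
    (stdSimplex.vertex (S := ℝ) (0 : Fin 2)).1 1 • b.1 = a.1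
  simp

lemma simplexSegment_vertex_one (a b : stdSimplex ℝ ι) :
    simplexSegment a b (stdSimplex.vertex 1) = b := by
  apply Subtype.ext
  change (stdSimplex.vertex (S := ℝ) (1 : Fin 2)).1 0 • a.1 +
    (stdSimplex.vertex (S := ℝ) (1 : Fin 2)).1 1 • b.1 = b.1
  simp

lemma simplexSegment_comp (a b : stdSimplex ℝ ι) (u v : stdSimplex ℝ (Fin 2)) :
    (simplexSegment a b).comp (simplexSegment u v) =
      simplexSegment (simplexSegment a b u) (simplexSegment a b v) := by
  ext x i
  change (x.1 0 * u.1 0 + x.1 1 * v.1 0) * a.1 i + (x.1 0 * u.1 1 + x.1 1 * v.1 1) * b.1 i =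
    x.1 0 * (u.1 0 * a.1 i + u.1 1 * b.1 i) + x.1 1 * (v.1 0 * a.1 i + v.1 1 * b.1 i)
  ring

/-- The midpoint of the standard `1`-simplex. -/
def simplexHalf : stdSimplex ℝ (Fin 2) := ⟨fun _ => 1 / 2, fun _ => by norm_num, by simp⟩

/-- The midpoint of two points in a simplex. -/
def simplexMid (a b : stdSimplex ℝ ι) : stdSimplex ℝ ι := simplexSegment a b simplexHalf

lemma simplexMid_coe (a b : stdSimplex ℝ ι) :
    (simplexMid a b).1 = (1 / 2 : ℝ) • a.1 + (1 / 2 : ℝ) • b.1 := rfl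

lemma simplexMid_comm (a b : stdSimplex ℝ ι) : simplexMid a b = simplexMid b a := by
  apply Subtype.ext
  rw [simplexMid_coe, simplexMid_coe, add_comm]

end Segments

/-! ### Stokes' theorem for locally exact forms, by bisection. -/

section Stokes

variable {X : Type} [TopologicalSpace X] {G : X → (X → ℂ) → Prop}

lemma primIntegral_eq (hG : IsPrimitiveSystem G) {σ : C(stdSimplex ℝ (Fin 2), X)}
    {h : stdSimplex ℝ (Fin 2) → ℂ} (hh : PrimAlong G σ h) :
    primIntegral G σ = h (stdSimplex.vertex 1) - h (stdSimplex.vertex 0) := by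
  have hex : ∃ h, PrimAlong G σ h := ⟨h, hh⟩
  rw [primIntegral, dif_pos hex]
  have := PrimAlong.sub_eq hG σ.continuous hex.choose_spec hh
    (stdSimplex.vertex 1) (stdSimplex.vertex 0)
  linear_combination this

/-- The integral along the image of an affine path in a simplex. -/
def segIntegral (G : X → (X → ℂ) → Prop) {ι : Type*} [Fintype ι] (σ : C(stdSimplex ℝ ι, X))
    (a b : stdSimplex ℝ ι) : ℂ :=
  primIntegral G (σ.comp (simplexSegment a b))

variable {ι : Type*} [Fintype ι] (σ : C(stdSimplex ℝ ι, X))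

/-- One primitive along the whole segment computes all its subsegments at once, so reversal and
additivity become identities between differences. -/
lemma exists_segIntegral_eq (hG : IsPrimitiveSystem G) (a b : stdSimplex ℝ ι) :
    ∃ h : stdSimplex ℝ (Fin 2) → ℂ, ∀ u v,
      segIntegral G σ (simplexSegment a b u) (simplexSegment a b v) = h v - h u := by
  obtain ⟨h, hh⟩ := PrimAlong.exists_simplex hG (σ.comp (simplexSegment a b)).continuous
  refine ⟨h, fun u v => ?_⟩
  rw [segIntegral, ← simplexSegment_comp]
  have := hh.comp (simplexSegment u v).continuous
  rw [primIntegral_eq (σ := σ.comp ((simplexSegment a b).comp (simplexSegment u v))) hG this]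
  simp [simplexSegment_vertex_zero, simplexSegment_vertex_one]

lemma segIntegral_symm (hG : IsPrimitiveSystem G) (a b : stdSimplex ℝ ι) :
    segIntegral G σ b a = - segIntegral G σ a b := by
  obtain ⟨h, hh⟩ := exists_segIntegral_eq σ hG a b
  have h1 := hh (stdSimplex.vertex 0) (stdSimplex.vertex 1)
  have h2 := hh (stdSimplex.vertex 1) (stdSimplex.vertex 0)
  simp only [simplexSegment_vertex_zero, simplexSegment_vertex_one] at h1 h2
  rw [h1, h2]; ring

lemma segIntegral_mid (hG : IsPrimitiveSystem G) (a b : stdSimplex ℝ ι) :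
    segIntegral G σ a b = segIntegral G σ a (simplexMid a b) +
      segIntegral G σ (simplexMid a b) b := by
  obtain ⟨h, hh⟩ := exists_segIntegral_eq σ hG a b
  have h1 := hh (stdSimplex.vertex 0) (stdSimplex.vertex 1)
  have h2 := hh (stdSimplex.vertex 0) simplexHalf
  have h3 := hh simplexHalf (stdSimplex.vertex 1)
  simp only [simplexSegment_vertex_zero, simplexSegment_vertex_one] at h1 h2 h3
  rw [simplexMid, h1, h2, h3]; ring

/-- The integral around the image of an affine triangle in a simplex. -/
def triIntegral (G : X → (X → ℂ) → Prop) (p : stdSimplex ℝ ι × stdSimplex ℝ ι × stdSimplex ℝ ι) :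
    ℂ :=
  segIntegral G σ p.1 p.2.1 + segIntegral G σ p.2.1 p.2.2 + segIntegral G σ p.2.2 p.1

/-- Each outer edge splits at its midpoint, and each inner edge is traversed in both directions. -/
lemma triIntegral_subdivide (hG : IsPrimitiveSystem G) (a b c : stdSimplex ℝ ι) :
    triIntegral σ G (a, b, c) = triIntegral σ G (a, simplexMid a b, simplexMid c a) +
      triIntegral σ G (simplexMid a b, b, simplexMid b c) +
      triIntegral σ G (simplexMid c a, simplexMid b c, c) +
      triIntegral σ G (simplexMid a b, simplexMid b c, simplexMid c a) := by
  simp only [triIntegral]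
  rw [segIntegral_mid σ hG a b, segIntegral_mid σ hG b c, segIntegral_mid σ hG c a,
    segIntegral_symm σ hG (simplexMid a b) (simplexMid c a),
    segIntegral_symm σ hG (simplexMid b c) (simplexMid a b),
    segIntegral_symm σ hG (simplexMid c a) (simplexMid b c)]
  ring

/-- The diameter of a triangle in a simplex. -/
def triDiam (p : stdSimplex ℝ ι × stdSimplex ℝ ι × stdSimplex ℝ ι) : ℝ :=
  max (dist p.1 p.2.1) (max (dist p.2.1 p.2.2) (dist p.2.2 p.1))

lemma dist_mid_mid (a b c d : stdSimplex ℝ ι) :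
    dist (simplexMid a b) (simplexMid c d) ≤ 1 / 2 * dist a c + 1 / 2 * dist b d := by
  rw [Subtype.dist_eq, Subtype.dist_eq, Subtype.dist_eq, simplexMid_coe, simplexMid_coe]
  refine (dist_add_add_le _ _ _ _).trans ?_
  rw [dist_smul₀, dist_smul₀, Real.norm_of_nonneg (by norm_num : (0 : ℝ) ≤ 1 / 2)]

lemma simplexMid_self (a : stdSimplex ℝ ι) : simplexMid a a = a := by
  apply Subtype.ext
  rw [simplexMid_coe, ← add_smul]
  norm_num

/-- Goursat's bisection: if the integrals over all four quarters vanished, so would the whole. No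
lower bound on the integral is needed, because the form is exact, not merely closed to first order,
near the limit point. -/
lemma exists_subtriangle (hG : IsPrimitiveSystem G)
    (p : stdSimplex ℝ ι × stdSimplex ℝ ι × stdSimplex ℝ ι) :
    ∃ q : stdSimplex ℝ ι × stdSimplex ℝ ι × stdSimplex ℝ ι,
      (triIntegral σ G p ≠ 0 → triIntegral σ G q ≠ 0) ∧ triDiam q ≤ triDiam p / 2 ∧
      dist p.1 q.1 ≤ triDiam p := by
  obtain ⟨a, b, c⟩ := p
  have d1 := dist_mid_mid a a a b
  have d2 := dist_mid_mid b a c a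
  have d3 := dist_mid_mid c a a a
  have d4 := dist_mid_mid a b b b
  have d5 := dist_mid_mid b b b c
  have d6 := dist_mid_mid a b c b
  have d7 := dist_mid_mid a c b c
  have d8 := dist_mid_mid b c c c
  have d9 := dist_mid_mid c c c a
  rw [simplexMid_comm b a] at d2
  rw [simplexMid_comm c b] at d6
  rw [simplexMid_comm a c] at d7
  simp only [simplexMid_self, dist_self] at d1 d2 d3 d4 d5 d6 d7 d8 d9
  have e1 := dist_comm c a
  have e2 := dist_comm c b
  have e3 := dist_comm (simplexMid a b) (simplexMid b c)
  have e4 := dist_comm (simplexMid b c) (simplexMid c a)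
  have e5 := dist_comm (simplexMid c a) (simplexMid a b)
  have e6 := dist_comm a (simplexMid c a)
  have m1 : dist a b ≤ triDiam (a, b, c) := le_max_left _ _
  have m2 : dist b c ≤ triDiam (a, b, c) := (le_max_left _ _).trans (le_max_right _ _)
  have m3 : dist c a ≤ triDiam (a, b, c) := (le_max_right _ _).trans (le_max_right _ _)
  have m0 : 0 ≤ dist a b := dist_nonneg
  by_cases h1 : triIntegral σ G (a, simplexMid a b, simplexMid c a) ≠ 0
  · refine ⟨(a, simplexMid a b, simplexMid c a), fun _ => h1, ?_, ?_⟩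
    · exact max_le (by dsimp only; linarith) (max_le (by dsimp only; linarith) (by dsimp only; linarith))
    · rw [dist_self]; linarith
  by_cases h2 : triIntegral σ G (simplexMid a b, b, simplexMid b c) ≠ 0
  · refine ⟨(simplexMid a b, b, simplexMid b c), fun _ => h2, ?_, ?_⟩
    · exact max_le (by dsimp only; linarith) (max_le (by dsimp only; linarith) (by dsimp only; linarith))
    · dsimp only; linarith
  by_cases h3 : triIntegral σ G (simplexMid c a, simplexMid b c, c) ≠ 0
  · refine ⟨(simplexMid c a, simplexMid b c, c), fun _ => h3, ?_, ?_⟩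
    · refine max_le (by dsimp only; linarith) (max_le (by dsimp only; linarith) (by dsimp only; linarith))
    · dsimp only; linarith
  refine ⟨(simplexMid a b, simplexMid b c, simplexMid c a), fun h h4 => h ?_, ?_, ?_⟩
  · push Not at h1 h2 h3
    rw [triIntegral_subdivide σ hG, h1, h2, h3, h4]; ring
  · refine max_le (by dsimp only; linarith) (max_le (by dsimp only; linarith) (by dsimp only; linarith))
  · dsimp only; linarith

/-- The nested triangles converge to a point. Once they lie in a ball on which a single primitive
exists, the integral telescopes to zero, against the choice of the triangles. -/
lemma triIntegral_eq_zero (hG : IsPrimitiveSystem G)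
    (p : stdSimplex ℝ ι × stdSimplex ℝ ι × stdSimplex ℝ ι) : triIntegral σ G p = 0 := by
  by_contra hp
  choose next hnext using exists_subtriangle σ hG
  let q : ℕ → stdSimplex ℝ ι × stdSimplex ℝ ι × stdSimplex ℝ ι := fun n => next^[n] p
  have q0 : q 0 = p := rfl
  have qs : ∀ n, q (n + 1) = next (q n) := fun n => Function.iterate_succ_apply' _ _ _
  have hne : ∀ n, triIntegral σ G (q n) ≠ 0 := by
    intro n
    induction n with
    | zero => exact hp
    | succ n ih => rw [qs]; exact (hnext _).1 ih
  have hd : ∀ n, triDiam (q n) ≤ triDiam p / 2 ^ n := by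
    intro n
    induction n with
    | zero => simp [q0]
    | succ n ih =>
      rw [qs]
      refine (hnext _).2.1.trans ?_
      rw [pow_succ, ← div_div]
      linarith
  have hc : CauchySeq fun n => (q n).1 := by
    refine cauchySeq_of_le_geometric_two (C := 2 * triDiam p) fun n => ?_
    rw [qs]
    refine (hnext _).2.2.trans ((hd n).trans (le_of_eq (by ring)))
  obtain ⟨s, hs⟩ := cauchySeq_tendsto_of_complete hc
  obtain ⟨F, hF⟩ := hG.exists_primitive (σ s)
  have hN : σ ⁻¹' {x | G x F} ∈ 𝓝 s := ((hG.isOpen F).preimage σ.continuous).mem_nhds hF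
  obtain ⟨δ, hδ, hball⟩ := Metric.mem_nhds_iff.1 hN
  have seg : ∀ a b : stdSimplex ℝ ι, a ∈ Metric.ball s δ → b ∈ Metric.ball s δ →
      segIntegral G σ a b = F (σ b) - F (σ a) := by
    intro a b ha hb
    have hp : PrimAlong G (σ.comp (simplexSegment a b)) fun x => F (σ (simplexSegment a b x)) := by
      intro x
      refine ⟨F, hball ?_, Filter.Eventually.of_forall fun _ => rfl⟩
      exact (convex_ball s.1 δ) ha hb (x.2.1 0) (x.2.1 1) (by simpa using x.2.2)
    rw [segIntegral, primIntegral_eq hG hp, simplexSegment_vertex_zero, simplexSegment_vertex_one]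
  have hlim : Filter.Tendsto (fun n : ℕ => triDiam p / 2 ^ n) Filter.atTop (𝓝 0) := by
    have := (tendsto_pow_atTop_nhds_zero_of_lt_one (r := (1 / 2 : ℝ)) (by norm_num)
      (by norm_num)).const_mul (triDiam p)
    simpa [div_eq_mul_inv] using this
  obtain ⟨n, hn1, hn2⟩ := ((hs.eventually (Metric.ball_mem_nhds s (half_pos hδ))).and
    (hlim.eventually (gt_mem_nhds (half_pos hδ)))).exists
  have hdn := hd n
  have m1 : dist (q n).1 (q n).2.1 ≤ triDiam (q n) := le_max_left _ _
  have m3 : dist (q n).2.2 (q n).1 ≤ triDiam (q n) := (le_max_right _ _).trans (le_max_right _ _)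
  have b1 : (q n).1 ∈ Metric.ball s δ := by rw [Metric.mem_ball]; linarith
  have b2 : (q n).2.1 ∈ Metric.ball s δ := by
    rw [Metric.mem_ball]
    have := dist_triangle (q n).2.1 (q n).1 s
    rw [dist_comm (q n).2.1 (q n).1] at this
    linarith
  have b3 : (q n).2.2 ∈ Metric.ball s δ := by
    rw [Metric.mem_ball]
    have := dist_triangle (q n).2.2 (q n).1 s
    linarith
  apply hne n
  rw [triIntegral, seg _ _ b1 b2, seg _ _ b2 b3, seg _ _ b3 b1]
  ring

lemma simplexFace_eq (i : Fin 3) : simplexFace i =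
    simplexSegment (stdSimplex.vertex (i.succAbove 0)) (stdSimplex.vertex (i.succAbove 1)) := by
  ext x j
  change (FunOnFinite.linearMap ℝ ℝ (Fin.succAbove i) x.1) j =
    x.1 0 * (stdSimplex.vertex (S := ℝ) (i.succAbove 0)).1 j +
      x.1 1 * (stdSimplex.vertex (S := ℝ) (i.succAbove 1)).1 j
  rw [FunOnFinite.linearMap_apply_apply]
  rw [Finset.sum_filter, Fin.sum_univ_two]
  fin_cases i <;> fin_cases j <;> simp [Fin.succAbove]

/-- Stokes' theorem for a closed form and a singular `2`-simplex. -/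
lemma primIntegral_boundary (hG : IsPrimitiveSystem G) (σ : C(stdSimplex ℝ (Fin 3), X)) :
    primIntegral G (σ.comp (simplexFace 0)) - primIntegral G (σ.comp (simplexFace 1)) +
      primIntegral G (σ.comp (simplexFace 2)) = 0 := by
  have h := triIntegral_eq_zero σ hG
    (stdSimplex.vertex 0, stdSimplex.vertex 1, stdSimplex.vertex 2)
  rw [simplexFace_eq, simplexFace_eq, simplexFace_eq]
  have h2 := segIntegral_symm σ hG (stdSimplex.vertex 0) (stdSimplex.vertex 2)
  simp only [triIntegral] at h
  rw [h2] at h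
  simp only [segIntegral] at h
  change primIntegral G (σ.comp (simplexSegment (stdSimplex.vertex 1) (stdSimplex.vertex 2))) -
    primIntegral G (σ.comp (simplexSegment (stdSimplex.vertex 0) (stdSimplex.vertex 2))) +
    primIntegral G (σ.comp (simplexSegment (stdSimplex.vertex 0) (stdSimplex.vertex 1))) = 0
  linear_combination h

end Stokes

end AbelianCover

namespace AbelianCover

/-! ### The connected component of the equation locus -/

/-- The finite branch points `0, 1, l`. -/
def branchPt (l : ℂ) : Fin 3 → ℂ := ![0, 1, l]

@[simp] lemma branchPt_zero (l : ℂ) : branchPt l 0 = 0 := rfl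

@[simp] lemma branchPt_one (l : ℂ) : branchPt l 1 = 1 := rfl

@[simp] lemma branchPt_two (l : ℂ) : branchPt l 2 = l := rfl

lemma continuous_branchPt (j : Fin 3) : Continuous fun l => branchPt l j := by
  fin_cases j
  · exact continuous_const
  · exact continuous_const
  · exact continuous_id

variable {N m : ℕ}

/-- The points of the equation locus of the form `w_i = c_i ∏_j x_j ^ {a_ij}`, where the `x_j` are
arbitrary `N`-th roots of `z`, `z - 1`, `z - l`. -/
def rootLocus (A : Matrix (Fin m) (Fin 4) (ZMod N)) (c : Fin m → ℂ) :
    Set (ℂ × ℂ × (Fin m → ℂ)) :=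
  {y | 0 < y.1.im ∧ (∀ j, y.2.1 ≠ branchPt y.1 j) ∧ ∃ x : Fin 3 → ℂ,
    (∀ j, x j ^ N = y.2.1 - branchPt y.1 j) ∧
    ∀ i, y.2.2 i = c i * ∏ j : Fin 3, x j ^ (A i j.castSucc).val}

lemma mem_equationLocus {A : Matrix (Fin m) (Fin 4) (ZMod N)} {y : ℂ × ℂ × (Fin m → ℂ)} :
    y ∈ equationLocus A ↔ 0 < y.1.im ∧ (∀ j, y.2.1 ≠ branchPt y.1 j) ∧
      ∀ i, y.2.2 i ^ N = ∏ j : Fin 3, (y.2.1 - branchPt y.1 j) ^ (A i j.castSucc).val := by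
  simp only [equationLocus, Set.mem_ofPred_eq, Fin.forall_fin_succ, Fin.prod_univ_three,
    branchPt_zero, branchPt_one, branchPt_two, sub_zero]
  simp [branchPt]
  tauto

lemma rootLocus_subset {A : Matrix (Fin m) (Fin 4) (ZMod N)} {c : Fin m → ℂ}
    (hc : ∀ i, c i ^ N = 1) : rootLocus A c ⊆ equationLocus A := by
  rintro y ⟨h1, h2, x, hx, hw⟩
  refine mem_equationLocus.2 ⟨h1, h2, fun i => ?_⟩
  rw [hw, mul_pow, hc, one_mul, ← Finset.prod_pow]
  exact Finset.prod_congr rfl fun j _ => by rw [← hx, pow_right_comm]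

lemma exists_mem_rootLocus [NeZero N] {A : Matrix (Fin m) (Fin 4) (ZMod N)}
    {y : ℂ × ℂ × (Fin m → ℂ)} (hy : y ∈ equationLocus A) :
    ∃ c : Fin m → ℂ, (∀ i, c i ^ N = 1) ∧ y ∈ rootLocus A c := by
  obtain ⟨h1, h2, hw⟩ := mem_equationLocus.1 hy
  have hN : N ≠ 0 := NeZero.ne N
  set x : Fin 3 → ℂ := fun j => (y.2.1 - branchPt y.1 j) ^ ((N : ℂ)⁻¹) with hx
  have hxN : ∀ j, x j ^ N = y.2.1 - branchPt y.1 j := fun j => Complex.cpow_nat_inv_pow _ hN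
  have hx0 : ∀ j, x j ≠ 0 := fun j h => by
    have := hxN j
    rw [h, zero_pow hN] at this
    exact h2 j (sub_eq_zero.1 this.symm)
  have hp : ∀ i, ∏ j : Fin 3, x j ^ (A i j.castSucc).val ≠ 0 := fun i =>
    Finset.prod_ne_zero_iff.2 fun j _ => pow_ne_zero _ (hx0 j)
  refine ⟨fun i => y.2.2 i / ∏ j : Fin 3, x j ^ (A i j.castSucc).val, fun i => ?_, h1, h2, x, hxN,
    fun i => (div_mul_cancel₀ _ (hp i)).symm⟩
  rw [div_pow, hw, ← Finset.prod_pow]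
  rw [div_eq_one_iff_eq]
  · exact Finset.prod_congr rfl fun j _ => by rw [← hxN, pow_right_comm]
  · exact Finset.prod_ne_zero_iff.2 fun j _ => pow_ne_zero _ (pow_ne_zero _ (hx0 j))

/-- At the common point the two systems of roots differ by N-th roots of unity. Multiplying by these
ratios turns every presentation with constants c into one with c'. -/
lemma rootLocus_eq_of_inter [NeZero N] {A : Matrix (Fin m) (Fin 4) (ZMod N)} {c c' : Fin m → ℂ}
    {y : ℂ × ℂ × (Fin m → ℂ)} (h : y ∈ rootLocus A c) (h' : y ∈ rootLocus A c') :
    rootLocus A c ⊆ rootLocus A c' := by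
  obtain ⟨-, h2, x, hx, hw⟩ := h
  obtain ⟨-, -, x', hx', hw'⟩ := h'
  have hN : N ≠ 0 := NeZero.ne N
  have hx0 : ∀ j, x j ≠ 0 := fun j h => by
    have := hx j
    rw [h, zero_pow hN] at this
    exact h2 j (sub_eq_zero.1 this.symm)
  rintro q ⟨q1, q2, v, hv, hq⟩
  refine ⟨q1, q2, fun j => v j * (x' j / x j), fun j => ?_, fun i => ?_⟩
  · rw [mul_pow, div_pow, hx, hx', div_self (by rw [← hx]; exact pow_ne_zero _ (hx0 j)), hv,
      mul_one]
  · have := (hw i).symm.trans (hw' i)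
    have hp : ∏ j : Fin 3, x j ^ (A i j.castSucc).val ≠ 0 :=
      Finset.prod_ne_zero_iff.2 fun j _ => pow_ne_zero _ (hx0 j)
    rw [hq]
    simp only [mul_pow, div_pow, Finset.prod_mul_distrib, Finset.prod_div_distrib]
    field_simp
    linear_combination (∏ j : Fin 3, v j ^ (A i j.castSucc).val) * this

/-- Each root is x_j = |z - b_j|^(1/N) u_j with u_j on the circle. So the locus is the projection of
a closed set along the compact space of the u_j, and such projections are closed. -/
lemma exists_isClosed_rootLocus [NeZero N] (A : Matrix (Fin m) (Fin 4) (ZMod N)) (c : Fin m → ℂ) :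
    ∃ t : Set (ℂ × ℂ × (Fin m → ℂ)), IsClosed t ∧
      ∀ y, 0 < y.1.im → (∀ j, y.2.1 ≠ branchPt y.1 j) → (y ∈ t ↔ y ∈ rootLocus A c) := by
  have hN : N ≠ 0 := NeZero.ne N
  let ρ : (ℂ × ℂ × (Fin m → ℂ)) → Fin 3 → ℂ := fun y j =>
    ((‖y.2.1 - branchPt y.1 j‖ ^ ((N : ℝ)⁻¹) : ℝ) : ℂ)
  have hρ : ∀ j, Continuous fun y => ρ y j := fun j => by
    refine Complex.continuous_ofReal.comp (Continuous.rpow_const ?_ fun _ => Or.inr (by positivity))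
    exact ((continuous_fst.comp continuous_snd).sub
      ((continuous_branchPt j).comp continuous_fst)).norm
  let K : Set ((ℂ × ℂ × (Fin m → ℂ)) × (Fin 3 → Circle)) :=
    {q | (∀ j, (ρ q.1 j * (q.2 j : ℂ)) ^ N = q.1.2.1 - branchPt q.1.1 j) ∧
      ∀ i, q.1.2.2 i = c i * ∏ j : Fin 3, (ρ q.1 j * (q.2 j : ℂ)) ^ (A i j.castSucc).val}
  have hu : ∀ j, Continuous fun q : (ℂ × ℂ × (Fin m → ℂ)) × (Fin 3 → Circle) =>
      ρ q.1 j * (q.2 j : ℂ) := fun j =>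
    ((hρ j).comp continuous_fst).mul
      (continuous_subtype_val.comp ((continuous_apply j).comp continuous_snd))
  have hK : IsClosed K := by
    have e : K = (⋂ j, {q | (ρ q.1 j * (q.2 j : ℂ)) ^ N = q.1.2.1 - branchPt q.1.1 j}) ∩
      ⋂ i, {q | q.1.2.2 i = c i * ∏ j : Fin 3, (ρ q.1 j * (q.2 j : ℂ)) ^ (A i j.castSucc).val} := by
      ext q; simp [K]
    rw [e]
    refine IsClosed.inter (isClosed_iInter fun j => isClosed_eq ((hu j).pow N) ?_)
      (isClosed_iInter fun i => isClosed_eq ?_ ?_)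
    · exact ((continuous_fst.comp (continuous_snd.comp continuous_fst))).sub
        ((continuous_branchPt j).comp (continuous_fst.comp continuous_fst))
    · fun_prop
    · exact continuous_const.mul (continuous_finsetProd _ fun j _ => (hu j).pow _)
  refine ⟨Prod.fst '' K, isClosedMap_fst_of_compactSpace _ hK, fun y h1 h2 => ⟨?_, ?_⟩⟩
  · rintro ⟨⟨y', u⟩, ⟨hq1, hq2⟩, rfl⟩
    exact ⟨h1, h2, fun j => ρ y' j * (u j : ℂ), hq1, hq2⟩
  · rintro ⟨-, -, x, hx, hw⟩
    have hx0 : ∀ j, x j ≠ 0 := fun j h => by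
      have := hx j
      rw [h, zero_pow hN] at this
      exact h2 j (sub_eq_zero.1 this.symm)
    have hρx : ∀ j, ρ y j = (‖x j‖ : ℂ) := fun j => by
      simp only [ρ]
      rw [← hx, norm_pow, Real.pow_rpow_inv_natCast (norm_nonneg _) hN]
    let u : Fin 3 → Circle := fun j => ⟨x j / ‖x j‖, by
      refine mem_sphere_zero_iff_norm.2 ?_
      rw [norm_div, Complex.norm_real, norm_norm, div_self (norm_ne_zero_iff.2 (hx0 j))]⟩
    have hru : ∀ j, ρ y j * (u j : ℂ) = x j := fun j => by
      rw [hρx]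
      exact mul_div_cancel₀ _ (by exact_mod_cast norm_ne_zero_iff.2 (hx0 j))
    refine ⟨(y, u), ⟨fun j => ?_, fun i => ?_⟩, rfl⟩
    · simp only [hru]; exact hx j
    · simp only [hru]; exact hw i

/-- Finitely many root loci cover the equation locus; they are relatively closed, and any two are
equal or disjoint. A connected set therefore stays in one of them. -/
lemma component_subset [NeZero N] {A : Matrix (Fin m) (Fin 4) (ZMod N)} {c : Fin m → ℂ}
    {y₀ : ℂ × ℂ × (Fin m → ℂ)} (hy : y₀ ∈ rootLocus A c) (hyE : y₀ ∈ equationLocus A) :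
    connectedComponentIn (equationLocus A) y₀ ⊆ rootLocus A c := by
  have hfin : {c' : Fin m → ℂ | ∀ i, c' i ^ N = 1}.Finite := by
    refine Set.Finite.pi' (t := fun _ => {x : ℂ | x ^ N = 1}) fun _ => ?_
    have := (Polynomial.nthRoots N (1 : ℂ)).toFinset.finite_toSet
    refine this.subset fun x hx => ?_
    simpa [Polynomial.mem_nthRoots (NeZero.pos N)] using hx
  choose t ht1 ht2 using exists_isClosed_rootLocus (N := N) A
  intro y hyC
  by_contra hyn
  have hpre := isPreconnected_connectedComponentIn (F := equationLocus A) (x := y₀)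
  have hsub := connectedComponentIn_subset (equationLocus A) y₀
  rw [isPreconnected_closed_iff] at hpre
  -- Distinct constants may define the same locus, so only those whose locus is disjoint from the
  -- given one are collected in the complement.
  let B := {c' : Fin m → ℂ | ∀ i, c' i ^ N = 1} ∩ {c' | rootLocus A c' ∩ rootLocus A c = ∅}
  have hB : IsClosed (⋃ c' ∈ B, t c') := (hfin.inter_of_left _).isClosed_biUnion fun c' _ => ht1 c'
  have hmem : ∀ y ∈ equationLocus A, ∀ c, (y ∈ t c ↔ y ∈ rootLocus A c) := fun y hy c =>
    ht2 c y (mem_equationLocus.1 hy).1 (mem_equationLocus.1 hy).2.1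
  have hcov : ∀ y ∈ equationLocus A, y ∉ rootLocus A c → ∃ c' ∈ B, y ∈ rootLocus A c' := by
    intro y hy hn
    obtain ⟨c', hc', hyc'⟩ := exists_mem_rootLocus hy
    refine ⟨c', ⟨hc', ?_⟩, hyc'⟩
    by_contra hne
    obtain ⟨q, hq1, hq2⟩ := Set.nonempty_iff_ne_empty.2 hne
    exact hn (rootLocus_eq_of_inter hq1 hq2 hyc')
  obtain ⟨q, hqC, hq1, hq2⟩ := hpre _ _ (ht1 c) hB (fun q hq => by
      by_cases hqc : q ∈ rootLocus A c
      · exact Or.inl ((hmem q (hsub hq) c).2 hqc)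
      · obtain ⟨c', hc', hq'⟩ := hcov q (hsub hq) hqc
        exact Or.inr (Set.mem_biUnion hc' ((hmem q (hsub hq) c').2 hq')))
    ⟨y₀, mem_connectedComponentIn hyE, (hmem y₀ hyE c).2 hy⟩
    (by
      obtain ⟨c', hc', hq'⟩ := hcov y (hsub hyC) hyn
      exact ⟨y, hyC, Set.mem_biUnion hc' ((hmem y (hsub hyC) c').2 hq')⟩)
  obtain ⟨c', hc', hq'⟩ := Set.mem_iUnion₂.1 hq2
  have : q ∈ rootLocus A c' ∩ rootLocus A c :=
    ⟨(hmem q (hsub hqC) c').1 hq', (hmem q (hsub hqC) c).1 hq1⟩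
  rw [hc'.2] at this
  exact this

/-! ### Sheets over the plane slit upwards from the branch points. -/

/-- The `N`-th root with argument in `(- 3 π / (2 N), π / (2 N)]`. -/
def lowerRoot (N : ℕ) (z : ℂ) : ℂ :=
  (-Complex.I) ^ ((N : ℂ)⁻¹) * (Complex.I * z) ^ ((N : ℂ)⁻¹)

lemma lowerRoot_pow [NeZero N] (z : ℂ) : lowerRoot N z ^ N = z := by
  rw [lowerRoot, mul_pow, Complex.cpow_nat_inv_pow _ (NeZero.ne N),
    Complex.cpow_nat_inv_pow _ (NeZero.ne N), ← mul_assoc]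
  simp

lemma continuousAt_lowerRoot {z : ℂ} (hz : Complex.I * z ∈ Complex.slitPlane) :
    ContinuousAt (lowerRoot N) z := by
  refine ContinuousAt.mul continuousAt_const ?_
  exact ContinuousAt.cpow (by fun_prop) continuousAt_const hz

/-- On the cut, `Complex.log` is still continuous from the side of nonnegative imaginary part, and
moving z to the right moves iz upwards. -/
lemma tendsto_lowerRoot_right {z : ℂ} (hz : z ≠ 0) :
    Filter.Tendsto (fun s : ℝ => lowerRoot N (z + s)) (𝓝[>] 0) (𝓝 (lowerRoot N z)) := by
  refine Filter.Tendsto.mul tendsto_const_nhds ?_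
  have hIz : Complex.I * z ≠ 0 := mul_ne_zero Complex.I_ne_zero hz
  have h0 : Filter.Tendsto (fun s : ℝ => Complex.I * (z + s)) (𝓝[>] 0) (𝓝 (Complex.I * z)) := by
    have : Continuous fun s : ℝ => Complex.I * (z + s) := by fun_prop
    have h := this.tendsto 0
    simp only [Complex.ofReal_zero, add_zero] at h
    exact h.mono_left nhdsWithin_le_nhds
  have hlog : Filter.Tendsto (fun s : ℝ => Complex.log (Complex.I * (z + s))) (𝓝[>] 0)
      (𝓝 (Complex.log (Complex.I * z))) := by
    by_cases hs : Complex.I * z ∈ Complex.slitPlane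
    · exact (continuousAt_clog hs).tendsto.comp h0
    · have hs' := (Complex.mem_slitPlane_iff_not_le_zero.not_left.1 hs)
      rw [Complex.le_def] at hs'
      have hre : (Complex.I * z).re < 0 := lt_of_le_of_ne hs'.1 fun h =>
        hIz (Complex.ext h hs'.2)
      refine (Complex.continuousWithinAt_log_of_re_neg_of_im_zero hre hs'.2).tendsto.comp ?_
      refine tendsto_nhdsWithin_iff.2 ⟨h0, ?_⟩
      filter_upwards [self_mem_nhdsWithin] with s hs0
      have h2 := hs'.2
      simp only [Complex.mul_im, Complex.I_re, Complex.I_im, zero_mul, one_mul, zero_add,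
        Complex.zero_im] at h2
      simp [h2, le_of_lt (Set.mem_Ioi.1 hs0)]
  have hne : ∀ᶠ s : ℝ in 𝓝[>] 0, Complex.I * (z + s) ≠ 0 := h0.eventually_ne hIz
  have h1 := (Complex.continuous_exp.tendsto _).comp (hlog.mul_const ((N : ℂ)⁻¹))
  rw [Complex.cpow_def_of_ne_zero hIz]
  refine h1.congr' ?_
  filter_upwards [hne] with s hs
  rw [Complex.cpow_def_of_ne_zero hs]
  rfl

/-- The pairs `(l, z)` with `l` in the upper half-plane and `z` not on the vertical rays upwards
from the branch points. -/
def slitDomain : Set (ℂ × ℂ) :=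
  {q | 0 < q.1.im ∧ ∀ j, Complex.I * (q.2 - branchPt q.1 j) ∈ Complex.slitPlane}

/-- The slits run upwards, so every point can be pushed straight down into the lower half-plane
without meeting one; the pairs with z in the lower half-plane form a convex set. -/
lemma isPreconnected_slitDomain : IsPreconnected slitDomain := by
  let L : Set (ℂ × ℂ) := {q | 0 < q.1.im ∧ q.2.im < 0}
  have him : ∀ l : ℂ, 0 < l.im → ∀ j, 0 ≤ (branchPt l j).im := by
    intro l hl j
    fin_cases j <;> simp [branchPt, hl.le]
  have hL : L ⊆ slitDomain := by
    rintro ⟨l, z⟩ ⟨h1, h2⟩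
    refine ⟨h1, fun j => Or.inl ?_⟩
    have := him l h1 j
    simp at h2 ⊢
    linarith
  have hconv : Convex ℝ L := by
    have e : L = {q : ℂ × ℂ | 0 < Complex.imLm q.1} ∩ {q : ℂ × ℂ | Complex.imLm q.2 < 0} := rfl
    rw [e]
    exact (convex_halfSpace_gt (f := fun q : ℂ × ℂ => Complex.imLm q.1)
      ((Complex.imLm.comp (LinearMap.fst ℝ ℂ ℂ)).isLinear) 0).inter
      (convex_halfSpace_lt (f := fun q : ℂ × ℂ => Complex.imLm q.2)
      ((Complex.imLm.comp (LinearMap.snd ℝ ℂ ℂ)).isLinear) 0)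
  refine isPreconnected_of_forall (x := (Complex.I, -Complex.I)) ?_
  rintro ⟨l, z⟩ ⟨h1, h2⟩
  let R : Set (ℂ × ℂ) := (fun s : ℝ => ((l, z - s * Complex.I) : ℂ × ℂ)) '' Set.Ici 0
  have hR : R ⊆ slitDomain := by
    rintro _ ⟨s, hs, rfl⟩
    refine ⟨h1, fun j => ?_⟩
    have h3 := h2 j
    rw [Complex.mem_slitPlane_iff] at h3 ⊢
    rcases h3 with h3 | h3
    · left
      simp at h3 hs ⊢
      linarith
    · right
      simpa using h3
  have hRp : IsPreconnected R := (convex_Ici (0 : ℝ)).isPreconnected.image _ (by fun_prop)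
  have hx : ((l, z - ((z.im ⊔ 0 + 1 : ℝ) : ℂ) * Complex.I) : ℂ × ℂ) ∈ L := by
    refine ⟨h1, ?_⟩
    simp
    have := le_max_left z.im 0
    linarith
  refine ⟨L ∪ R, Set.union_subset hL hR, Or.inl ⟨by simp, by simp⟩, Or.inr ⟨0, by simp, by simp⟩,
    IsPreconnected.union _ hx ⟨_, ?_, rfl⟩ hconv.isPreconnected hRp⟩
  simp only [Set.mem_Ici]
  have := le_max_right z.im 0
  linarith

/-- The sheet of the root locus over the slit domain with given roots of unity. -/
def sheet (A : Matrix (Fin m) (Fin 4) (ZMod N)) (c : Fin m → ℂ) (n : Fin 3 → ℕ) (q : ℂ × ℂ) :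
    ℂ × ℂ × (Fin m → ℂ) :=
  (q.1, q.2, fun i => c i * ∏ j : Fin 3,
    (xi N ^ n j * lowerRoot N (q.2 - branchPt q.1 j)) ^ (A i j.castSucc).val)

lemma isPrimitiveRoot_xi [NeZero N] : IsPrimitiveRoot (xi N) N :=
  Complex.isPrimitiveRoot_exp N (NeZero.ne N)

lemma xi_pow_pow [NeZero N] (k : ℕ) : (xi N ^ k) ^ N = 1 := by
  rw [pow_right_comm, isPrimitiveRoot_xi.pow_eq_one, one_pow]

lemma exists_xi_pow [NeZero N] {x y : ℂ} (h : x ^ N = y ^ N) (hy : y ≠ 0) :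
    ∃ k : ℕ, x = xi N ^ k * y := by
  obtain ⟨k, -, hk⟩ := isPrimitiveRoot_xi (N := N).eq_pow_of_pow_eq_one
    (ξ := x / y) (by rw [div_pow, h, div_self (pow_ne_zero _ hy)])
  exact ⟨k, by rw [hk, div_mul_cancel₀ _ hy]⟩

lemma ne_of_mem_slitDomain {q : ℂ × ℂ} (hq : q ∈ slitDomain) (j : Fin 3) :
    q.2 ≠ branchPt q.1 j := fun h => by
  have := hq.2 j
  rw [h, sub_self, mul_zero] at this
  exact Complex.zero_notMem_slitPlane this

lemma sheet_mem [NeZero N] {A : Matrix (Fin m) (Fin 4) (ZMod N)} {c : Fin m → ℂ} (n : Fin 3 → ℕ)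
    {q : ℂ × ℂ} (h1 : 0 < q.1.im) (h2 : ∀ j, q.2 ≠ branchPt q.1 j) :
    sheet A c n q ∈ rootLocus A c :=
  ⟨h1, h2, fun j => xi N ^ n j * lowerRoot N (q.2 - branchPt q.1 j), fun j => by
    rw [mul_pow, xi_pow_pow, lowerRoot_pow, one_mul]; rfl, fun i => rfl⟩

lemma isPreconnected_sheet [NeZero N] (A : Matrix (Fin m) (Fin 4) (ZMod N)) (c : Fin m → ℂ)
    (n : Fin 3 → ℕ) : IsPreconnected (sheet A c n '' slitDomain) := by
  refine isPreconnected_slitDomain.image _ fun q hq => ContinuousAt.continuousWithinAt ?_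
  have h : ∀ j, ContinuousAt (fun q : ℂ × ℂ => lowerRoot N (q.2 - branchPt q.1 j)) q := fun j =>
    ContinuousAt.comp (f := fun q : ℂ × ℂ => q.2 - branchPt q.1 j)
      (continuousAt_lowerRoot (hq.2 j))
      (continuous_snd.sub ((continuous_branchPt j).comp continuous_fst)).continuousAt
  refine continuousAt_fst.prodMk (continuousAt_snd.prodMk (continuousAt_pi.2 fun i => ?_))
  refine continuousAt_const.mul (tendsto_finsetProd _ fun j _ => ?_)
  exact (continuousAt_const.mul (h j)).pow _

/-- Two points that lie in a common preconnected subset. -/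
def Linked {α : Type*} [TopologicalSpace α] (S : Set α) (x y : α) : Prop :=
  ∃ t ⊆ S, x ∈ t ∧ y ∈ t ∧ IsPreconnected t

lemma Linked.trans {α : Type*} [TopologicalSpace α] {S : Set α} {x y z : α} (h : Linked S x y)
    (h' : Linked S y z) : Linked S x z := by
  obtain ⟨t, h1, h2, h3, h4⟩ := h
  obtain ⟨t', h1', h2', h3', h4'⟩ := h'
  exact ⟨t ∪ t', Set.union_subset h1 h1', Or.inl h2, Or.inr h3', h4.union y h3 h2' h4'⟩

lemma slit_of_re_ne {w : ℂ} (h : w.re ≠ 0) : Complex.I * w ∈ Complex.slitPlane :=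
  Or.inr (by simpa using h)

/-- Above this base value of l, a circle of radius 1/2 about one branch point avoids the slits of
the other two. -/
lemma branchPt_re_sep (j k : Fin 3) (h : k ≠ j) :
    1 ≤ |(branchPt (5 + Complex.I) j).re - (branchPt (5 + Complex.I) k).re| := by
  fin_cases j <;> fin_cases k <;> simp at h ⊢ <;> norm_num [branchPt]

/-- One turn about the j-th branch point multiplies the j-th root by ξ_N and returns the other roots
to their values. The turn is made over l = 5 + i; within the slit domain each sheet is connected, so
the endpoints may be moved at will. -/
lemma linked_sheet_update [NeZero N] (A : Matrix (Fin m) (Fin 4) (ZMod N)) (c : Fin m → ℂ)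
    (n : Fin 3 → ℕ) (j : Fin 3) {q q' : ℂ × ℂ} (hq : q ∈ slitDomain) (hq' : q' ∈ slitDomain) :
    Linked (rootLocus A c) (sheet A c n q)
      (sheet A c (Function.update n j (n j + 1)) q') := by
  have hS : ∀ n : Fin 3 → ℕ, ∀ q q' : ℂ × ℂ, q ∈ slitDomain → q' ∈ slitDomain →
      Linked (rootLocus A c) (sheet A c n q) (sheet A c n q') := fun n q q' hq hq' =>
    ⟨sheet A c n '' slitDomain, by
      rintro _ ⟨q, hq, rfl⟩
      exact sheet_mem n hq.1 (ne_of_mem_slitDomain hq), ⟨q, hq, rfl⟩, ⟨q', hq', rfl⟩,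
      isPreconnected_sheet A c n⟩
  set l : ℂ := 5 + Complex.I with hl
  have hlim : 0 < l.im := by simp [hl]
  let zc : ℝ → ℂ := fun θ => branchPt l j + 1 / 2 * Complex.exp (θ * Complex.I)
  have hzc : ∀ θ k, k ≠ j → (zc θ - branchPt l k).re ≠ 0 := by
    intro θ k hk h0
    have h1 := branchPt_re_sep j k hk
    have h2 : (zc θ - branchPt l k).re = (branchPt l j).re - (branchPt l k).re +
        1 / 2 * Real.cos θ := by
      simp [zc, Complex.exp_ofReal_mul_I_re]
      ring
    rw [h2] at h0
    have h3 : (branchPt l j).re - (branchPt l k).re = - (1 / 2 * Real.cos θ) := by linarith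
    rw [← hl, h3, abs_neg, abs_mul] at h1
    have h4 := Real.abs_cos_le_one θ
    rw [abs_of_pos (by norm_num : (0 : ℝ) < 1 / 2)] at h1
    linarith
  have hne : ∀ θ k, zc θ ≠ branchPt l k := by
    intro θ k h
    by_cases hk : k = j
    · subst hk
      simp [zc, Complex.exp_ne_zero] at h
    · exact hzc θ k hk (by rw [h, sub_self, Complex.zero_re])
  -- The j-th root is continued explicitly as a multiple of e^(iθ/N), across its own slit; the other
  -- roots stay on the branch `lowerRoot`.
  let xr : ℝ → Fin 3 → ℂ := fun θ k => if k = j then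
      xi N ^ n j * (lowerRoot N (1 / 2) * Complex.exp (θ * Complex.I / N))
    else xi N ^ n k * lowerRoot N (zc θ - branchPt l k)
  have hxr : ∀ θ k, xr θ k ^ N = zc θ - branchPt l k := by
    intro θ k
    by_cases hk : k = j
    · subst hk
      simp only [xr, if_true, zc]
      rw [mul_pow, xi_pow_pow, mul_pow, lowerRoot_pow, ← Complex.exp_nat_mul,
        mul_div_cancel₀ _ (Nat.cast_ne_zero.2 (NeZero.ne N))]
      ring
    · simp only [xr, if_neg hk]
      rw [mul_pow, xi_pow_pow, lowerRoot_pow, one_mul]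
  let γ : ℝ → ℂ × ℂ × (Fin m → ℂ) := fun θ =>
    (l, zc θ, fun i => c i * ∏ k : Fin 3, xr θ k ^ (A i k.castSucc).val)
  have hγ : Continuous γ := by
    have hz : Continuous zc := by fun_prop
    refine continuous_const.prodMk (hz.prodMk (continuous_pi fun i => ?_))
    refine continuous_const.mul (continuous_finsetProd _ fun k _ => ?_)
    refine Continuous.pow ?_ _
    by_cases hk : k = j
    · simp only [xr, if_pos hk]
      fun_prop
    · simp only [xr, if_neg hk]
      refine continuous_const.mul (continuous_iff_continuousAt.2 fun θ => ?_)
      exact ContinuousAt.comp (f := fun θ => zc θ - branchPt l k)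
        (continuousAt_lowerRoot (slit_of_re_ne (hzc θ k hk))) (by fun_prop)
  have hγS : Set.range γ ⊆ rootLocus A c := by
    rintro _ ⟨θ, rfl⟩
    exact ⟨hlim, hne θ, xr θ, hxr θ, fun i => rfl⟩
  have hb : (l, zc 0) ∈ slitDomain := by
    refine ⟨hlim, fun k => slit_of_re_ne ?_⟩
    by_cases hk : k = j
    · subst hk
      simp [zc]
    · exact hzc 0 k hk
  have e0 : γ 0 = sheet A c n (l, zc 0) := by
    simp only [γ, sheet]
    refine Prod.ext rfl (Prod.ext rfl (funext fun i => ?_))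
    simp only
    congr 1
    refine Finset.prod_congr rfl fun k _ => ?_
    by_cases hk : k = j
    · subst hk
      simp [xr, zc]
    · simp [xr, hk]
  have hper : zc (2 * Real.pi) = zc 0 := by
    simp [zc]
  have e1 : γ (2 * Real.pi) = sheet A c (Function.update n j (n j + 1)) (l, zc 0) := by
    simp only [γ, sheet]
    refine Prod.ext rfl (Prod.ext hper (funext fun i => ?_))
    simp only
    congr 1
    refine Finset.prod_congr rfl fun k _ => ?_
    by_cases hk : k = j
    · subst hk
      simp only [xr, if_true, Function.update_self]
      congr 1
      rw [pow_succ, xi]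
      simp [zc]
      ring
    · simp [xr, hk, hper]
  refine (hS n q _ hq hb).trans (Linked.trans ?_ (hS _ _ q' hb hq'))
  exact ⟨Set.range γ, hγS, ⟨0, e0⟩, ⟨_, e1⟩, isPreconnected_range hγ⟩

/-- Over the slit domain the locus is a union of sheets, all linked by turns about the branch
points. A point over a slit is a limit from the right of points of one sheet, and adding a limit
point keeps a set connected. -/
lemma isPreconnected_rootLocus [NeZero N] (A : Matrix (Fin m) (Fin 4) (ZMod N)) (c : Fin m → ℂ) :
    IsPreconnected (rootLocus A c) := by
  have hq₀ : ((Complex.I, -Complex.I) : ℂ × ℂ) ∈ slitDomain := by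
    refine ⟨by simp, fun j => Or.inl ?_⟩
    fin_cases j <;> simp [branchPt]
  set q₀ : ℂ × ℂ := (Complex.I, -Complex.I)
  have h1 : ∀ (k : ℕ) (n : Fin 3 → ℕ) (j : Fin 3), Linked (rootLocus A c) (sheet A c n q₀)
      (sheet A c (Function.update n j (n j + k)) q₀) := by
    intro k
    induction k with
    | zero =>
      intro n j
      simp only [add_zero, Function.update_eq_self]
      exact ⟨{sheet A c n q₀}, Set.singleton_subset_iff.2 (sheet_mem n hq₀.1
        (ne_of_mem_slitDomain hq₀)), rfl, rfl, isPreconnected_singleton⟩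
    | succ k ih =>
      intro n j
      refine (ih n j).trans ?_
      have := linked_sheet_update A c (Function.update n j (n j + k)) j hq₀ hq₀
      simpa [add_assoc] using this
  have h2 : ∀ n : Fin 3 → ℕ, Linked (rootLocus A c) (sheet A c 0 q₀) (sheet A c n q₀) := by
    intro n
    have a := h1 (n 0) 0 0
    have b := h1 (n 1) (Function.update 0 0 (n 0)) 1
    have d := h1 (n 2) (Function.update (Function.update 0 0 (n 0)) 1 (n 1)) 2
    simp only [Pi.zero_apply, zero_add, ne_eq, one_ne_zero, not_false_eq_true, Function.update_of_ne,
      Fin.reduceEq] at a b d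
    refine (a.trans b).trans ?_
    convert d using 2
    ext j
    fin_cases j <;> simp [Function.update]
  refine isPreconnected_of_forall (x := sheet A c 0 q₀) ?_
  rintro ⟨l, z, w⟩ ⟨y1, y2, x, hx, hw⟩
  simp only at y1 y2 hx hw
  have hy0 : ∀ j, z - branchPt l j ≠ 0 := fun j => sub_ne_zero.2 (y2 j)
  have hr0 : ∀ j, lowerRoot N (z - branchPt l j) ≠ 0 := fun j h => by
    have := lowerRoot_pow (N := N) (z - branchPt l j)
    rw [h, zero_pow (NeZero.ne N)] at this
    exact hy0 j this.symm
  have : ∀ j, ∃ k : ℕ, x j = xi N ^ k * lowerRoot N (z - branchPt l j) := fun j =>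
    exists_xi_pow (by rw [hx, lowerRoot_pow]) (hr0 j)
  choose n hn using this
  have hy : ((l, z, w) : ℂ × ℂ × (Fin m → ℂ)) = sheet A c n (l, z) := by
    refine Prod.ext rfl (Prod.ext rfl (funext fun i => ?_))
    simp only [sheet, hw, hn]
  have hlim : Filter.Tendsto (fun s : ℝ => sheet A c n (l, z + s)) (𝓝[>] 0)
      (𝓝 (sheet A c n (l, z))) := by
    refine tendsto_const_nhds.prodMk_nhds (Filter.Tendsto.prodMk_nhds ?_ (tendsto_pi_nhds.2
      fun i => tendsto_const_nhds.mul (tendsto_finsetProd _ fun j _ => ?_)))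
    · have : Continuous fun s : ℝ => z + s := by fun_prop
      have h := this.tendsto 0
      simp only [Complex.ofReal_zero, add_zero] at h
      exact h.mono_left nhdsWithin_le_nhds
    · refine (tendsto_const_nhds.mul ?_).pow _
      have := tendsto_lowerRoot_right (N := N) (hy0 j)
      refine this.congr fun s => ?_
      simp only
      congr 1
      ring
  have hev : ∀ᶠ s : ℝ in 𝓝[>] 0, (l, z + s) ∈ slitDomain := by
    have : ∀ j, ∀ᶠ s : ℝ in 𝓝[>] 0, Complex.I * (z + s - branchPt l j) ∈ Complex.slitPlane := by
      intro j
      by_cases hre : (z - branchPt l j).re = 0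
      · filter_upwards [self_mem_nhdsWithin] with s hs
        refine slit_of_re_ne ?_
        have : (z + s - branchPt l j).re = (z - branchPt l j).re + s := by simp; ring
        rw [this, hre, zero_add]
        exact ne_of_gt hs
      · have hc : Continuous fun s : ℝ => (z + s - branchPt l j).re := by fun_prop
        have h := (hc.tendsto 0).eventually_ne (by simpa using hre)
        filter_upwards [nhdsWithin_le_nhds h] with s hs
        exact slit_of_re_ne hs
    filter_upwards [Filter.eventually_all.2 this] with s hs
    exact ⟨y1, hs⟩
  obtain ⟨s₁, hs₁⟩ := hev.exists
  have hmem : sheet A c n (l, z) ∈ closure (sheet A c n '' slitDomain) :=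
    mem_closure_of_tendsto hlim (hev.mono fun s hs => ⟨_, hs, rfl⟩)
  have hsub : sheet A c n '' slitDomain ⊆ rootLocus A c := by
    rintro _ ⟨q, hq, rfl⟩
    exact sheet_mem n hq.1 (ne_of_mem_slitDomain hq)
  refine (h2 n).trans ?_
  rw [hy]
  refine ⟨insert (sheet A c n (l, z)) (sheet A c n '' slitDomain),
    Set.insert_subset (sheet_mem n y1 y2) hsub, Or.inr ⟨q₀, hq₀, rfl⟩, Or.inl rfl,
    (isPreconnected_sheet A c n).subset_closure (Set.subset_insert _ _)
      (Set.insert_subset hmem subset_closure)⟩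

lemma component_eq [NeZero N] {A : Matrix (Fin m) (Fin 4) (ZMod N)} {c : Fin m → ℂ}
    (hc : ∀ i, c i ^ N = 1) {y₀ : ℂ × ℂ × (Fin m → ℂ)} (hy : y₀ ∈ rootLocus A c) :
    connectedComponentIn (equationLocus A) y₀ = rootLocus A c :=
  (component_subset hy (rootLocus_subset hc hy)).antisymm
    ((isPreconnected_rootLocus A c).subset_connectedComponentIn hy (rootLocus_subset hc))

end AbelianCover

namespace AbelianCover

/-! ### The Kummer cover -/

open Filter OnePoint

variable {N m : ℕ}

/-- The affine cone over the Kummer curve `X_j ^ N = X_0 ^ N - b_j X_3 ^ N`, where `b_j` are the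
finite branch points. It parametrizes the compact surfaces `cover A y₀ l`. -/
def kummer (N : ℕ) (l : ℂ) : Set (Fin 4 → ℂ) :=
  {X | X ≠ 0 ∧ ∀ j : Fin 3, X j.castSucc ^ N = X 0 ^ N - branchPt l j * X 3 ^ N}

lemma kummer_ext [NeZero N] {l : ℂ} {X : Fin 4 → ℂ} (hX : X ∈ kummer N l) (h0 : X 0 ^ N = 0)
    (h3 : X 3 ^ N = 0) : False := by
  refine hX.1 (funext fun j => pow_eq_zero_iff (NeZero.ne N) |>.1 ?_)
  refine Fin.lastCases ?_ (fun j => ?_) j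
  · exact h3
  · rw [hX.2 j, h0, h3, mul_zero, sub_zero]

/-- As 0, 1, l, ∞ are distinct, two vanishing coordinates give independent linear conditions on
X_0^N and X_3^N; both vanish, and then X = 0. -/
lemma kummer_zero_unique [NeZero N] {l : ℂ} (hl : 0 < l.im) {X : Fin 4 → ℂ} (hX : X ∈ kummer N l)
    {i j : Fin 4} (hi : X i = 0) (hj : X j = 0) : i = j := by
  have hl0 : l ≠ 0 := by rintro rfl; simp at hl
  have hl1 : l - 1 ≠ 0 := fun h => by rw [sub_eq_zero.1 h] at hl; simp at hl
  have hN := NeZero.ne N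
  have h1 : X 1 ^ N = X 0 ^ N - X 3 ^ N := by simpa using hX.2 1
  have h2 : X 2 ^ N = X 0 ^ N - l * X 3 ^ N := by simpa using hX.2 2
  have hi' : X i ^ N = 0 := by rw [hi, zero_pow hN]
  have hj' : X j ^ N = 0 := by rw [hj, zero_pow hN]
  have key : X 0 ^ N = 0 → X 3 ^ N = 0 → i = j := fun h h' => (kummer_ext hX h h').elim
  fin_cases i <;> fin_cases j <;> first
    | rfl
    | (simp only [Fin.reduceFinMk, Fin.zero_eta, Fin.mk_one] at hi' hj' key ⊢
       refine key ?_ ?_ <;> grind)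

lemma smul_mem_kummer {l ρ : ℂ} {X : Fin 4 → ℂ} (hX : X ∈ kummer N l) (hρ : ρ ≠ 0) :
    ρ • X ∈ kummer N l := by
  refine ⟨smul_ne_zero hρ hX.1, fun j => ?_⟩
  simp only [Pi.smul_apply, smul_eq_mul, mul_pow, hX.2 j]
  ring

/-- A Laurent monomial, as a function with values in `ℂ ∪ {∞}`. -/
def monomialMap (C : ℂ) (E : Fin 4 → ℤ) (X : Fin 4 → ℂ) : OnePoint ℂ :=
  open Classical in
  if ∃ j, X j = 0 ∧ E j < 0 then ∞ else ((C * ∏ j, X j ^ E j : ℂ) : OnePoint ℂ)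

lemma monomialMap_of_ne {C : ℂ} {E : Fin 4 → ℤ} {X : Fin 4 → ℂ} (h : ∀ j, X j ≠ 0) :
    monomialMap C E X = ((C * ∏ j, X j ^ E j : ℂ) : OnePoint ℂ) :=
  if_neg fun ⟨j, hj, _⟩ => h j hj

lemma continuousAt_inv_onePoint :
    ContinuousAt (fun g : ℂ => open Classical in
      if g = 0 then (∞ : OnePoint ℂ) else ((g⁻¹ : ℂ) : OnePoint ℂ)) 0 := by
  rw [ContinuousAt, if_pos rfl, ← pure_sup_nhdsNE, tendsto_sup]
  constructor
  · rw [tendsto_pure_left]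
    intro s hs
    simpa using mem_of_mem_nhds hs
  · have h : Tendsto (fun g : ℂ => ((g⁻¹ : ℂ) : OnePoint ℂ)) (𝓝[≠] 0) (𝓝 ∞) := by
      refine tendsto_coe_infty.comp ?_
      rw [coclosedCompact_eq_cocompact, ← Metric.cobounded_eq_cocompact]
      exact tendsto_inv₀_nhdsNE_zero
    refine h.congr' ?_
    filter_upwards [self_mem_nhdsWithin] with g hg
    exact (if_neg (by simpa using hg)).symm

/-- At most one coordinate vanishes at X, so no expression 0 · ∞ arises. -/
lemma continuousAt_monomialMap {C : ℂ} (hC : C ≠ 0) (E : Fin 4 → ℤ) {X : Fin 4 → ℂ}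
    (hX : ∀ i j, X i = 0 → X j = 0 → i = j) : ContinuousAt (monomialMap C E) X := by
  have hcoord : ∀ j : Fin 4, ContinuousAt (fun Y : Fin 4 → ℂ => Y j) X := fun j =>
    (continuous_apply j).continuousAt
  by_cases h : ∃ j, X j = 0 ∧ E j < 0
  · obtain ⟨j₀, hj₀, hE⟩ := h
    have hne : ∀ j, j ≠ j₀ → X j ≠ 0 := fun j hj h => hj (hX j j₀ h hj₀)
    -- At a pole, continuity is checked for the reciprocal monomial, which vanishes exactly where a
    -- nearby value is infinite.
    set G : (Fin 4 → ℂ) → ℂ := fun Y => C⁻¹ * ∏ j, Y j ^ (-E j) with hG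
    have hGc : ContinuousAt G X := by
      refine continuousAt_const.mul (tendsto_finsetProd _ fun j _ => ?_)
      by_cases hj : j = j₀
      · exact (hcoord j).zpow₀ _ (Or.inr (by rw [hj]; omega))
      · exact (hcoord j).zpow₀ _ (Or.inl (hne j hj))
    have hG0 : ∀ Y : Fin 4 → ℂ, Y j₀ = 0 → G Y = 0 := fun Y hY => by
      rw [hG]
      simp only
      rw [Finset.prod_eq_zero (Finset.mem_univ j₀), mul_zero]
      rw [hY, zero_zpow _ (by omega)]
    have hev : ∀ᶠ Y in 𝓝 X, ∀ j, j ≠ j₀ → Y j ≠ 0 := by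
      rw [eventually_all]
      intro j
      by_cases hj : j = j₀
      · simp [hj]
      · filter_upwards [(hcoord j).eventually_ne (hne j hj)] with Y hY _ using hY
    have h := ContinuousAt.comp (x := X) (f := G) (by rw [hG0 X hj₀]; exact continuousAt_inv_onePoint)
      hGc
    refine h.congr ?_
    filter_upwards [hev] with Y hY
    by_cases hY0 : Y j₀ = 0
    · simp only [Function.comp_apply, hG0 Y hY0, if_true]
      rw [monomialMap, if_pos ⟨j₀, hY0, hE⟩]
    · have hall : ∀ j, Y j ≠ 0 := fun j => by
        by_cases hj : j = j₀
        · rwa [hj]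
        · exact hY j hj
      have hGY : G Y = (C * ∏ j, Y j ^ E j)⁻¹ := by
        rw [hG, mul_inv, ← Finset.prod_inv_distrib]
        simp only [zpow_neg]
      have : G Y ≠ 0 := by
        rw [hGY]
        exact inv_ne_zero (mul_ne_zero hC (Finset.prod_ne_zero_iff.2 fun j _ =>
          zpow_ne_zero _ (hall j)))
      simp only [Function.comp_apply]
      rw [if_neg this, hGY, inv_inv, monomialMap_of_ne hall]
  · have hev : ∀ᶠ Y in 𝓝 X, ∀ j, E j < 0 → Y j ≠ 0 := by
      rw [eventually_all]
      intro j
      by_cases hj : E j < 0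
      · have : X j ≠ 0 := fun h0 => h ⟨j, h0, hj⟩
        filter_upwards [(hcoord j).eventually_ne this] with Y hY _ using hY
      · simp [hj]
    have hc : ContinuousAt (fun Y : Fin 4 → ℂ => ((C * ∏ j, Y j ^ E j : ℂ) : OnePoint ℂ)) X := by
      refine ContinuousAt.comp (g := ((↑) : ℂ → OnePoint ℂ))
        OnePoint.continuous_coe.continuousAt ?_
      refine continuousAt_const.mul (tendsto_finsetProd _ fun j _ => ?_)
      refine (hcoord j).zpow₀ _ ?_
      by_cases hj : E j < 0
      · exact Or.inl fun h0 => h ⟨j, h0, hj⟩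
      · exact Or.inr (not_lt.1 hj)
    refine hc.congr ?_
    filter_upwards [hev] with Y hY
    rw [monomialMap, if_neg]
    rintro ⟨j, h0, hj⟩
    exact hY j hj h0

lemma monomialMap_smul {C : ℂ} {E : Fin 4 → ℤ} (hE : ∑ j, E j = 0) {ρ : ℂ} (hρ : ρ ≠ 0)
    (X : Fin 4 → ℂ) : monomialMap C E (ρ • X) = monomialMap C E X := by
  have h1 : ∏ j, (ρ • X) j ^ E j = ∏ j, X j ^ E j := by
    simp only [Pi.smul_apply, smul_eq_mul, mul_zpow, Finset.prod_mul_distrib]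
    have : ∏ j, ρ ^ E j = 1 := by
      rw [Fin.prod_univ_four, ← zpow_add₀ hρ, ← zpow_add₀ hρ, ← zpow_add₀ hρ]
      rw [Fin.sum_univ_four] at hE
      rw [hE, zpow_zero]
    rw [this, one_mul]
  rw [monomialMap, h1]
  simp only [monomialMap, Pi.smul_apply, smul_eq_mul, mul_eq_zero, hρ, false_or]

/-- The exponents of a monomial `w ^ n z ^ k_0 (z - 1) ^ k_1 (z - l) ^ k_2` in the coordinates of the
Kummer curve. -/
def kummerExp (A : Matrix (Fin m) (Fin 4) (ZMod N)) (e : Exponent m) : Fin 4 → ℤ :=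
  Fin.snoc (α := fun _ => ℤ) (fun j : Fin 3 => ∑ i, e.1 i * (A i j.castSucc).val + N * e.2 j)
    (-∑ j : Fin 3, (∑ i, e.1 i * (A i j.castSucc).val + N * e.2 j))

lemma kummerExp_castSucc (A : Matrix (Fin m) (Fin 4) (ZMod N)) (e : Exponent m) (j : Fin 3) :
    kummerExp A e j.castSucc = ∑ i, e.1 i * (A i j.castSucc).val + N * e.2 j :=
  Fin.snoc_castSucc (α := fun _ => ℤ) _ _ j

lemma kummerExp_last (A : Matrix (Fin m) (Fin 4) (ZMod N)) (e : Exponent m) :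
    kummerExp A e 3 = -∑ j : Fin 3, kummerExp A e j.castSucc := by
  simp only [kummerExp_castSucc]
  exact Fin.snoc_last (α := fun _ => ℤ) _ _

lemma sum_kummerExp (A : Matrix (Fin m) (Fin 4) (ZMod N)) (e : Exponent m) :
    ∑ j, kummerExp A e j = 0 := by
  rw [Fin.sum_univ_castSucc, show Fin.last 3 = (3 : Fin 4) from rfl, kummerExp_last, add_neg_cancel]

/-- The constant factor of a monomial on the component of the equation locus given by `c`. -/
def unitFactor (c : Fin m → ℂ) (e : Exponent m) : ℂ := ∏ i, c i ^ e.1 i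

/-- The map of the Kummer curve to the compact surface. -/
def kummerMap (A : Matrix (Fin m) (Fin 4) (ZMod N)) (c : Fin m → ℂ) (X : Fin 4 → ℂ) :
    Exponent m → OnePoint ℂ := fun e => monomialMap (unitFactor c e) (kummerExp A e) X

/-- The point of the open curve given by a point of the Kummer curve. -/
def kummerPt (A : Matrix (Fin m) (Fin 4) (ZMod N)) (c : Fin m → ℂ) (X : Fin 4 → ℂ) :
    ℂ × (Fin m → ℂ) :=
  ((X 0 / X 3) ^ N, fun i => c i * ∏ j : Fin 3, (X j.castSucc / X 3) ^ (A i j.castSucc).val)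

lemma kummerMap_smul (A : Matrix (Fin m) (Fin 4) (ZMod N)) (c : Fin m → ℂ) {ρ : ℂ} (hρ : ρ ≠ 0)
    (X : Fin 4 → ℂ) : kummerMap A c (ρ • X) = kummerMap A c X :=
  funext fun e => monomialMap_smul (sum_kummerExp A e) hρ X

lemma unitFactor_ne_zero {c : Fin m → ℂ} (hc : ∀ i, c i ≠ 0) (e : Exponent m) :
    unitFactor c e ≠ 0 :=
  Finset.prod_ne_zero_iff.2 fun i _ => zpow_ne_zero _ (hc i)

lemma continuousAt_kummerMap [NeZero N] (A : Matrix (Fin m) (Fin 4) (ZMod N)) {c : Fin m → ℂ}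
    (hc : ∀ i, c i ≠ 0) {l : ℂ} (hl : 0 < l.im) {X : Fin 4 → ℂ} (hX : X ∈ kummer N l) :
    ContinuousAt (kummerMap A c) X :=
  continuousAt_pi.2 fun e => continuousAt_monomialMap (unitFactor_ne_zero hc e) _
    fun _ _ h h' => kummer_zero_unique hl hX h h'

lemma kummerPt_sub [NeZero N] {l : ℂ} {A : Matrix (Fin m) (Fin 4) (ZMod N)} {c : Fin m → ℂ}
    {X : Fin 4 → ℂ} (hX : X ∈ kummer N l) (h3 : X 3 ≠ 0) (j : Fin 3) :
    (X j.castSucc / X 3) ^ N = (kummerPt A c X).1 - branchPt l j := by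
  have := pow_ne_zero N h3
  simp only [kummerPt, div_pow, hX.2 j]
  field_simp

/-- The value of a monomial `w ^ n z ^ k_0 (z - 1) ^ k_1 (z - l) ^ k_2` on the open curve. -/
def monomialValue (l : ℂ) (p : ℂ × (Fin m → ℂ)) (e : Exponent m) : ℂ :=
  (∏ i, p.2 i ^ e.1 i) * (p.1 ^ e.2 0 * (p.1 - 1) ^ e.2 1 * (p.1 - l) ^ e.2 2)

lemma monomialValues_eq (l : ℂ) (p : ℂ × (Fin m → ℂ)) (e : Exponent m) :
    monomialValues l p e = (monomialValue l p e : OnePoint ℂ) := rfl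

lemma zpow_finset_sum {ι : Type*} {x : ℂ} (hx : x ≠ 0) (s : Finset ι) (n : ι → ℤ) :
    x ^ (∑ i ∈ s, n i) = ∏ i ∈ s, x ^ n i := by
  classical
  induction s using Finset.induction_on with
  | empty => simp
  | insert a s ha ih => rw [Finset.sum_insert ha, Finset.prod_insert ha, zpow_add₀ hx, ih]

/-- Substitute z - b_j = (X_j / X_3)^N and w_i = c_i ∏ (X_j / X_3)^(a_ij) and collect exponents;
that of X_3 is the one making the total degree zero. -/
lemma monomialValue_kummerPt [NeZero N] {l : ℂ} {A : Matrix (Fin m) (Fin 4) (ZMod N)}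
    {c : Fin m → ℂ} {X : Fin 4 → ℂ} (hX : X ∈ kummer N l) (h : ∀ j, X j ≠ 0) (e : Exponent m) :
    monomialValue l (kummerPt A c X) e = unitFactor c e * ∏ j, X j ^ kummerExp A e j := by
  have h3 := h 3
  have hb : ∀ j : Fin 3, X j.castSucc / X 3 ≠ 0 := fun j => div_ne_zero (h _) h3
  have e1 : (kummerPt A c X).1 ^ e.2 0 * ((kummerPt A c X).1 - 1) ^ e.2 1 *
      ((kummerPt A c X).1 - l) ^ e.2 2 = ∏ j : Fin 3, (X j.castSucc / X 3) ^ (N * e.2 j : ℤ) := by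
    simp only [zpow_mul, zpow_natCast, kummerPt_sub (A := A) (c := c) hX h3, Fin.prod_univ_three]
    simp
  have e2 : ∏ i, (kummerPt A c X).2 i ^ e.1 i = unitFactor c e *
      ∏ j : Fin 3, (X j.castSucc / X 3) ^ (∑ i, e.1 i * (A i j.castSucc).val) := by
    simp only [kummerPt, mul_zpow, Finset.prod_mul_distrib, unitFactor]
    congr 1
    simp only [← Finset.prod_zpow]
    rw [Finset.prod_comm]
    refine Finset.prod_congr rfl fun j _ => ?_
    rw [zpow_finset_sum (hb j)]
    refine Finset.prod_congr rfl fun i _ => ?_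
    rw [← zpow_natCast, ← zpow_mul, mul_comm]
  rw [monomialValue, e1, e2, mul_assoc, ← Finset.prod_mul_distrib,
    Fin.prod_univ_castSucc (fun j : Fin 4 => X j ^ kummerExp A e j),
    show Fin.last 3 = (3 : Fin 4) from rfl, kummerExp_last, zpow_neg, zpow_finset_sum h3,
    ← Finset.prod_inv_distrib, ← Finset.prod_mul_distrib]
  congr 1
  refine Finset.prod_congr rfl fun j _ => ?_
  rw [← zpow_add₀ (hb j), kummerExp_castSucc, div_zpow, div_eq_mul_inv]

lemma kummerMap_of_ne [NeZero N] {l : ℂ} {A : Matrix (Fin m) (Fin 4) (ZMod N)}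
    {c : Fin m → ℂ} {X : Fin 4 → ℂ} (hX : X ∈ kummer N l) (h : ∀ j, X j ≠ 0) :
    kummerMap A c X = monomialValues l (kummerPt A c X) := by
  funext e
  rw [monomialValues_eq, monomialValue_kummerPt hX h, kummerMap, monomialMap_of_ne h]

/-- The choice `y₀` of a component of the equation locus is that given by the roots of unity `c`. -/
structure IsChoice (A : Matrix (Fin m) (Fin 4) (ZMod N)) (y₀ : ℂ × ℂ × (Fin m → ℂ))
    (c : Fin m → ℂ) : Prop where
  pow : ∀ i, c i ^ N = 1
  comp : connectedComponentIn (equationLocus A) y₀ = rootLocus A c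

lemma exists_isChoice [NeZero N] (A : Matrix (Fin m) (Fin 4) (ZMod N)) {y₀ : ℂ × ℂ × (Fin m → ℂ)}
    (hy : y₀ ∈ equationLocus A) : ∃ c, IsChoice A y₀ c := by
  obtain ⟨c, hc, h⟩ := exists_mem_rootLocus hy
  exact ⟨c, hc, component_eq hc h⟩

variable {A : Matrix (Fin m) (Fin 4) (ZMod N)} {y₀ : ℂ × ℂ × (Fin m → ℂ)} {c : Fin m → ℂ} {l : ℂ}

lemma IsChoice.ne_zero [NeZero N] (h : IsChoice A y₀ c) (i : Fin m) : c i ≠ 0 := fun h0 => by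
  have := h.pow i
  rw [h0, zero_pow (NeZero.ne N)] at this
  exact zero_ne_one this

lemma kummerPt_mem [NeZero N] (h : IsChoice A y₀ c) (hl : 0 < l.im) {X : Fin 4 → ℂ}
    (hX : X ∈ kummer N l) (h0 : ∀ j, X j ≠ 0) : kummerPt A c X ∈ openCover A y₀ l := by
  rw [openCover, Set.mem_ofPred_eq, h.comp]
  refine ⟨hl, fun j => ?_, fun j => X j.castSucc / X 3, fun j => kummerPt_sub hX (h0 3) j,
    fun i => rfl⟩
  rw [← sub_ne_zero]
  simp only
  rw [← kummerPt_sub (A := A) (c := c) hX (h0 3)]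
  exact pow_ne_zero _ (div_ne_zero (h0 _) (h0 3))

lemma exists_kummerPt [NeZero N] (h : IsChoice A y₀ c) {p : ℂ × (Fin m → ℂ)}
    (hp : p ∈ openCover A y₀ l) : ∃ X ∈ kummer N l, (∀ j, X j ≠ 0) ∧ kummerPt A c X = p := by
  rw [openCover, Set.mem_ofPred_eq, h.comp] at hp
  obtain ⟨-, h2, x, hx, hw⟩ := hp
  have hN := NeZero.ne N
  have hx0 : ∀ j, x j ≠ 0 := fun j h0 => by
    have := hx j
    rw [h0, zero_pow hN] at this
    exact h2 j (sub_eq_zero.1 this.symm)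
  set X : Fin 4 → ℂ := Fin.snoc (α := fun _ => ℂ) x 1 with hXdef
  have hXc : ∀ j : Fin 3, X j.castSucc = x j := fun j => Fin.snoc_castSucc (α := fun _ => ℂ) _ _ j
  have hX3 : X 3 = 1 := Fin.snoc_last (α := fun _ => ℂ) _ _
  have hX0 : X 0 = x 0 := hXc 0
  refine ⟨X, ⟨fun h0 => ?_, fun j => ?_⟩, fun j => ?_, ?_⟩
  · rw [h0] at hX3
    simp at hX3
  · rw [hXc, hX3, hX0, hx, hx]
    simp
  · refine Fin.lastCases ?_ (fun j => ?_) j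
    · rw [show X (Fin.last 3) = 1 from hX3]
      exact one_ne_zero
    · rw [hXc]
      exact hx0 j
  · refine Prod.ext ?_ (funext fun i => ?_)
    · simp only [kummerPt, hX3, hX0, div_one, hx]
      simp
    · simp only [kummerPt, hX3, hXc, div_one]
      exact (hw i).symm

end AbelianCover

namespace AbelianCover

open Filter OnePoint

variable {N m : ℕ}

/-! ### Charts of the Kummer curve -/

/-- Near 1 the argument stays within π/N of zero, where the principal root inverts the N-th power.
-/
lemma eventually_eq_root [NeZero N] : ∀ᶠ y in 𝓝 (1 : ℂ), (y ^ N) ^ ((N : ℂ)⁻¹) = y := by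
  have hN : (0 : ℝ) < N := Nat.cast_pos.2 (Nat.pos_of_ne_zero (NeZero.ne N))
  have h : Tendsto Complex.arg (𝓝 1) (𝓝 0) := by
    simpa using (Complex.continuousAt_arg Complex.one_mem_slitPlane).tendsto
  have hpos : 0 < Real.pi / N := div_pos Real.pi_pos hN
  filter_upwards [h.eventually (Ioo_mem_nhds (neg_lt_zero.2 hpos) hpos)] with y hy
  exact Complex.pow_cpow_nat_inv (NeZero.ne N) hy.1 hy.2.le

lemma tendsto_root_one {α : Type*} {F : Filter α} {f : α → ℂ} (h : Tendsto f F (𝓝 1)) (a : ℂ) :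
    Tendsto (fun x => f x ^ a) F (𝓝 1) := by
  have := h.cpow (tendsto_const_nhds (x := a)) Complex.one_mem_slitPlane
  rwa [Complex.one_cpow] at this

/-- The direction of the line on which the `N`-th powers of the coordinates move in a chart. -/
def chartDir (l : ℂ) (X : Fin 4 → ℂ) : Fin 4 → ℂ :=
  open Classical in
  if X 3 = 0 then Fin.snoc (α := fun _ => ℂ) (fun j => -branchPt l j) 1
  else Fin.snoc (α := fun _ => ℂ) (fun _ => 1) 0

/-- The order of the local coordinate at a point of the Kummer curve. -/
def chartOrder (N : ℕ) (X : Fin 4 → ℂ) : ℕ :=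
  open Classical in if ∃ j, X j = 0 then N else 1

/-- A chart of the Kummer curve with centre `X`. -/
def chart (N : ℕ) (l : ℂ) (X : Fin 4 → ℂ) (t : ℂ) : Fin 4 → ℂ := fun j =>
  open Classical in
  if X j = 0 then t else
    X j * (1 + t ^ chartOrder N X * chartDir l X j / X j ^ N) ^ ((N : ℂ)⁻¹)

variable {l : ℂ} {X : Fin 4 → ℂ}

lemma chartOrder_ne_zero [NeZero N] : chartOrder N X ≠ 0 := by
  rw [chartOrder]
  split_ifs
  · exact NeZero.ne N
  · exact one_ne_zero

lemma chartDir_castSucc (j : Fin 3) :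
    chartDir l X j.castSucc = chartDir l X 0 - branchPt l j * chartDir l X 3 := by
  have h3 : (3 : Fin 4) = Fin.last 3 := rfl
  have h0 : (0 : Fin 4) = (0 : Fin 3).castSucc := rfl
  simp only [chartDir]
  split_ifs <;> rw [h3, h0] <;> simp only [Fin.snoc_castSucc, Fin.snoc_last] <;> simp

lemma chartDir_eq_one (hl : 0 < l.im) [NeZero N] (hX : X ∈ kummer N l) {j : Fin 4} (hj : X j = 0) :
    chartDir l X j = 1 := by
  have h3' : (3 : Fin 4) = Fin.last 3 := rfl
  by_cases h3 : X 3 = 0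
  · rw [kummer_zero_unique hl hX hj h3, chartDir, if_pos h3, h3']
    exact Fin.snoc_last (α := fun _ => ℂ) _ _
  · rw [chartDir, if_neg h3]
    refine Fin.lastCases (motive := fun j => X j = 0 → Fin.snoc (α := fun _ => ℂ) (fun _ => (1 : ℂ))
      (0 : ℂ) j = 1) (fun h => (h3 h).elim) (fun j _ => ?_) j hj
    exact Fin.snoc_castSucc (α := fun _ => ℂ) _ _ _

lemma chart_zero [NeZero N] : chart N l X 0 = X := by
  funext j
  rw [chart]
  split_ifs with h
  · exact h.symm
  · rw [zero_pow chartOrder_ne_zero]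
    simp

/-- The Kummer equations are linear in the N-th powers, so they persist when these move along a
line. At a point with a vanishing coordinate the line parameter is t^N, which makes t itself that
coordinate. -/
lemma chart_pow [NeZero N] (hl : 0 < l.im) (hX : X ∈ kummer N l) (t : ℂ) (j : Fin 4) :
    chart N l X t j ^ N = X j ^ N + t ^ chartOrder N X * chartDir l X j := by
  rw [chart]
  split_ifs with h
  · rw [chartDir_eq_one hl hX h, h, zero_pow (NeZero.ne N), chartOrder, if_pos ⟨j, h⟩, zero_add,
      mul_one]
  · rw [mul_pow, Complex.cpow_nat_inv_pow _ (NeZero.ne N)]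
    field_simp

lemma eventually_chart_slit [NeZero N] : ∀ᶠ t in 𝓝 (0 : ℂ), ∀ j,
    1 + t ^ chartOrder N X * chartDir l X j / X j ^ N ∈ Complex.slitPlane := by
  rw [eventually_all]
  intro j
  have h : ContinuousAt (fun t : ℂ => 1 + t ^ chartOrder N X * chartDir l X j / X j ^ N) 0 := by
    fun_prop
  refine h (Complex.isOpen_slitPlane.mem_nhds ?_)
  simp only
  rw [zero_pow chartOrder_ne_zero]
  simp

lemma differentiableAt_chart {t : ℂ}
    (h : ∀ j, 1 + t ^ chartOrder N X * chartDir l X j / X j ^ N ∈ Complex.slitPlane) (j : Fin 4) :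
    DifferentiableAt ℂ (fun t => chart N l X t j) t := by
  simp only [chart]
  split_ifs
  · exact differentiableAt_fun_id
  · refine (differentiableAt_const _).mul ?_
    exact DifferentiableAt.cpow (by fun_prop) (differentiableAt_const _) (h j)

lemma continuousAt_chart [NeZero N] : ContinuousAt (chart N l X) 0 := by
  refine continuousAt_pi.2 fun j => ?_
  exact (differentiableAt_chart (eventually_chart_slit.self_of_nhds) j).continuousAt

/-- All that is needed of a parameter `t` of a chart. -/
structure ChartGood (N : ℕ) (l : ℂ) (X : Fin 4 → ℂ) (t : ℂ) : Prop where
  mem : chart N l X t ∈ kummer N l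
  slit : ∀ j, 1 + t ^ chartOrder N X * chartDir l X j / X j ^ N ∈ Complex.slitPlane
  ne : ∀ j, X j ≠ 0 → chart N l X t j ≠ 0

lemma eventually_chartGood [NeZero N] (hl : 0 < l.im) (hX : X ∈ kummer N l) :
    ∀ᶠ t in 𝓝 (0 : ℂ), ChartGood N l X t := by
  have hc : ContinuousAt (chart N l X) 0 := continuousAt_chart
  have h1 : ∀ᶠ t in 𝓝 (0 : ℂ), chart N l X t ≠ 0 :=
    hc.eventually_ne (by rw [chart_zero (N := N)]; exact hX.1)
  have h2 : ∀ᶠ t in 𝓝 (0 : ℂ), ∀ j, X j ≠ 0 → chart N l X t j ≠ 0 := by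
    rw [eventually_all]
    intro j
    by_cases hj : X j = 0
    · simp [hj]
    · have : ContinuousAt (fun t => chart N l X t j) 0 :=
        (continuous_apply j).continuousAt.comp hc
      filter_upwards [this.eventually_ne (by rw [chart_zero]; exact hj)] with t ht _ using ht
  filter_upwards [h1, h2, eventually_chart_slit (N := N)] with t ht1 ht2 ht3
  refine ⟨⟨ht1, fun j => ?_⟩, ht3, ht2⟩
  rw [chart_pow hl hX, chart_pow hl hX, chart_pow hl hX, hX.2 j, chartDir_castSucc]
  ring

lemma ChartGood.ne_zero {t : ℂ} (h : ChartGood N l X t) (ht : t ≠ 0 ∨ ∀ j, X j ≠ 0) (j : Fin 4) :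
    chart N l X t j ≠ 0 := by
  by_cases hj : X j = 0
  · rw [chart, if_pos hj]
    rcases ht with ht | ht
    · exact ht
    · exact (ht j hj).elim
  · exact h.ne j hj

/-- Up to scaling, all points of the Kummer curve near `X` are in the chart. -/
lemma exists_chart_param [NeZero N] (hl : 0 < l.im) (hX : X ∈ kummer N l) :
    ∃ (T ρ : (Fin 4 → ℂ) → ℂ), Tendsto T (𝓝[kummer N l] X) (𝓝 0) ∧
      ∀ᶠ Y in 𝓝[kummer N l] X, ρ Y ≠ 0 ∧ chart N l X (T Y) = ρ Y • Y := by
  classical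
  have hN := NeZero.ne N
  have hcoord : ∀ j : Fin 4, Tendsto (fun Y : Fin 4 → ℂ => Y j) (𝓝[kummer N l] X) (𝓝 (X j)) :=
    fun j => (continuous_apply j).continuousAt.tendsto.mono_left nhdsWithin_le_nhds
  -- This is the coordinate the chart keeps fixed; it is used to normalize the scaling.
  set k : Fin 4 := if X 3 = 0 then 0 else 3 with hk
  have hXk : X k ≠ 0 := by
    rw [hk]
    split_ifs with h
    · exact fun h0 => absurd (kummer_zero_unique (N := N) hl hX h h0) (by decide)
    · exact h
  have hdk : chartDir l X k = 0 := by
    rw [hk, chartDir]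
    split_ifs with h
    · rw [show (0 : Fin 4) = (0 : Fin 3).castSucc from rfl, Fin.snoc_castSucc]
      simp
    · exact Fin.snoc_last (α := fun _ => ℂ) _ _
  -- Scaling by ρ gives the fixed coordinate of Y the same N-th power as that of X. As ρ tends to 1,
  -- the scaled point is still close to X.
  set ρ : (Fin 4 → ℂ) → ℂ := fun Y => (X k ^ N / Y k ^ N) ^ ((N : ℂ)⁻¹) with hρ
  have hρ1 : Tendsto ρ (𝓝[kummer N l] X) (𝓝 1) := by
    refine tendsto_root_one ?_ _
    have := (tendsto_const_nhds (x := X k ^ N)).div ((hcoord k).pow N) (pow_ne_zero _ hXk)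
    rwa [div_self (pow_ne_zero _ hXk)] at this
  have hW : ∀ j, Tendsto (fun Y => ρ Y * Y j) (𝓝[kummer N l] X) (𝓝 (X j)) := fun j => by
    simpa using hρ1.mul (hcoord j)
  -- The parameter is read off from the vanishing coordinate if there is one, otherwise from the
  -- displacement of X_0^N.
  set T : (Fin 4 → ℂ) → ℂ := fun Y => if h : ∃ j, X j = 0 then ρ Y * Y h.choose
    else (ρ Y * Y 0) ^ N - X 0 ^ N with hT
  have hT0 : Tendsto T (𝓝[kummer N l] X) (𝓝 0) := by
    by_cases h : ∃ j, X j = 0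
    · simp only [hT, dif_pos h]
      have := hW h.choose
      rwa [h.choose_spec] at this
    · simp only [hT, dif_neg h]
      have := ((hW 0).pow N).sub_const (X 0 ^ N)
      rwa [sub_self] at this
  refine ⟨T, ρ, hT0, ?_⟩
  -- The N-th powers determine the coordinates only up to roots of unity; closeness to X selects the
  -- principal root.
  have hroot : ∀ᶠ Y in 𝓝[kummer N l] X, ∀ j, X j ≠ 0 →
      ((ρ Y * Y j / X j) ^ N) ^ ((N : ℂ)⁻¹) = ρ Y * Y j / X j := by
    rw [eventually_all]
    intro j
    by_cases hj : X j = 0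
    · simp [hj]
    · have h1 : Tendsto (fun Y => ρ Y * Y j / X j) (𝓝[kummer N l] X) (𝓝 1) := by
        have := (hW j).div_const (X j)
        rwa [div_self hj] at this
      filter_upwards [h1.eventually (eventually_eq_root (N := N))] with Y hY _ using hY
  filter_upwards [hroot, hρ1.eventually_ne one_ne_zero, (hcoord k).eventually_ne hXk,
    self_mem_nhdsWithin] with Y hroot hρ0 hYk hY
  refine ⟨hρ0, ?_⟩
  set W : Fin 4 → ℂ := ρ Y • Y with hWdef
  have hWj : ∀ j, ρ Y * Y j = W j := fun j => rfl
  have hWK : W ∈ kummer N l := smul_mem_kummer hY hρ0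
  have hWk : W k ^ N = X k ^ N := by
    rw [← hWj, mul_pow, hρ, Complex.cpow_nat_inv_pow _ hN, div_mul_cancel₀ _ (pow_ne_zero _ hYk)]
  obtain ⟨s, hs⟩ : ∃ s : ℂ, ∀ j, W j ^ N = X j ^ N + s * chartDir l X j := by
    have h0d : ∀ j : Fin 3, W j.castSucc ^ N - X j.castSucc ^ N =
        (W 0 ^ N - X 0 ^ N) - branchPt l j * (W 3 ^ N - X 3 ^ N) := fun j => by
      rw [hWK.2 j, hX.2 j]; ring
    have h3' : (3 : Fin 4) = Fin.last 3 := rfl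
    by_cases h3 : X 3 = 0
    · rw [hk, if_pos h3] at hWk
      refine ⟨W 3 ^ N - X 3 ^ N, fun j => ?_⟩
      refine Fin.lastCases ?_ (fun j => ?_) j
      · rw [chartDir, if_pos h3, Fin.snoc_last, h3']; ring
      · rw [chartDir, if_pos h3, Fin.snoc_castSucc]
        linear_combination h0d j + hWk
    · rw [hk, if_neg h3] at hWk
      refine ⟨W 0 ^ N - X 0 ^ N, fun j => ?_⟩
      refine Fin.lastCases ?_ (fun j => ?_) j
      · rw [chartDir, if_neg h3, Fin.snoc_last, mul_zero, add_zero]; exact hWk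
      · rw [chartDir, if_neg h3, Fin.snoc_castSucc]
        linear_combination h0d j - branchPt l j * hWk
  have hsT : s = T Y ^ chartOrder N X := by
    by_cases h : ∃ j, X j = 0
    · simp only [hT, dif_pos h, chartOrder, if_pos h, hWj]
      rw [hs, chartDir_eq_one hl hX h.choose_spec, h.choose_spec, zero_pow hN]
      ring
    · simp only [hT, dif_neg h, chartOrder, if_neg h, hWj]
      have h3 : X 3 ≠ 0 := fun h3 => h ⟨3, h3⟩
      rw [hs, chartDir, if_neg h3, show (0 : Fin 4) = (0 : Fin 3).castSucc from rfl,
        Fin.snoc_castSucc]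
      ring
  funext j
  rw [chart, ← hsT]
  split_ifs with hj
  · have h : ∃ j, X j = 0 := ⟨j, hj⟩
    simp only [hT, dif_pos h, hWj]
    rw [kummer_zero_unique hl hX h.choose_spec hj]
  · have h1 : 1 + s * chartDir l X j / X j ^ N = (ρ Y * Y j / X j) ^ N := by
      rw [div_pow, hWj, hs]
      field_simp
    rw [h1, hroot j hj, mul_div_cancel₀ _ hj]
    rfl

/-! ### The cover as a quotient of the Kummer curve -/

variable {A : Matrix (Fin m) (Fin 4) (ZMod N)} {y₀ : ℂ × ℂ × (Fin m → ℂ)} {c : Fin m → ℂ}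

/-- For t ≠ 0 the chart consists of points over the open curve, and the given point is their limit
as t tends to 0. -/
lemma kummerMap_mem_cover [NeZero N] (h : IsChoice A y₀ c) (hl : 0 < l.im) (hX : X ∈ kummer N l) :
    kummerMap A c X ∈ cover A y₀ l := by
  have h1 : Tendsto (fun t => kummerMap A c (chart N l X t)) (𝓝[≠] 0) (𝓝 (kummerMap A c X)) := by
    have h2 : ContinuousAt (kummerMap A c) (chart N l X 0) := by
      rw [chart_zero]
      exact continuousAt_kummerMap A h.ne_zero hl hX
    have h3 := ContinuousAt.comp (f := chart N l X) (x := 0) h2 continuousAt_chart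
    have h4 := h3.tendsto
    rw [Function.comp_apply, chart_zero] at h4
    exact h4.mono_left nhdsWithin_le_nhds
  refine mem_closure_of_tendsto h1 ?_
  filter_upwards [self_mem_nhdsWithin, nhdsWithin_le_nhds (eventually_chartGood hl hX)] with t ht hg
  have hne := hg.ne_zero (Or.inl ht)
  rw [kummerMap_of_ne hg.mem hne]
  exact Set.mem_image_of_mem _ (kummerPt_mem h hl hg.mem hne)

lemma isCompact_kummer_sphere : IsCompact (kummer N l ∩ Metric.sphere 0 1) := by
  have : kummer N l ∩ Metric.sphere 0 1 = {X : Fin 4 → ℂ | ∀ j : Fin 3,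
      X j.castSucc ^ N = X 0 ^ N - branchPt l j * X 3 ^ N} ∩ Metric.sphere 0 1 := by
    ext X
    simp only [kummer, Set.mem_inter_iff, Set.mem_ofPred_eq]
    constructor
    · exact fun h => ⟨h.1.2, h.2⟩
    · refine fun h => ⟨⟨fun h0 => ?_, h.1⟩, h.2⟩
      have := h.2
      rw [h0] at this
      simp at this
  rw [this]
  refine (isCompact_sphere 0 1).inter_left ?_
  rw [Set.ofPred_forall]
  exact isClosed_iInter fun j => isClosed_eq (by fun_prop) (by fun_prop)

/-- The unit vectors of the Kummer cone form a compact set, so their image is closed. By homogeneity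
it contains the open curve, hence its closure. -/
lemma exists_kummerMap_sphere [NeZero N] (h : IsChoice A y₀ c) (hl : 0 < l.im)
    {x : Exponent m → OnePoint ℂ} (hx : x ∈ cover A y₀ l) :
    ∃ X ∈ kummer N l ∩ Metric.sphere 0 1, kummerMap A c X = x := by
  have hcomp : IsCompact (kummerMap A c '' (kummer N l ∩ Metric.sphere 0 1)) :=
    isCompact_kummer_sphere.image_of_continuousOn fun X hX =>
      (continuousAt_kummerMap A h.ne_zero hl hX.1).continuousWithinAt
  refine closure_minimal ?_ hcomp.isClosed hx
  rintro _ ⟨p, hp, rfl⟩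
  obtain ⟨X, hX, hne, rfl⟩ := exists_kummerPt h hp
  have hn : (‖X‖ : ℂ) ≠ 0 := by simpa using hX.1
  refine ⟨(‖X‖ : ℂ)⁻¹ • X, ⟨smul_mem_kummer hX (inv_ne_zero hn), ?_⟩, ?_⟩
  · have : ‖X‖ ≠ 0 := by simpa using hn
    rw [mem_sphere_zero_iff_norm, norm_smul, norm_inv, Complex.norm_real, norm_norm,
      inv_mul_cancel₀ this]
  · rw [kummerMap_smul A c (inv_ne_zero hn), kummerMap_of_ne hX hne]

/-- What holds near the centres of all charts over `x` holds near `x`. -/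
lemma eventually_cover [NeZero N] (h : IsChoice A y₀ c) (hl : 0 < l.im)
    {Q : (Exponent m → OnePoint ℂ) → Prop} {x : Exponent m → OnePoint ℂ}
    (hQ : ∀ X ∈ kummer N l, kummerMap A c X = x →
      ∀ᶠ t in 𝓝 (0 : ℂ), Q (kummerMap A c (chart N l X t))) :
    ∀ᶠ y in 𝓝[cover A y₀ l] x, Q y := by
  classical
  by_contra hcon
  -- If Q failed near x, an ultrafilter converging to x on which Q fails would lift to the compact
  -- Kummer sphere. The lift converges to a point over x, and the chart there gives Q after all.
  set F : Filter (Exponent m → OnePoint ℂ) := 𝓝[cover A y₀ l] x ⊓ 𝓟 {y | ¬ Q y}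
  have hF : F.NeBot := by
    have : ∃ᶠ y in 𝓝[cover A y₀ l] x, ¬ Q y := Filter.not_eventually.1 hcon
    exact Filter.frequently_mem_iff_neBot.1 this
  set U := Ultrafilter.of F
  have hU : (U : Filter _) ≤ F := Ultrafilter.of_le F
  have hUc : ∀ᶠ y in (U : Filter _), y ∈ cover A y₀ l :=
    (hU.trans inf_le_left) self_mem_nhdsWithin
  have hUQ : ∀ᶠ y in (U : Filter _), ¬ Q y := (hU.trans inf_le_right) (mem_principal_self _)
  choose! σ hσ hσ' using fun x (hx : x ∈ cover A y₀ l) => exists_kummerMap_sphere h hl hx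
  obtain ⟨X, hXK, hXlim⟩ := isCompact_kummer_sphere.ultrafilter_le_nhds (U.map σ) (by
    rw [le_principal_iff]
    exact hUc.mono fun y hy => hσ y hy)
  have hlim : Tendsto σ U (𝓝 X) := hXlim
  have hX := hXK.1
  have hxX : kummerMap A c X = x := by
    have h1 : Tendsto (fun y => kummerMap A c (σ y)) U (𝓝 (kummerMap A c X)) :=
      (continuousAt_kummerMap A h.ne_zero hl hX).tendsto.comp hlim
    have h2 : Tendsto (fun y => kummerMap A c (σ y)) U (𝓝 x) := by
      have h3 : Tendsto id (U : Filter _) (𝓝 x) :=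
        (hU.trans inf_le_left).trans nhdsWithin_le_nhds
      refine h3.congr' ?_
      filter_upwards [hUc] with y hy using (hσ' y hy).symm
    exact tendsto_nhds_unique h1 h2
  have hlim' : Tendsto σ U (𝓝[kummer N l] X) :=
    tendsto_nhdsWithin_iff.2 ⟨hlim, hUc.mono fun y hy => (hσ y hy).1⟩
  obtain ⟨T, ρ, hT, hTρ⟩ := exists_chart_param hl hX
  have hev : ∀ᶠ y in (U : Filter _), Q y := by
    filter_upwards [(hT.comp hlim').eventually (hQ X hX hxX), hlim'.eventually hTρ, hUc]
      with y h1 h2 h3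
    rw [Function.comp_apply, h2.2, kummerMap_smul A c h2.1, hσ' y h3] at h1
    exact h1
  exact (hev.and hUQ).exists.elim fun y hy => hy.2 hy.1

end AbelianCover

namespace AbelianCover

open Filter OnePoint

variable {N m : ℕ} {A : Matrix (Fin m) (Fin 4) (ZMod N)} {y₀ : ℂ × ℂ × (Fin m → ℂ)}
  {c : Fin m → ℂ} {l : ℂ} {X : Fin 4 → ℂ}

/-! ### Functions on the cover in the coordinates of the Kummer curve -/

/-- A function on the compact surface as a function of the coordinates of the Kummer curve. -/
def pullback (c : Fin m → ℂ) (F : cover A y₀ l → ℂ) (X : Fin 4 → ℂ) : ℂ :=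
  Function.extend Subtype.val F 0 (kummerMap A c X)

/-- A function on the open curve as a function of the coordinates of the Kummer curve. -/
def pullbackOpen (c : Fin m → ℂ) (f : openCover A y₀ l → ℂ) (X : Fin 4 → ℂ) : ℂ :=
  Function.extend Subtype.val f 0 (kummerPt A c X)

lemma pullback_eq (F : cover A y₀ l → ℂ) (x : cover A y₀ l) (hx : kummerMap A c X = x.1) :
    pullback c F X = F x := by
  rw [pullback, hx, Subtype.val_injective.extend_apply]

lemma pullbackOpen_eq (f : openCover A y₀ l → ℂ) (p : openCover A y₀ l)
    (hp : kummerPt A c X = p.1) : pullbackOpen c f X = f p := by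
  rw [pullbackOpen, hp, Subtype.val_injective.extend_apply]

lemma eventually_cover_subtype [NeZero N] (h : IsChoice A y₀ c) (hl : 0 < l.im)
    {Q : cover A y₀ l → Prop} {x : cover A y₀ l}
    (hQ : ∀ X ∈ kummer N l, kummerMap A c X = x.1 →
      ∀ᶠ t in 𝓝 (0 : ℂ), ∀ y : cover A y₀ l, kummerMap A c (chart N l X t) = y.1 → Q y) :
    ∀ᶠ y in 𝓝 x, Q y := by
  have h1 := eventually_cover h hl (Q := fun y => ∀ hy : y ∈ cover A y₀ l, Q ⟨y, hy⟩)
    (x := x.1) fun X hX hXx => (hQ X hX hXx).mono fun t ht hy => ht ⟨_, hy⟩ rfl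
  rw [← map_nhds_subtype_val, eventually_map] at h1
  exact h1.mono fun y hy => hy y.2

lemma monomialValues_injective : Function.Injective (monomialValues (m := m) l) := by
  intro p q hpq
  have h1 : ∀ e, monomialValue l p e = monomialValue l q e := fun e =>
    OnePoint.coe_injective (congrFun hpq e)
  refine Prod.ext ?_ (funext fun i => ?_)
  · simpa [monomialValue] using h1 (0, Pi.single 0 1)
  · have := h1 (Pi.single i 1, 0)
    simpa [monomialValue, Pi.single_apply, apply_ite, Finset.prod_ite_eq'] using this

lemma openCover_ne [NeZero N] (h : IsChoice A y₀ c) (p : openCover A y₀ l) :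
    (∀ j, p.1.1 ≠ branchPt l j) ∧ ∀ i, p.1.2 i ≠ 0 := by
  obtain ⟨X, hX, hne, hp⟩ := exists_kummerPt h p.2
  constructor
  · intro j
    rw [← sub_ne_zero, ← hp, ← kummerPt_sub hX (hne 3)]
    exact pow_ne_zero _ (div_ne_zero (hne _) (hne 3))
  · intro i
    rw [← hp]
    exact mul_ne_zero (h.ne_zero i) (Finset.prod_ne_zero_iff.2 fun j _ =>
      pow_ne_zero _ (div_ne_zero (hne _) (hne 3)))

lemma continuous_monomialValue [NeZero N] (h : IsChoice A y₀ c) (e : Exponent m) :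
    Continuous fun p : openCover A y₀ l => monomialValue l p.1 e := by
  have h1 : Continuous fun p : openCover A y₀ l => p.1.1 := by fun_prop
  have hb : ∀ j : Fin 3, Continuous fun p : openCover A y₀ l => (p.1.1 - branchPt l j) ^ e.2 j :=
    fun j => (h1.sub continuous_const).zpow₀ _ fun p =>
      Or.inl (sub_ne_zero.2 ((openCover_ne h p).1 j))
  have hb0 := hb 0
  have hb1 := hb 1
  have hb2 := hb 2
  simp only [branchPt_zero, branchPt_one, branchPt_two, sub_zero] at hb0 hb1 hb2
  refine Continuous.mul ?_ ((hb0.mul hb1).mul hb2)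
  refine continuous_finsetProd _ fun i _ => ?_
  have h2 : Continuous fun p : openCover A y₀ l => p.1.2 i := by fun_prop
  exact h2.zpow₀ _ fun p => Or.inl ((openCover_ne h p).2 i)

lemma continuous_openInclusion [NeZero N] (h : IsChoice A y₀ c) :
    Continuous (openInclusion A y₀ l) := by
  refine Continuous.subtype_mk (continuous_pi fun e => ?_) _
  exact OnePoint.continuous_coe.comp (continuous_monomialValue h e)

/-- If the image of a point of the Kummer curve lies in the open curve, then no coordinate
vanishes. -/
lemma kummer_ne_zero_of_finite [NeZero N] {p : ℂ × (Fin m → ℂ)}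
    (hp : kummerMap A c X = monomialValues l p) (j : Fin 4) : X j ≠ 0 := fun hj => by
  obtain ⟨e, he⟩ : ∃ e : Exponent m, kummerExp A e j < 0 := by
    refine Fin.lastCases ?_ (fun j => ?_) j
    · refine ⟨(0, Pi.single 0 1), ?_⟩
      rw [show Fin.last 3 = (3 : Fin 4) from rfl, kummerExp_last]
      simp only [kummerExp_castSucc, Fin.sum_univ_three]
      simp [Nat.pos_of_ne_zero (NeZero.ne N)]
    · refine ⟨(0, Pi.single j (-1)), ?_⟩
      rw [kummerExp_castSucc]
      simp [Nat.pos_of_ne_zero (NeZero.ne N)]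
  have h1 := congrFun hp e
  rw [kummerMap, monomialMap, if_pos ⟨j, hj, he⟩, monomialValues_eq] at h1
  exact OnePoint.infty_ne_coe _ h1

lemma kummerPt_eq_of_kummerMap [NeZero N] (hX : X ∈ kummer N l) {p : ℂ × (Fin m → ℂ)}
    (hp : kummerMap A c X = monomialValues l p) : kummerPt A c X = p :=
  monomialValues_injective ((kummerMap_of_ne hX (kummer_ne_zero_of_finite hp)).symm.trans hp)

lemma eventually_openCover [NeZero N] (h : IsChoice A y₀ c) (hl : 0 < l.im)
    {Q : openCover A y₀ l → Prop} {p : openCover A y₀ l}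
    (hQ : ∀ X ∈ kummer N l, (∀ j, X j ≠ 0) → kummerPt A c X = p.1 →
      ∀ᶠ t in 𝓝 (0 : ℂ), ∀ q : openCover A y₀ l, kummerPt A c (chart N l X t) = q.1 → Q q) :
    ∀ᶠ q in 𝓝 p, Q q := by
  have h1 : ∀ᶠ y in 𝓝 (openInclusion A y₀ l p), ∀ q, openInclusion A y₀ l q = y → Q q := by
    refine eventually_cover_subtype h hl fun X hX hXp => ?_
    have hp : kummerMap A c X = monomialValues l p.1 := hXp
    filter_upwards [hQ X hX (kummer_ne_zero_of_finite hp) (kummerPt_eq_of_kummerMap hX hp),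
      eventually_chartGood hl hX] with t ht hg y hy q hq
    refine ht q (kummerPt_eq_of_kummerMap hg.mem (hy.trans ?_))
    rw [← hq]
    rfl
  exact ((continuous_openInclusion h).tendsto p |>.eventually h1).mono fun q hq => hq q rfl

/-! ### Primitives along curves in the Kummer curve -/

section Curves

variable {𝕜 : Type*} [NontriviallyNormedField 𝕜] [NormedAlgebra 𝕜 ℂ]

lemma continuousAt_pullback {S : Type*} [TopologicalSpace S] [NeZero N] (h : IsChoice A y₀ c)
    (hl : 0 < l.im) {F : cover A y₀ l → ℂ} {γ : S → Fin 4 → ℂ} {s : S} {x : cover A y₀ l}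
    (hγ : ContinuousAt γ s) (hK : ∀ᶠ t in 𝓝 s, γ t ∈ kummer N l)
    (hx : kummerMap A c (γ s) = x.1) (hF : ContinuousAt F x) :
    ContinuousAt (fun t => pullback c F (γ t)) s := by
  have h1 : ContinuousAt (fun t => kummerMap A c (γ t)) s :=
    ContinuousAt.comp (f := γ) (continuousAt_kummerMap A h.ne_zero hl hK.self_of_nhds) hγ
  have h2 : Tendsto (fun t => kummerMap A c (γ t)) (𝓝 s) (𝓝[cover A y₀ l] x.1) := by
    rw [← hx]
    exact tendsto_nhdsWithin_iff.2 ⟨h1, hK.mono fun t ht => kummerMap_mem_cover h hl ht⟩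
  have h3 : Tendsto (Function.extend Subtype.val F 0) (𝓝[cover A y₀ l] x.1) (𝓝 (F x)) := by
    rw [← map_nhds_subtype_val, tendsto_map'_iff]
    refine hF.tendsto.congr fun y => ?_
    rw [Function.comp_apply, Subtype.val_injective.extend_apply]
  have h4 := h3.comp h2
  rw [ContinuousAt, pullback_eq F x hx]
  exact h4

lemma continuousAt_kummerPt (h3 : X 3 ≠ 0) : ContinuousAt (kummerPt A c) X := by
  have hd : ∀ j : Fin 4, ContinuousAt (fun Y : Fin 4 → ℂ => Y j / Y 3) X := fun j =>
    (continuous_apply j).continuousAt.div (continuous_apply 3).continuousAt h3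
  refine ((hd 0).pow N).prodMk (continuousAt_pi.2 fun i => ?_)
  exact continuousAt_const.mul (tendsto_finsetProd _ fun j _ => (hd _).pow _)

/-- The difference quotients that define a primitive are taken with respect to z. The condition z' ≠
0 ensures that z really changes along the curve, so the chain rule applies. Charts need this over ℂ,
paths over ℝ. -/
lemma hasDerivAt_pullback [NeZero N] (h : IsChoice A y₀ c) (hl : 0 < l.im)
    {f : openCover A y₀ l → ℂ} {U : Set (cover A y₀ l)} {F : cover A y₀ l → ℂ}
    (hF : IsPrimitiveOn f U F) {γ : 𝕜 → Fin 4 → ℂ} {s : 𝕜} {z' : ℂ} (hγ : ContinuousAt γ s)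
    (hK : ∀ᶠ t in 𝓝 s, γ t ∈ kummer N l) (hne : ∀ j, γ s j ≠ 0) {x : cover A y₀ l} (hxU : x ∈ U)
    (hx : kummerMap A c (γ s) = x.1) (hz : HasDerivAt (fun t => (kummerPt A c (γ t)).1) z' s)
    (hz' : z' ≠ 0) :
    HasDerivAt (fun t => pullback c F (γ t)) (pullbackOpen c f (γ s) * z') s := by
  classical
  have hK0 := hK.self_of_nhds
  have hne' : ∀ᶠ t in 𝓝 s, ∀ j, γ t j ≠ 0 := by
    rw [eventually_all]
    exact fun j => ((continuous_apply j).continuousAt.comp hγ).eventually_ne (hne j)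
  set p : openCover A y₀ l := ⟨kummerPt A c (γ s), kummerPt_mem h hl hK0 hne⟩ with hp
  have hpx : openInclusion A y₀ l p = x := Subtype.ext (by
    rw [← hx, kummerMap_of_ne hK0 hne]; rfl)
  set q : 𝕜 → openCover A y₀ l := fun t =>
    if h : kummerPt A c (γ t) ∈ openCover A y₀ l then ⟨_, h⟩ else p with hq
  have hqv : ∀ᶠ t in 𝓝 s, (q t).1 = kummerPt A c (γ t) := by
    filter_upwards [hK, hne'] with t h1 h2
    simp only [hq, dif_pos (kummerPt_mem h hl h1 h2)]
  have hqlim : Tendsto q (𝓝[≠] s) (𝓝[≠] p) := by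
    refine tendsto_nhdsWithin_iff.2 ⟨?_, ?_⟩
    · refine Tendsto.mono_left ?_ nhdsWithin_le_nhds
      rw [tendsto_subtype_rng]
      refine Tendsto.congr' (EventuallyEq.symm hqv) ?_
      exact (ContinuousAt.comp (f := γ) (continuousAt_kummerPt (hne 3)) hγ).tendsto
    · filter_upwards [nhdsWithin_le_nhds hqv, hz.eventually_ne (c := p.1.1) hz'] with t h1 h2 h3
      rw [Set.mem_singleton_iff] at h3
      rw [← h1, h3] at h2
      exact h2 rfl
  rw [hasDerivAt_iff_tendsto_slope] at hz ⊢
  have h1 := ((hF.2 p (by rwa [hpx])).comp hqlim).mul hz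
  rw [pullbackOpen_eq f p rfl]
  refine h1.congr' ?_
  filter_upwards [nhdsWithin_le_nhds hqv, nhdsWithin_le_nhds hK, nhdsWithin_le_nhds hne',
    hqlim.eventually self_mem_nhdsWithin, hz.eventually_ne hz'] with t h1 h2 h3 h4 h5
  have hz0 : (kummerPt A c (γ t)).1 - (kummerPt A c (γ s)).1 ≠ 0 := by
    intro h0
    rw [slope, vsub_eq_sub, h0, smul_zero] at h5
    exact h5 rfl
  have e1 : F (openInclusion A y₀ l (q t)) = pullback c F (γ t) := by
    refine (pullback_eq F _ ?_).symm
    rw [kummerMap_of_ne h2 h3, ← h1]; rfl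
  have e2 : F (openInclusion A y₀ l p) = pullback c F (γ s) := by
    refine (pullback_eq F _ ?_).symm
    rw [kummerMap_of_ne hK0 hne]; rfl
  simp only [Function.comp_apply, slope, vsub_eq_sub, e1, e2, h1]
  rw [mul_smul_comm, div_mul_cancel₀ _ hz0]

end Curves

/-! ### Primitives in charts -/

/-- The derivative of `z` in a chart. -/
def chartDeriv (N : ℕ) (l : ℂ) (X : Fin 4 → ℂ) (t : ℂ) : ℂ :=
  chartOrder N X * t ^ (chartOrder N X - 1) *
    (chartDir l X 0 * X 3 ^ N - chartDir l X 3 * X 0 ^ N) / (chart N l X t 3 ^ N) ^ 2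

/-- In a chart, z is a fractional linear function of the line parameter; this is its determinant, up
to which z has nonzero derivative. -/
lemma chartDir_det_ne_zero [NeZero N] (hl : 0 < l.im) (hX : X ∈ kummer N l) :
    chartDir l X 0 * X 3 ^ N - chartDir l X 3 * X 0 ^ N ≠ 0 := by
  have h3' : (3 : Fin 4) = Fin.last 3 := rfl
  have h0' : (0 : Fin 4) = (0 : Fin 3).castSucc := rfl
  by_cases h3 : X 3 = 0
  · have h0 : X 0 ≠ 0 := fun h0 => absurd (kummer_zero_unique hl hX h3 h0) (by decide)
    rw [chartDir_eq_one hl hX h3, h3, zero_pow (NeZero.ne N), mul_zero, zero_sub, one_mul]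
    exact neg_ne_zero.2 (pow_ne_zero _ h0)
  · have e1 : chartDir l X 0 = 1 := by
      rw [chartDir, if_neg h3, h0']; exact Fin.snoc_castSucc (α := fun _ => ℂ) _ _ _
    have e2 : chartDir l X 3 = 0 := by
      rw [chartDir, if_neg h3, h3']; exact Fin.snoc_last (α := fun _ => ℂ) _ _
    rw [e1, e2, one_mul, zero_mul, sub_zero]
    exact pow_ne_zero _ h3

lemma hasDerivAt_chart_z [NeZero N] (hl : 0 < l.im) (hX : X ∈ kummer N l) {t : ℂ}
    (h3 : chart N l X t 3 ≠ 0) :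
    HasDerivAt (fun t => (kummerPt A c (chart N l X t)).1) (chartDeriv N l X t) t := by
  have hfun : (fun t => (kummerPt A c (chart N l X t)).1) = fun t =>
      (X 0 ^ N + t ^ chartOrder N X * chartDir l X 0) /
        (X 3 ^ N + t ^ chartOrder N X * chartDir l X 3) := by
    funext t
    simp only [kummerPt, div_pow, chart_pow hl hX]
  have hd : X 3 ^ N + t ^ chartOrder N X * chartDir l X 3 ≠ 0 := by
    rw [← chart_pow hl hX]; exact pow_ne_zero _ h3
  rw [hfun, chartDeriv, chart_pow hl hX]
  have hnum := fun j : Fin 4 =>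
    ((hasDerivAt_pow (chartOrder N X) t).mul_const (chartDir l X j)).const_add (X j ^ N)
  refine ((hnum 0).div (hnum 3) hd).congr_deriv ?_
  congr 1
  ring

lemma ChartGood.chartDeriv_ne_zero [NeZero N] (hl : 0 < l.im) (hX : X ∈ kummer N l) {t : ℂ}
    (hg : ChartGood N l X t) (ht : t ≠ 0 ∨ ∀ j, X j ≠ 0) : chartDeriv N l X t ≠ 0 := by
  refine div_ne_zero (mul_ne_zero (mul_ne_zero (Nat.cast_ne_zero.2 chartOrder_ne_zero) ?_)
    (chartDir_det_ne_zero hl hX)) (pow_ne_zero _ (pow_ne_zero _ (hg.ne_zero ht 3)))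
  rcases ht with ht | ht
  · exact pow_ne_zero _ ht
  · rw [chartOrder, if_neg (by simpa using ht)]
    simp

lemma ChartGood.continuousAt {t : ℂ} (hg : ChartGood N l X t) : ContinuousAt (chart N l X) t :=
  continuousAt_pi.2 fun j => (differentiableAt_chart hg.slit j).continuousAt

/-- Primitives in charts are holomorphic. -/
lemma eventually_differentiableAt_pullback [NeZero N] (h : IsChoice A y₀ c) (hl : 0 < l.im)
    {f : openCover A y₀ l → ℂ} {U : Set (cover A y₀ l)} {F : cover A y₀ l → ℂ}
    (hF : IsPrimitiveOn f U F) (hX : X ∈ kummer N l) {x : cover A y₀ l}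
    (hx : kummerMap A c X = x.1) (hU : U ∈ 𝓝 x) :
    ∃ δ > 0, ∀ t ∈ Metric.ball (0 : ℂ) δ, ChartGood N l X t ∧
      DifferentiableAt ℂ (fun t => pullback c F (chart N l X t)) t ∧
      ((t ≠ 0 ∨ ∀ j, X j ≠ 0) → HasDerivAt (fun t => pullback c F (chart N l X t))
        (pullbackOpen c f (chart N l X t) * chartDeriv N l X t) t) := by
  have hg := eventually_chartGood hl hX
  have hUo : ∀ᶠ t in 𝓝 (0 : ℂ), ∀ y : cover A y₀ l, kummerMap A c (chart N l X t) = y.1 →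
      U ∈ 𝓝 y := by
    have h1 : ContinuousAt (fun t => kummerMap A c (chart N l X t)) 0 := by
      refine ContinuousAt.comp (f := chart N l X) (g := kummerMap A c) ?_ continuousAt_chart
      rw [chart_zero]
      exact continuousAt_kummerMap A h.ne_zero hl hX
    have h2 : Tendsto (fun t => kummerMap A c (chart N l X t)) (𝓝 0) (𝓝[cover A y₀ l] x.1) := by
      refine tendsto_nhdsWithin_iff.2 ⟨?_, hg.mono fun t ht => kummerMap_mem_cover h hl ht.mem⟩
      have := h1.tendsto
      rwa [chart_zero, hx] at this
    rw [← map_nhds_subtype_val] at h2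
    have h3 : ∀ᶠ y in map Subtype.val (𝓝 x), ∀ y' : cover A y₀ l, y = y'.1 → U ∈ 𝓝 y' := by
      rw [eventually_map]
      filter_upwards [eventually_eventually_nhds.2 hU] with y hy y' hyy
      rwa [← Subtype.ext hyy]
    exact h2.eventually h3
  obtain ⟨δ, hδ, hball⟩ := Metric.eventually_nhds_iff_ball.1 (hg.and hUo)
  have hcont : ∀ t ∈ Metric.ball (0 : ℂ) δ,
      ContinuousAt (fun t => pullback c F (chart N l X t)) t := by
    intro t ht
    obtain ⟨hg, hU⟩ := hball t ht
    refine continuousAt_pullback (x := ⟨_, kummerMap_mem_cover h hl hg.mem⟩) h hl hg.continuousAt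
      ?_ rfl ?_
    · filter_upwards [Metric.isOpen_ball.mem_nhds ht] with t ht using (hball t ht).1.mem
    · exact hF.1.continuousAt (hU _ rfl)
  have hder : ∀ t ∈ Metric.ball (0 : ℂ) δ, (t ≠ 0 ∨ ∀ j, X j ≠ 0) →
      HasDerivAt (fun t => pullback c F (chart N l X t))
        (pullbackOpen c f (chart N l X t) * chartDeriv N l X t) t := by
    intro t ht ht0
    obtain ⟨hg, hU⟩ := hball t ht
    refine hasDerivAt_pullback (x := ⟨_, kummerMap_mem_cover h hl hg.mem⟩) h hl hF
      hg.continuousAt ?_ (hg.ne_zero ht0) (mem_of_mem_nhds (hU _ rfl)) rfl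
      (hasDerivAt_chart_z hl hX (hg.ne_zero ht0 3)) (hg.chartDeriv_ne_zero hl hX ht0)
    filter_upwards [Metric.isOpen_ball.mem_nhds ht] with t ht using (hball t ht).1.mem
  refine ⟨δ, hδ, fun t ht => ⟨(hball t ht).1, ?_, hder t ht⟩⟩
  -- At a ramification point only continuity is known; the singularity is removable.
  have hd : DifferentiableOn ℂ (fun t => pullback c F (chart N l X t)) (Metric.ball 0 δ) := by
    refine (Complex.differentiableOn_compl_singleton_and_continuousAt_iff
      (Metric.ball_mem_nhds (0 : ℂ) hδ)).1 ⟨fun t ht => ?_, hcont 0 (Metric.mem_ball_self hδ)⟩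
    exact (hder t ht.1 (Or.inl ht.2)).differentiableAt.differentiableWithinAt
  exact hd.differentiableAt (Metric.isOpen_ball.mem_nhds ht)

/-- The local primitives of a form are unique up to additive constants. -/
lemma primitive_unique [NeZero N] (h : IsChoice A y₀ c) (hl : 0 < l.im)
    {f : openCover A y₀ l → ℂ} {x : cover A y₀ l} {U₁ U₂ : Set (cover A y₀ l)}
    {F₁ F₂ : cover A y₀ l → ℂ} (hU₁ : U₁ ∈ 𝓝 x) (hU₂ : U₂ ∈ 𝓝 x) (h₁ : IsPrimitiveOn f U₁ F₁)
    (h₂ : IsPrimitiveOn f U₂ F₂) : ∀ᶠ y in 𝓝 x, F₁ y - F₂ y = F₁ x - F₂ x := by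
  refine eventually_cover_subtype h hl fun X hX hXx => ?_
  obtain ⟨δ₁, hδ₁, H₁⟩ := eventually_differentiableAt_pullback h hl h₁ hX hXx hU₁
  obtain ⟨δ₂, hδ₂, H₂⟩ := eventually_differentiableAt_pullback h hl h₂ hX hXx hU₂
  set B := Metric.ball (0 : ℂ) (min δ₁ δ₂) with hB
  have hB1 : B ⊆ Metric.ball 0 δ₁ := Metric.ball_subset_ball (min_le_left _ _)
  have hB2 : B ⊆ Metric.ball 0 δ₂ := Metric.ball_subset_ball (min_le_right _ _)
  have hB0 : (0 : ℂ) ∈ B := Metric.mem_ball_self (lt_min hδ₁ hδ₂)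
  set D : ℂ → ℂ := fun t => pullback c F₁ (chart N l X t) - pullback c F₂ (chart N l X t) with hD
  have hDd : DifferentiableOn ℂ D B := fun t ht =>
    ((H₁ t (hB1 ht)).2.1.sub (H₂ t (hB2 ht)).2.1).differentiableWithinAt
  have hD0 : ∀ t ∈ B, t ≠ 0 → deriv D t = 0 := fun t ht ht0 => by
    have := ((H₁ t (hB1 ht)).2.2 (Or.inl ht0)).sub ((H₂ t (hB2 ht)).2.2 (Or.inl ht0))
    rw [sub_self] at this
    exact this.deriv
  -- Both primitives have the same derivative off the centre; at the centre it agrees by continuity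
  -- of the derivative.
  have hD1 : B.EqOn (deriv D) 0 := by
    intro t ht
    by_cases ht0 : t = 0
    · subst ht0
      have hc : ContinuousAt (deriv D) 0 :=
        ((hDd.deriv Metric.isOpen_ball).continuousOn).continuousAt
          (Metric.isOpen_ball.mem_nhds hB0)
      refine tendsto_nhds_unique (hc.tendsto.mono_left (nhdsWithin_le_nhds (s := {0}ᶜ)))
        (tendsto_const_nhds.congr' ?_)
      filter_upwards [self_mem_nhdsWithin, nhdsWithin_le_nhds (Metric.isOpen_ball.mem_nhds hB0)]
        with t ht ht'
      exact (hD0 t ht' ht).symm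
    · exact hD0 t ht ht0
  filter_upwards [Metric.isOpen_ball.mem_nhds hB0] with t ht y hy
  have := Metric.isOpen_ball.is_const_of_deriv_eq_zero (convex_ball _ _).isPreconnected hDd hD1 ht
    hB0
  simp only [hD] at this
  rwa [chart_zero, pullback_eq F₁ y hy, pullback_eq F₂ y hy, pullback_eq F₁ x hXx,
    pullback_eq F₂ x hXx] at this

/-- The local primitives of a one-form. -/
def LocalPrimitive (f : openCover A y₀ l → ℂ) (x : cover A y₀ l) (F : cover A y₀ l → ℂ) : Prop :=
  ∃ U ∈ 𝓝 x, IsPrimitiveOn f U F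

lemma isPrimitiveSystem [NeZero N] (h : IsChoice A y₀ c) (hl : 0 < l.im)
    {f : openCover A y₀ l → ℂ} (hf : IsHolomorphicForm f) :
    IsPrimitiveSystem (LocalPrimitive f) where
  exists_primitive x := by
    obtain ⟨U, hU, F, hF⟩ := hf x
    exact ⟨F, U, hU, hF⟩
  add_const x F k := by
    rintro ⟨U, hU, hF⟩
    refine ⟨U, hU, hF.1.add continuousOn_const, fun p hp => ?_⟩
    simpa using hF.2 p hp
  isOpen F := by
    rw [isOpen_iff_mem_nhds]
    rintro x ⟨U, hU, hF⟩
    filter_upwards [eventually_eventually_nhds.2 hU] with y hy using ⟨U, hy, hF⟩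
  unique x F₁ F₂ := by
    rintro ⟨U₁, hU₁, h₁⟩ ⟨U₂, hU₂, h₂⟩
    exact primitive_unique h hl hU₁ hU₂ h₁ h₂

lemma pathIntegral_eq_primIntegral (f : openCover A y₀ l → ℂ)
    (σ : C(stdSimplex ℝ (Fin 2), cover A y₀ l)) :
    pathIntegral f σ = primIntegral (LocalPrimitive f) σ := by
  have : IsPrimitiveAlong f σ = PrimAlong (LocalPrimitive f) σ := by
    funext h
    refine propext (forall_congr' fun s => ?_)
    constructor
    · rintro ⟨U, hU, F, hF, he⟩
      exact ⟨F, ⟨U, hU, hF⟩, he⟩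
    · rintro ⟨F, ⟨U, hU, hF⟩, he⟩
      exact ⟨U, hU, F, hF, he⟩
  exact congrArg (fun P : (stdSimplex ℝ (Fin 2) → ℂ) → Prop => open Classical in
    if h : ∃ h, P h then h.choose (stdSimplex.vertex 1) - h.choose (stdSimplex.vertex 0) else 0)
    this

end AbelianCover

namespace AbelianCover

open Filter MeasureTheory

/-! ### Weighted integrals -/

lemma intervalIntegrable_weighted {w : ℝ → ℝ} {a b : ℝ} (hab : a ≤ b)
    (hw : IntervalIntegrable w volume a b) {K : ℝ → ℂ} (hK : ContinuousOn K (Set.Icc a b)) :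
    IntervalIntegrable (fun σ => (w σ : ℂ) * K σ) volume a b :=
  IntervalIntegrable.mul_continuousOn (f := fun σ => (w σ : ℂ)) ⟨hw.1.ofReal, hw.2.ofReal⟩ (by rwa [Set.uIcc_of_le hab])

/-- The weight carries the endpoint singularities and does not depend on the parameter. The
derivative of the kernel is bounded on a compact set, so a multiple of |w| dominates. -/
lemma hasDerivAt_weighted {w : ℝ → ℝ} {a b : ℝ} (hab : a ≤ b)
    (hw : IntervalIntegrable w volume a b) {K K' : ℂ → ℝ → ℂ} {v₀ : ℂ} {s : Set ℂ} (hs : s ∈ 𝓝 v₀)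
    (hK : ∀ v ∈ s, ContinuousOn (K v) (Set.Icc a b))
    (hK' : ContinuousOn (fun p : ℂ × ℝ => K' p.1 p.2) (s ×ˢ Set.Icc a b))
    (hd : ∀ v ∈ s, ∀ σ ∈ Set.Icc a b, HasDerivAt (fun v => K v σ) (K' v σ) v) :
    HasDerivAt (fun v => ∫ σ in a..b, (w σ : ℂ) * K v σ) (∫ σ in a..b, (w σ : ℂ) * K' v₀ σ) v₀ := by
  obtain ⟨ε, hε, hsub⟩ := Metric.nhds_basis_closedBall.mem_iff.1 hs
  obtain ⟨C, hC⟩ := ((isCompact_closedBall v₀ ε).prod isCompact_Icc).exists_bound_of_continuousOn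
    (hK'.mono (Set.prod_mono hsub le_rfl))
  have hmem : ∀ t ∈ Set.uIoc a b, t ∈ Set.Icc a b := fun t ht => by
    rw [Set.uIoc_of_le hab] at ht; exact Set.Ioc_subset_Icc_self ht
  have hv₀ : v₀ ∈ s := mem_of_mem_nhds hs
  refine (intervalIntegral.hasDerivAt_integral_of_dominated_loc_of_deriv_le
    (F := fun v σ => (w σ : ℂ) * K v σ) (F' := fun v σ => (w σ : ℂ) * K' v σ)
    (bound := fun σ => |w σ| * C) (Metric.closedBall_mem_nhds v₀ hε) ?_
    (intervalIntegrable_weighted hab hw (hK v₀ hv₀)) ?_ ?_ ?_ ?_).2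
  · filter_upwards [hs] with v hv
    exact (intervalIntegrable_weighted hab hw (hK v hv)).def'.aestronglyMeasurable
  · refine (intervalIntegrable_weighted hab hw ?_).def'.aestronglyMeasurable
    exact hK'.comp (f := fun σ : ℝ => (v₀, σ)) (by fun_prop) fun σ hσ => ⟨hv₀, hσ⟩
  · refine Eventually.of_forall fun t ht v hv => ?_
    rw [norm_mul, Complex.norm_real, Real.norm_eq_abs]
    exact mul_le_mul_of_nonneg_left (hC (v, t) ⟨hv, hmem t ht⟩) (abs_nonneg _)
  · exact hw.abs.mul_const C
  · exact Eventually.of_forall fun t ht v hv => (hd v (hsub hv) t (hmem t ht)).const_mul _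

/-- A solution of the differential equation `(1 - s) h + v h' = g` near `0`. -/
lemma exists_weighted_primitive {s : ℝ} (hs : s < 1) {ρ : ℝ} {g : ℂ → ℂ}
    (hg : DifferentiableOn ℂ g (Metric.ball 0 ρ)) :
    ∃ h h' : ℂ → ℂ, ∀ v ∈ Metric.ball (0 : ℂ) ρ,
      HasDerivAt h (h' v) v ∧ (1 - s) * h v + v * h' v = g v := by
  have hw : IntervalIntegrable (fun σ : ℝ => σ ^ (-s)) volume 0 1 :=
    intervalIntegral.intervalIntegrable_rpow' (by linarith)
  have hmem : ∀ v ∈ Metric.ball (0 : ℂ) ρ, ∀ σ ∈ Set.Icc (0 : ℝ) 1,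
      (σ : ℂ) * v ∈ Metric.ball (0 : ℂ) ρ := fun v hv σ hσ => by
    rw [mem_ball_zero_iff] at hv ⊢
    rw [norm_mul, Complex.norm_real, Real.norm_of_nonneg hσ.1]
    exact (mul_le_of_le_one_left (norm_nonneg _) hσ.2).trans_lt hv
  have hg' := hg.deriv Metric.isOpen_ball
  have hd : ∀ v ∈ Metric.ball (0 : ℂ) ρ, HasDerivAt g (deriv g v) v := fun v hv =>
    (hg.differentiableAt (Metric.isOpen_ball.mem_nhds hv)).hasDerivAt
  have hKc : ∀ v ∈ Metric.ball (0 : ℂ) ρ,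
      ContinuousOn (fun σ : ℝ => g ((σ : ℂ) * v)) (Set.Icc 0 1) := fun v hv =>
    hg.continuousOn.comp (by fun_prop) fun σ hσ => hmem v hv σ hσ
  have hK'c : ContinuousOn (fun p : ℂ × ℝ => (p.2 : ℂ) * deriv g ((p.2 : ℂ) * p.1))
      (Metric.ball 0 ρ ×ˢ Set.Icc 0 1) := by
    refine ContinuousOn.mul (by fun_prop) ?_
    exact hg'.continuousOn.comp (by fun_prop) fun p hp => hmem p.1 hp.1 p.2 hp.2
  -- This is v^(s-1) ∫₀^v x^(-s) g(x) dx after the substitution x = σv, in a form that needs no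
  -- branch of a power of v.
  refine ⟨fun v => ∫ σ in (0 : ℝ)..1, ((σ ^ (-s) : ℝ) : ℂ) * g ((σ : ℂ) * v),
    fun v => ∫ σ in (0 : ℝ)..1, ((σ ^ (-s) : ℝ) : ℂ) * ((σ : ℂ) * deriv g ((σ : ℂ) * v)),
    fun v hv => ⟨?_, ?_⟩⟩
  · refine hasDerivAt_weighted (K := fun v σ => g ((σ : ℂ) * v))
      (K' := fun v σ => (σ : ℂ) * deriv g ((σ : ℂ) * v)) zero_le_one hw (Metric.isOpen_ball.mem_nhds hv) hKc hK'c
      fun v hv σ hσ => ?_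
    have h1 : HasDerivAt (fun v : ℂ => (σ : ℂ) * v) (σ : ℂ) v := by
      simpa using (hasDerivAt_id v).const_mul (σ : ℂ)
    have := (hd _ (hmem v hv σ hσ)).comp v h1
    rwa [mul_comm] at this
  · have hI1 := intervalIntegrable_weighted zero_le_one hw (hKc v hv)
    have hI2 := intervalIntegrable_weighted zero_le_one hw
      (K := fun σ : ℝ => (σ : ℂ) * deriv g ((σ : ℂ) * v))
      (hK'c.comp (f := fun σ : ℝ => (v, σ)) (by fun_prop) fun σ hσ => ⟨hv, hσ⟩)
    -- Integrating the σ-derivative of σ^(1-s) g(σv) gives the differential equation; the lower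
    -- boundary term vanishes because s < 1.
    have h3 := intervalIntegral.integral_eq_sub_of_hasDerivAt_of_le (a := 0) (b := 1)
      (f := fun σ : ℝ => ((σ ^ (1 - s) : ℝ) : ℂ) * g ((σ : ℂ) * v))
      (f' := fun σ : ℝ => (1 - s) * (((σ ^ (-s) : ℝ) : ℂ) * g ((σ : ℂ) * v)) +
        v * (((σ ^ (-s) : ℝ) : ℂ) * ((σ : ℂ) * deriv g ((σ : ℂ) * v)))) zero_le_one ?_ ?_
        ((hI1.const_mul _).add (hI2.const_mul _))
    · rw [intervalIntegral.integral_add (hI1.const_mul _) (hI2.const_mul _),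
        intervalIntegral.integral_const_mul, intervalIntegral.integral_const_mul] at h3
      rw [h3, Real.zero_rpow (by linarith)]
      simp
    · refine ContinuousOn.mul ?_ (hKc v hv)
      refine Complex.continuous_ofReal.comp_continuousOn ?_
      exact continuousOn_id.rpow_const fun σ _ => Or.inr (by linarith)
    · intro σ hσ
      have h1 : HasDerivAt (fun σ : ℝ => (σ : ℂ) * v) v σ := by
        simpa using (Complex.ofRealCLM.hasDerivAt (x := σ)).mul_const v
      have h2 := (hd _ (hmem v hv σ (Set.Ioo_subset_Icc_self hσ))).comp σ h1
      have h3 := ((Real.hasDerivAt_rpow_const (x := σ) (p := 1 - s)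
        (Or.inl hσ.1.ne')).ofReal_comp).mul h2
      refine h3.congr_deriv ?_
      have e1 : σ ^ (1 - s) = σ ^ (-s) * σ := by
        rw [show 1 - s = -s + 1 by ring, Real.rpow_add_one hσ.1.ne']
      rw [Function.comp_apply, e1, show (1 - s - 1 : ℝ) = -s by ring]
      push_cast
      ring

/-! ### A removable singularity theorem on the sphere -/

/-- A function that is holomorphic outside a finite set, whose singularities are weaker than simple
poles, and that grows less than linearly at infinity is constant. -/
lemma exists_const_of_growth (S : Finset ℂ) (Γ : ℂ → ℂ)
    (hd : ∀ z ∉ S, DifferentiableAt ℂ Γ z)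
    (hS : ∀ b ∈ S, Tendsto (fun z => (z - b) * Γ z) (𝓝[≠] b) (𝓝 0))
    (hinf : Tendsto (fun z => Γ z / z) (cocompact ℂ) (𝓝 0)) : ∃ κ, ∀ z ∉ S, Γ z = κ := by
  classical
  induction S using Finset.induction_on generalizing Γ with
  | empty =>
    have hΓ : Differentiable ℂ Γ := fun z => hd z (by simp)
    -- Sublinear growth says that the slope from 0, an entire function, tends to zero at infinity;
    -- Liouville's theorem makes it zero.
    have h1 : Differentiable ℂ (dslope Γ 0) := by
      rw [← differentiableOn_univ, Complex.differentiableOn_dslope univ_mem]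
      exact hΓ.differentiableOn
    have h2 : Tendsto (dslope Γ 0) (cocompact ℂ) (𝓝 0) := by
      have h3 : Tendsto (fun z : ℂ => Γ z / z - Γ 0 * z⁻¹) (cocompact ℂ) (𝓝 (0 - Γ 0 * 0)) := by
        refine hinf.sub (tendsto_const_nhds.mul ?_)
        rw [← Metric.cobounded_eq_cocompact]
        exact tendsto_inv₀_cobounded
      rw [mul_zero, sub_zero] at h3
      refine h3.congr' ?_
      filter_upwards [(isCompact_singleton (x := (0 : ℂ))).compl_mem_cocompact] with z hz
      rw [dslope_of_ne _ (by simpa using hz), slope_def_field]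
      simp only [sub_zero]
      ring
    refine ⟨Γ 0, fun z _ => ?_⟩
    have h3 := sub_smul_dslope Γ 0 z
    rw [h1.apply_eq_of_tendsto_cocompact z h2, smul_zero] at h3
    exact (sub_eq_zero.1 h3.symm)
  | insert b S hb ih =>
    -- The singularity at b is removable; filling in the limit leaves one exceptional point fewer.
    set Γ' := Function.update Γ b (limUnder (𝓝[≠] b) Γ) with hΓ'
    have heq : ∀ z, z ≠ b → Γ' z = Γ z := fun z hz => Function.update_of_ne hz _ _
    have heq' : ∀ z, z ≠ b → Γ' =ᶠ[𝓝 z] Γ := fun z hz => by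
      filter_upwards [isOpen_ne.mem_nhds hz] with y hy using heq y hy
    have hex : ∃ κ, ∀ z ∉ S, Γ' z = κ := by
      refine ih Γ' ?_ ?_ ?_
      · intro z hz
        by_cases hzb : z = b
        · subst hzb
          have hV : ((S : Set ℂ)ᶜ) ∈ 𝓝 z := S.finite_toSet.isClosed.isOpen_compl.mem_nhds (by simpa)
          refine (Complex.differentiableOn_update_limUnder_of_isLittleO hV ?_ ?_).differentiableAt hV
          · intro y hy
            refine (hd y ?_).differentiableWithinAt
            rw [Finset.mem_insert, not_or]
            exact ⟨hy.2, hy.1⟩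
          · rw [Asymptotics.isLittleO_iff_tendsto']
            · have h1 : Tendsto (fun y : ℂ => (y - z) * Γ z) (𝓝[≠] z) (𝓝 0) := by
                have : ContinuousAt (fun y : ℂ => (y - z) * Γ z) z := by fun_prop
                have h2 := this.tendsto
                simp only [sub_self, zero_mul] at h2
                exact h2.mono_left nhdsWithin_le_nhds
              have h2 := (hS z (Finset.mem_insert_self _ _)).sub h1
              rw [sub_zero] at h2
              refine h2.congr fun y => ?_
              rw [div_inv_eq_mul]
              ring
            · filter_upwards [self_mem_nhdsWithin] with y hy h0
              exact (inv_ne_zero (sub_ne_zero.2 hy) h0).elim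
        · refine (hd z ?_).congr_of_eventuallyEq (heq' z hzb)
          rw [Finset.mem_insert, not_or]
          exact ⟨hzb, hz⟩
      · intro a ha
        have hab : a ≠ b := fun h => hb (h ▸ ha)
        refine (hS a (Finset.mem_insert_of_mem ha)).congr' ?_
        filter_upwards [nhdsWithin_le_nhds (heq' a hab)] with z hz
        rw [hz]
      · refine hinf.congr' ?_
        filter_upwards [(isCompact_singleton (x := b)).compl_mem_cocompact] with z hz
        rw [heq z (by simpa using hz)]
    obtain ⟨κ, hκ⟩ := hex
    refine ⟨κ, fun z hz => ?_⟩
    rw [Finset.mem_insert, not_or] at hz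
    rw [← heq z hz.1, hκ z hz.2]

end AbelianCover

namespace AbelianCover

open Filter OnePoint

variable {N m : ℕ} {A : Matrix (Fin m) (Fin 4) (ZMod N)} {y₀ : ℂ × ℂ × (Fin m → ℂ)}
  {c : Fin m → ℂ} {l : ℂ} {X : Fin 4 → ℂ} {r : Fin 4 → ZMod N} {e : Exponent m}

/-! ### The exponents of the holomorphic form -/

lemma tPart_eq [NeZero N] (r : Fin 4 → ZMod N) (j : Fin 4) : tPart r j = ((r j).val : ℝ) / N := by
  have hN : (0 : ℝ) < N := Nat.cast_pos.2 (Nat.pos_of_ne_zero (NeZero.ne N))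
  refine Int.fract_eq_self.2 ⟨by positivity, (div_lt_one hN).2 ?_⟩
  exact_mod_cast ZMod.val_lt (r j)

/-- The exponent `e` of a monomial `w ^ n z ^ k_0 (z - 1) ^ k_1 (z - l) ^ k_2` whose orders in the
coordinates of the Kummer curve over the finite branch points are minus the residues of `-r`. -/
structure IsFormExponent (A : Matrix (Fin m) (Fin 4) (ZMod N)) (r : Fin 4 → ZMod N)
    (e : Exponent m) : Prop where
  fin : ∀ j : Fin 3, kummerExp A e j.castSucc = -(((-r) j.castSucc).val : ℤ)
  cast : ∀ j : Fin 4, ((∑ i, e.1 i * (A i j).val : ℤ) : ZMod N) = r j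
  sum : ∑ j, (((-r) j).val : ℤ) = 2 * N
  pos : ∀ j, 0 < ((-r) j).val

/-- The parts of r_j and -r_j add up to 1, or to 0 if r_j = 0. As the total is 4, no r_j vanishes.
The exponents of the w_i come from writing r as a combination of rows. -/
lemma exists_isFormExponent [NeZero N] (hr : r ∈ rowSpan A) (hneg : tSum (-r) = 2)
    (hpos : tSum r = 2) : ∃ e : Exponent m, IsFormExponent A r e := by
  have hN : (0 : ℝ) < N := Nat.cast_pos.2 (Nat.pos_of_ne_zero (NeZero.ne N))
  have hsum : ∑ j, (((-r) j).val : ℤ) = 2 * N := by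
    have h1 : ∑ j, (((-r) j).val : ℝ) = 2 * N := by
      rw [tSum] at hneg
      simp only [tPart_eq] at hneg
      rw [← Finset.sum_div, div_eq_iff hN.ne'] at hneg
      exact hneg
    exact_mod_cast h1
  have hle : ∀ j, tPart (-r) j + tPart r j = if r j = 0 then 0 else 1 := fun j => by
    rw [tPart_eq, tPart_eq, Pi.neg_apply, ZMod.neg_val]
    split_ifs with h
    · simp [h]
    · rw [Nat.cast_sub (ZMod.val_lt _).le]
      field_simp
      ring
  have hne : ∀ j, r j ≠ 0 := by
    intro j hj
    have h1 : ∑ j, (tPart (-r) j + tPart r j) = 4 := by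
      rw [Finset.sum_add_distrib]
      rw [tSum] at hneg hpos
      linarith
    have h2 : ∑ j, (tPart (-r) j + tPart r j) < ∑ j : Fin 4, (1 : ℝ) := by
      refine Finset.sum_lt_sum (fun k _ => ?_) ⟨j, Finset.mem_univ _, ?_⟩
      · rw [hle]; split_ifs <;> norm_num
      · rw [hle, if_pos hj]; norm_num
    rw [h1] at h2
    norm_num at h2
  have hvpos : ∀ j, 0 < ((-r) j).val := fun j => by
    refine Nat.pos_of_ne_zero fun h => hne j ?_
    rw [ZMod.val_eq_zero] at h
    simpa using h
  obtain ⟨n, hn⟩ := (Submodule.mem_span_range_iff_exists_fun _).1 hr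
  have hcast : ∀ j : Fin 4, ((∑ i, ((n i).val : ℤ) * (A i j).val : ℤ) : ZMod N) = r j := fun j => by
    have := congrFun hn j
    simp only [Finset.sum_apply, Pi.smul_apply, smul_eq_mul] at this
    rw [← this]
    push_cast
    simp
  -- The rows give the exponents only modulo N; powers of z - b_j, which change them by multiples of
  -- N, bring them to the exact representatives.
  have hk : ∀ j : Fin 3, ∃ k : ℤ, -(((-r) j.castSucc).val : ℤ) -
      ∑ i, ((n i).val : ℤ) * (A i j.castSucc).val = N * k := fun j => by
    refine (ZMod.intCast_zmod_eq_zero_iff_dvd _ N).1 ?_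
    rw [Int.cast_sub, hcast]
    push_cast
    simp
  choose k hk using hk
  refine ⟨(fun i => (n i).val, k), ⟨fun j => ?_, hcast, hsum, hvpos⟩⟩
  rw [kummerExp_castSucc]
  linarith [hk j]

/-- Here t(-r) = 2 enters. The 2N compensates the double pole of dz at infinity, so that the residue
of -r governs the form there as at the finite branch points. -/
lemma IsFormExponent.last (he : IsFormExponent A r e) :
    kummerExp A e 3 = 2 * N - (((-r) 3).val : ℤ) := by
  have h1 := he.sum
  rw [Fin.sum_univ_castSucc] at h1
  rw [kummerExp_last]
  simp only [he.fin, Finset.sum_neg_distrib, neg_neg]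
  rw [← h1]
  simp [show Fin.last 3 = (3 : Fin 4) from rfl]

lemma IsFormExponent.fin_div [NeZero N] (he : IsFormExponent A r e) (j : Fin 3) :
    (kummerExp A e j.castSucc : ℂ) / N = -(tPart (-r) j.castSucc : ℂ) := by
  rw [he.fin, tPart_eq]
  push_cast
  ring

lemma tPart_pos [NeZero N] (he : IsFormExponent A r e) (j : Fin 4) : 0 < tPart (-r) j := by
  have hN : (0 : ℝ) < N := Nat.cast_pos.2 (Nat.pos_of_ne_zero (NeZero.ne N))
  rw [tPart_eq]
  exact div_pos (Nat.cast_pos.2 (he.pos j)) hN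

lemma tPart_lt_one (j : Fin 4) : tPart r j < 1 := Int.fract_lt_one _

lemma tPart_sum [NeZero N] (he : IsFormExponent A r e) :
    ∑ j : Fin 3, tPart (-r) j.castSucc = 2 - tPart (-r) 3 := by
  have hN : (N : ℝ) ≠ 0 := Nat.cast_ne_zero.2 (NeZero.ne N)
  have h1 : ∑ j, (((-r) j).val : ℝ) = 2 * N := by exact_mod_cast he.sum
  rw [Fin.sum_univ_castSucc] at h1
  simp only [tPart_eq]
  rw [← Finset.sum_div, eq_sub_iff_add_eq, ← add_div, div_eq_iff hN]
  exact h1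

/-! ### Finite parts and coordinates -/

/-- The finite value of a point of `ℂ ∪ {∞}`, with `∞ ↦ 0`. -/
def finitePart : OnePoint ℂ → ℂ := Function.extend ((↑) : ℂ → OnePoint ℂ) id 0

@[simp] lemma finitePart_coe (z : ℂ) : finitePart (z : OnePoint ℂ) = z :=
  OnePoint.coe_injective.extend_apply _ _ _

@[simp] lemma finitePart_infty : finitePart ∞ = 0 :=
  Function.extend_apply' _ _ _ fun ⟨_, h⟩ => OnePoint.coe_ne_infty _ h

/-- The exponent of the monomial `z`. -/
def zExp : Exponent m := (0, Pi.single 0 1)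

lemma kummerExp_zExp_castSucc (j : Fin 3) :
    kummerExp A (zExp : Exponent m) j.castSucc = if j = 0 then (N : ℤ) else 0 := by
  rw [kummerExp_castSucc]
  simp [zExp, Pi.single_apply]

lemma kummerExp_zExp_last : kummerExp A (zExp : Exponent m) 3 = -(N : ℤ) := by
  rw [kummerExp_last]
  simp [kummerExp_zExp_castSucc]

lemma unitFactor_zExp : unitFactor c zExp = 1 := by simp [unitFactor, zExp]

lemma kummerMap_zExp (h3 : X 3 ≠ 0) :
    kummerMap A c X zExp = (((X 0 / X 3) ^ N : ℂ) : OnePoint ℂ) := by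
  have hE : ∏ j, X j ^ kummerExp A (zExp : Exponent m) j = (X 0 / X 3) ^ N := by
    rw [Fin.prod_univ_castSucc, show Fin.last 3 = (3 : Fin 4) from rfl, kummerExp_zExp_last]
    simp only [kummerExp_zExp_castSucc, Fin.prod_univ_three]
    simp [div_eq_mul_inv, mul_pow]
  rw [kummerMap, monomialMap, if_neg, hE, unitFactor_zExp, one_mul]
  rintro ⟨j, hj, hneg⟩
  refine Fin.lastCases (motive := fun j => X j = 0 → kummerExp A (zExp : Exponent m) j < 0 → False)
    (fun h _ => h3 h) (fun j _ h => ?_) j hj hneg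
  rw [kummerExp_zExp_castSucc] at h
  split_ifs at h <;> omega

lemma kummerMap_zExp_infty [NeZero N] (h3 : X 3 = 0) : kummerMap A c X zExp = ∞ := by
  have := Nat.pos_of_ne_zero (NeZero.ne N)
  rw [kummerMap, monomialMap, if_pos ⟨3, h3, by rw [kummerExp_zExp_last]; omega⟩]

/-! ### Logarithmic derivatives -/

lemma hasDerivAt_prod_log {ι : Type*} (s : Finset ι) {f : ι → ℂ → ℂ} {L : ι → ℂ} {x : ℂ}
    (h : ∀ j ∈ s, HasDerivAt (f j) (f j x * L j) x) :
    HasDerivAt (fun t => ∏ j ∈ s, f j t) ((∏ j ∈ s, f j x) * ∑ j ∈ s, L j) x := by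
  classical
  induction s using Finset.induction_on with
  | empty => simpa using hasDerivAt_const x (1 : ℂ)
  | insert a s ha ih =>
    have h1 := (h a (Finset.mem_insert_self _ _)).mul
      (ih fun j hj => h j (Finset.mem_insert_of_mem hj))
    simp only [Finset.prod_insert ha, Finset.sum_insert ha]
    refine h1.congr_deriv ?_
    ring

lemma hasDerivAt_zpow_log {f : ℂ → ℂ} {L x : ℂ} (n : ℤ) (h : HasDerivAt f (f x * L) x)
    (h0 : f x ≠ 0) : HasDerivAt (fun t => f t ^ n) (f x ^ n * (n * L)) x := by
  refine ((hasDerivAt_zpow n (f x) (Or.inl h0)).comp x h).congr_deriv ?_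
  rw [zpow_sub_one₀ h0]
  field_simp

lemma chart_apply_of_ne (h : ∀ j, X j ≠ 0) (t : ℂ) (j : Fin 4) :
    chart N l X t j = X j * (1 + t * chartDir l X j / X j ^ N) ^ ((N : ℂ)⁻¹) := by
  rw [chart, if_neg (h j), chartOrder, if_neg (by simpa using h), pow_one]

lemma chartDir_of_ne (h : X 3 ≠ 0) : (∀ j : Fin 3, chartDir l X j.castSucc = 1) ∧
    chartDir l X 3 = 0 := by
  constructor
  · intro j
    rw [chartDir, if_neg h]
    exact Fin.snoc_castSucc (α := fun _ => ℂ) _ _ _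
  · rw [chartDir, if_neg h]
    exact Fin.snoc_last (α := fun _ => ℂ) _ _

lemma chartDeriv_of_ne (h : ∀ j, X j ≠ 0) : chartDeriv N l X 0 = (X 3 ^ N)⁻¹ := by
  have h0 := (chartDir_of_ne (l := l) (h 3)).1 0
  have h3 := (chartDir_of_ne (l := l) (h 3)).2
  have hc : chart N l X 0 3 = X 3 := by
    rw [chart_apply_of_ne h]
    simp
  have := pow_ne_zero N (h 3)
  rw [Fin.castSucc_zero] at h0
  rw [chartDeriv, hc, chartOrder, if_neg (by simpa using h), h0, h3]
  field_simp
  simp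

/-- The form as a function of the coordinates of the Kummer curve. -/
lemma hasDerivAt_monomial_chart [NeZero N] (he : IsFormExponent A r e) (hX : X ∈ kummer N l)
    (hne : ∀ j, X j ≠ 0) :
    HasDerivAt (fun t => unitFactor c e * ∏ j, chart N l X t j ^ kummerExp A e j)
      ((unitFactor c e * ∏ j, X j ^ kummerExp A e j) *
        (-∑ j : Fin 3, (tPart (-r) j.castSucc : ℂ) / ((kummerPt A c X).1 - branchPt l j)) *
          chartDeriv N l X 0) 0 := by
  have hN : (N : ℂ) ≠ 0 := Nat.cast_ne_zero.2 (NeZero.ne N)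
  have hc : ∀ j, chart N l X 0 j = X j := fun j => by
    rw [chart_apply_of_ne hne]
    simp
  have h1 : ∀ j, HasDerivAt (fun t => chart N l X t j)
      (chart N l X 0 j * (chartDir l X j / (N * X j ^ N))) 0 := fun j => by
    have h2 : HasDerivAt (fun t : ℂ => 1 + t * chartDir l X j / X j ^ N)
        (chartDir l X j / X j ^ N) 0 := by
      have := (((hasDerivAt_id (0 : ℂ)).mul_const (chartDir l X j)).div_const (X j ^ N)).const_add 1
      simpa using this
    have h3 := (h2.cpow_const (c := (N : ℂ)⁻¹) (by simp)).const_mul (X j)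
    have : (fun t => chart N l X t j) = fun t =>
        X j * (1 + t * chartDir l X j / X j ^ N) ^ ((N : ℂ)⁻¹) :=
      funext fun t => chart_apply_of_ne hne t j
    rw [this]
    refine h3.congr_deriv ?_
    rw [hc]
    simp only [zero_mul, zero_div, add_zero, Complex.one_cpow, mul_one]
    field_simp
  have h2 := (hasDerivAt_prod_log Finset.univ fun j _ =>
    hasDerivAt_zpow_log (kummerExp A e j) (h1 j) (by rw [hc]; exact hne j)).const_mul
      (unitFactor c e)
  refine h2.congr_deriv ?_
  simp only [hc]
  rw [mul_assoc (unitFactor c e * _), ← mul_assoc (unitFactor c e)]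
  congr 1
  rw [Fin.sum_univ_castSucc, show Fin.last 3 = (3 : Fin 4) from rfl, (chartDir_of_ne (hne 3)).2,
    zero_div, mul_zero, add_zero, ← Finset.sum_neg_distrib, Finset.sum_mul]
  refine Finset.sum_congr rfl fun j _ => ?_
  rw [← kummerPt_sub hX (hne 3), (chartDir_of_ne (hne 3)).1, chartDeriv_of_ne hne, div_pow,
    ← neg_div, ← he.fin_div j]
  have := pow_ne_zero N (hne j.castSucc)
  have := pow_ne_zero N (hne 3)
  field_simp

/-! ### The criterion for primitives -/

/-- A difference quotient in z is a quotient of two difference quotients in the chart parameter, and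
checking all charts over a point suffices. -/
lemma tendsto_slope_of_chart [NeZero N] (h : IsChoice A y₀ c) (hl : 0 < l.im)
    {G : openCover A y₀ l → ℂ} {p : openCover A y₀ l} {d : ℂ}
    (hG : ∀ X ∈ kummer N l, (∀ j, X j ≠ 0) → kummerPt A c X = p.1 →
      HasDerivAt (fun t => pullbackOpen c G (chart N l X t)) (d * chartDeriv N l X 0) 0) :
    Tendsto (fun q : openCover A y₀ l => (G q - G p) / (q.1.1 - p.1.1)) (𝓝[≠] p) (𝓝 d) := by
  rw [Metric.tendsto_nhds]
  intro ε hε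
  rw [eventually_nhdsWithin_iff]
  refine eventually_openCover h hl fun X hX hne hp => ?_
  have hg0 := (eventually_chartGood hl hX).self_of_nhds
  have hz := hasDerivAt_chart_z (A := A) (c := c) hl hX (t := 0) (hg0.ne_zero (Or.inr hne) 3)
  have hz' := hg0.chartDeriv_ne_zero hl hX (Or.inr hne)
  have h1 := hasDerivAt_iff_tendsto_slope.1 (hG X hX hne hp)
  have h2 := (h1.div (hasDerivAt_iff_tendsto_slope.1 hz) hz')
  rw [mul_div_cancel_right₀ _ hz'] at h2
  have h3 := eventually_nhdsWithin_iff.1 (h2.eventually (Metric.ball_mem_nhds d hε))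
  filter_upwards [h3] with t ht q hq hqp
  have ht0 : t ≠ 0 := by
    rintro rfl
    rw [chart_zero, hp] at hq
    exact hqp (Subtype.ext hq.symm)
  have h4 := ht ht0
  simp only [slope, vsub_eq_sub, chart_zero, sub_zero, Pi.div_apply] at h4
  rw [smul_eq_mul, smul_eq_mul, mul_div_mul_left _ _ (inv_ne_zero ht0), pullbackOpen_eq G q hq,
    pullbackOpen_eq G p hp, hq, hp] at h4
  exact h4

/-- A criterion for `f H(z)` to be a primitive of the form with coefficient the monomial `f`. -/
lemma localPrimitive_of [NeZero N] (h : IsChoice A y₀ c) (hl : 0 < l.im)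
    (he : IsFormExponent A r e) {S : Set (OnePoint ℂ)} (hS : IsOpen S) {H : ℂ → ℂ}
    (ha : ∀ z : ℂ, (z : OnePoint ℂ) ∈ S → (∀ j, z ≠ branchPt l j) →
      HasDerivAt H (1 + H z * ∑ j : Fin 3, (tPart (-r) j.castSucc : ℂ) / (z - branchPt l j)) z)
    (hb : ∀ X ∈ kummer N l, kummerMap A c X zExp ∈ S → (∃ j, X j = 0) →
      ContinuousAt (fun t => finitePart (kummerMap A c (chart N l X t) e) *
        H (finitePart (kummerMap A c (chart N l X t) zExp))) 0)
    {x : cover A y₀ l} (hx : x.1 zExp ∈ S) :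
    LocalPrimitive (fun p : openCover A y₀ l => monomialValue l p.1 e) x
      fun y => finitePart (y.1 e) * H (finitePart (y.1 zExp)) := by
  set F : cover A y₀ l → ℂ := fun y => finitePart (y.1 e) * H (finitePart (y.1 zExp)) with hF
  set U : Set (cover A y₀ l) := {y | y.1 zExp ∈ S} with hU
  have hUo : IsOpen U := hS.preimage ((continuous_apply _).comp continuous_subtype_val)
  -- The monomial f has logarithmic derivative -Σ t_j / (z - b_j), so the equation in `ha` says
  -- precisely that (f H)' = f.
  have hgood : ∀ X ∈ kummer N l, (∀ j, X j ≠ 0) → kummerMap A c X zExp ∈ S →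
      HasDerivAt (fun t => (unitFactor c e * ∏ j, chart N l X t j ^ kummerExp A e j) *
        H (kummerPt A c (chart N l X t)).1)
        ((unitFactor c e * ∏ j, X j ^ kummerExp A e j) * chartDeriv N l X 0) 0 := by
    intro X hX hne hXS
    have hg0 := (eventually_chartGood hl hX).self_of_nhds
    have hz := hasDerivAt_chart_z (A := A) (c := c) hl hX (t := 0) (hg0.ne_zero (Or.inr hne) 3)
    rw [kummerMap_zExp (hne 3)] at hXS
    have hHz := ha (kummerPt A c X).1 hXS fun j => by
      rw [← sub_ne_zero, ← kummerPt_sub hX (hne 3)]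
      exact pow_ne_zero _ (div_ne_zero (hne _) (hne 3))
    have hH' : HasDerivAt H (1 + H (kummerPt A c X).1 * ∑ j : Fin 3,
        (tPart (-r) j.castSucc : ℂ) / ((kummerPt A c X).1 - branchPt l j))
        (kummerPt A c (chart N l X 0)).1 := by rwa [chart_zero]
    have h1 := (hasDerivAt_monomial_chart (c := c) he hX hne).mul (hH'.comp 0 hz)
    refine h1.congr_deriv ?_
    simp only [chart_zero, Function.comp_apply]
    ring
  refine ⟨U, hUo.mem_nhds hx, ?_, ?_⟩
  · intro y hy
    refine ContinuousAt.continuousWithinAt ?_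
    rw [ContinuousAt, Metric.tendsto_nhds]
    intro ε hε
    refine eventually_cover_subtype h hl fun X hX hXy => ?_
    have hXS : kummerMap A c X zExp ∈ S := by rw [hXy]; exact hy
    have hcont : ContinuousAt (fun t => finitePart (kummerMap A c (chart N l X t) e) *
        H (finitePart (kummerMap A c (chart N l X t) zExp))) 0 := by
      by_cases h0 : ∃ j, X j = 0
      · exact hb X hX hXS h0
      · have hne : ∀ j, X j ≠ 0 := by simpa using h0
        refine (hgood X hX hne hXS).continuousAt.congr ?_
        filter_upwards [eventually_chartGood hl hX] with t ht
        have hne' := ht.ne_zero (Or.inr hne)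
        rw [kummerMap_of_ne ht.mem hne', monomialValues_eq, monomialValues_eq,
          monomialValue_kummerPt ht.mem hne']
        simp [monomialValue, zExp]
    have h1 := hcont.eventually (Metric.ball_mem_nhds _ hε)
    filter_upwards [h1] with t ht y' hy'
    rw [chart_zero, hXy, hy'] at ht
    exact ht
  · intro p hp
    refine tendsto_slope_of_chart (G := fun q => F (openInclusion A y₀ l q)) h hl
      fun X hX hne hXp => ?_
    have hKX : kummerMap A c X = monomialValues l p.1 := by rw [kummerMap_of_ne hX hne, hXp]
    have hXS : kummerMap A c X zExp ∈ S := by rw [hKX]; exact hp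
    have h1 := hgood X hX hne hXS
    rw [← monomialValue_kummerPt hX hne, hXp] at h1
    refine h1.congr_of_eventuallyEq ?_
    filter_upwards [eventually_chartGood hl hX] with t ht
    have hne' := ht.ne_zero (Or.inr hne)
    rw [pullbackOpen_eq _ ⟨_, kummerPt_mem h hl ht.mem hne'⟩ rfl, ← monomialValue_kummerPt ht.mem
      hne']
    simp only [hF, openInclusion, monomialValues_eq, finitePart_coe]
    simp [monomialValue, zExp]

/-! ### Local solutions -/

/-- The integrating factor ∏ (1 + κ_j v)^(-t_j) reduces the equation to that of
`exists_weighted_primitive`. One form serves both finite points, with v = z - P, and infinity, with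
v = 1/z. -/
lemma exists_local_solution {s : ℝ} (hs : s < 1) (κ t : Fin 3 → ℂ) :
    ∃ ρ > 0, (∀ v ∈ Metric.ball (0 : ℂ) ρ, ∀ j, 1 + κ j * v ∈ Complex.slitPlane) ∧
      ∃ y y' : ℂ → ℂ, ∀ v ∈ Metric.ball (0 : ℂ) ρ, HasDerivAt y (y' v) v ∧
        (1 - s) * y v + v * y' v = 1 + v * y v * ∑ j, t j * κ j / (1 + κ j * v) := by
  have h0 : ∀ᶠ v in 𝓝 (0 : ℂ), ∀ j, 1 + κ j * v ∈ Complex.slitPlane := by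
    rw [eventually_all]
    intro j
    have : ContinuousAt (fun v => 1 + κ j * v) 0 := by fun_prop
    exact this.eventually (Complex.isOpen_slitPlane.mem_nhds (by simp))
  obtain ⟨ρ, hρ, hball⟩ := Metric.eventually_nhds_iff_ball.1 h0
  refine ⟨ρ, hρ, hball, ?_⟩
  set g : ℂ → ℂ := fun v => ∏ j, (1 + κ j * v) ^ (-t j) with hg
  have hgne : ∀ v ∈ Metric.ball (0 : ℂ) ρ, g v ≠ 0 := fun v hv =>
    Finset.prod_ne_zero_iff.2 fun j _ => by
      rw [Ne, Complex.cpow_eq_zero_iff]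
      exact fun h => Complex.slitPlane_ne_zero (hball v hv j) h.1
  have hgd : ∀ v ∈ Metric.ball (0 : ℂ) ρ,
      HasDerivAt g (g v * ∑ j, -(t j * κ j / (1 + κ j * v))) v := fun v hv => by
    refine hasDerivAt_prod_log Finset.univ fun j _ => ?_
    have h1 : HasDerivAt (fun v => 1 + κ j * v) (κ j) v := by
      simpa using ((hasDerivAt_id v).const_mul (κ j)).const_add 1
    have hne := Complex.slitPlane_ne_zero (hball v hv j)
    refine (h1.cpow_const (c := -t j) (hball v hv j)).congr_deriv ?_
    rw [Complex.cpow_sub _ _ hne, Complex.cpow_one]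
    field_simp
  obtain ⟨h, h', hh⟩ := exists_weighted_primitive hs (g := g)
    fun v hv => (hgd v hv).differentiableAt.differentiableWithinAt
  refine ⟨fun v => h v / g v, _, fun v hv => ⟨(hh v hv).1.div (hgd v hv) (hgne v hv), ?_⟩⟩
  have h1 := (hh v hv).2
  have h2 := hgne v hv
  rw [Finset.sum_neg_distrib]
  field_simp
  linear_combination h1

end AbelianCover

namespace AbelianCover

open Filter OnePoint

variable {N m : ℕ} {A : Matrix (Fin m) (Fin 4) (ZMod N)} {y₀ : ℂ × ℂ × (Fin m → ℂ)}
  {c : Fin m → ℂ} {l : ℂ} {X : Fin 4 → ℂ} {r : Fin 4 → ZMod N} {e : Exponent m}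

/-! ### The holomorphic form -/

lemma kummerMap_of_eq_zero [NeZero N] (hl : 0 < l.im) (hX : X ∈ kummer N l) {k : Fin 4}
    (hk : X k = 0) (hE : kummerExp A e k ≠ 0) : finitePart (kummerMap A c X e) = 0 := by
  by_cases h : kummerExp A e k < 0
  · rw [kummerMap, monomialMap, if_pos ⟨k, hk, h⟩, finitePart_infty]
  · rw [kummerMap, monomialMap, if_neg, finitePart_coe, Finset.prod_eq_zero (Finset.mem_univ k),
      mul_zero]
    · rw [hk, zero_zpow _ hE]
    · rintro ⟨j, hj, hlt⟩
      rw [kummer_zero_unique hl hX hj hk] at hlt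
      exact h hlt

/-- The monomials in a chart near a point over a branch point. -/
lemma exists_monomial_chart [NeZero N] (hl : 0 < l.im) (hX : X ∈ kummer N l) {k : Fin 4}
    (hk : X k = 0) (E : Fin 4 → ℤ) {C : ℂ} (hC : C ≠ 0) :
    ∃ R : ℂ → ℂ, ContinuousAt R 0 ∧ R 0 ≠ 0 ∧
      ∀ t, C * ∏ j, chart N l X t j ^ E j = t ^ E k * R t := by
  refine ⟨fun t => C * ∏ j ∈ Finset.univ.erase k, chart N l X t j ^ E j, ?_, ?_, fun t => ?_⟩
  · refine continuousAt_const.mul (tendsto_finsetProd _ fun j hj => ?_)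
    refine ((continuous_apply j).continuousAt.comp continuousAt_chart).zpow₀ _ (Or.inl ?_)
    simp only [Function.comp_apply, chart_zero]
    exact fun h0 => (Finset.mem_erase.1 hj).1 (kummer_zero_unique hl hX h0 hk)
  · refine mul_ne_zero hC (Finset.prod_ne_zero_iff.2 fun j hj => zpow_ne_zero _ ?_)
    rw [chart_zero]
    exact fun h0 => (Finset.mem_erase.1 hj).1 (kummer_zero_unique hl hX h0 hk)
  · rw [← Finset.mul_prod_erase _ _ (Finset.mem_univ k)]
    have : chart N l X t k = t := by rw [chart, if_pos hk]
    rw [this]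
    ring

/-- In the chart the monomial is t^E times a continuous function and H is t^q times one, so the
product has a zero of positive order E + q. The value at t = 0 is 0 whether the monomial vanishes or
has a pole there, since `finitePart` sends ∞ to 0. -/
lemma continuousAt_branch [NeZero N] (h : IsChoice A y₀ c) (hl : 0 < l.im) (hX : X ∈ kummer N l)
    {k : Fin 4} (hk : X k = 0) {H W : ℂ → ℂ} (hW : ContinuousAt W 0) {q : ℤ}
    (hq : 0 < kummerExp A e k + q) (hE : kummerExp A e k ≠ 0)
    (hH : ∀ᶠ t in 𝓝[≠] (0 : ℂ), H (kummerPt A c (chart N l X t)).1 = t ^ q * W t) :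
    ContinuousAt (fun t => finitePart (kummerMap A c (chart N l X t) e) *
      H (finitePart (kummerMap A c (chart N l X t) zExp))) 0 := by
  obtain ⟨R, hR, -, hRt⟩ := exists_monomial_chart hl hX hk (kummerExp A e)
    (unitFactor_ne_zero h.ne_zero e)
  have hc : ContinuousAt (fun t : ℂ => t ^ (kummerExp A e k + q) * (R t * W t)) 0 :=
    (continuousAt_id.zpow₀ _ (Or.inr hq.le)).mul (hR.mul hW)
  refine hc.congr ?_
  have hg := eventually_chartGood hl hX
  filter_upwards [hg, eventually_nhdsWithin_iff.1 hH] with t ht hHt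
  by_cases ht0 : t = 0
  · rw [ht0, zero_zpow _ hq.ne', zero_mul, chart_zero, kummerMap_of_eq_zero hl hX hk hE, zero_mul]
  · have hne := ht.ne_zero (Or.inl ht0)
    have h1 := hHt ht0
    rw [kummerMap_of_ne ht.mem hne, monomialValues_eq, monomialValues_eq,
      monomialValue_kummerPt ht.mem hne, hRt]
    simp only [finitePart_coe]
    rw [show monomialValue l (kummerPt A c (chart N l X t)) zExp = (kummerPt A c (chart N l X t)).1 by
      simp [monomialValue, zExp], h1, zpow_add₀ ht0]
    ring

lemma branchPt_injective (hl : 0 < l.im) : Function.Injective (branchPt l) := by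
  have h0 : l ≠ 0 := by rintro rfl; simp at hl
  have h1 : l ≠ 1 := by rintro rfl; simp at hl
  intro i j hij
  fin_cases i <;> fin_cases j <;> simp [branchPt, h0, h1, h0.symm, h1.symm] at hij ⊢

lemma kummer_zero_branchPt [NeZero N] (hX : X ∈ kummer N l) (h3 : X 3 ≠ 0) {k : Fin 3}
    (hk : X k.castSucc = 0) : (X 0 / X 3) ^ N = branchPt l k := by
  have h1 := hX.2 k
  rw [hk, zero_pow (NeZero.ne N)] at h1
  rw [div_pow, div_eq_iff (pow_ne_zero _ h3)]
  linear_combination -h1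

/-- The primitive is sought as f · (z - P) · y(z - P) with y holomorphic. The resulting equation is
solvable because the form has exponent -s at P with s < 1. -/
lemma exists_localPrimitive_finite [NeZero N] (h : IsChoice A y₀ c) (hl : 0 < l.im)
    (he : IsFormExponent A r e) (P : ℂ) {x : cover A y₀ l} (hx : x.1 zExp = (P : OnePoint ℂ)) :
    ∃ F, LocalPrimitive (fun p : openCover A y₀ l => monomialValue l p.1 e) x F := by
  -- The sum has at most one nonzero term; it is zero if P is not a branch point.
  set s : ℝ := ∑ j : Fin 3, if P = branchPt l j then tPart (-r) j.castSucc else 0 with hs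
  have hs1 : s < 1 := by
    by_cases hP : ∃ k, P = branchPt l k
    · obtain ⟨k, hk⟩ := hP
      have : ∀ j : Fin 3, (if P = branchPt l j then tPart (-r) j.castSucc else 0) =
          if k = j then tPart (-r) j.castSucc else 0 := fun j => by
        simp only [hk, (branchPt_injective hl).eq_iff]
      rw [hs]
      simp only [this]
      rw [Finset.sum_ite_eq, if_pos (Finset.mem_univ _)]
      exact tPart_lt_one _
    · have : ∀ j : Fin 3, (if P = branchPt l j then tPart (-r) j.castSucc else 0) = 0 :=
        fun j => if_neg fun h => hP ⟨j, h⟩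
      rw [hs]
      simp only [this]
      simp
  -- If b_j = P, the inverse of zero makes κ_j = 0: that factor is accounted for by s and drops out
  -- of the regular part.
  obtain ⟨ρ, hρ, hslit, y, y', hy⟩ := exists_local_solution hs1 (fun j => (P - branchPt l j)⁻¹)
    (fun j => (tPart (-r) j.castSucc : ℂ))
  -- At a branch point other than P the factor 1 + κ_j v would vanish, so the disc contains none.
  have hbP : ∀ j, branchPt l j ∈ Metric.ball P ρ → P = branchPt l j := by
    intro j hj
    by_contra hne
    have h1 := hslit (branchPt l j - P) (by rwa [mem_ball_zero_iff, ← dist_eq_norm]) j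
    have h2 := sub_ne_zero.2 hne
    rw [show 1 + (P - branchPt l j)⁻¹ * (branchPt l j - P) = 0 by field_simp; ring] at h1
    exact Complex.zero_notMem_slitPlane h1
  refine ⟨_, localPrimitive_of (S := ((↑) : ℂ → OnePoint ℂ) '' Metric.ball P ρ)
    (H := fun z => (z - P) * y (z - P)) h hl he (OnePoint.isOpen_image_coe.2 Metric.isOpen_ball)
    ?_ ?_ (by rw [hx]; exact Set.mem_image_of_mem _ (Metric.mem_ball_self hρ))⟩
  · intro z hzS hzb
    obtain ⟨z', hz', hzz⟩ := hzS
    obtain rfl := OnePoint.coe_injective hzz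
    have hv : z' - P ∈ Metric.ball (0 : ℂ) ρ := by rwa [mem_ball_zero_iff, ← dist_eq_norm]
    obtain ⟨hd, hode⟩ := hy _ hv
    have h1 : HasDerivAt (fun z : ℂ => z - P) 1 z' := (hasDerivAt_id z').sub_const P
    refine (h1.mul (hd.comp z' h1)).congr_deriv ?_
    have hterm : (z' - P) * y (z' - P) * ∑ j : Fin 3, (tPart (-r) j.castSucc : ℂ) /
        (z' - branchPt l j) = s * y (z' - P) + (z' - P) * y (z' - P) *
        ∑ j : Fin 3, (tPart (-r) j.castSucc : ℂ) * (P - branchPt l j)⁻¹ /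
          (1 + (P - branchPt l j)⁻¹ * (z' - P)) := by
      rw [hs]
      push_cast
      rw [Finset.mul_sum, Finset.mul_sum, Finset.sum_mul, ← Finset.sum_add_distrib]
      refine Finset.sum_congr rfl fun j _ => ?_
      have hzj := sub_ne_zero.2 (hzb j)
      by_cases hPj : P = branchPt l j
      · rw [if_pos hPj]
        rw [← hPj] at hzj ⊢
        simp only [sub_self, inv_zero, mul_zero, zero_div, add_zero]
        field_simp
      · rw [if_neg hPj]
        have h2 := sub_ne_zero.2 hPj
        have h3 : 1 + (P - branchPt l j)⁻¹ * (z' - P) = (z' - branchPt l j) / (P - branchPt l j) := by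
          field_simp
          ring
        rw [h3]
        push_cast
        field_simp
        ring
    rw [hterm]
    simp only [Function.comp_apply]
    linear_combination hode
  · rintro X hX ⟨z, hz, hzX⟩ ⟨k, hk⟩
    have h3 : X 3 ≠ 0 := fun h3 => by
      rw [kummerMap_zExp_infty h3] at hzX
      exact OnePoint.coe_ne_infty _ hzX
    rw [kummerMap_zExp h3] at hzX
    obtain rfl := OnePoint.coe_injective hzX
    obtain ⟨k, rfl⟩ : ∃ k' : Fin 3, k = k'.castSucc := by
      refine Fin.lastCases (motive := fun k => X k = 0 → ∃ k' : Fin 3, k = k'.castSucc)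
        (fun h => (h3 h).elim) (fun k _ => ⟨k, rfl⟩) k hk
    have hzk := kummer_zero_branchPt hX h3 hk
    rw [hzk] at hz
    have hPk := hbP k hz
    have hpos := he.pos k.castSucc
    have hlt := ZMod.val_lt ((-r) k.castSucc)
    have hW : ContinuousAt (fun t : ℂ => (X 3 ^ N)⁻¹ * y (t ^ N / X 3 ^ N)) 0 := by
      refine continuousAt_const.mul ?_
      refine ContinuousAt.comp (f := fun t : ℂ => t ^ N / X 3 ^ N) ?_ (by fun_prop)
      simp only [zero_pow (NeZero.ne N), zero_div]
      exact (hy 0 (Metric.mem_ball_self hρ)).1.continuousAt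
    -- Here z - P has order N in t, and the order of the monomial is greater than -N.
    refine continuousAt_branch (H := fun z => (z - P) * y (z - P)) h hl hX hk hW (q := N) (by rw [he.fin]; omega)
      (by rw [he.fin]; omega) (Eventually.of_forall fun t => ?_)
    have h3N := pow_ne_zero N h3
    have : (kummerPt A c (chart N l X t)).1 - P = t ^ N / X 3 ^ N := by
      rw [hPk, ← hzk]
      have h0 := (chartDir_of_ne (l := l) h3).1 0
      rw [Fin.castSucc_zero] at h0
      simp only [kummerPt, div_pow, chart_pow hl hX, h0, (chartDir_of_ne (l := l) h3).2, chartOrder,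
        if_pos (show ∃ j, X j = 0 from ⟨_, hk⟩)]
      field_simp
      ring
    rw [this, zpow_natCast]
    field_simp

/-- The same construction in v = 1/z, with the primitive -f · z · y(1/z). The condition t₄ < 1 makes
the equation solvable. -/
lemma exists_localPrimitive_infty [NeZero N] (h : IsChoice A y₀ c) (hl : 0 < l.im)
    (he : IsFormExponent A r e) {x : cover A y₀ l} (hx : x.1 zExp = ∞) :
    ∃ F, LocalPrimitive (fun p : openCover A y₀ l => monomialValue l p.1 e) x F := by
  obtain ⟨ρ, hρ, hslit, y, y', hy⟩ := exists_local_solution (tPart_lt_one (r := -r) 3)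
    (fun j => -branchPt l j) (fun j => (tPart (-r) j.castSucc : ℂ))
  have hS : ∀ z : ℂ, (z : OnePoint ℂ) ∈ (((↑) : ℂ → OnePoint ℂ) '' Metric.closedBall 0 ρ⁻¹)ᶜ ↔
      ρ⁻¹ < ‖z‖ := fun z => by
    rw [Set.mem_compl_iff, OnePoint.coe_injective.mem_set_image, mem_closedBall_zero_iff, not_le]
  have hinv : ∀ z : ℂ, ρ⁻¹ < ‖z‖ → z ≠ 0 ∧ z⁻¹ ∈ Metric.ball (0 : ℂ) ρ := fun z hz => by
    have h0 : 0 < ‖z‖ := (inv_pos.2 hρ).trans hz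
    refine ⟨norm_pos_iff.1 h0, ?_⟩
    rw [mem_ball_zero_iff, norm_inv]
    exact inv_lt_of_inv_lt₀ hρ hz
  have hb : ∀ j, ¬ ρ⁻¹ < ‖branchPt l j‖ := fun j hj => by
    obtain ⟨h0, h1⟩ := hinv _ hj
    have h2 := hslit _ h1 j
    rw [neg_mul, mul_inv_cancel₀ h0, add_neg_cancel] at h2
    exact Complex.zero_notMem_slitPlane h2
  refine ⟨_, localPrimitive_of (S := (((↑) : ℂ → OnePoint ℂ) '' Metric.closedBall 0 ρ⁻¹)ᶜ)
    (H := fun z => -(z * y z⁻¹)) h hl he (OnePoint.isOpen_compl_image_coe.2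
      ⟨Metric.isClosed_closedBall, isCompact_closedBall _ _⟩) ?_ ?_ ?_⟩
  · intro z hzS hzb
    obtain ⟨h0, hv⟩ := hinv z ((hS z).1 hzS)
    obtain ⟨hd, hode⟩ := hy _ hv
    have h1 : HasDerivAt (fun z : ℂ => z⁻¹) (-(z ^ 2)⁻¹) z := hasDerivAt_inv h0
    refine ((hasDerivAt_id z).mul (hd.comp z h1)).neg.congr_deriv ?_
    have hsum : (∑ j : Fin 3, (tPart (-r) j.castSucc : ℂ)) = 2 - (tPart (-r) 3 : ℂ) := by
      exact_mod_cast tPart_sum he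
    have hterm : z * ∑ j : Fin 3, (tPart (-r) j.castSucc : ℂ) / (z - branchPt l j) =
        (2 - (tPart (-r) 3 : ℂ)) - z⁻¹ * ∑ j : Fin 3, (tPart (-r) j.castSucc : ℂ) * -branchPt l j /
          (1 + -branchPt l j * z⁻¹) := by
      rw [← hsum, Finset.mul_sum, Finset.mul_sum, ← Finset.sum_sub_distrib]
      refine Finset.sum_congr rfl fun j _ => ?_
      have hzj := sub_ne_zero.2 (hzb j)
      rw [show 1 + -branchPt l j * z⁻¹ = (z - branchPt l j) / z by field_simp; ring]
      field_simp
      ring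
    simp only [Function.comp_apply, id_eq]
    have e1 : -(z * y z⁻¹) * ∑ j : Fin 3, (tPart (-r) j.castSucc : ℂ) / (z - branchPt l j) =
        -y z⁻¹ * (z * ∑ j : Fin 3, (tPart (-r) j.castSucc : ℂ) / (z - branchPt l j)) := by ring
    rw [e1, hterm]
    field_simp at hode ⊢
    linear_combination hode
  · intro X hX hXS ⟨k, hk⟩
    have h3 : X 3 = 0 := by
      by_contra h3
      rw [kummerMap_zExp h3, hS] at hXS
      refine Fin.lastCases (motive := fun k => X k = 0 → False)
        (fun h => h3 h) (fun k hk => ?_) k hk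
      rw [kummer_zero_branchPt hX h3 hk] at hXS
      exact hb k hXS
    have h0 : X 0 ≠ 0 := fun h0 => absurd (kummer_zero_unique hl hX h3 h0) (by decide)
    have h0N := pow_ne_zero N h0
    have hpos := he.pos 3
    have hlt := ZMod.val_lt ((-r) 3)
    have hW : ContinuousAt (fun t : ℂ => -(X 0 ^ N * y (t ^ N / X 0 ^ N))) 0 := by
      refine (continuousAt_const.mul ?_).neg
      refine ContinuousAt.comp (f := fun t : ℂ => t ^ N / X 0 ^ N) ?_ (by fun_prop)
      simp only [zero_pow (NeZero.ne N), zero_div]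
      exact (hy 0 (Metric.mem_ball_self hρ)).1.continuousAt
    -- z has order -N in t and the monomial has order 2N minus a residue below N, so the product
    -- still vanishes.
    refine continuousAt_branch (H := fun z => -(z * y z⁻¹)) h hl hX h3 hW (q := -N) (by rw [he.last]; omega)
      (by rw [he.last]; omega) (Eventually.of_forall fun t => ?_)
    have h1 := chartDir_eq_one hl hX h3
    have h2 : chartDir l X 0 = 0 := by
      rw [chartDir, if_pos h3, ← Fin.castSucc_zero, Fin.snoc_castSucc]
      simp
    have : (kummerPt A c (chart N l X t)).1 = X 0 ^ N / t ^ N := by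
      simp only [kummerPt, div_pow, chart_pow hl hX, h1, h2, chartOrder, h3,
        if_pos (show ∃ j, X j = 0 from ⟨_, h3⟩), zero_pow (NeZero.ne N)]
      simp
    simp only [this, inv_div, zpow_neg, zpow_natCast]
    ring
  · rw [hx]
    exact OnePoint.infty_notMem_image_coe

lemma isHolomorphicForm_monomial [NeZero N] (h : IsChoice A y₀ c) (hl : 0 < l.im)
    (he : IsFormExponent A r e) :
    IsHolomorphicForm (fun p : openCover A y₀ l => monomialValue l p.1 e) := by
  intro x
  obtain ⟨F, U, hU, hF⟩ : ∃ F, LocalPrimitive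
      (fun p : openCover A y₀ l => monomialValue l p.1 e) x F := by
    by_cases hx : x.1 zExp = ∞
    · exact exists_localPrimitive_infty h hl he hx
    · obtain ⟨P, hP⟩ := OnePoint.ne_infty_iff_exists.1 hx
      exact exists_localPrimitive_finite h hl he P hP.symm
  exact ⟨U, hU, F, hF⟩

/-- The eigenspace contains a nonzero form. -/
lemma monomial_mem_H10 [NeZero N] (h : IsChoice A y₀ c) (hl : 0 < l.im)
    (he : IsFormExponent A r e) :
    (fun p : openCover A y₀ l => monomialValue l p.1 e) ∈ H10 A y₀ r l := by
  refine ⟨isHolomorphicForm_monomial h hl he, fun j p q hz hw => ?_⟩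
  simp only [monomialValue, hz, hw, mul_zpow, Finset.prod_mul_distrib]
  rw [← mul_assoc (xi N ^ _)]
  congr 2
  have hxi : xi N ≠ 0 := Complex.exp_ne_zero _
  have h1 : ∀ i, (xi N ^ (A i j).val) ^ e.1 i = xi N ^ (e.1 i * (A i j).val) := fun i => by
    rw [← zpow_natCast, ← zpow_mul, mul_comm]
  simp only [h1]
  rw [← zpow_finset_sum hxi, ← zpow_natCast]
  have h2 : (N : ℤ) ∣ (∑ i, e.1 i * (A i j).val) - (r j).val := by
    rw [← ZMod.intCast_zmod_eq_zero_iff_dvd, Int.cast_sub, he.cast]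
    simp
  obtain ⟨k, hk⟩ := h2
  rw [show (∑ i, e.1 i * (A i j).val) = (r j).val + N * k by linarith, zpow_add₀ hxi, zpow_mul,
    zpow_natCast (xi N) N, isPrimitiveRoot_xi.pow_eq_one, one_zpow, mul_one]

lemma monomialValue_ne_zero [NeZero N] (h : IsChoice A y₀ c) (p : openCover A y₀ l) :
    monomialValue l p.1 e ≠ 0 := by
  obtain ⟨X, hX, hne, hp⟩ := exists_kummerPt h p.2
  rw [← hp, monomialValue_kummerPt hX hne]
  exact mul_ne_zero (unitFactor_ne_zero h.ne_zero e)
    (Finset.prod_ne_zero_iff.2 fun j _ => zpow_ne_zero _ (hne j))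

end AbelianCover

namespace AbelianCover

open Filter OnePoint

variable {N m : ℕ} {A : Matrix (Fin m) (Fin 4) (ZMod N)} {y₀ : ℂ × ℂ × (Fin m → ℂ)}
  {c : Fin m → ℂ} {l : ℂ} {X : Fin 4 → ℂ} {r : Fin 4 → ZMod N} {e : Exponent m}

/-! ### The eigenspace is one-dimensional -/

/-- Powers of a deck transformation multiply one root x_j by a root of unity, so they preserve the
chosen component. -/
lemma shift_mem [NeZero N] (h : IsChoice A y₀ c) (hl : 0 < l.im) (p : openCover A y₀ l) (j : Fin 3)
    (n : ℕ) :
    ((p.1.1, fun i => (xi N ^ n) ^ (A i j.castSucc).val * p.1.2 i) : ℂ × (Fin m → ℂ)) ∈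
      openCover A y₀ l := by
  obtain ⟨-, h2, x, hx, hw⟩ : (l, p.1) ∈ rootLocus A c := by rw [← h.comp]; exact p.2
  change (l, _) ∈ connectedComponentIn (equationLocus A) y₀
  rw [h.comp]
  refine ⟨hl, h2, fun k => (if k = j then xi N ^ n else 1) * x k, fun k => ?_, fun i => ?_⟩
  · rw [mul_pow, hx]
    split_ifs
    · rw [xi_pow_pow, one_mul]
    · rw [one_pow, one_mul]
  · simp only [mul_pow, Finset.prod_mul_distrib]
    simp only at hw
    have e1 : ∏ k : Fin 3, (if k = j then xi N ^ n else 1) ^ (A i k.castSucc).val =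
        (xi N ^ n) ^ (A i j.castSucc).val := by
      rw [Finset.prod_eq_single j]
      · rw [if_pos rfl]
      · intro k _ hk
        rw [if_neg hk, one_pow]
      · simp
    rw [hw, e1]
    ring

lemma H10_shift [NeZero N] (h : IsChoice A y₀ c) (hl : 0 < l.im) {f : openCover A y₀ l → ℂ}
    (hf : f ∈ H10 A y₀ r l) (j : Fin 3) (n : ℕ) (p q : openCover A y₀ l) (hz : q.1.1 = p.1.1)
    (hw : ∀ i, q.1.2 i = (xi N ^ n) ^ (A i j.castSucc).val * p.1.2 i) :
    f q = (xi N ^ n) ^ (r j.castSucc).val * f p := by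
  induction n generalizing q with
  | zero =>
    have : q = p := Subtype.ext (Prod.ext hz (funext fun i => by simpa using hw i))
    simp [this]
  | succ n ih =>
    have h1 := ih ⟨_, shift_mem h hl p j n⟩ rfl fun i => rfl
    rw [hf.2 j.castSucc ⟨_, shift_mem h hl p j n⟩ q hz fun i => ?_, h1]
    · ring
    · rw [hw]; ring

/-- Two points over the same z have roots that differ by powers of ξ_N, so powers of T_1, T_2, T_3
carry one to the other. The resulting factor depends on r only, not on the form. -/
lemma H10_fibre [NeZero N] (h : IsChoice A y₀ c) (hl : 0 < l.im) (p q : openCover A y₀ l)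
    (hz : q.1.1 = p.1.1) : ∃ κ : ℂ, ∀ f ∈ H10 A y₀ r l, f q = κ * f p := by
  obtain ⟨X, hX, hXne, hXp⟩ := exists_kummerPt h p.2
  obtain ⟨Y, hY, hYne, hYq⟩ := exists_kummerPt h q.2
  have hk : ∀ j : Fin 3, ∃ k : ℕ, Y j.castSucc / Y 3 = xi N ^ k * (X j.castSucc / X 3) := fun j => by
    refine exists_xi_pow ?_ (div_ne_zero (hXne _) (hXne 3))
    rw [kummerPt_sub (A := A) (c := c) hY (hYne 3), kummerPt_sub (A := A) (c := c) hX (hXne 3), hXp,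
      hYq, hz]
  choose k hk using hk
  have hw : ∀ i, q.1.2 i = (xi N ^ k 2) ^ (A i 2).val * ((xi N ^ k 1) ^ (A i 1).val *
      ((xi N ^ k 0) ^ (A i 0).val * p.1.2 i)) := fun i => by
    rw [← hYq, ← hXp]
    simp only [kummerPt, hk, mul_pow, Fin.prod_univ_three]
    simp only [Fin.castSucc_zero, Fin.castSucc_one, show (2 : Fin 3).castSucc = (2 : Fin 4) from rfl]
    ring
  refine ⟨(xi N ^ k 2) ^ (r 2).val * ((xi N ^ k 1) ^ (r 1).val * (xi N ^ k 0) ^ (r 0).val),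
    fun f hf => ?_⟩
  let p₁ : openCover A y₀ l := ⟨_, shift_mem h hl p 0 (k 0)⟩
  let p₂ : openCover A y₀ l := ⟨_, shift_mem h hl p₁ 1 (k 1)⟩
  have h1 := H10_shift h hl hf 0 (k 0) p p₁ rfl fun i => rfl
  have h2 := H10_shift h hl hf 1 (k 1) p₁ p₂ rfl fun i => rfl
  have h3 := H10_shift h hl hf 2 (k 2) p₂ q hz fun i => hw i
  rw [h3, h2, h1]
  simp only [Fin.castSucc_zero, Fin.castSucc_one, show (2 : Fin 3).castSucc = (2 : Fin 4) from rfl]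
  ring

/-- Points of the Kummer curve over all points of the sphere. -/
lemma exists_kummer_finite [NeZero N] (l P : ℂ) : ∃ X ∈ kummer N l, X 3 = 1 ∧
    ∀ j : Fin 3, X j.castSucc ^ N = P - branchPt l j := by
  have hN := NeZero.ne N
  set X : Fin 4 → ℂ := Fin.snoc (α := fun _ => ℂ)
    (fun j : Fin 3 => (P - branchPt l j) ^ ((N : ℂ)⁻¹)) 1 with hX
  have hXc : ∀ j : Fin 3, X j.castSucc ^ N = P - branchPt l j := fun j => by
    rw [hX, Fin.snoc_castSucc]
    exact Complex.cpow_nat_inv_pow _ hN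
  have hX3 : X 3 = 1 := Fin.snoc_last (α := fun _ => ℂ) _ _
  refine ⟨X, ⟨fun h0 => ?_, fun j => ?_⟩, hX3, hXc⟩
  · rw [h0] at hX3
    simp at hX3
  · have h0 := hXc 0
    rw [Fin.castSucc_zero, branchPt_zero, sub_zero] at h0
    rw [hXc, h0, hX3, one_pow, mul_one]

lemma exists_kummer_infty [NeZero N] (l : ℂ) : ∃ X ∈ kummer N l, X 3 = 0 ∧ X 0 = 1 := by
  set X : Fin 4 → ℂ := Fin.snoc (α := fun _ => ℂ) (fun _ => 1) 0 with hX
  have hXc : ∀ j : Fin 3, X j.castSucc = 1 := fun j => Fin.snoc_castSucc (α := fun _ => ℂ) _ _ _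
  have hX3 : X 3 = 0 := Fin.snoc_last (α := fun _ => ℂ) _ _
  have hX0 : X 0 = 1 := hXc 0
  refine ⟨X, ⟨fun h0 => ?_, fun j => ?_⟩, hX3, hX0⟩
  · rw [h0] at hX0
    simp at hX0
  · rw [hXc, hX3, hX0, zero_pow (NeZero.ne N)]
    simp

/-- The quotient of a form by a monomial, in a chart. -/
lemma exists_chart_quotient [NeZero N] (h : IsChoice A y₀ c) (hl : 0 < l.im)
    {η : openCover A y₀ l → ℂ} (hη : IsHolomorphicForm η) {Γ : ℂ → ℂ}
    (hΓ : ∀ p : openCover A y₀ l, η p = Γ p.1.1 * monomialValue l p.1 e) (hX : X ∈ kummer N l) :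
    ∃ φ' : ℂ → ℂ, DifferentiableAt ℂ φ' 0 ∧ ∀ᶠ t in 𝓝 (0 : ℂ), (t ≠ 0 ∨ ∀ j, X j ≠ 0) →
      Γ (kummerPt A c (chart N l X t)).1 * chartDeriv N l X t *
        (unitFactor c e * ∏ j, chart N l X t j ^ kummerExp A e j) = φ' t := by
  obtain ⟨U, hU, F, hF⟩ := hη ⟨_, kummerMap_mem_cover h hl hX⟩
  obtain ⟨δ, hδ, H⟩ := eventually_differentiableAt_pullback h hl hF hX rfl hU
  have hd : DifferentiableOn ℂ (fun t => pullback c F (chart N l X t)) (Metric.ball 0 δ) :=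
    fun t ht => (H t ht).2.1.differentiableWithinAt
  refine ⟨_, (hd.deriv Metric.isOpen_ball).differentiableAt (Metric.ball_mem_nhds 0 hδ), ?_⟩
  filter_upwards [Metric.ball_mem_nhds (0 : ℂ) hδ] with t ht ht0
  obtain ⟨hg, -, hder⟩ := H t ht
  have hne := hg.ne_zero ht0
  rw [(hder ht0).deriv, pullbackOpen_eq _ ⟨_, kummerPt_mem h hl hg.mem hne⟩ rfl, hΓ,
    monomialValue_kummerPt hg.mem hne]
  ring

/-- Γ times the monomial times dz/dt is holomorphic in t. The bound on the orders leaves at least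
one factor t in t^N Γ: the singularity is weaker than a simple pole in z, or the growth sublinear if
z = ∞. -/
lemma tendsto_quotient_branch [NeZero N] (h : IsChoice A y₀ c) (hl : 0 < l.im)
    {η : openCover A y₀ l → ℂ} (hη : IsHolomorphicForm η) {Γ : ℂ → ℂ}
    (hΓ : ∀ p : openCover A y₀ l, η p = Γ p.1.1 * monomialValue l p.1 e) (hX : X ∈ kummer N l)
    {k : Fin 4} (hk : X k = 0) {κ : ℂ} (hκ : κ ≠ 0) {q : ℤ} (hq : kummerExp A e k + q + 1 ≤ N)
    (hderiv : ∀ t ≠ 0, chartDeriv N l X t = κ * t ^ q) :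
    Tendsto (fun t => t ^ N * Γ (kummerPt A c (chart N l X t)).1) (𝓝[≠] 0) (𝓝 0) := by
  obtain ⟨φ', hφ', hev⟩ := exists_chart_quotient h hl hη hΓ hX
  obtain ⟨R, hR, hR0, hRt⟩ := exists_monomial_chart hl hX hk (kummerExp A e)
    (unitFactor_ne_zero h.ne_zero e)
  have hc : ContinuousAt (fun t : ℂ => t * t ^ ((N : ℤ) - (kummerExp A e k + q + 1)) *
      (φ' t / (κ * R t))) 0 := by
    refine (continuousAt_id.mul (continuousAt_id.zpow₀ _ (Or.inr (by omega)))).mul ?_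
    exact hφ'.continuousAt.div (continuousAt_const.mul hR) (mul_ne_zero hκ hR0)
  have h0 := hc.tendsto
  simp only [zero_mul] at h0
  refine (h0.mono_left nhdsWithin_le_nhds).congr' ?_
  filter_upwards [self_mem_nhdsWithin, nhdsWithin_le_nhds hev,
    nhdsWithin_le_nhds (hR.eventually_ne hR0)] with t ht hev hRne
  have ht' : t ≠ 0 := ht
  rw [← hev (Or.inl ht), hRt, hderiv t ht]
  have e1 : t * t ^ ((N : ℤ) - (kummerExp A e k + q + 1)) * (t ^ q * t ^ kummerExp A e k) = t ^ N := by
    nth_rw 1 [← zpow_one t]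
    rw [← zpow_add₀ ht', ← zpow_add₀ ht', ← zpow_add₀ ht', ← zpow_natCast]
    congr 1
    ring
  rw [← e1]
  field_simp

/-- The substitution t = (z - b)^(1/N), or t = (1/z)^(1/N), turns limits in the chart parameter into
limits in z. Continuity of the root is not needed away from 0. -/
lemma tendsto_root_nhdsNE [NeZero N] {α : Type*} {F : Filter α} {g : α → ℂ}
    (hg : Tendsto g F (𝓝[≠] 0)) : Tendsto (fun x => g x ^ ((N : ℂ)⁻¹)) F (𝓝[≠] 0) := by
  have hN := NeZero.ne N
  have hN' : (N : ℂ)⁻¹ ≠ 0 := inv_ne_zero (Nat.cast_ne_zero.2 hN)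
  refine tendsto_nhdsWithin_iff.2 ⟨?_, ?_⟩
  · have hre : 0 < ((N : ℂ)⁻¹).re := by
      rw [show (N : ℂ)⁻¹ = (((N : ℝ)⁻¹ : ℝ) : ℂ) by push_cast; rfl, Complex.ofReal_re]
      exact inv_pos.2 (Nat.cast_pos.2 (Nat.pos_of_ne_zero hN))
    have h1 : ContinuousAt (fun x : ℂ => x ^ ((N : ℂ)⁻¹)) 0 :=
      Complex.continuousAt_cpow_const_of_re_pos (Or.inl le_rfl) hre
    have h2 := h1.tendsto
    rw [Complex.zero_cpow hN'] at h2
    exact h2.comp (hg.mono_right nhdsWithin_le_nhds)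
  · filter_upwards [hg.eventually self_mem_nhdsWithin] with x hx
    exact fun h0 => hx ((Complex.cpow_eq_zero_iff _ _).1 h0).1

/-- Both forms have the same character, so their quotient Γ is a function of z. It is holomorphic
off the branch points, and `tendsto_quotient_branch` controls it at all four;
`exists_const_of_growth` applies. -/
lemma H10_eq_smul [NeZero N] (h : IsChoice A y₀ c) (hl : 0 < l.im) (he : IsFormExponent A r e)
    {η : openCover A y₀ l → ℂ} (hη : η ∈ H10 A y₀ r l) :
    ∃ κ : ℂ, ∀ p : openCover A y₀ l, η p = κ * monomialValue l p.1 e := by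
  classical
  have hf := monomial_mem_H10 h hl he
  -- The quotient is evaluated at an arbitrary point over z; `H10_fibre` shows that the choice does
  -- not matter.
  set Γ : ℂ → ℂ := fun z => if hz : ∃ p : openCover A y₀ l, p.1.1 = z then
    η hz.choose / monomialValue l hz.choose.1 e else 0 with hΓdef
  have hΓ : ∀ p : openCover A y₀ l, η p = Γ p.1.1 * monomialValue l p.1 e := by
    intro p
    have hz : ∃ q : openCover A y₀ l, q.1.1 = p.1.1 := ⟨p, rfl⟩
    obtain ⟨κ, hκ⟩ := H10_fibre (r := r) h hl hz.choose p hz.choose_spec.symm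
    have h0 : monomialValue l hz.choose.1 e ≠ 0 := monomialValue_ne_zero h _
    have h1 : monomialValue l p.1 e = κ * monomialValue l hz.choose.1 e := hκ _ hf
    simp only [hΓdef, dif_pos hz]
    rw [hκ η hη, h1]
    field_simp
  set S : Finset ℂ := Finset.univ.image (branchPt l) with hS
  have hN := NeZero.ne N
  have hN' : (N : ℂ) ≠ 0 := Nat.cast_ne_zero.2 hN
  have hex : ∃ κ, ∀ z ∉ S, Γ z = κ := by
    refine exists_const_of_growth S Γ ?_ ?_ ?_
    · intro P hP
      simp only [hS, Finset.mem_image, Finset.mem_univ, true_and, not_exists] at hP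
      obtain ⟨X, hX, hX3, hXj⟩ := exists_kummer_finite (N := N) l P
      have hne : ∀ j, X j ≠ 0 := by
        intro j
        refine Fin.lastCases ?_ (fun j hj => ?_) j
        · rw [show Fin.last 3 = (3 : Fin 4) from rfl, hX3]; exact one_ne_zero
        · have := hXj j
          rw [hj, zero_pow hN] at this
          exact hP j (sub_eq_zero.1 this.symm).symm
      obtain ⟨φ', hφ', hev⟩ := exists_chart_quotient h hl hη.1 hΓ hX
      have hprod : DifferentiableAt ℂ
          (fun t => unitFactor c e * ∏ j, chart N l X t j ^ kummerExp A e j) 0 :=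
        (hasDerivAt_monomial_chart he hX hne).differentiableAt
      have hprod0 : unitFactor c e * ∏ j, chart N l X 0 j ^ kummerExp A e j ≠ 0 := by
        rw [chart_zero]
        exact mul_ne_zero (unitFactor_ne_zero h.ne_zero e)
          (Finset.prod_ne_zero_iff.2 fun j _ => zpow_ne_zero _ (hne j))
      have h0 := (chartDir_of_ne (l := l) (hne 3)).1 0
      have h3 := (chartDir_of_ne (l := l) (hne 3)).2
      rw [Fin.castSucc_zero] at h0
      have hX0 := hXj 0
      rw [Fin.castSucc_zero, branchPt_zero, sub_zero] at hX0
      have hM : chartOrder N X = 1 := if_neg (by simpa using hne)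
      have hcd : ∀ t, chartDeriv N l X t = 1 := fun t => by
        rw [chartDeriv, chart_pow hl hX, h0, h3, hX3, hM]
        simp
      have hz : ∀ t, (kummerPt A c (chart N l X t)).1 = P + t := fun t => by
        simp only [kummerPt, div_pow, chart_pow hl hX, h0, h3, hX3, hM, hX0]
        simp
      have hd : DifferentiableAt ℂ (fun t => Γ (P + t)) 0 := by
        refine (hφ'.div hprod hprod0).congr_of_eventuallyEq ?_
        filter_upwards [hev, hprod.continuousAt.eventually_ne hprod0] with t ht ht0
        have := ht (Or.inr hne)
        rw [hz, hcd, mul_one] at this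
        rw [Pi.div_apply, ← this, mul_div_cancel_right₀ _ ht0]
      have hd' : DifferentiableAt ℂ (fun t => Γ (P + t)) (P - P) := by rwa [sub_self]
      have h2 := hd'.comp (f := fun z => z - P) P (by fun_prop)
      refine h2.congr_of_eventuallyEq (Eventually.of_forall fun z => ?_)
      simp
    · intro P hP
      obtain ⟨k, -, rfl⟩ := Finset.mem_image.1 hP
      obtain ⟨X, hX, hX3, hXj⟩ := exists_kummer_finite (N := N) l (branchPt l k)
      have h3ne : X 3 ≠ 0 := by rw [hX3]; exact one_ne_zero
      have hk : X k.castSucc = 0 := by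
        have := hXj k
        rw [sub_self] at this
        exact pow_eq_zero_iff hN |>.1 this
      have h0 := (chartDir_of_ne (l := l) h3ne).1 0
      have h3 := (chartDir_of_ne (l := l) h3ne).2
      rw [Fin.castSucc_zero] at h0
      have hX0 := hXj 0
      rw [Fin.castSucc_zero, branchPt_zero, sub_zero] at hX0
      have hM : chartOrder N X = N := if_pos ⟨_, hk⟩
      have hcd : ∀ t ≠ 0, chartDeriv N l X t = N * t ^ ((N : ℤ) - 1) := fun t ht => by
        rw [chartDeriv, chart_pow hl hX, h0, h3, hX3, hM, zpow_sub_one₀ ht, zpow_natCast,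
          ← pow_sub_one_mul hN t]
        field_simp
        simp
      have hz : ∀ t, (kummerPt A c (chart N l X t)).1 = branchPt l k + t ^ N := fun t => by
        simp only [kummerPt, div_pow, chart_pow hl hX, h0, h3, hX3, hM, hX0]
        simp
      have hpos := he.pos k.castSucc
      have h1 := tendsto_quotient_branch h hl hη.1 hΓ hX hk hN' (q := (N : ℤ) - 1)
        (by rw [he.fin]; omega) hcd
      have hsub : Tendsto (fun z : ℂ => z - branchPt l k) (𝓝[≠] branchPt l k) (𝓝[≠] 0) := by
        refine tendsto_nhdsWithin_iff.2 ⟨?_, ?_⟩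
        · have : ContinuousAt (fun z : ℂ => z - branchPt l k) (branchPt l k) := by fun_prop
          have h2 := this.tendsto
          rw [sub_self] at h2
          exact h2.mono_left nhdsWithin_le_nhds
        · filter_upwards [self_mem_nhdsWithin] with z hz using sub_ne_zero.2 hz
      refine (h1.comp (tendsto_root_nhdsNE (N := N) hsub)).congr fun z => ?_
      simp only [Function.comp_apply, hz, Complex.cpow_nat_inv_pow _ hN]
      rw [add_sub_cancel]
    · obtain ⟨X, hX, hX3, hX0⟩ := exists_kummer_infty (N := N) l
      have h3 := chartDir_eq_one hl hX hX3
      have h0 : chartDir l X 0 = 0 := by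
        rw [chartDir, if_pos hX3, ← Fin.castSucc_zero, Fin.snoc_castSucc]
        simp
      have hM : chartOrder N X = N := if_pos ⟨_, hX3⟩
      have hcd : ∀ t ≠ 0, chartDeriv N l X t = -N * t ^ (-(N : ℤ) - 1) := fun t ht => by
        rw [chartDeriv, chart_pow hl hX, h0, h3, hX3, hM, hX0, zpow_sub_one₀ ht, zpow_neg,
          zpow_natCast, zero_pow hN, ← pow_sub_one_mul hN t]
        field_simp
        ring
      have hz : ∀ t, (kummerPt A c (chart N l X t)).1 = (t ^ N)⁻¹ := fun t => by
        simp only [kummerPt, div_pow, chart_pow hl hX, h0, h3, hX3, hM, hX0]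
        simp [hN]
      have hpos := he.pos 3
      have h1 := tendsto_quotient_branch h hl hη.1 hΓ hX hX3 (neg_ne_zero.2 hN')
        (q := -(N : ℤ) - 1) (by rw [he.last]; omega) hcd
      have hinv : Tendsto (fun z : ℂ => z⁻¹) (cocompact ℂ) (𝓝[≠] 0) := by
        rw [← Metric.cobounded_eq_cocompact]
        exact tendsto_inv₀_cobounded'
      refine (h1.comp (tendsto_root_nhdsNE (N := N) hinv)).congr fun z => ?_
      simp only [Function.comp_apply, hz, Complex.cpow_nat_inv_pow _ hN, inv_inv]
      ring
  obtain ⟨κ, hκ⟩ := hex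
  refine ⟨κ, fun p => ?_⟩
  rw [hΓ p, hκ]
  simp only [hS, Finset.mem_image, Finset.mem_univ, true_and, not_exists]
  exact fun j hj => (openCover_ne h p).1 j hj.symm

end AbelianCover

namespace AbelianCover

open Filter OnePoint MeasureTheory

variable {N m : ℕ} {A : Matrix (Fin m) (Fin 4) (ZMod N)} {y₀ : ℂ × ℂ × (Fin m → ℂ)}
  {c : Fin m → ℂ} {X : Fin 4 → ℂ} {r : Fin 4 → ZMod N} {e : Exponent m} {i j : Fin 4}

/-! ### Integration along paths between branch points -/

/-- Families of paths in the Kummer curves that begin over the `i`-th branch point and end over the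
`j`-th branch point. -/
structure PathFamily (N : ℕ) (i j : Fin 4) where
  X : ℍ → ℝ → Fin 4 → ℂ
  dz : ℍ → ℝ → ℂ
  ne : i ≠ j
  cont : Continuous fun p : ℍ × ℝ => X p.1 p.2
  mem : ∀ l : ℍ, ∀ u ∈ Set.Icc (0 : ℝ) 1, X l u ∈ kummer N l
  zero : ∀ l, X l 0 i = 0
  one : ∀ l, X l 1 j = 0
  ne_zero : ∀ l, ∀ u ∈ Set.Ioo (0 : ℝ) 1, ∀ k, X l u k ≠ 0
  deriv : ∀ l, ∀ u ∈ Set.Ioo (0 : ℝ) 1, HasDerivAt (fun u => (X l u 0 / X l u 3) ^ N) (dz l u) u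
  dz_ne : ∀ l, ∀ u ∈ Set.Ioo (0 : ℝ) 1, dz l u ≠ 0

lemma phase_mem_kummer {l : ℂ} (hX : X ∈ kummer N l) {ph : Fin 4 → ℂ}
    (hph0 : ∀ k, ph k ≠ 0) (hph : ∀ k, ph k ^ N = 1) : (fun k => ph k * X k) ∈ kummer N l := by
  refine ⟨fun h0 => hX.1 (funext fun k => ?_), fun k => ?_⟩
  · have := congrFun h0 k
    simpa [hph0 k] using this
  · simp only [mul_pow, hph, one_mul]
    exact hX.2 k

namespace PathFamily

variable (P : PathFamily N i j) (c e) in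
/-- The integrand of the form along a path. -/
def integrand (A : Matrix (Fin m) (Fin 4) (ZMod N)) (l : ℍ) (u : ℝ) : ℂ :=
  unitFactor c e * (∏ k, P.X l u k ^ kummerExp A e k) * P.dz l u

variable (P : PathFamily N i j)

lemma continuous_apply (l : ℍ) : Continuous (P.X l) :=
  P.cont.comp (continuous_const.prodMk continuous_id)

/-- Phases that are N-th roots of unity leave z, and hence dz, unchanged and multiply the monomial
by a constant. The endpoints lie over branch points, where only continuity of the primitive is used.
-/
lemma segment_integral [NeZero N] (h : IsChoice A y₀ c) {l : ℍ} {η : openCover A y₀ l → ℂ} {κ : ℂ}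
    (hη : ∀ p, η p = κ * monomialValue l p.1 e)
    (hint : IntervalIntegrable (P.integrand c e A l) volume 0 1) {ph : Fin 4 → ℂ}
    (hph0 : ∀ k, ph k ≠ 0) (hph : ∀ k, ph k ^ N = 1) {γ : ℝ → cover A y₀ l} (hγ : Continuous γ)
    (hγX : ∀ u ∈ Set.Icc (0 : ℝ) 1, kummerMap A c (fun k => ph k * P.X l u k) = (γ u).1)
    {g : ℝ → ℂ} (hg : PrimAlong (LocalPrimitive η) γ g) :
    g 1 - g 0 = κ * (∏ k, ph k ^ kummerExp A e k) * ∫ u in (0 : ℝ)..1, P.integrand c e A l u := by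
  rw [← intervalIntegral.integral_const_mul]
  refine (intervalIntegral.integral_eq_sub_of_hasDerivAt_of_le zero_le_one ?_ ?_
    (hint.const_mul _)).symm
  · intro u _
    obtain ⟨F, ⟨U, hU, hF⟩, hgF⟩ := hg u
    have h1 : ContinuousAt (fun u => F (γ u)) u :=
      ContinuousAt.comp (f := γ) (hF.1.continuousAt hU) hγ.continuousAt
    exact (h1.congr (hgF.mono fun _ h => h.symm)).continuousWithinAt
  · intro u hu
    obtain ⟨F, ⟨U, hU, hF⟩, hgF⟩ := hg u
    have hIoo : ∀ᶠ u' in 𝓝 u, u' ∈ Set.Ioo (0 : ℝ) 1 := isOpen_Ioo.mem_nhds hu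
    have hc : ContinuousAt (fun u k => ph k * P.X l u k) u := by
      have := P.continuous_apply l
      exact Continuous.continuousAt (by fun_prop)
    have hK : ∀ᶠ u' in 𝓝 u, (fun k => ph k * P.X l u' k) ∈ kummer N l := by
      filter_upwards [hIoo] with u' hu'
      exact phase_mem_kummer (P.mem l u' (Set.Ioo_subset_Icc_self hu')) hph0 hph
    have hne : ∀ k, ph k * P.X l u k ≠ 0 := fun k => mul_ne_zero (hph0 k) (P.ne_zero l u hu k)
    have hz : HasDerivAt (fun u => (kummerPt A c (fun k => ph k * P.X l u k)).1) (P.dz l u) u := by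
      refine (P.deriv l u hu).congr_of_eventuallyEq (Eventually.of_forall fun u => ?_)
      simp only [kummerPt, div_pow, mul_pow, hph, one_mul]
    have h1 := hasDerivAt_pullback (𝕜 := ℝ) h l.im_pos hF hc hK hne (mem_of_mem_nhds hU)
      (hγX u (Set.Ioo_subset_Icc_self hu)) hz (P.dz_ne l u hu)
    refine (h1.congr_of_eventuallyEq ?_).congr_deriv ?_
    · filter_upwards [hgF, hIoo] with u' h1 h2
      rw [h1, pullback_eq F _ (hγX u' (Set.Ioo_subset_Icc_self h2))]
    · rw [pullbackOpen_eq _ ⟨_, kummerPt_mem h l.im_pos hK.self_of_nhds hne⟩ rfl, hη,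
        monomialValue_kummerPt hK.self_of_nhds hne, integrand]
      simp only [mul_zpow, Finset.prod_mul_distrib]
      ring

/-! ### Commutator loops -/

/-- The parameter of the path that is run through forth and back twice. -/
def tent (s : ℝ) : ℝ := max 0 (1 - |(|s - 2| - 1)|)

lemma continuous_tent : Continuous tent := by unfold tent; fun_prop

lemma tent_mem (s : ℝ) : tent s ∈ Set.Icc (0 : ℝ) 1 := by
  refine ⟨le_max_left _ _, max_le zero_le_one ?_⟩
  linarith [abs_nonneg (|s - 2| - 1)]

lemma tent_of_le_one {s : ℝ} (h0 : 0 ≤ s) (h1 : s ≤ 1) : tent s = s := by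
  rw [tent, abs_of_nonpos (by linarith : s - 2 ≤ 0), abs_of_nonneg (by linarith),
    max_eq_right (by linarith)]
  ring

lemma tent_of_le_two {s : ℝ} (h0 : 1 ≤ s) (h1 : s ≤ 2) : tent s = 2 - s := by
  rw [tent, abs_of_nonpos (by linarith : s - 2 ≤ 0), abs_of_nonpos (by linarith),
    max_eq_right (by linarith)]
  ring

lemma tent_of_le_three {s : ℝ} (h0 : 2 ≤ s) (h1 : s ≤ 3) : tent s = s - 2 := by
  rw [tent, abs_of_nonneg (by linarith : 0 ≤ s - 2), abs_of_nonpos (by linarith),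
    max_eq_right (by linarith)]
  ring

lemma tent_of_le_four {s : ℝ} (h0 : 3 ≤ s) (h1 : s ≤ 4) : tent s = 4 - s := by
  rw [tent, abs_of_nonneg (by linarith : 0 ≤ s - 2), abs_of_nonneg (by linarith),
    max_eq_right (by linarith)]
  ring

/-- The loop that belongs to the commutator of the monodromies about two branch points. -/
def loopPt (l : ℍ) (s : ℝ) : Fin 4 → ℂ := fun k =>
  if k = i then (if s ≤ 2 then P.X l (tent s) k else xi N * P.X l (tent s) k)
  else if k = j then
    (if 1 ≤ s then (if s ≤ 3 then xi N * P.X l (tent s) k else P.X l (tent s) k)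
      else P.X l (tent s) k)
  else P.X l (tent s) k

/-- Phases on the coordinates `i` and `j`. -/
def phase (i j : Fin 4) (a b : ℂ) (k : Fin 4) : ℂ := if k = i then a else if k = j then b else 1

lemma phase_ne_zero {a b : ℂ} (ha : a ≠ 0) (hb : b ≠ 0) (k : Fin 4) : phase i j a b k ≠ 0 := by
  unfold phase
  split_ifs
  exacts [ha, hb, one_ne_zero]

lemma phase_pow {a b : ℂ} (ha : a ^ N = 1) (hb : b ^ N = 1) (k : Fin 4) :
    phase i j a b k ^ N = 1 := by
  unfold phase
  split_ifs
  exacts [ha, hb, one_pow _]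

lemma prod_phase (hij : i ≠ j) (a b : ℂ) (E : Fin 4 → ℤ) :
    ∏ k, phase i j a b k ^ E k = a ^ E i * b ^ E j := by
  rw [Finset.prod_eq_mul i j hij]
  · rw [phase, if_pos rfl, phase, if_neg hij.symm, if_pos rfl]
  · intro k _ hk
    rw [phase, if_neg hk.1, if_neg hk.2, one_zpow]
  · simp
  · simp

lemma xi_ne_zero : xi N ≠ 0 := Complex.exp_ne_zero _

/-- At the ends of the path one of the two coordinates vanishes, so its phase is irrelevant there.
This freedom lets the phases jump at s = 1, 2, 3 without breaking continuity. -/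
lemma loopPt_eq_phase (l : ℍ) (s : ℝ) (a b : ℂ)
    (ha : tent s ≠ 0 → a = if s ≤ 2 then 1 else xi N)
    (hb : tent s ≠ 1 → b = if 1 ≤ s then (if s ≤ 3 then xi N else 1) else 1) :
    P.loopPt l s = fun k => phase i j a b k * P.X l (tent s) k := by
  funext k
  unfold loopPt phase
  by_cases hki : k = i
  · simp only [hki, if_true]
    by_cases h0 : tent s = 0
    · rw [h0, P.zero]; simp
    · rw [ha h0]; split_ifs <;> simp
  · simp only [hki, if_false]
    by_cases hkj : k = j
    · simp only [hkj, if_true]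
      by_cases h0 : tent s = 1
      · rw [h0, P.one]; simp
      · rw [hb h0]; split_ifs <;> simp
    · simp [hkj]

lemma loopPt_mem [NeZero N] (l : ℍ) (s : ℝ) : P.loopPt l s ∈ kummer N l := by
  rw [P.loopPt_eq_phase l s _ _ (fun _ => rfl) (fun _ => rfl)]
  have h1 : xi N ^ N = 1 := isPrimitiveRoot_xi.pow_eq_one
  refine phase_mem_kummer (P.mem l _ (tent_mem s)) (phase_ne_zero ?_ ?_) (phase_pow ?_ ?_) <;>
    split_ifs <;> simp [xi_ne_zero, h1]

lemma continuous_loopPt : Continuous fun p : ℍ × ℝ => P.loopPt p.1 p.2 := by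
  have hX : ∀ k, Continuous fun p : ℍ × ℝ => P.X p.1 (tent p.2) k := fun k =>
    (_root_.continuous_apply k).comp
      (P.cont.comp (continuous_fst.prodMk (continuous_tent.comp continuous_snd)))
  refine continuous_pi fun k => ?_
  unfold loopPt
  by_cases hki : k = i
  · simp only [hki, if_true]
    refine Continuous.if_le (hX i) (continuous_const.mul (hX i)) continuous_snd continuous_const
      fun p hp => ?_
    rw [hp, tent_of_le_two one_le_two le_rfl, sub_self, P.zero, mul_zero]
  · by_cases hkj : k = j
    · have hji : j ≠ i := P.ne.symm
      simp only [hkj, hji, if_true, if_false]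
      have h3 : Continuous fun p : ℍ × ℝ => if p.2 ≤ 3 then xi N * P.X p.1 (tent p.2) j
          else P.X p.1 (tent p.2) j := by
        refine Continuous.if_le (continuous_const.mul (hX j)) (hX j) continuous_snd continuous_const
          fun p hp => ?_
        rw [hp, tent_of_le_three (by norm_num) le_rfl, show (3 : ℝ) - 2 = 1 by norm_num, P.one,
          mul_zero]
      refine Continuous.if_le h3 (hX j) continuous_const continuous_snd fun p hp => ?_
      rw [← hp, tent_of_le_one zero_le_one le_rfl, P.one]
      simp
    · simp only [hki, hkj, if_false]
      exact hX k

lemma loopPt_four (l : ℍ) : P.loopPt l 0 = P.loopPt l 4 := by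
  have h0 : tent 0 = 0 := tent_of_le_one le_rfl zero_le_one
  have h4 : tent 4 = 0 := by rw [tent_of_le_four (by norm_num) le_rfl, sub_self]
  rw [P.loopPt_eq_phase l 0 1 1 (fun h => (h h0).elim) (fun _ => by norm_num),
    P.loopPt_eq_phase l 4 1 1 (fun h => (h h4).elim) (fun _ => by norm_num), h0, h4]

variable [NeZero N] (h : IsChoice A y₀ c)

/-- The loop in the compact surface. -/
def loopFun (l : ℍ) (s : ℝ) : cover A y₀ l :=
  ⟨kummerMap A c (P.loopPt l s), kummerMap_mem_cover h l.im_pos (P.loopPt_mem l s)⟩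

lemma continuous_kummerMap_loopPt (h : IsChoice A y₀ c) :
    Continuous fun p : ℍ × ℝ => kummerMap A c (P.loopPt p.1 p.2) := by
  rw [continuous_iff_continuousAt]
  intro p
  exact ContinuousAt.comp (f := fun p : ℍ × ℝ => P.loopPt p.1 p.2)
    (continuousAt_kummerMap A h.ne_zero p.1.im_pos (P.loopPt_mem p.1 p.2))
    P.continuous_loopPt.continuousAt

lemma continuous_loopFun (l : ℍ) : Continuous (P.loopFun h l) :=
  ((P.continuous_kummerMap_loopPt h).comp (continuous_const.prodMk continuous_id)).subtype_mk _

instance fact_four_pos : Fact (0 < (4 : ℝ)) := ⟨by norm_num⟩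

/-- The loop in the compact surface, as a map of the circle. -/
def loopMap (l : ℍ) : C(AddCircle (4 : ℝ), cover A y₀ l) where
  toFun := AddCircle.liftIco 4 0 (P.loopFun h l)
  continuous_toFun := AddCircle.liftIco_continuous
    (Subtype.ext (by simp only [loopFun, zero_add, P.loopPt_four]))
    (P.continuous_loopFun h l).continuousOn

lemma loopMap_coe (l : ℍ) {s : ℝ} (hs : s ∈ Set.Icc (0 : ℝ) 4) :
    P.loopMap h l (s : AddCircle (4 : ℝ)) = P.loopFun h l s := by
  rcases hs.2.lt_or_eq with h4 | h4
  · exact AddCircle.liftIco_zero_coe_apply (p := (4 : ℝ)) (f := P.loopFun h l) ⟨hs.1, h4⟩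
  · rw [h4]
    have h0 : ((4 : ℝ) : AddCircle (4 : ℝ)) = ((0 : ℝ) : AddCircle (4 : ℝ)) := by
      rw [AddCircle.coe_period]; rfl
    rw [h0]
    refine (AddCircle.liftIco_zero_coe_apply (p := (4 : ℝ)) (f := P.loopFun h l)
      ⟨le_rfl, by norm_num⟩).trans ?_
    exact Subtype.ext (by simp only [loopFun, P.loopPt_four])

open CategoryTheory in
lemma _root_.AbelianCover.H1map_comp_apply {X Y Z : Type} [TopologicalSpace X] [TopologicalSpace Y]
    [TopologicalSpace Z] (ψ : C(Y, Z)) (φ : C(X, Y)) (x : H1 X) :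
    H1map ψ (H1map φ x) = H1map (ψ.comp φ) x := by
  have h1 : H1map φ ≫ H1map ψ = H1map (ψ.comp φ) := by
    rw [H1map, H1map, ← HomologicalComplex.homologyMap_comp, ← CategoryTheory.Functor.map_comp,
      ← TopCat.ofHom_comp]
  rw [← h1]
  rfl

/-- The class of the loop is invariant under parallel transport. -/
lemma isFlat : IsFlat fun l : ℍ => H1map (P.loopMap h l) circleClass := by
  intro l l'
  rw [H1map_comp_apply, H1map_comp_apply]
  suffices hs : ContinuousMap.Homotopic ((fibreInclusion A y₀ l).comp (P.loopMap h l))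
      ((fibreInclusion A y₀ l').comp (P.loopMap h l')) by rw [H1map_congr hs]
  -- The loops over the points of a path in ℍ form a homotopy in the total space.
  let γ := PathConnectedSpace.somePath l l'
  let K₀ : C(ℝ × unitInterval, totalSpace A y₀) :=
    ⟨fun p => ⟨((γ p.2 : ℂ), kummerMap A c (P.loopPt (γ p.2) p.1)), (γ p.2).im_pos,
      kummerMap_mem_cover h (γ p.2).im_pos (P.loopPt_mem (γ p.2) p.1)⟩, by
      refine Continuous.subtype_mk (Continuous.prodMk ?_ ?_) _
      · exact UpperHalfPlane.continuous_coe.comp (γ.continuous.comp continuous_snd)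
      · exact (P.continuous_kummerMap_loopPt h).comp
          ((γ.continuous.comp continuous_snd).prodMk continuous_fst)⟩
  -- Currying puts the homotopy parameter into the values, so that only one real variable has to
  -- descend to the circle.
  let K : C(ℝ, C(unitInterval, totalSpace A y₀)) := K₀.curry
  have hKeq : K 0 = K (0 + 4) := by
    ext1 t
    refine Subtype.ext (Prod.ext rfl ?_)
    change kummerMap A c (P.loopPt (γ t) 0) = kummerMap A c (P.loopPt (γ t) (0 + 4))
    rw [zero_add, P.loopPt_four]
  have hKc : Continuous (AddCircle.liftIco 4 0 K) :=
    AddCircle.liftIco_continuous hKeq K.continuous.continuousOn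
  have hend : ∀ (t : unitInterval) (l₁ : ℍ), γ t = l₁ → ∀ θ : AddCircle (4 : ℝ),
      (AddCircle.liftIco 4 0 K θ) t = fibreInclusion A y₀ l₁ (P.loopMap h l₁ θ) := by
    rintro t _ rfl θ
    rfl
  exact ⟨⟨⟨fun p => (AddCircle.liftIco 4 0 K p.2) p.1,
    (continuous_eval (F := C(unitInterval, totalSpace A y₀))).comp
      ((hKc.comp continuous_snd).prodMk continuous_fst)⟩,
    fun θ => hend 0 l γ.source θ, fun θ => hend 1 l' γ.target θ⟩⟩

/-- The parametrization of the standard `1`-simplex by `[0, 4]`. -/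
def simplexParam (s : ℝ) : stdSimplex ℝ (Fin 2) :=
  stdSimplexHomeomorphUnitInterval.symm (Set.projIcc 0 1 zero_le_one (s / 4))

lemma continuous_simplexParam : Continuous simplexParam :=
  stdSimplexHomeomorphUnitInterval.symm.continuous.comp
    (continuous_projIcc.comp (continuous_id.div_const 4))

lemma simplexParam_apply {s : ℝ} (hs : s ∈ Set.Icc (0 : ℝ) 4) : (simplexParam s).1 1 = s / 4 := by
  have h1 : s / 4 ∈ Set.Icc (0 : ℝ) 1 := ⟨by linarith [hs.1], by linarith [hs.2]⟩
  have : (simplexParam s).1 1 = (Set.projIcc 0 1 zero_le_one (s / 4) : unitInterval).1 := rfl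
  rw [this, Set.projIcc_of_mem _ h1]

/-- The four segments contribute with signs +, -, +, - and phases 1, ξ^(E_j), ξ^(E_i + E_j),
ξ^(E_i); the sum factors as (1 - ξ^(E_i)) (1 - ξ^(E_j)). -/
lemma isPeriod_loop {l : ℍ} {η : openCover A y₀ l → ℂ} (hhol : IsHolomorphicForm η) {κ : ℂ}
    (hη : ∀ p, η p = κ * monomialValue l p.1 e)
    (hint : IntervalIntegrable (P.integrand c e A l) volume 0 1) :
    IsPeriod η (H1map (P.loopMap h l) circleClass) (κ * (1 - xi N ^ kummerExp A e i) *
      (1 - xi N ^ kummerExp A e j) * ∫ u in (0 : ℝ)..1, P.integrand c e A l u) := by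
  have hG := isPrimitiveSystem h l.im_pos hhol
  -- The period has to be correct for every representing cycle; by Stokes' theorem the integral
  -- depends on the class only.
  obtain ⟨Θ, hΘ⟩ := exists_functional (primIntegral (LocalPrimitive η))
    fun σ => primIntegral_boundary hG σ
  intro z hz
  have h1 : chainIntegral η = cochain (primIntegral (LocalPrimitive η)) := by
    unfold chainIntegral cochain
    refine congrArg CategoryTheory.Limits.Sigma.desc (funext fun σ => ?_)
    rw [pathIntegral_eq_primIntegral]
  have h2 : chainIntegral η ((chains (cover A y₀ l)).iCycles 1 z) =
      Θ ((chains (cover A y₀ l)).homologyπ 1 z) := by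
    rw [h1]
    exact congrArg (fun f => f.hom z) hΘ.symm
  rw [h2, hz, functional_circleClass _ Θ hΘ]
  set σ := (P.loopMap h l).comp circleSimplex with hσ
  obtain ⟨g₀, hg₀⟩ := PrimAlong.exists_simplex hG σ.continuous
  rw [primIntegral_eq hG hg₀]
  set ρ : ℝ → cover A y₀ l := σ ∘ simplexParam with hρ
  set g : ℝ → ℂ := g₀ ∘ simplexParam with hg
  have hρc : Continuous ρ := σ.continuous.comp continuous_simplexParam
  have hgρ : PrimAlong (LocalPrimitive η) ρ g := hg₀.comp continuous_simplexParam
  have hρs : ∀ s ∈ Set.Icc (0 : ℝ) 4, ρ s = P.loopFun h l s := fun s hs => by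
    rw [hρ, hσ, Function.comp_apply, ContinuousMap.comp_apply]
    have : circleSimplex (simplexParam s) = (s : AddCircle (4 : ℝ)) := by
      change ((4 * (simplexParam s).1 1 : ℝ) : AddCircle (4 : ℝ)) = _
      rw [simplexParam_apply hs, mul_div_cancel₀ _ (by norm_num)]
    rw [this, P.loopMap_coe h l hs]
  have hv0 : stdSimplex.vertex 0 = simplexParam 0 := by
    refine stdSimplexHomeomorphUnitInterval.injective ?_
    rw [simplexParam, Homeomorph.apply_symm_apply, zero_div, Set.projIcc_left]
    refine Subtype.ext ?_
    simp [stdSimplexHomeomorphUnitInterval, stdSimplexEquivIcc]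
  have hv1 : stdSimplex.vertex 1 = simplexParam 4 := by
    refine stdSimplexHomeomorphUnitInterval.injective ?_
    rw [simplexParam, Homeomorph.apply_symm_apply, div_self (by norm_num), Set.projIcc_right]
    refine Subtype.ext ?_
    simp [stdSimplexHomeomorphUnitInterval, stdSimplexEquivIcc]
  rw [hv0, hv1]
  change g 4 - g 0 = _
  have hξ : xi N ^ N = 1 := isPrimitiveRoot_xi.pow_eq_one
  set J := ∫ u in (0 : ℝ)..1, P.integrand c e A l u
  -- Each quarter is parametrized by the path parameter u, so on the backward quarters the increment
  -- appears with the opposite sign.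
  have seg : ∀ (κ' : ℝ → ℝ) (a b : ℂ), Continuous κ' → (a = 1 ∨ a = xi N) → (b = 1 ∨ b = xi N) →
      (∀ u ∈ Set.Icc (0 : ℝ) 1, κ' u ∈ Set.Icc (0 : ℝ) 4 ∧ tent (κ' u) = u ∧
        (u ≠ 0 → a = if κ' u ≤ 2 then 1 else xi N) ∧
        (u ≠ 1 → b = if 1 ≤ κ' u then (if κ' u ≤ 3 then xi N else 1) else 1)) →
      g (κ' 1) - g (κ' 0) = κ * (a ^ kummerExp A e i * b ^ kummerExp A e j) * J := by
    intro κ' a b hκ ha hb hu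
    have ha0 : a ≠ 0 := by rcases ha with rfl | rfl; exacts [one_ne_zero, xi_ne_zero]
    have hb0 : b ≠ 0 := by rcases hb with rfl | rfl; exacts [one_ne_zero, xi_ne_zero]
    have ha1 : a ^ N = 1 := by rcases ha with rfl | rfl; exacts [one_pow _, hξ]
    have hb1 : b ^ N = 1 := by rcases hb with rfl | rfl; exacts [one_pow _, hξ]
    rw [← prod_phase P.ne]
    refine P.segment_integral (γ := ρ ∘ κ') (g := g ∘ κ') h hη hint (phase_ne_zero ha0 hb0)
      (phase_pow ha1 hb1) (hρc.comp hκ) (fun u hu' => ?_) (hgρ.comp hκ)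
    obtain ⟨h1, h2, h3, h4⟩ := hu u hu'
    rw [Function.comp_apply, hρs _ h1]
    change _ = kummerMap A c (P.loopPt l (κ' u))
    rw [P.loopPt_eq_phase l (κ' u) a b (by rwa [h2]) (by rwa [h2]), h2]
  have s1 := seg (fun u => u) 1 1 (by fun_prop) (Or.inl rfl) (Or.inl rfl) fun u hu =>
    ⟨⟨hu.1, by linarith [hu.2]⟩, tent_of_le_one hu.1 hu.2,
      fun _ => by rw [if_pos (by linarith [hu.2])],
      fun hne => by rw [if_neg (not_le.2 (lt_of_le_of_ne hu.2 hne))]⟩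
  have s2 := seg (fun u => 2 - u) 1 (xi N) (by fun_prop) (Or.inl rfl) (Or.inr rfl) fun u hu =>
    ⟨⟨by linarith [hu.2], by linarith [hu.1]⟩,
      by rw [tent_of_le_two (by linarith [hu.2]) (by linarith [hu.1])]; ring,
      fun _ => by rw [if_pos (by linarith [hu.1])],
      fun hne => by rw [if_pos (by linarith [hu.2]), if_pos (by linarith [hu.1])]⟩
  have s3 := seg (fun u => 2 + u) (xi N) (xi N) (by fun_prop) (Or.inr rfl) (Or.inr rfl) fun u hu =>
    ⟨⟨by linarith [hu.1], by linarith [hu.2]⟩,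
      by rw [tent_of_le_three (by linarith [hu.1]) (by linarith [hu.2])]; ring,
      fun hne => by
        rw [if_neg]
        have := lt_of_le_of_ne hu.1 (Ne.symm hne)
        linarith,
      fun hne => by rw [if_pos (by linarith [hu.1]), if_pos (by linarith [hu.2])]⟩
  have s4 := seg (fun u => 4 - u) (xi N) 1 (by fun_prop) (Or.inr rfl) (Or.inl rfl) fun u hu =>
    ⟨⟨by linarith [hu.2], by linarith [hu.1]⟩,
      by rw [tent_of_le_four (by linarith [hu.2]) (by linarith [hu.1])]; ring,
      fun hne => by
        rw [if_neg]
        linarith [hu.2],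
      fun hne => by
        have := lt_of_le_of_ne hu.2 hne
        rw [if_pos (by linarith [hu.2]), if_neg (by linarith)]⟩
  norm_num at s1 s2 s3 s4
  linear_combination s1 - s2 + s3 - s4

end PathFamily

end AbelianCover

namespace AbelianCover

open Filter MeasureTheory

/-! ### Euler integrals -/

/-- The weight of an Euler integral. -/
def eulerWeight (p q s : ℝ) : ℝ := s ^ (-p) * (1 - s) ^ (-q)

/-- The Euler integral `∫₀¹ s⁻ᵖ (1 - s)⁻ᵠ (1 - s x)⁻ʳ ds`. -/
def eulerIntegral (p q r : ℝ) (x : ℂ) : ℂ :=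
  ∫ s in (0 : ℝ)..1, (eulerWeight p q s : ℂ) * (1 - s * x) ^ (-r : ℂ)

lemma intervalIntegrable_eulerWeight {p q : ℝ} (hp : p < 1) (hq : q < 1) :
    IntervalIntegrable (eulerWeight p q) volume 0 1 := by
  have h := (Complex.betaIntegral_convergent (u := ((1 - p : ℝ) : ℂ)) (v := ((1 - q : ℝ) : ℂ))
    (by simpa using hp) (by simpa using hq))
  have h2 : IntervalIntegrable (fun s => ((eulerWeight p q s : ℝ) : ℂ)) volume 0 1 := by
    refine h.congr fun s hs => ?_
    rw [Set.uIoc_of_le zero_le_one] at hs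
    simp only [eulerWeight]
    rw [Complex.ofReal_mul, Complex.ofReal_cpow hs.1.le, Complex.ofReal_cpow (by linarith [hs.2])]
    push_cast
    congr 2 <;> ring
  exact ⟨h2.1.re, h2.2.re⟩

lemma one_sub_mul_mem_slitPlane {x : ℂ} (hx : x.im ≠ 0) (s : ℝ) : 1 - s * x ∈ Complex.slitPlane := by
  by_cases hs : s = 0
  · simp [hs]
  · right
    simpa using ⟨hs, hx⟩

lemma ofReal_root_zpow {N : ℕ} {s : ℝ} (hs : 0 ≤ s) (n : ℤ) :
    ((s ^ ((N : ℝ)⁻¹) : ℝ) : ℂ) ^ n = ((s ^ ((n : ℝ) / N) : ℝ) : ℂ) := by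
  rw [← Complex.ofReal_zpow, ← Real.rpow_mul_intCast hs, inv_mul_eq_div]

lemma ofReal_root_pow {N : ℕ} [NeZero N] {s : ℝ} (hs : 0 ≤ s) :
    ((s ^ ((N : ℝ)⁻¹) : ℝ) : ℂ) ^ N = s := by
  rw [← Complex.ofReal_pow, Real.rpow_inv_natCast_pow hs (NeZero.ne N)]

lemma root_zpow {N : ℕ} (w : ℂ) (n : ℤ) : (w ^ ((N : ℂ)⁻¹)) ^ n = w ^ ((n : ℂ) / N) := by
  rw [← Complex.cpow_mul_int, inv_mul_eq_div]

lemma root_ne_zero {N : ℕ} {w : ℂ} (hw : w ≠ 0) : w ^ ((N : ℂ)⁻¹) ≠ 0 :=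
  fun h => hw ((Complex.cpow_eq_zero_iff _ _).1 h).1

lemma continuous_real_root {N : ℕ} : Continuous fun s : ℝ => ((s ^ ((N : ℝ)⁻¹) : ℝ) : ℂ) :=
  Complex.continuous_ofReal.comp
    (Real.continuous_rpow_const (by positivity))

lemma neg_mem_slitPlane (l : ℍ) : -(l : ℂ) ∈ Complex.slitPlane := Or.inr (by
  simpa using l.im_ne_zero)

lemma inv_im_ne_zero (l : ℍ) : ((l : ℂ)⁻¹).im ≠ 0 := by
  rw [Complex.inv_im, UpperHalfPlane.coe_im]
  exact div_ne_zero (neg_ne_zero.2 l.im_ne_zero) (Complex.normSq_pos.2 l.ne_zero).ne'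

/-! ### The paths from `∞` and from `0` to `1` -/

section Paths

variable (N : ℕ) [NeZero N]

/-- The path from `∞` to `1` along the real axis. -/
def pathInftyOne : PathFamily N 3 1 where
  -- The parameter is s = 1/z. For nonreal l the number 1 - s l never meets the cut of the principal
  -- root.
  X l s := ![1, (((1 - s) ^ ((N : ℝ)⁻¹) : ℝ) : ℂ), (1 - s * (l : ℂ)) ^ ((N : ℂ)⁻¹),
    ((s ^ ((N : ℝ)⁻¹) : ℝ) : ℂ)]
  dz _ s := -((s : ℂ) ^ 2)⁻¹
  ne := by decide
  cont := by
    refine continuous_pi fun k => ?_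
    fin_cases k
    · exact continuous_const
    · exact continuous_real_root.comp (continuous_const.sub continuous_snd)
    · refine Continuous.cpow ?_ continuous_const fun p => one_sub_mul_mem_slitPlane p.1.im_ne_zero _
      exact continuous_const.sub ((Complex.continuous_ofReal.comp continuous_snd).mul
        (UpperHalfPlane.continuous_coe.comp continuous_fst))
    · exact continuous_real_root.comp continuous_snd
  mem l s hs := by
    refine ⟨fun h => one_ne_zero (congrFun h 0), fun j => ?_⟩
    have h1 : (0 : ℝ) ≤ 1 - s := by linarith [hs.2]
    fin_cases j
    · simp [branchPt]
    · simp [branchPt, ofReal_root_pow h1, ofReal_root_pow hs.1]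
    · simp [branchPt, ofReal_root_pow hs.1, NeZero.ne N]
      ring
  zero l := by simp [NeZero.ne N]
  one l := by simp [NeZero.ne N]
  ne_zero l s hs k := by
    have h1 : (0 : ℝ) < 1 - s := by linarith [hs.2]
    fin_cases k
    · exact one_ne_zero
    · exact Complex.ofReal_ne_zero.2 (Real.rpow_pos_of_pos h1 _).ne'
    · exact root_ne_zero (Complex.slitPlane_ne_zero (one_sub_mul_mem_slitPlane l.im_ne_zero s))
    · exact Complex.ofReal_ne_zero.2 (Real.rpow_pos_of_pos hs.1 _).ne'
  deriv l s hs := by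
    have hs0 : (s : ℂ) ≠ 0 := Complex.ofReal_ne_zero.2 hs.1.ne'
    refine (((hasDerivAt_inv hs0).comp_ofReal)).congr_of_eventuallyEq ?_
    filter_upwards [isOpen_Ioo.mem_nhds hs] with u hu
    simp [ofReal_root_pow hu.1.le]
  dz_ne l s hs := by
    simpa using hs.1.ne'

/-- The path from `0` to `1` along the real axis. -/
def pathZeroOne : PathFamily N 0 1 where
  -- The root of z - l is written as a product so that the integrand becomes an Euler integrand with
  -- argument 1/l, on principal branches.
  X l s := ![((s ^ ((N : ℝ)⁻¹) : ℝ) : ℂ), (-1) ^ ((N : ℂ)⁻¹) * (((1 - s) ^ ((N : ℝ)⁻¹) : ℝ) : ℂ),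
    (-(l : ℂ)) ^ ((N : ℂ)⁻¹) * (1 - s * (l : ℂ)⁻¹) ^ ((N : ℂ)⁻¹), 1]
  dz _ _ := 1
  ne := by decide
  cont := by
    refine continuous_pi fun k => ?_
    fin_cases k
    · exact continuous_real_root.comp continuous_snd
    · exact continuous_const.mul
        (continuous_real_root.comp (continuous_const.sub continuous_snd))
    · have hl : Continuous fun p : ℍ × ℝ => (p.1 : ℂ) :=
        UpperHalfPlane.continuous_coe.comp continuous_fst
      refine (Continuous.cpow hl.neg continuous_const fun p => neg_mem_slitPlane p.1).mul
        (Continuous.cpow ?_ continuous_const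
          fun p => one_sub_mul_mem_slitPlane (inv_im_ne_zero p.1) _)
      exact continuous_const.sub ((Complex.continuous_ofReal.comp continuous_snd).mul
        (hl.inv₀ fun p => p.1.ne_zero))
    · exact continuous_const
  mem l s hs := by
    refine ⟨fun h => one_ne_zero (congrFun h 3), fun j => ?_⟩
    have h1 : (0 : ℝ) ≤ 1 - s := by linarith [hs.2]
    have hl := l.ne_zero
    fin_cases j
    · simp [branchPt]
    · simp [branchPt, ofReal_root_pow h1, ofReal_root_pow hs.1, mul_pow, NeZero.ne N]
    · simp [branchPt, ofReal_root_pow hs.1, mul_pow, NeZero.ne N]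
      field_simp
      ring
  zero l := by simp [NeZero.ne N]
  one l := by simp [NeZero.ne N]
  ne_zero l s hs k := by
    have h1 : (0 : ℝ) < 1 - s := by linarith [hs.2]
    fin_cases k
    · exact Complex.ofReal_ne_zero.2 (Real.rpow_pos_of_pos hs.1 _).ne'
    · exact mul_ne_zero (root_ne_zero (neg_ne_zero.2 one_ne_zero))
        (Complex.ofReal_ne_zero.2 (Real.rpow_pos_of_pos h1 _).ne')
    · exact mul_ne_zero (root_ne_zero (neg_ne_zero.2 l.ne_zero))
        (root_ne_zero (Complex.slitPlane_ne_zero (one_sub_mul_mem_slitPlane (inv_im_ne_zero l) s)))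
    · exact one_ne_zero
  deriv l s hs := by
    refine ((hasDerivAt_id (s : ℂ)).comp_ofReal).congr_of_eventuallyEq ?_
    filter_upwards [isOpen_Ioo.mem_nhds hs] with u hu
    simp [ofReal_root_pow hu.1.le]
  dz_ne l s hs := one_ne_zero

end Paths

variable {N m : ℕ} {A : Matrix (Fin m) (Fin 4) (ZMod N)} {y₀ : ℂ × ℂ × (Fin m → ℂ)}
  {c : Fin m → ℂ} {r : Fin 4 → ZMod N} {e : Exponent m}

lemma IsFormExponent.real_div [NeZero N] (he : IsFormExponent A r e) (j : Fin 3) :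
    (kummerExp A e j.castSucc : ℝ) / N = -(tPart (-r) j.castSucc) := by
  exact_mod_cast he.fin_div j

lemma IsFormExponent.last_div [NeZero N] (he : IsFormExponent A r e) :
    (kummerExp A e 3 : ℝ) / N = 2 - tPart (-r) 3 := by
  have hN : (N : ℝ) ≠ 0 := Nat.cast_ne_zero.2 (NeZero.ne N)
  rw [he.last, tPart_eq]
  push_cast
  field_simp

/-- No residue of -r is divisible by N, so the factors of the commutator periods do not vanish. -/
lemma xi_zpow_ne_one [NeZero N] (he : IsFormExponent A r e) (j : Fin 4) :
    1 - xi N ^ kummerExp A e j ≠ 0 := by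
  rw [sub_ne_zero, ne_comm, Ne, (isPrimitiveRoot_xi (N := N)).zpow_eq_one_iff_dvd]
  have hlt := ZMod.val_lt ((-r) j)
  have hpos := he.pos j
  have key : ¬ ((N : ℤ) ∣ (((-r) j).val : ℤ)) := fun h =>
    hlt.not_ge (Nat.le_of_dvd hpos (Int.natCast_dvd_natCast.1 h))
  induction j using Fin.lastCases with
  | last =>
    rw [show Fin.last 3 = (3 : Fin 4) from rfl] at *
    rw [he.last]
    intro h
    exact key ((dvd_sub_right (Dvd.intro_left 2 rfl)).1 h)
  | cast j =>
    rw [he.fin, dvd_neg]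
    exact key

lemma intervalIntegrable_euler {p q : ℝ} (hp : p < 1) (hq : q < 1) (r : ℝ) {x : ℂ} (hx : x.im ≠ 0) :
    IntervalIntegrable (fun s => (eulerWeight p q s : ℂ) * (1 - s * x) ^ (-r : ℂ)) volume 0 1 := by
  refine intervalIntegrable_weighted zero_le_one (intervalIntegrable_eulerWeight hp hq) ?_
  exact ContinuousOn.cpow (by fun_prop) continuousOn_const
    fun s _ => one_sub_mul_mem_slitPlane hx s

lemma integrand_pathInftyOne [NeZero N] (he : IsFormExponent A r e) (l : ℍ) {s : ℝ}
    (hs : s ∈ Set.Ioo (0 : ℝ) 1) :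
    (pathInftyOne N).integrand c e A l s = -unitFactor c e *
      ((eulerWeight (tPart (-r) 3) (tPart (-r) 1) s : ℂ) *
        (1 - s * (l : ℂ)) ^ (-(tPart (-r) 2) : ℂ)) := by
  have h1 : (0 : ℝ) < 1 - s := by linarith [hs.2]
  have hs0 : (s : ℂ) ≠ 0 := Complex.ofReal_ne_zero.2 hs.1.ne'
  have e3 : (s : ℝ) ^ (2 - tPart (-r) 3) = s ^ 2 * s ^ (-tPart (-r) 3) := by
    rw [sub_eq_add_neg, Real.rpow_add hs.1]
    norm_num
  have e1 := he.real_div 1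
  have e2 := he.fin_div 2
  rw [show (1 : Fin 3).castSucc = (1 : Fin 4) from rfl] at e1
  rw [show (2 : Fin 3).castSucc = (2 : Fin 4) from rfl] at e2
  simp only [PathFamily.integrand, pathInftyOne, Fin.prod_univ_four, Matrix.cons_val, one_zpow,
    ofReal_root_zpow h1.le, ofReal_root_zpow hs.1.le, root_zpow, he.last_div, e1, e2, eulerWeight, e3]
  push_cast
  field_simp

lemma integrand_pathZeroOne [NeZero N] (he : IsFormExponent A r e) (l : ℍ) {s : ℝ}
    (hs : s ∈ Set.Ioo (0 : ℝ) 1) :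
    (pathZeroOne N).integrand c e A l s =
      unitFactor c e * ((-1) ^ ((N : ℂ)⁻¹)) ^ kummerExp A e 1 *
        ((-(l : ℂ)) ^ (-(tPart (-r) 2) : ℂ) *
        ((eulerWeight (tPart (-r) 0) (tPart (-r) 1) s : ℂ) *
        (1 - s * (l : ℂ)⁻¹) ^ (-(tPart (-r) 2) : ℂ))) := by
  have h1 : (0 : ℝ) < 1 - s := by linarith [hs.2]
  have e0 := he.real_div 0
  have e1 := he.real_div 1
  have e2 := he.fin_div 2
  rw [show (0 : Fin 3).castSucc = (0 : Fin 4) from rfl] at e0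
  rw [show (1 : Fin 3).castSucc = (1 : Fin 4) from rfl] at e1
  rw [show (2 : Fin 3).castSucc = (2 : Fin 4) from rfl] at e2
  simp only [PathFamily.integrand, pathZeroOne, Fin.prod_univ_four, Matrix.cons_val, one_zpow,
    mul_zpow, ofReal_root_zpow h1.le, ofReal_root_zpow hs.1.le, root_zpow (1 - _), root_zpow (-(l : ℂ)),
    e0, e1, e2, eulerWeight]
  push_cast
  ring

/-! ### Linearity of periods -/

/-- A representative of the combination differs from the combination of representatives by a
null-homologous cycle. Its integral is zero, as one sees by adding it to a representative of α. -/
lemma IsPeriod.add_smul {l : ℂ} {η : openCover A y₀ l → ℂ} {α β : H1 (cover A y₀ l)} {u v : ℂ}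
    (hα : IsPeriod η α u) (hβ : IsPeriod η β v) (a b : ℂ) :
    IsPeriod η (a • α + b • β) (a * u + b * v) := by
  have hsurj : Function.Surjective ((chains (cover A y₀ l)).homologyπ 1) :=
    (ModuleCat.epi_iff_surjective _).1 inferInstance
  intro z hz
  obtain ⟨zα, rfl⟩ := hsurj α
  obtain ⟨zβ, rfl⟩ := hsurj β
  set z' := z - (a • zα + b • zβ) with hz'
  have h0 : (chains (cover A y₀ l)).homologyπ 1 z' = 0 := by
    rw [hz', map_sub, hz, map_add, map_smul, map_smul, sub_self]
  have h1 := hα (zα + z') (by rw [map_add, h0, add_zero])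
  rw [map_add, map_add, hα zα rfl, add_eq_left] at h1
  have h2 : z = z' + (a • zα + b • zβ) := by rw [hz', sub_add_cancel]
  rw [h2, map_add, map_add, h1, zero_add, map_add, map_add, map_smul, map_smul, map_smul, map_smul,
    hα zα rfl, hβ zβ rfl, smul_eq_mul, smul_eq_mul]

lemma IsFlat.add_smul {α β : ∀ l : ℍ, H1 (cover A y₀ l)} (hα : IsFlat α) (hβ : IsFlat β)
    (a b : ℂ) : IsFlat fun l => a • α l + b • β l := by
  intro l l'
  simp only [map_add, map_smul]
  rw [hα l l', hβ l l']

/-- The periods of the eigenforms along two fixed homology classes, in terms of Euler integrals. -/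
theorem exists_flat_periods [NeZero N] (hr : r ∈ rowSpan A) (hneg : tSum (-r) = 2)
    (hpos : tSum r = 2) (hy₀ : y₀ ∈ equationLocus A) :
    (∀ j, 0 < tPart (-r) j) ∧ ∃ α β : ∀ l : ℍ, H1 (cover A y₀ l), IsFlat α ∧ IsFlat β ∧
      ∀ l : ℍ, (∃ η ∈ H10 A y₀ r l, η ≠ 0) ∧ ∀ η ∈ H10 A y₀ r l, η ≠ 0 → ∃ k : ℂ, k ≠ 0 ∧
        IsPeriod η (α l)
          (k * eulerIntegral (tPart (-r) 3) (tPart (-r) 1) (tPart (-r) 2) l) ∧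
        IsPeriod η (β l) (k * ((-(l : ℂ)) ^ (-(tPart (-r) 2) : ℂ) *
          eulerIntegral (tPart (-r) 0) (tPart (-r) 1) (tPart (-r) 2) (l : ℂ)⁻¹)) := by
  obtain ⟨c, h⟩ := exists_isChoice A hy₀
  obtain ⟨e, he⟩ := exists_isFormExponent hr hneg hpos
  have hxi := xi_zpow_ne_one he
  have hu : unitFactor c e ≠ 0 := unitFactor_ne_zero h.ne_zero e
  have hω : ((-1 : ℂ) ^ ((N : ℂ)⁻¹)) ^ kummerExp A e 1 ≠ 0 :=
    zpow_ne_zero _ (root_ne_zero (neg_ne_zero.2 one_ne_zero))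
  -- The constants of the loop and of the integrand are divided out of the homology classes, so that
  -- the periods become the bare Euler integrals.
  set κ₁ : ℂ := (1 - xi N ^ kummerExp A e 3) * (1 - xi N ^ kummerExp A e 1) * -unitFactor c e
    with hκ₁
  set κ₂ : ℂ := (1 - xi N ^ kummerExp A e 0) * (1 - xi N ^ kummerExp A e 1) *
    (unitFactor c e * ((-1) ^ ((N : ℂ)⁻¹)) ^ kummerExp A e 1) with hκ₂
  have hκ₁0 : κ₁ ≠ 0 := mul_ne_zero (mul_ne_zero (hxi 3) (hxi 1)) (neg_ne_zero.2 hu)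
  have hκ₂0 : κ₂ ≠ 0 := mul_ne_zero (mul_ne_zero (hxi 0) (hxi 1)) (mul_ne_zero hu hω)
  have ae : ∀ {f g : ℝ → ℂ}, (∀ s ∈ Set.Ioo (0 : ℝ) 1, f s = g s) →
      f =ᵐ[volume.restrict (Set.uIoc 0 1)] g := fun hfg => by
    rw [Set.uIoc_of_le zero_le_one, ← restrict_Ioo_eq_restrict_Ioc]
    exact (ae_restrict_iff' measurableSet_Ioo).2 (Eventually.of_forall hfg)
  have hint : ∀ {f g : ℝ → ℂ} (k : ℂ), (∀ s ∈ Set.Ioo (0 : ℝ) 1, f s = k * g s) →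
      IntervalIntegrable g volume 0 1 →
      IntervalIntegrable f volume 0 1 ∧ ∫ s in (0 : ℝ)..1, f s = k * ∫ s in (0 : ℝ)..1, g s := by
    intro f g k hfg hg
    refine ⟨(hg.const_mul k).congr_ae (ae hfg).symm, ?_⟩
    rw [← intervalIntegral.integral_const_mul]
    exact intervalIntegral.integral_congr_ae_restrict (ae hfg)
  have hL : ∀ l : ℍ, _ := fun l => hint (-unitFactor c e)
    (fun s hs => integrand_pathInftyOne (c := c) he l hs)
    (intervalIntegrable_euler (tPart_lt_one 3) (tPart_lt_one 1) _ l.im_ne_zero)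
  have hM : ∀ l : ℍ, _ := fun l => hint _
    (fun s hs => integrand_pathZeroOne (c := c) he l hs)
    ((intervalIntegrable_euler (tPart_lt_one 0) (tPart_lt_one 1) _ (inv_im_ne_zero l)).const_mul _)
  have hFα := (pathInftyOne N).isFlat h
  have hFβ := (pathZeroOne N).isFlat h
  refine ⟨tPart_pos he, fun l => κ₁⁻¹ • H1map ((pathInftyOne N).loopMap h l) circleClass +
      (0 : ℂ) • H1map ((pathZeroOne N).loopMap h l) circleClass,
    fun l => (0 : ℂ) • H1map ((pathInftyOne N).loopMap h l) circleClass +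
      κ₂⁻¹ • H1map ((pathZeroOne N).loopMap h l) circleClass,
    hFα.add_smul hFβ _ _, hFα.add_smul hFβ _ _, fun l => ⟨⟨_, monomial_mem_H10 h l.im_pos he, ?_⟩,
      fun η hη hη0 => ?_⟩⟩
  · have hX := (pathZeroOne N).mem l (1 / 2) ⟨by norm_num, by norm_num⟩
    have hne := (pathZeroOne N).ne_zero l (1 / 2) ⟨by norm_num, by norm_num⟩
    exact fun h0 => monomialValue_ne_zero (e := e) h
      (⟨_, kummerPt_mem h l.im_pos hX hne⟩ : openCover A y₀ l) (congrFun h0 _)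
  · obtain ⟨k, hk⟩ := H10_eq_smul h l.im_pos he hη
    have h1 := (pathInftyOne N).isPeriod_loop h hη.1 hk (hL l).1
    have h2 := (pathZeroOne N).isPeriod_loop h hη.1 hk (hM l).1
    rw [(hL l).2] at h1
    rw [(hM l).2, intervalIntegral.integral_const_mul] at h2
    refine ⟨k, ?_, ?_, ?_⟩
    · rintro rfl
      exact hη0 (funext fun p => by rw [hk, zero_mul]; rfl)
    · convert h1.add_smul h2 κ₁⁻¹ 0 using 1
      rw [zero_mul, add_zero]
      change k * (∫ s in (0 : ℝ)..1, _) = _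
      rw [eq_inv_mul_iff_mul_eq₀ hκ₁0, hκ₁]
      ring
    · convert h1.add_smul h2 0 κ₂⁻¹ using 1
      rw [zero_mul, zero_add]
      change k * (_ * ∫ s in (0 : ℝ)..1, _) = _
      rw [eq_inv_mul_iff_mul_eq₀ hκ₂0, hκ₂]
      ring

end AbelianCover

namespace AbelianCover

open Filter MeasureTheory

/-! ### Powers of products -/

lemma mul_cpow_of_arg {x y : ℂ} (hx : x ≠ 0) (hy : y ≠ 0)
    (h : x.arg + y.arg ∈ Set.Ioc (-Real.pi) Real.pi) (c : ℂ) : (x * y) ^ c = x ^ c * y ^ c := by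
  rw [Complex.cpow_def_of_ne_zero (mul_ne_zero hx hy), Complex.cpow_def_of_ne_zero hx,
    Complex.cpow_def_of_ne_zero hy, (Complex.log_mul_eq_add_log_iff hx hy).2 h, add_mul,
    Complex.exp_add]

/-- The arguments have opposite signs, so their sum stays in the principal range. -/
lemma mul_cpow_of_im {x y : ℂ} (hx : x.im < 0) (hy : 0 < y.im) (c : ℂ) :
    (x * y) ^ c = x ^ c * y ^ c := by
  have hx0 : x ≠ 0 := fun h => by simp [h] at hx
  have hy0 : y ≠ 0 := fun h => by simp [h] at hy
  have h1 := Complex.arg_neg_iff.2 hx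
  have h2 := Complex.arg_nonneg_iff.2 hy.le
  exact mul_cpow_of_arg hx0 hy0 ⟨by linarith [Complex.neg_pi_lt_arg x],
    by linarith [Complex.arg_le_pi y]⟩ c

lemma ofReal_mul_cpow {s : ℝ} (hs : 0 < s) {y : ℂ} (hy : y ≠ 0) (c : ℂ) :
    ((s : ℂ) * y) ^ c = (s : ℂ) ^ c * y ^ c := by
  refine mul_cpow_of_arg (Complex.ofReal_ne_zero.2 hs.ne') hy ?_ c
  rw [Complex.arg_ofReal_of_nonneg hs.le, zero_add]
  exact Complex.arg_mem_Ioc y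

/-! ### Differentiation of Euler integrals -/

/-- The plane slit along `[1, ∞)`. -/
def eulerDomain : Set ℂ := {x | 1 - x ∈ Complex.slitPlane}

lemma isOpen_eulerDomain : IsOpen eulerDomain :=
  Complex.isOpen_slitPlane.preimage (continuous_const.sub continuous_id)

lemma mem_eulerDomain_of_im {x : ℂ} (hx : x.im ≠ 0) : x ∈ eulerDomain := by
  have := one_sub_mul_mem_slitPlane hx 1
  rwa [Complex.ofReal_one, one_mul] at this

lemma eulerDomain_mul {x : ℂ} (hx : x ∈ eulerDomain) {s : ℝ} (hs : s ∈ Set.Icc (0 : ℝ) 1) :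
    1 - s * x ∈ Complex.slitPlane := by
  by_cases him : x.im = 0
  · left
    have h1 : 0 < 1 - x.re := by
      rcases hx with h | h
      · simpa using h
      · simp [him] at h
    simp only [Complex.sub_re, Complex.one_re, Complex.mul_re, Complex.ofReal_re, Complex.ofReal_im,
      zero_mul, sub_zero]
    rcases hs.2.lt_or_eq with h | h
    · nlinarith [mul_nonneg hs.1 h1.le]
    · rw [h]; linarith
  · exact one_sub_mul_mem_slitPlane him s

lemma continuousOn_kernel {x : ℂ} (hx : x ∈ eulerDomain) (c : ℂ) :
    ContinuousOn (fun s : ℝ => (1 - s * x) ^ c) (Set.Icc (0 : ℝ) 1) :=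
  ContinuousOn.cpow (by fun_prop) continuousOn_const fun _ hs => eulerDomain_mul hx hs

variable {p q r : ℝ}

lemma hasDerivAt_eulerIntegral (hp : p < 1) (hq : q < 1) (r : ℝ) {x : ℂ} (hx : x ∈ eulerDomain) :
    HasDerivAt (eulerIntegral p q r) (r * eulerIntegral (p - 1) q (r + 1) x) x := by
  have h := hasDerivAt_weighted zero_le_one (intervalIntegrable_eulerWeight hp hq)
    (K := fun x s => (1 - s * x) ^ (-r : ℂ))
    (K' := fun x s => -r * (1 - s * x) ^ (-r - 1 : ℂ) * -s)
    (isOpen_eulerDomain.mem_nhds hx) (fun v hv => continuousOn_kernel hv _) ?_ ?_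
  · refine h.congr_deriv ?_
    rw [eulerIntegral, ← intervalIntegral.integral_const_mul]
    refine intervalIntegral.integral_congr_ae (Eventually.of_forall fun s hs => ?_)
    rw [Set.uIoc_of_le zero_le_one] at hs
    have h1 : s ^ (-(p - 1)) = s ^ (-p) * s := by
      rw [neg_sub, sub_eq_add_neg, Real.rpow_add hs.1, Real.rpow_one, mul_comm]
    rw [eulerWeight, eulerWeight, h1]
    push_cast
    rw [neg_add']
    ring
  · refine ContinuousOn.mul (continuousOn_const.mul (ContinuousOn.cpow ?_ continuousOn_const
      fun a ha => eulerDomain_mul ha.1 ha.2)) ?_ <;> fun_prop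
  · intro v hv s hs
    have h1 : HasDerivAt (fun v : ℂ => 1 - s * v) (-s) v := by
      simpa using ((hasDerivAt_id v).const_mul (s : ℂ)).const_sub 1
    exact h1.cpow_const (eulerDomain_mul hv hs)

lemma intervalIntegrable_eulerIntegrand (hp : p < 1) (hq : q < 1) (r : ℝ) {x : ℂ}
    (hx : x ∈ eulerDomain) :
    IntervalIntegrable (fun s => (eulerWeight p q s : ℂ) * (1 - s * x) ^ (-r : ℂ)) volume 0 1 :=
  intervalIntegrable_weighted zero_le_one (intervalIntegrable_eulerWeight hp hq)
    (continuousOn_kernel hx _)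

/-- The hypergeometric differential equation for Euler integrals. -/
lemma eulerIntegral_equation (hp : p < 1) (hq : q < 1) (r : ℝ) {x : ℂ} (hx : x ∈ eulerDomain) :
    x * (x - 1) * (r * ((r + 1) * eulerIntegral (p - 2) q (r + 2) x)) +
      ((2 - p + r) * x - (2 - p - q)) * (r * eulerIntegral (p - 1) q (r + 1) x) +
      (1 - p) * r * eulerIntegral p q r x = 0 := by
  have i0 := intervalIntegrable_eulerIntegrand hp hq r hx
  have i1 := intervalIntegrable_eulerIntegrand (by linarith : p - 1 < 1) hq (r + 1) hx
  have i2 := intervalIntegrable_eulerIntegrand (by linarith : p - 2 < 1) hq (r + 2) hx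
  -- The combination of integrands in the hypergeometric equation is the derivative of this
  -- function, which vanishes at both ends because p, q < 1.
  set G : ℝ → ℂ := fun s => r * (((s ^ (1 - p) * (1 - s) ^ (1 - q) : ℝ) : ℂ) *
    (1 - s * x) ^ (-r - 1 : ℂ)) with hG
  have hGc : ContinuousOn G (Set.Icc 0 1) := by
    refine continuousOn_const.mul (ContinuousOn.mul ?_ (continuousOn_kernel hx _))
    refine (Complex.continuous_ofReal.comp (Continuous.mul ?_ ?_)).continuousOn
    · exact Real.continuous_rpow_const (by linarith)
    · exact (Real.continuous_rpow_const (by linarith)).comp (continuous_const.sub continuous_id)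
  have hd : ∀ s ∈ Set.Ioo (0 : ℝ) 1, HasDerivAt G
      (x * (x - 1) * (r * (r + 1)) *
        ((eulerWeight (p - 2) q s : ℂ) * (1 - s * x) ^ (-(r + 2 : ℝ) : ℂ)) +
      ((2 - p + r) * x - (2 - p - q)) * r *
        ((eulerWeight (p - 1) q s : ℂ) * (1 - s * x) ^ (-(r + 1 : ℝ) : ℂ)) +
      (1 - p) * r * ((eulerWeight p q s : ℂ) * (1 - s * x) ^ (-r : ℂ))) s := by
    intro s hs
    have hs1 : 0 < 1 - s := by linarith [hs.2]
    have hk := eulerDomain_mul hx (Set.Ioo_subset_Icc_self hs)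
    have hk0 := Complex.slitPlane_ne_zero hk
    have d1 : HasDerivAt (fun s : ℝ => s ^ (1 - p)) ((1 - p) * s ^ (-p)) s := by
      convert Real.hasDerivAt_rpow_const (p := 1 - p) (Or.inl hs.1.ne') using 3
      ring
    have d2 : HasDerivAt (fun s : ℝ => (1 - s) ^ (1 - q)) (-((1 - q) * (1 - s) ^ (-q))) s := by
      have := ((hasDerivAt_id s).const_sub 1).rpow_const (p := 1 - q) (Or.inl hs1.ne')
      refine this.congr_deriv ?_
      rw [show (1 - q - 1 : ℝ) = -q by ring]
      simp only [id_eq]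
      ring
    have d3 : HasDerivAt (fun s : ℝ => (1 - s * x) ^ (-r - 1 : ℂ))
        ((-r - 1) * (1 - s * x) ^ (-r - 1 - 1 : ℂ) * -x) s := by
      have h1 : HasDerivAt (fun z : ℂ => 1 - z * x) (-x) (s : ℂ) := by
        simpa using ((hasDerivAt_id (s : ℂ)).mul_const x).const_sub 1
      exact (h1.cpow_const (c := (-r - 1 : ℂ)) hk).comp_ofReal
    have d := (((d1.mul d2).ofReal_comp.mul d3).const_mul (r : ℂ))
    refine d.congr_deriv ?_
    have e1 : s ^ (1 - p) = s ^ (-p) * s := by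
      rw [sub_eq_add_neg, Real.rpow_add hs.1, Real.rpow_one, mul_comm]
    have e2 : (1 - s) ^ (1 - q) = (1 - s) ^ (-q) * (1 - s) := by
      rw [sub_eq_add_neg 1 q, Real.rpow_add hs1, Real.rpow_one, mul_comm]
    have e3 : s ^ (-(p - 1)) = s ^ (-p) * s := by rw [← e1]; congr 1; ring
    have e4 : s ^ (-(p - 2)) = s ^ (-p) * s ^ 2 := by
      rw [show -(p - 2) = -p + (2 : ℕ) by push_cast; ring, Real.rpow_add hs.1, Real.rpow_natCast]
    have k1 : (1 - s * x) ^ (-(r + 1 : ℝ) : ℂ) = (1 - s * x) ^ (-(r + 2 : ℝ) : ℂ) * (1 - s * x) := by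
      rw [show (-(r + 1 : ℝ) : ℂ) = -(r + 2 : ℝ) + 1 by push_cast; ring, Complex.cpow_add _ _ hk0,
        Complex.cpow_one]
    have k0 : (1 - s * x) ^ (-r : ℂ) = (1 - s * x) ^ (-(r + 2 : ℝ) : ℂ) * (1 - s * x) ^ 2 := by
      rw [show (-r : ℂ) = -(r + 2 : ℝ) + (2 : ℕ) by push_cast; ring, Complex.cpow_add _ _ hk0,
        Complex.cpow_natCast]
    have k2 : (1 - s * x) ^ (-r - 1 - 1 : ℂ) = (1 - s * x) ^ (-(r + 2 : ℝ) : ℂ) := by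
      congr 1; push_cast; ring
    have k3 : (1 - s * x) ^ (-r - 1 : ℂ) = (1 - s * x) ^ (-(r + 1 : ℝ) : ℂ) := by
      congr 1; push_cast; ring
    simp only [Pi.mul_apply]
    rw [k2, k3, k0, k1, eulerWeight, eulerWeight, eulerWeight, e3, e4, e1, e2]
    push_cast
    ring
  have hint := intervalIntegral.integral_eq_sub_of_hasDerivAt_of_le zero_le_one hGc hd
    (((i2.const_mul _).add (i1.const_mul _)).add (i0.const_mul _))
  rw [intervalIntegral.integral_add ((i2.const_mul _).add (i1.const_mul _)) (i0.const_mul _),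
    intervalIntegral.integral_add (i2.const_mul _) (i1.const_mul _),
    intervalIntegral.integral_const_mul, intervalIntegral.integral_const_mul,
    intervalIntegral.integral_const_mul] at hint
  have hG0 : G 0 = 0 := by simp [hG, Real.zero_rpow (by linarith : 1 - p ≠ 0)]
  have hG1 : G 1 = 0 := by simp [hG, Real.zero_rpow (by linarith : 1 - q ≠ 0)]
  rw [hG0, hG1, sub_zero] at hint
  simp only [eulerIntegral]
  linear_combination hint

/-! ### Solutions of the hypergeometric equation -/

lemma IsHypergeometricSolution.of_hasDerivAt {a b c : ℝ} {f f' f'' : ℂ → ℂ}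
    (h1 : ∀ x ∈ UpperHalfPlane.upperHalfPlaneSet, HasDerivAt f (f' x) x)
    (h2 : ∀ x ∈ UpperHalfPlane.upperHalfPlaneSet, HasDerivAt f' (f'' x) x)
    (h : ∀ x ∈ UpperHalfPlane.upperHalfPlaneSet,
      x * (x - 1) * f'' x + ((a + b + 1) * x - c) * f' x + a * b * f x = 0) :
    IsHypergeometricSolution a b c f := by
  refine ⟨fun x hx => (h1 x hx).differentiableAt.differentiableWithinAt, fun x hx => ?_⟩
  have h3 : deriv f =ᶠ[𝓝 x] f' := by
    filter_upwards [UpperHalfPlane.isOpen_upperHalfPlaneSet.mem_nhds hx] with y hy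
    exact (h1 y hy).deriv
  rw [h3.deriv_eq, (h1 x hx).deriv, (h2 x hx).deriv]
  exact h x hx

lemma IsHypergeometricSolution.linear {a b c : ℝ} {f g : ℂ → ℂ}
    (hf : IsHypergeometricSolution a b c f) (hg : IsHypergeometricSolution a b c g) (x y : ℂ) :
    IsHypergeometricSolution a b c fun l => x * f l + y * g l := by
  have ho := UpperHalfPlane.isOpen_upperHalfPlaneSet
  have hd : ∀ {f : ℂ → ℂ}, DifferentiableOn ℂ f UpperHalfPlane.upperHalfPlaneSet →
      ∀ l ∈ UpperHalfPlane.upperHalfPlaneSet, HasDerivAt f (deriv f l) l := fun h l hl =>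
    (h.differentiableAt (ho.mem_nhds hl)).hasDerivAt
  refine .of_hasDerivAt (f' := fun l => x * deriv f l + y * deriv g l)
    (f'' := fun l => x * deriv (deriv f) l + y * deriv (deriv g) l) (fun l hl => ?_) (fun l hl => ?_)
    fun l hl => ?_
  · exact ((hd hf.1 l hl).const_mul x).add ((hd hg.1 l hl).const_mul y)
  · exact ((hd (hf.1.deriv ho) l hl).const_mul x).add ((hd (hg.1.deriv ho) l hl).const_mul y)
  · linear_combination x * hf.2 l hl + y * hg.2 l hl

lemma IsHypergeometricSolution.congr {a b c : ℝ} {f g : ℂ → ℂ}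
    (hf : IsHypergeometricSolution a b c f)
    (hg : ∀ l ∈ UpperHalfPlane.upperHalfPlaneSet, g l = f l) : IsHypergeometricSolution a b c g := by
  have ho := UpperHalfPlane.isOpen_upperHalfPlaneSet
  refine ⟨hf.1.congr hg, fun l hl => ?_⟩
  have h0 : g =ᶠ[𝓝 l] f := by filter_upwards [ho.mem_nhds hl] with y hy using hg y hy
  rw [h0.deriv.deriv_eq, h0.deriv_eq, hg l hl]
  exact hf.2 l hl

lemma isHypergeometricSolution_eulerIntegral (hp : p < 1) (hq : q < 1) (r : ℝ) :
    IsHypergeometricSolution (1 - p) r (2 - p - q) (eulerIntegral p q r) := by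
  have hm : ∀ x ∈ UpperHalfPlane.upperHalfPlaneSet, x ∈ eulerDomain := fun x hx =>
    mem_eulerDomain_of_im (ne_of_gt hx)
  refine .of_hasDerivAt (fun x hx => hasDerivAt_eulerIntegral hp hq r (hm x hx))
    (fun x hx => (hasDerivAt_eulerIntegral (by linarith) hq (r + 1) (hm x hx)).const_mul (r : ℂ))
    fun x hx => ?_
  have h := eulerIntegral_equation hp hq r (hm x hx)
  rw [show p - 1 - 1 = p - 2 by ring, show r + 1 + 1 = r + 2 by ring]
  push_cast
  linear_combination h

/-- The substitution x ↦ 1 - x preserves the equation and replaces c by a + b + 1 - c, here r + q.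
-/
lemma isHypergeometricSolution_eulerIntegral_reflect (hp : p < 1) (hq : q < 1) (r : ℝ) :
    IsHypergeometricSolution (1 - p) r (r + q) fun x => eulerIntegral p q r (1 - x) := by
  have hm : ∀ x ∈ UpperHalfPlane.upperHalfPlaneSet, 1 - x ∈ eulerDomain := fun x hx => by
    refine mem_eulerDomain_of_im ?_
    have : 0 < x.im := hx
    simpa using this.ne'
  have hr : ∀ x : ℂ, HasDerivAt (fun x : ℂ => 1 - x) (-1) x := fun x =>
    (hasDerivAt_id x).const_sub 1
  refine .of_hasDerivAt
    (f' := fun x => -(r * eulerIntegral (p - 1) q (r + 1) (1 - x)))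
    (f'' := fun x => r * ((r + 1) * eulerIntegral (p - 2) q (r + 2) (1 - x)))
    (fun x hx => ?_) (fun x hx => ?_) fun x hx => ?_
  · refine (HasDerivAt.comp x (hasDerivAt_eulerIntegral hp hq r (hm x hx)) (hr x)).congr_deriv ?_
    ring
  · refine (((HasDerivAt.comp x (hasDerivAt_eulerIntegral (by linarith) hq (r + 1) (hm x hx))
      (hr x)).const_mul (r : ℂ)).neg).congr_deriv ?_
    rw [show p - 1 - 1 = p - 2 by ring, show r + 1 + 1 = r + 2 by ring]
    push_cast
    ring
  · have h := eulerIntegral_equation hp hq r (hm x hx)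
    push_cast
    linear_combination h

end AbelianCover

namespace AbelianCover

open Filter MeasureTheory

/-! ### The three real periods and their linear relation -/

/-- The exponents at the four branch points. -/
structure Weights where
  t₁ : ℝ
  t₂ : ℝ
  t₃ : ℝ
  t₄ : ℝ
  pos₁ : 0 < t₁
  pos₂ : 0 < t₂
  pos₃ : 0 < t₃
  pos₄ : 0 < t₄
  lt₁ : t₁ < 1
  lt₂ : t₂ < 1
  lt₃ : t₃ < 1
  lt₄ : t₄ < 1
  sum : t₁ + t₂ + t₃ + t₄ = 2

namespace Weights

variable (W : Weights)

/-- The integral over `(1, ∞)`. -/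
def A (l : ℂ) : ℂ := eulerIntegral W.t₄ W.t₂ W.t₃ l

/-- The integral over `(0, 1)`. -/
def B (l : ℂ) : ℂ := (-l) ^ (-W.t₃ : ℂ) * eulerIntegral W.t₁ W.t₂ W.t₃ l⁻¹

/-- The integral over `(-∞, 0)`. -/
def C (l : ℂ) : ℂ := Complex.exp (Real.pi * W.t₃ * Complex.I) * eulerIntegral W.t₄ W.t₁ W.t₃ (1 - l)

end Weights

lemma neg_cpow_of_im {w : ℂ} (hw : 0 < w.im) (t : ℝ) :
    (-w) ^ (-t : ℂ) = Complex.exp (Real.pi * t * Complex.I) * w ^ (-t : ℂ) := by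
  have h0 : -w ≠ 0 := fun h => by simp [neg_eq_zero.1 h] at hw
  have h1 : (-w).arg < 0 := Complex.arg_neg_iff.2 (by simpa using hw)
  have h2 : w ^ (-t : ℂ) = (-1) ^ (-t : ℂ) * (-w) ^ (-t : ℂ) := by
    rw [← mul_cpow_of_arg (neg_ne_zero.2 one_ne_zero) h0, neg_one_mul, neg_neg]
    rw [Complex.arg_neg_one]
    exact ⟨by linarith [Complex.neg_pi_lt_arg (-w), Real.pi_pos], by linarith⟩
  rw [h2, Complex.cpow_def_of_ne_zero (neg_ne_zero.2 one_ne_zero), Complex.log_neg_one, ← mul_assoc,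
    ← Complex.exp_add]
  ring_nf
  simp

lemma I_mul_cpow_of_pos {x : ℝ} (hx : 0 < x) (t : ℝ) : (Complex.I * x) ^ (-t : ℂ) =
    ((x ^ (-t) : ℝ) : ℂ) * Complex.exp (-(Real.pi * t / 2 * Complex.I)) := by
  rw [mul_comm, ofReal_mul_cpow hx Complex.I_ne_zero, Complex.ofReal_cpow hx.le,
    Complex.cpow_def_of_ne_zero Complex.I_ne_zero, Complex.log_I]
  push_cast
  congr 2
  ring

lemma I_mul_cpow_of_neg {x : ℝ} (hx : x < 0) (t : ℝ) : (Complex.I * x) ^ (-t : ℂ) =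
    (((-x) ^ (-t) : ℝ) : ℂ) * Complex.exp (Real.pi * t / 2 * Complex.I) := by
  have hx' : 0 < -x := neg_pos.2 hx
  rw [show Complex.I * x = ((-x : ℝ) : ℂ) * -Complex.I by push_cast; ring,
    ofReal_mul_cpow hx' (neg_ne_zero.2 Complex.I_ne_zero), Complex.ofReal_cpow hx'.le,
    Complex.cpow_def_of_ne_zero (neg_ne_zero.2 Complex.I_ne_zero), Complex.log_neg_I]
  push_cast
  congr 2
  ring

/-- The change of variables that identifies the integral over one real interval as an Euler
integral; integrability is transported with it. -/
lemma setIntegral_image_eq_eulerIntegral {f f' : ℝ → ℝ} {S : Set ℝ} (hS : f '' Set.Ioo 0 1 = S)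
    (hf' : ∀ s ∈ Set.Ioo (0 : ℝ) 1, HasDerivAt f (f' s) s)
    (hf : Set.InjOn f (Set.Ioo (0 : ℝ) 1)) {g : ℝ → ℂ} {k x : ℂ} {p q r : ℝ} (hp : p < 1)
    (hq : q < 1) (hx : x ∈ eulerDomain)
    (h : ∀ s ∈ Set.Ioo (0 : ℝ) 1,
      |f' s| • g (f s) = k * ((eulerWeight p q s : ℂ) * (1 - s * x) ^ (-r : ℂ))) :
    IntegrableOn g S ∧ ∫ x in S, g x = k * eulerIntegral p q r x := by
  have hi := intervalIntegrable_eulerIntegrand hp hq r hx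
  rw [intervalIntegrable_iff_integrableOn_Ioo_of_le zero_le_one] at hi
  have hd : ∀ s ∈ Set.Ioo (0 : ℝ) 1, HasDerivWithinAt f (f' s) (Set.Ioo 0 1) s :=
    fun s hs => (hf' s hs).hasDerivWithinAt
  subst hS
  rw [integrableOn_image_iff_integrableOn_abs_deriv_smul measurableSet_Ioo hd hf,
    integral_image_eq_integral_abs_deriv_smul measurableSet_Ioo hd hf]
  refine ⟨IntegrableOn.congr_fun (hi.const_mul k) (fun s hs => (h s hs).symm) measurableSet_Ioo, ?_⟩
  rw [setIntegral_congr_fun measurableSet_Ioo h, eulerIntegral,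
    intervalIntegral.integral_of_le zero_le_one, integral_Ioc_eq_integral_Ioo, integral_const_mul]

/-! ### The integral over the real line and its displacement into the lower half-plane. -/

namespace Weights

variable (W : Weights)

/-- The integrand, continued to the lower half-plane. -/
def contour (l z : ℂ) : ℂ :=
  (Complex.I * z) ^ (-W.t₁ : ℂ) * (Complex.I * (z - 1)) ^ (-W.t₂ : ℂ) * (z - l) ^ (-W.t₃ : ℂ)

variable {l : ℂ} (hl : 0 < l.im)

include hl

/-- Substitute x = 1/s. The three factors and the Jacobian combine to s^(-t₄), because the exponents
add up to 2. -/
lemma contour_Ioi : IntegrableOn (fun x : ℝ => W.contour l x) (Set.Ioi 1) ∧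
    ∫ x in Set.Ioi (1 : ℝ), W.contour l x =
      Complex.exp (-(Real.pi * (W.t₁ + W.t₂) / 2 * Complex.I)) * W.A l := by
  refine setIntegral_image_eq_eulerIntegral (f := fun s => s⁻¹) (f' := fun s => -(s ^ 2)⁻¹) ?_
    (fun s hs => hasDerivAt_inv hs.1.ne') inv_injective.injOn W.lt₄ W.lt₂
    (mem_eulerDomain_of_im hl.ne') fun s hs => ?_
  · rw [Set.image_inv_eq_inv, Set.inv_Ioo_0_left one_pos, inv_one]
  · have hs0 := hs.1
    have hsc : (s : ℂ) ≠ 0 := Complex.ofReal_ne_zero.2 hs0.ne'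
    have hs1 : 0 < 1 - s := by linarith [hs.2]
    have h1 : (((s⁻¹ : ℝ) : ℂ) - 1) = ((s⁻¹ * (1 - s) : ℝ) : ℂ) := by
      push_cast; field_simp
    have h2 : (((s⁻¹ : ℝ) : ℂ) - l) = ((s⁻¹ : ℝ) : ℂ) * (1 - s * l) := by
      push_cast; field_simp
    have hne := Complex.slitPlane_ne_zero (one_sub_mul_mem_slitPlane hl.ne' s)
    have hsi : 0 < s⁻¹ := inv_pos.2 hs0
    have hw : s ^ (-W.t₄) = s⁻¹ ^ 2 * s⁻¹ ^ (-W.t₁) * s⁻¹ ^ (-W.t₂) * s⁻¹ ^ (-W.t₃) := by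
      rw [← Real.rpow_natCast, ← Real.rpow_add hsi, ← Real.rpow_add hsi, ← Real.rpow_add hsi,
        Real.inv_rpow hs0.le, ← Real.rpow_neg hs0.le]
      congr 1
      push_cast
      linarith [W.sum]
    rw [contour, h1, h2, I_mul_cpow_of_pos hsi, I_mul_cpow_of_pos (mul_pos hsi hs1),
      ofReal_mul_cpow hsi hne, abs_neg, abs_of_pos (by positivity), Complex.real_smul,
      eulerWeight, hw, Real.mul_rpow hsi.le hs1.le, ← Complex.ofReal_neg W.t₃,
      ← Complex.ofReal_cpow hsi.le,
      show -(Real.pi * (W.t₁ + W.t₂) / 2 * Complex.I : ℂ) =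
        -(Real.pi * W.t₁ / 2 * Complex.I) + -(Real.pi * W.t₂ / 2 * Complex.I) by ring,
      Complex.exp_add, ← inv_pow]
    push_cast
    ring

lemma contour_Ioo : IntegrableOn (fun x : ℝ => W.contour l x) (Set.Ioo 0 1) ∧
    ∫ x in Set.Ioo (0 : ℝ) 1, W.contour l x =
      Complex.exp (Real.pi * (W.t₂ - W.t₁) / 2 * Complex.I) * W.B l := by
  have hinv : (l⁻¹).im < 0 := by
    rw [Complex.inv_im]
    exact div_neg_of_neg_of_pos (neg_neg_of_pos hl)
      (Complex.normSq_pos.2 fun h => by simp [h] at hl)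
  have hl0 : l ≠ 0 := fun h => by simp [h] at hl
  have h := setIntegral_image_eq_eulerIntegral (f := fun s => s) (f' := fun _ => 1)
    (g := fun x : ℝ => W.contour l x) (S := Set.Ioo 0 1) (r := W.t₃)
    (k := Complex.exp (Real.pi * (W.t₂ - W.t₁) / 2 * Complex.I) * (-l) ^ (-W.t₃ : ℂ))
    (Set.image_id' _) (fun s _ => hasDerivAt_id' s) Function.injective_id.injOn W.lt₁ W.lt₂
    (mem_eulerDomain_of_im hinv.ne) fun s hs => ?_
  · rw [B, ← mul_assoc]; exact h
  · have hs1 : 0 < 1 - s := by linarith [hs.2]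
    have h1 : ((s : ℂ) - 1) = ((s - 1 : ℝ) : ℂ) := by push_cast; rfl
    have h2 : ((s : ℂ) - l) = (-l) * (1 - s * l⁻¹) := by field_simp; ring
    have him : 0 < (1 - (s : ℂ) * l⁻¹).im := by
      simp only [Complex.sub_im, Complex.one_im, Complex.mul_im, Complex.ofReal_re,
        Complex.ofReal_im, zero_mul, add_zero, zero_sub]
      exact neg_pos.2 (mul_neg_of_pos_of_neg hs.1 hinv)
    rw [contour, h1, h2, I_mul_cpow_of_pos hs.1, I_mul_cpow_of_neg (by linarith),
      mul_cpow_of_im (by simpa using hl) him, abs_one, one_smul, eulerWeight, neg_sub,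
      show (Real.pi * (W.t₂ - W.t₁) / 2 * Complex.I : ℂ) =
        -(Real.pi * W.t₁ / 2 * Complex.I) + Real.pi * W.t₂ / 2 * Complex.I by ring,
      Complex.exp_add]
    push_cast
    ring

/-- Substitute x = 1 - 1/s. Here x - l is a negative multiple of a number in the upper half-plane,
which produces the phase in `C`. -/
lemma contour_Iio : IntegrableOn (fun x : ℝ => W.contour l x) (Set.Iio 0) ∧
    ∫ x in Set.Iio (0 : ℝ), W.contour l x =
      Complex.exp (Real.pi * (W.t₁ + W.t₂) / 2 * Complex.I) * W.C l := by
  have hm : (1 - l).im < 0 := by simpa using hl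
  have h := setIntegral_image_eq_eulerIntegral (f := fun s => 1 - s⁻¹)
    (f' := fun s => (s ^ 2)⁻¹) (r := W.t₃) (g := fun x : ℝ => W.contour l x) (S := Set.Iio 0)
    (k := Complex.exp (Real.pi * (W.t₁ + W.t₂) / 2 * Complex.I) *
      Complex.exp (Real.pi * W.t₃ * Complex.I)) ?_
    (fun s hs => by simpa using (hasDerivAt_inv hs.1.ne').const_sub 1)
    (fun a _ b _ hab => inv_injective (by simpa using hab)) W.lt₄ W.lt₁
    (mem_eulerDomain_of_im hm.ne) fun s hs => ?_
  · rw [C, ← mul_assoc]; exact h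
  · rw [show (fun s : ℝ => 1 - s⁻¹) '' Set.Ioo 0 1 = (fun x => 1 - x) '' ((fun s => s⁻¹) '' Set.Ioo 0 1)
      from (Set.image_image _ _ _).symm, Set.image_inv_eq_inv, Set.inv_Ioo_0_left one_pos, inv_one,
      Set.image_const_sub_Ioi, sub_self]
  · have hs0 := hs.1
    have hsc : (s : ℂ) ≠ 0 := Complex.ofReal_ne_zero.2 hs0.ne'
    have hs1 : 0 < 1 - s := by linarith [hs.2]
    have hsi : 0 < s⁻¹ := inv_pos.2 hs0
    have hsl : 1 < s⁻¹ := (one_lt_inv₀ hs0).2 hs.2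
    have h1 : ((1 - s⁻¹ : ℝ) : ℂ) - 1 = ((-s⁻¹ : ℝ) : ℂ) := by push_cast; ring
    have h2 : ((1 - s⁻¹ : ℝ) : ℂ) - l = ((s⁻¹ : ℝ) : ℂ) * -(1 - s * (1 - l)) := by
      push_cast; field_simp; ring
    have h3 : -(1 - s⁻¹) = s⁻¹ * (1 - s) := by field_simp; ring
    have him : 0 < (1 - (s : ℂ) * (1 - l)).im := by
      simp only [Complex.sub_im, Complex.one_im, Complex.mul_im, Complex.ofReal_re,
        Complex.ofReal_im, zero_mul, add_zero, zero_sub]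
      nlinarith
    have hne : -(1 - (s : ℂ) * (1 - l)) ≠ 0 := fun h => by
      rw [neg_eq_zero.1 h] at him; simp at him
    have hw : s ^ (-W.t₄) = s⁻¹ ^ 2 * s⁻¹ ^ (-W.t₁) * s⁻¹ ^ (-W.t₂) * s⁻¹ ^ (-W.t₃) := by
      rw [← Real.rpow_natCast, ← Real.rpow_add hsi, ← Real.rpow_add hsi, ← Real.rpow_add hsi,
        Real.inv_rpow hs0.le, ← Real.rpow_neg hs0.le]
      congr 1
      push_cast
      linarith [W.sum]
    rw [contour, h1, h2, I_mul_cpow_of_neg (by linarith), I_mul_cpow_of_neg (by linarith),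
      ofReal_mul_cpow hsi hne, neg_cpow_of_im him, abs_of_pos (by positivity), Complex.real_smul,
      eulerWeight, hw, h3, neg_neg, Real.mul_rpow hsi.le hs1.le, ← Complex.ofReal_neg W.t₃,
      ← Complex.ofReal_cpow hsi.le,
      show (Real.pi * (W.t₁ + W.t₂) / 2 * Complex.I : ℂ) =
        Real.pi * W.t₁ / 2 * Complex.I + Real.pi * W.t₂ / 2 * Complex.I by ring,
      Complex.exp_add, ← inv_pow]
    push_cast
    ring

lemma integrable_contour : Integrable (fun x : ℝ => W.contour l x) ∧
    ∫ x : ℝ, W.contour l x = Complex.exp (Real.pi * (W.t₁ + W.t₂) / 2 * Complex.I) * W.C l +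
      (Complex.exp (Real.pi * (W.t₂ - W.t₁) / 2 * Complex.I) * W.B l +
      Complex.exp (-(Real.pi * (W.t₁ + W.t₂) / 2 * Complex.I)) * W.A l) := by
  obtain ⟨ha, ha'⟩ := W.contour_Ioi hl
  obtain ⟨hb, hb'⟩ := W.contour_Ioo hl
  obtain ⟨hc, hc'⟩ := W.contour_Iio hl
  have hb2 : IntegrableOn (fun x : ℝ => W.contour l x) (Set.Ioc 0 1) :=
    (integrableOn_Ioc_iff_integrableOn_Ioo).2 hb
  have hc2 : IntegrableOn (fun x : ℝ => W.contour l x) (Set.Iic 0) :=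
    (integrableOn_Iic_iff_integrableOn_Iio).2 hc
  have hu : Set.Ioc (0 : ℝ) 1 ∪ Set.Ioi 1 = Set.Ioi 0 := Set.Ioc_union_Ioi_eq_Ioi zero_le_one
  have hab : IntegrableOn (fun x : ℝ => W.contour l x) (Set.Ioi 0) := by
    rw [← hu]; exact hb2.union ha
  constructor
  · rw [← integrableOn_univ, ← Set.Iic_union_Ioi (a := (0 : ℝ))]
    exact hc2.union hab
  · rw [← intervalIntegral.integral_Iic_add_Ioi hc2 hab, ← hu,
      setIntegral_union (Set.Ioc_disjoint_Ioi le_rfl) measurableSet_Ioi hb2 ha,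
      integral_Iic_eq_integral_Iio, integral_Ioc_eq_integral_Ioo, ha', hb', hc']

omit hl

lemma hasDerivAt_contour (hl : 0 < l.im) {z : ℂ} (hz : z.im < 0) : HasDerivAt (W.contour l)
    (W.contour l z * (-W.t₁ / z + -W.t₂ / (z - 1) + -W.t₃ / (z - l))) z := by
  have h0 : z ≠ 0 := fun h => by simp [h] at hz
  have h1 : z - 1 ≠ 0 := fun h => by rw [sub_eq_zero.1 h] at hz; simp at hz
  have h2 : z - l ≠ 0 := fun h => by rw [sub_eq_zero.1 h] at hz; linarith
  have s0 : Complex.I * z ∈ Complex.slitPlane := Or.inl (by simpa using hz)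
  have s1 : Complex.I * (z - 1) ∈ Complex.slitPlane := Or.inl (by simpa using hz)
  have s2 : z - l ∈ Complex.slitPlane := Or.inr (by simp; linarith)
  have d0 := ((hasDerivAt_id z).const_mul Complex.I).cpow_const (c := (-W.t₁ : ℂ)) s0
  have d1 := (((hasDerivAt_id z).sub_const 1).const_mul Complex.I).cpow_const (c := (-W.t₂ : ℂ)) s1
  have d2 := ((hasDerivAt_id z).sub_const l).cpow_const (c := (-W.t₃ : ℂ)) s2
  refine ((d0.mul d1).mul d2).congr_deriv ?_
  have hI := Complex.I_ne_zero
  simp only [id, contour, Pi.mul_apply]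
  rw [Complex.cpow_sub _ _ (mul_ne_zero hI h0), Complex.cpow_sub _ _ (mul_ne_zero hI h1),
    Complex.cpow_sub _ _ h2, Complex.cpow_one, Complex.cpow_one, Complex.cpow_one]
  field_simp

lemma norm_cpow_neg (z : ℂ) (t : ℝ) : ‖z ^ (-t : ℂ)‖ = ‖z‖ ^ (-t) := by
  rw [← Complex.ofReal_neg, Complex.norm_cpow_real]

lemma norm_contour (l z : ℂ) :
    ‖W.contour l z‖ = ‖z‖ ^ (-W.t₁) * ‖z - 1‖ ^ (-W.t₂) * ‖z - l‖ ^ (-W.t₃) := by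
  rw [contour, norm_mul, norm_mul, norm_cpow_neg, norm_cpow_neg, norm_cpow_neg, norm_mul, norm_mul,
    Complex.norm_I, one_mul, one_mul]

/-- Moving down from the real line increases the distances to 0, 1 and l, none of which lies below
it. So the values on the line dominate all displaced integrands. -/
lemma norm_contour_le (hl : 0 < l.im) {x ε : ℝ} (hε : 0 ≤ ε) (h0 : x ≠ 0) (h1 : x ≠ 1) :
    ‖W.contour l (x - ε * Complex.I)‖ ≤ ‖W.contour l x‖ := by
  have key : ∀ (w : ℂ) (t : ℝ), 0 < t → (x : ℂ) - w ≠ 0 → 0 ≤ w.im →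
      ‖(x : ℂ) - ε * Complex.I - w‖ ^ (-t) ≤ ‖(x : ℂ) - w‖ ^ (-t) := by
    intro w t ht hw him
    refine Real.rpow_le_rpow_of_nonpos (norm_pos_iff.2 hw) ?_ (by linarith)
    rw [Complex.norm_def, Complex.norm_def]
    refine Real.sqrt_le_sqrt ?_
    simp only [Complex.normSq_apply, Complex.sub_re, Complex.ofReal_re, Complex.mul_re,
      Complex.ofReal_im, Complex.I_re, Complex.I_im, Complex.sub_im, Complex.mul_im]
    nlinarith
  have a0 := key 0 W.t₁ W.pos₁ (by simpa using h0) le_rfl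
  have a1 := key 1 W.t₂ W.pos₂ (by
    rw [sub_ne_zero]; exact_mod_cast h1) (by simp)
  have a2 := key l W.t₃ W.pos₃ (fun h => by
    rw [← sub_eq_zero.1 h] at hl; simp at hl) hl.le
  rw [sub_zero, sub_zero] at a0
  rw [norm_contour, norm_contour]
  gcongr

lemma norm_contour_le_rpow (hl : 0 < l.im) (x : ℝ) {ε : ℝ} (hε : 0 < ε) :
    ‖W.contour l (x - ε * Complex.I)‖ ≤ ε ^ (-W.t₁) * ε ^ (-W.t₂) * ε ^ (-W.t₃) := by
  have key : ∀ (w : ℂ) (t : ℝ), 0 < t → 0 ≤ w.im →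
      ‖(x : ℂ) - ε * Complex.I - w‖ ^ (-t) ≤ ε ^ (-t) := by
    intro w t ht him
    refine Real.rpow_le_rpow_of_nonpos hε ?_ (by linarith)
    refine le_trans ?_ (Complex.abs_im_le_norm _)
    simp only [Complex.sub_im, Complex.ofReal_im, Complex.mul_im, Complex.ofReal_re, Complex.I_im,
      Complex.I_re]
    rw [abs_of_neg] <;> linarith
  have a0 := key 0 W.t₁ W.pos₁ le_rfl
  have a1 := key 1 W.t₂ W.pos₂ (by simp)
  have a2 := key l W.t₃ W.pos₃ hl.le
  rw [sub_zero] at a0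
  rw [norm_contour]
  gcongr

lemma continuousAt_contour (hl : 0 < l.im) {x : ℝ} (h0 : x ≠ 0) (h1 : x ≠ 1) :
    ContinuousAt (W.contour l) x := by
  have s0 : Complex.I * x ∈ Complex.slitPlane := Or.inr (by simpa using h0)
  have s1 : Complex.I * (x - 1) ∈ Complex.slitPlane :=
    Or.inr (by simpa [sub_eq_zero] using h1)
  have s2 : (x : ℂ) - l ∈ Complex.slitPlane := Or.inr (by simpa using hl.ne')
  unfold contour
  exact ((ContinuousAt.cpow (by fun_prop) continuousAt_const s0).mul
    (ContinuousAt.cpow (by fun_prop) continuousAt_const s1)).mul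
    (ContinuousAt.cpow (by fun_prop) continuousAt_const s2)

/-- Let J(ε) be the integral over the line at height -ε. It is constant for ε > 0, tends to zero as
ε → ∞ and to the integral over the real line as ε → 0; both limits use domination by the values on
the real line. -/
lemma integral_contour_eq_zero (hl : 0 < l.im) : ∫ x : ℝ, W.contour l x = 0 := by
  have hg := (W.integrable_contour hl).1.norm
  set D : ℂ → ℂ := fun z => W.contour l z * (-W.t₁ / z + -W.t₂ / (z - 1) + -W.t₃ / (z - l)) with hD
  set J : ℝ → ℂ := fun ε => ∫ x : ℝ, W.contour l (x - ε * Complex.I) with hJ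
  have hae : ∀ᵐ x : ℝ, x ≠ 0 ∧ x ≠ 1 := by
    have h := (Set.toFinite ({0, 1} : Set ℝ)).measure_zero volume
    filter_upwards [measure_eq_zero_iff_ae_notMem.1 h] with x hx
    simpa [not_or] using hx
  have him : ∀ (x : ℝ) {ε : ℝ}, 0 < ε → ((x : ℂ) - ε * Complex.I).im < 0 := fun x ε hε => by
    simpa using hε
  have hcont : ∀ {ε : ℝ}, 0 < ε → Continuous fun x : ℝ => W.contour l (x - ε * Complex.I) :=
    fun {ε} hε => continuous_iff_continuousAt.2 fun x =>
      ContinuousAt.comp (f := fun x : ℝ => (x : ℂ) - ε * Complex.I)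
        (W.hasDerivAt_contour hl (him x hε)).continuousAt (by fun_prop)
  have hcontD : ∀ {ε : ℝ}, 0 < ε → Continuous fun x : ℝ => D (x - ε * Complex.I) := by
    intro ε hε
    have hne : ∀ (x : ℝ) (w : ℂ), 0 ≤ w.im → (x : ℂ) - ε * Complex.I - w ≠ 0 := fun x w hw h => by
      have := him x hε
      rw [sub_eq_zero.1 h] at this
      linarith
    have hx : Continuous fun x : ℝ => (x : ℂ) - ε * Complex.I := by fun_prop
    refine (hcont hε).mul (Continuous.add (Continuous.add ?_ ?_) ?_)
    · exact continuous_const.div hx fun x => by simpa using hne x 0 le_rfl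
    · exact continuous_const.div (hx.sub continuous_const) fun x => hne x 1 (by simp)
    · exact continuous_const.div (hx.sub continuous_const) fun x => hne x l hl.le
  have hint : ∀ {ε : ℝ}, 0 < ε → Integrable fun x : ℝ => W.contour l (x - ε * Complex.I) :=
    fun {ε} hε => hg.mono' (hcont hε).aestronglyMeasurable
      (hae.mono fun x hx => W.norm_contour_le hl hε.le hx.1 hx.2)
  have hDle : ∀ (x : ℝ) {ε δ : ℝ}, 0 < δ → δ ≤ ε → x ≠ 0 → x ≠ 1 →
      ‖D (x - ε * Complex.I)‖ ≤ ‖W.contour l x‖ * (W.t₁ / δ + W.t₂ / δ + W.t₃ / δ) := by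
    intro x ε δ hδ hε h0 h1
    have key : ∀ (w : ℂ) (t : ℝ), 0 < t → 0 ≤ w.im →
        ‖(-t : ℂ) / ((x : ℂ) - ε * Complex.I - w)‖ ≤ t / δ := by
      intro w t ht hw
      rw [norm_div, norm_neg, Complex.norm_real, Real.norm_of_nonneg ht.le]
      refine div_le_div_of_nonneg_left ht.le hδ (le_trans ?_ (Complex.abs_im_le_norm _))
      simp only [Complex.sub_im, Complex.ofReal_im, Complex.mul_im, Complex.ofReal_re, Complex.I_im,
        Complex.I_re]
      rw [abs_of_neg] <;> linarith
    rw [hD, norm_mul]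
    refine mul_le_mul (W.norm_contour_le hl (hδ.le.trans hε) h0 h1) ?_ (norm_nonneg _)
      (norm_nonneg _)
    refine (norm_add₃_le).trans (add_le_add (add_le_add ?_ ?_) ?_)
    · simpa using key 0 W.t₁ W.pos₁ le_rfl
    · exact key 1 W.t₂ W.pos₂ (by simp)
    · exact key l W.t₃ W.pos₃ hl.le
  have hDint : ∀ {ε : ℝ}, 0 < ε → Integrable fun x : ℝ => D (x - ε * Complex.I) :=
    fun {ε} hε => (hg.mul_const (W.t₁ / ε + W.t₂ / ε + W.t₃ / ε)).mono'
      (hcontD hε).aestronglyMeasurable (hae.mono fun x hx => hDle x hε le_rfl hx.1 hx.2)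
  -- The complex derivative is also the derivative along the line, of an integrable function, so its
  -- integral vanishes; up to a factor it is J'(ε).
  have hD0 : ∀ {ε : ℝ}, 0 < ε → ∫ x : ℝ, D (x - ε * Complex.I) = 0 := fun {ε} hε => by
    refine integral_eq_zero_of_hasDerivAt_of_integrable (f := fun x : ℝ =>
      W.contour l (x - ε * Complex.I)) (fun x => ?_) (hDint hε) (hint hε)
    have h1 : HasDerivAt (fun z : ℂ => W.contour l (z - ε * Complex.I))
        (D (x - ε * Complex.I)) (x : ℂ) := by
      refine (HasDerivAt.comp (x : ℂ) (W.hasDerivAt_contour hl (him x hε))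
        ((hasDerivAt_id (x : ℂ)).sub_const _)).congr_deriv ?_
      rw [mul_one]; rfl
    exact h1.comp_ofReal
  have hJd : ∀ ε ∈ Set.Ioi (0 : ℝ), HasDerivAt J 0 ε := by
    intro ε hε
    have hε' : 0 < ε / 2 := half_pos hε
    have h := (hasDerivAt_integral_of_dominated_loc_of_deriv_le (μ := volume)
      (F := fun (ε x : ℝ) => W.contour l (x - ε * Complex.I))
      (F' := fun (ε x : ℝ) => D (x - ε * Complex.I) * -Complex.I) (s := Set.Ioi (ε / 2))
      (bound := fun x : ℝ => ‖W.contour l x‖ * (W.t₁ / (ε / 2) + W.t₂ / (ε / 2) + W.t₃ / (ε / 2)))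
      (Ioi_mem_nhds (half_lt_self hε)) ?_ (hint hε)
      ((hcontD hε).mul continuous_const).aestronglyMeasurable ?_ (hg.mul_const _) ?_).2
    · rwa [integral_mul_const, hD0 hε, zero_mul] at h
    · filter_upwards [Ioi_mem_nhds hε] with δ hδ using (hcont hδ).aestronglyMeasurable
    · filter_upwards [hae] with x hx δ hδ
      rw [norm_mul, norm_neg, Complex.norm_I, mul_one]
      exact hDle x hε' (le_of_lt hδ) hx.1 hx.2
    · filter_upwards with x δ hδ
      have h1 : HasDerivAt (fun z : ℂ => W.contour l (x - z * Complex.I))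
          (D (x - δ * Complex.I) * -Complex.I) (δ : ℂ) := by
        refine (HasDerivAt.comp (δ : ℂ) (W.hasDerivAt_contour hl (him x (hε'.trans hδ)))
          (((hasDerivAt_id (δ : ℂ)).mul_const Complex.I).const_sub (x : ℂ))).congr_deriv ?_
        rw [one_mul]; rfl
      exact h1.comp_ofReal
  have hJc : ∀ ε ∈ Set.Ioi (0 : ℝ), J ε = J 1 := fun ε hε =>
    isOpen_Ioi.is_const_of_deriv_eq_zero isPreconnected_Ioi
      (fun x hx => (hJd x hx).differentiableAt.differentiableWithinAt)
      (fun x hx => (hJd x hx).deriv) hε (Set.mem_Ioi.2 one_pos)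
  have hinf : Tendsto J atTop (𝓝 0) := by
    have h := tendsto_integral_filter_of_dominated_convergence (μ := volume) (l := atTop)
      (F := fun (ε x : ℝ) => W.contour l (x - ε * Complex.I)) (f := fun _ => (0 : ℂ))
      (fun x => ‖W.contour l x‖) ?_ ?_ hg ?_
    · rwa [integral_zero] at h
    · filter_upwards [Ioi_mem_atTop 0] with ε hε using (hcont hε).aestronglyMeasurable
    · filter_upwards [Ioi_mem_atTop 0] with ε hε
      exact hae.mono fun x hx => W.norm_contour_le hl (le_of_lt hε) hx.1 hx.2
    · filter_upwards with x
      have h0 : Tendsto (fun ε : ℝ => ε ^ (-W.t₁) * ε ^ (-W.t₂) * ε ^ (-W.t₃)) atTop (𝓝 0) := by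
        simpa using ((tendsto_rpow_neg_atTop W.pos₁).mul (tendsto_rpow_neg_atTop W.pos₂)).mul
          (tendsto_rpow_neg_atTop W.pos₃)
      refine squeeze_zero_norm' ?_ h0
      filter_upwards [Ioi_mem_atTop 0] with ε hε using W.norm_contour_le_rpow hl x hε
  have hzero : Tendsto J (𝓝[>] 0) (𝓝 (∫ x : ℝ, W.contour l x)) := by
    refine tendsto_integral_filter_of_dominated_convergence
      (fun x => ‖W.contour l x‖) ?_ ?_ hg ?_
    · filter_upwards [self_mem_nhdsWithin] with ε hε using (hcont hε).aestronglyMeasurable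
    · filter_upwards [self_mem_nhdsWithin] with ε hε
      exact hae.mono fun x hx => W.norm_contour_le hl (le_of_lt hε) hx.1 hx.2
    · filter_upwards [hae] with x hx
      have h1 : Tendsto (fun ε : ℝ => (x : ℂ) - ε * Complex.I) (𝓝[>] 0) (𝓝 x) := by
        have : Continuous fun ε : ℝ => (x : ℂ) - ε * Complex.I := by fun_prop
        simpa using (this.tendsto 0).mono_left nhdsWithin_le_nhds
      exact (W.continuousAt_contour hl hx.1 hx.2).tendsto.comp h1
  have h1 : J 1 = 0 := tendsto_nhds_unique (tendsto_const_nhds.congr'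
    (by filter_upwards [Ioi_mem_atTop 0] with ε hε using (hJc ε hε).symm)) hinf
  refine tendsto_nhds_unique hzero (tendsto_const_nhds.congr' ?_)
  filter_upwards [self_mem_nhdsWithin] with ε hε
  rw [hJc ε hε, h1]

/-- The linear relation between the three periods. -/
lemma relation (hl : 0 < l.im) : W.A l + Complex.exp (Real.pi * W.t₂ * Complex.I) * W.B l +
    Complex.exp (Real.pi * (W.t₁ + W.t₂) * Complex.I) * W.C l = 0 := by
  have h := (W.integrable_contour hl).2
  rw [W.integral_contour_eq_zero hl] at h
  have e1 : Complex.exp (Real.pi * (W.t₁ + W.t₂) * Complex.I) =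
      Complex.exp (Real.pi * (W.t₁ + W.t₂) / 2 * Complex.I) *
        Complex.exp (Real.pi * (W.t₁ + W.t₂) / 2 * Complex.I) := by
    rw [← Complex.exp_add]; ring_nf
  have e2 : Complex.exp (Real.pi * W.t₂ * Complex.I) =
      Complex.exp (Real.pi * (W.t₁ + W.t₂) / 2 * Complex.I) *
        Complex.exp (Real.pi * (W.t₂ - W.t₁) / 2 * Complex.I) := by
    rw [← Complex.exp_add]; ring_nf
  have e3 : Complex.exp (Real.pi * (W.t₁ + W.t₂) / 2 * Complex.I) *
      Complex.exp (-(Real.pi * (W.t₁ + W.t₂) / 2 * Complex.I)) = 1 := by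
    rw [← Complex.exp_add, add_neg_cancel, Complex.exp_zero]
  rw [e1, e2]
  linear_combination (-Complex.exp (Real.pi * (W.t₁ + W.t₂) / 2 * Complex.I)) * h - W.A l * e3

end Weights

end AbelianCover

namespace AbelianCover

open Filter MeasureTheory

/-! ### Positivity of the three areas -/

lemma im_cpow_neg_pos {w : ℂ} (hw : w.im < 0) {t : ℝ} (h0 : 0 < t) (h1 : t < 1) :
    0 < (w ^ (-t : ℂ)).im := by
  have hw0 : w ≠ 0 := fun h => by simp [h] at hw
  have ha := Complex.arg_neg_iff.2 hw
  have hb := Complex.neg_pi_lt_arg w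
  rw [Complex.cpow_def_of_ne_zero hw0, Complex.exp_im]
  refine mul_pos (Real.exp_pos _) ?_
  have : (Complex.log w * (-t : ℂ)).im = -(t * w.arg) := by
    rw [← Complex.ofReal_neg, Complex.im_mul_ofReal, Complex.log_im]; ring
  rw [this]
  refine Real.sin_pos_of_pos_of_lt_pi (by nlinarith) ?_
  nlinarith [Real.pi_pos]

lemma conj_cpow_neg {v : ℂ} (hv : v.im < 0) (t : ℝ) : conj (v ^ (-t : ℂ)) = (conj v) ^ (-t : ℂ) := by
  have hpi : v.arg ≠ Real.pi := by
    have := Complex.arg_neg_iff.2 hv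
    have := Real.pi_pos
    linarith
  rw [Complex.conj_cpow _ _ hpi]
  simp

/-- The arguments of u and of the conjugate of v have opposite signs, so the product of the powers
is the power of the product, taken at a point of the lower half-plane. -/
lemma im_cpow_mul_conj_pos {u v : ℂ} (hu : u.im < 0) (hv : v.im < 0) (h : (u * conj v).im < 0)
    {t : ℝ} (h0 : 0 < t) (h1 : t < 1) : 0 < (u ^ (-t : ℂ) * conj (v ^ (-t : ℂ))).im := by
  rw [conj_cpow_neg hv, ← mul_cpow_of_im hu (by simpa using hv)]
  exact im_cpow_neg_pos h h0 h1

lemma im_integral_pos {f : ℝ → ℂ} (hf : IntervalIntegrable f volume 0 1)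
    (h : ∀ s ∈ Set.Ioo (0 : ℝ) 1, 0 < (f s).im) : 0 < (∫ s in (0 : ℝ)..1, f s).im := by
  have h1 : ∫ s in (0 : ℝ)..1, (f s).im = (∫ s in (0 : ℝ)..1, f s).im :=
    Complex.imCLM.intervalIntegral_comp_comm hf
  rw [← h1]
  exact intervalIntegral.intervalIntegral_pos_of_pos_on ⟨hf.1.im, hf.2.im⟩ h one_pos

lemma eulerWeight_pos (p q : ℝ) {s : ℝ} (hs : s ∈ Set.Ioo (0 : ℝ) 1) : 0 < eulerWeight p q s :=
  mul_pos (Real.rpow_pos_of_pos hs.1 _) (Real.rpow_pos_of_pos (by linarith [hs.2]) _)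

lemma inv_im_neg {l : ℂ} (hl : 0 < l.im) : (l⁻¹).im < 0 := by
  rw [Complex.inv_im]
  exact div_neg_of_neg_of_pos (neg_neg_of_pos hl)
    (Complex.normSq_pos.2 fun h => by simp [h] at hl)

lemma ne_zero_of_im {l : ℂ} (hl : 0 < l.im) : l ≠ 0 := fun h => by simp [h] at hl

lemma one_sub_inv_im_pos {l : ℂ} (hl : 0 < l.im) : 0 < (1 - l⁻¹).im := by
  have := inv_im_neg hl
  rw [Complex.sub_im, Complex.one_im]
  linarith

/-- Pfaff's transformation, from s ↦ 1 - s and 1 - (1 - s) x = (1 - x) (1 - s x / (x - 1)). The two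
factors have imaginary parts of opposite signs, so the power splits. -/
lemma eulerIntegral_reflect (p q r : ℝ) {x : ℂ} (hx : x.im ≠ 0) :
    eulerIntegral p q r x = (1 - x) ^ (-r : ℂ) * eulerIntegral q p r (x / (x - 1)) := by
  have h1 : x - 1 ≠ 0 := fun h => hx (by rw [sub_eq_zero.1 h]; rfl)
  have hn := Complex.normSq_pos.2 h1
  have him : (x / (x - 1)).im = -x.im / Complex.normSq (x - 1) := by
    rw [show x / (x - 1) = 1 + (x - 1)⁻¹ by field_simp; ring, Complex.add_im, Complex.inv_im]
    simp
  rw [eulerIntegral, eulerIntegral, ← intervalIntegral.integral_const_mul]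
  have h := intervalIntegral.integral_comp_sub_left (a := 0) (b := 1)
    (fun s : ℝ => (eulerWeight p q s : ℂ) * (1 - s * x) ^ (-r : ℂ)) 1
  rw [sub_self, sub_zero] at h
  rw [← h]
  refine intervalIntegral.integral_congr_ae ?_
  rw [Set.uIoc_of_le zero_le_one]
  filter_upwards with s hs
  have e1 : 1 - ((1 - s : ℝ) : ℂ) * x = (1 - x) * (1 - s * (x / (x - 1))) := by
    push_cast
    field_simp
    ring
  have e2 : eulerWeight p q (1 - s) = eulerWeight q p s := by
    rw [eulerWeight, eulerWeight, sub_sub_cancel, mul_comm]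
  have e3 : (1 - (s : ℂ) * (x / (x - 1))).im = s * x.im / Complex.normSq (x - 1) := by
    rw [Complex.sub_im, Complex.im_ofReal_mul, him, Complex.one_im]
    ring
  have e4 : (1 - x).im = -x.im := by simp
  have e5 : ((1 - x) * (1 - s * (x / (x - 1)))) ^ (-r : ℂ) =
      (1 - x) ^ (-r : ℂ) * (1 - s * (x / (x - 1))) ^ (-r : ℂ) := by
    rcases lt_or_gt_of_ne hx with hx | hx
    · rw [mul_comm, mul_comm (_ ^ _), mul_cpow_of_im]
      · rw [e3]
        exact div_neg_of_neg_of_pos (mul_neg_of_pos_of_neg hs.1 hx) hn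
      · rw [e4]; linarith
    · rw [mul_cpow_of_im]
      · rw [e4]; linarith
      · rw [e3]
        exact div_pos (mul_pos hs.1 hx) hn
  rw [e1, e2, e5]
  ring

/-! ### Positivity and cyclic symmetry of the barycentric coordinates. -/

namespace Weights

variable (W : Weights) {l : ℂ}

lemma cpow_mul_kernel (hl : 0 < l.im) {s : ℝ} (hs : 0 < s) (t : ℂ) :
    (-l) ^ t * (1 - s * l⁻¹) ^ t = (s - l) ^ t := by
  have hl0 := ne_zero_of_im hl
  rw [← mul_cpow_of_im]
  · congr 1
    field_simp
    ring
  · simpa using hl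
  · rw [Complex.sub_im, Complex.im_ofReal_mul, Complex.one_im]
    nlinarith [inv_im_neg hl]

/-- The first barycentric coordinate of the period map. -/
def y₁ (l : ℂ) : ℝ := (W.B l * conj (W.A l)).im

/-- The second barycentric coordinate of the period map. -/
def y₂ (l : ℂ) : ℝ := (W.C l * conj (W.B l)).im

/-- The third barycentric coordinate of the period map. -/
def y₃ (l : ℂ) : ℝ := (Complex.exp (Real.pi * W.t₃ * Complex.I) * W.A l * conj (W.C l)).im

/-- With s' fixed, the integrand over s is already positive: the product of s - l with the conjugate
of 1 - s' l has imaginary part (s s' - 1) Im l < 0. -/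
lemma im_B_mul_conj_pos (hl : 0 < l.im) {s' : ℝ} (hs' : s' ∈ Set.Ioo (0 : ℝ) 1) :
    0 < (W.B l * conj ((1 - s' * l) ^ (-W.t₃ : ℂ))).im := by
  rw [B, eulerIntegral, ← intervalIntegral.integral_const_mul,
    ← intervalIntegral.integral_mul_const]
  refine im_integral_pos (((intervalIntegrable_eulerIntegrand W.lt₁ W.lt₂ _
    (mem_eulerDomain_of_im (inv_im_neg hl).ne)).const_mul _).mul_const _) fun s hs => ?_
  have h1 : (-l) ^ (-W.t₃ : ℂ) * ((eulerWeight W.t₁ W.t₂ s : ℂ) * (1 - s * l⁻¹) ^ (-W.t₃ : ℂ)) *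
      conj ((1 - s' * l) ^ (-W.t₃ : ℂ)) = (eulerWeight W.t₁ W.t₂ s : ℂ) *
        ((s - l) ^ (-W.t₃ : ℂ) * conj ((1 - s' * l) ^ (-W.t₃ : ℂ))) := by
    rw [← cpow_mul_kernel hl hs.1]
    ring
  rw [h1, Complex.im_ofReal_mul]
  refine mul_pos (eulerWeight_pos _ _ hs) (im_cpow_mul_conj_pos ?_ ?_ ?_ W.pos₃ W.lt₃)
  · simpa using hl
  · simpa using mul_pos hs'.1 hl
  · have : s * s' < 1 := by nlinarith [hs.1, hs.2, hs'.1, hs'.2]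
    simp only [map_sub, map_one, map_mul, Complex.conj_ofReal, Complex.mul_im, Complex.sub_re,
      Complex.sub_im, Complex.ofReal_re, Complex.ofReal_im, Complex.one_re, Complex.one_im,
      Complex.conj_re, Complex.conj_im, Complex.mul_re]
    nlinarith

/-- The remaining integral over s' has a positive integrand as well. -/
lemma y₁_pos (hl : 0 < l.im) : 0 < W.y₁ l := by
  have h : W.y₁ l = (W.A l * -conj (W.B l)).im := by
    simp only [y₁, Complex.mul_im, Complex.conj_re, Complex.conj_im, Complex.neg_re, Complex.neg_im]
    ring
  rw [h, A, eulerIntegral, ← intervalIntegral.integral_mul_const]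
  refine im_integral_pos ((intervalIntegrable_eulerIntegrand W.lt₄ W.lt₂ _
    (mem_eulerDomain_of_im hl.ne')).mul_const _) fun s hs => ?_
  have h1 : ((eulerWeight W.t₄ W.t₂ s : ℂ) * (1 - s * l) ^ (-W.t₃ : ℂ) * -conj (W.B l)).im =
      eulerWeight W.t₄ W.t₂ s * (W.B l * conj ((1 - s * l) ^ (-W.t₃ : ℂ))).im := by
    rw [mul_assoc, Complex.im_ofReal_mul]
    simp only [Complex.mul_im, Complex.conj_re, Complex.conj_im, Complex.neg_re, Complex.neg_im]
    ring
  rw [h1]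
  exact mul_pos (eulerWeight_pos _ _ hs) (W.im_B_mul_conj_pos hl hs)

/-- The weights after a cyclic permutation of three of the branch points. -/
@[simps] def rotate : Weights where
  t₁ := W.t₂
  t₂ := W.t₄
  t₃ := W.t₃
  t₄ := W.t₁
  pos₁ := W.pos₂
  pos₂ := W.pos₄
  pos₃ := W.pos₃
  pos₄ := W.pos₁
  lt₁ := W.lt₂
  lt₂ := W.lt₄
  lt₃ := W.lt₃
  lt₄ := W.lt₁
  sum := by linarith [W.sum]

/-- The substitution l ↦ 1 - 1/l sends 1, ∞, 0 to 0, 1, ∞. Up to phases and the common factor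
l^(-t₃), it permutes the three real segments and hence the periods. -/
lemma B_eq_rotate (hl : 0 < l.im) : W.B l = l ^ (-W.t₃ : ℂ) * W.rotate.C (1 - l⁻¹) := by
  rw [B, C, neg_cpow_of_im hl, sub_sub_cancel]
  simp only [rotate_t₃, rotate_t₄, rotate_t₁]
  ring

lemma A_eq_rotate (hl : 0 < l.im) : W.A l = l ^ (-W.t₃ : ℂ) * W.rotate.B (1 - l⁻¹) := by
  have hl0 := ne_zero_of_im hl
  have h1 : l - 1 ≠ 0 := fun h => by rw [sub_eq_zero.1 h] at hl; simp at hl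
  have e1 : (1 - l⁻¹)⁻¹ = l / (l - 1) := by
    rw [show 1 - l⁻¹ = (l - 1) / l by field_simp, inv_div]
  have e2 : 1 - l = -(1 - l⁻¹) * l := by field_simp; ring
  rw [A, B, eulerIntegral_reflect _ _ _ hl.ne', e1, e2, mul_cpow_of_im _ hl]
  · simp only [rotate_t₃, rotate_t₂, rotate_t₁]
    ring
  · simpa using inv_im_neg hl

lemma C_eq_rotate (hl : 0 < l.im) : W.C l =
    Complex.exp (Real.pi * W.t₃ * Complex.I) * (l ^ (-W.t₃ : ℂ) * W.rotate.A (1 - l⁻¹)) := by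
  have hl0 := ne_zero_of_im hl
  have him : (1 - l).im ≠ 0 := by simpa using hl.ne'
  have e1 : (1 - l) / (1 - l - 1) = 1 - l⁻¹ := by
    rw [show 1 - l - 1 = -l by ring]
    field_simp
    ring
  rw [C, A, eulerIntegral_reflect _ _ _ him, e1, sub_sub_cancel]
  simp only [rotate_t₃, rotate_t₂, rotate_t₄]

lemma normSq_exp_mul_I (t : ℝ) : Complex.exp (Real.pi * t * Complex.I) *
    conj (Complex.exp (Real.pi * t * Complex.I)) = 1 := by
  rw [← Complex.exp_conj, ← Complex.exp_add]
  simp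

lemma im_mul_conj_smul (k x y : ℂ) :
    ((k * x) * conj (k * y)).im = Complex.normSq k * (x * conj y).im := by
  rw [map_mul, show k * x * (conj k * conj y) = (k * conj k) * (x * conj y) by ring,
    Complex.mul_conj, Complex.im_ofReal_mul]

/-- A common factor of the periods changes the coordinates only by its squared modulus, and the
phase in `C_eq_rotate` is absorbed by the one in `y₃`. -/
lemma y_rotate (hl : 0 < l.im) : ∃ k : ℝ, 0 < k ∧ W.y₁ l = k * W.rotate.y₂ (1 - l⁻¹) ∧
    W.y₂ l = k * W.rotate.y₃ (1 - l⁻¹) ∧ W.y₃ l = k * W.rotate.y₁ (1 - l⁻¹) := by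
  have hl0 := ne_zero_of_im hl
  have hk : l ^ (-W.t₃ : ℂ) ≠ 0 := fun h => hl0 ((Complex.cpow_eq_zero_iff _ _).1 h).1
  refine ⟨Complex.normSq (l ^ (-W.t₃ : ℂ)), Complex.normSq_pos.2 hk, ?_, ?_, ?_⟩
  · rw [y₁, y₂, W.A_eq_rotate hl, W.B_eq_rotate hl, im_mul_conj_smul]
  · rw [y₂, y₃, W.C_eq_rotate hl, W.B_eq_rotate hl, mul_left_comm, im_mul_conj_smul]
    rfl
  · rw [y₃, y₁, W.A_eq_rotate hl, W.C_eq_rotate hl, ← im_mul_conj_smul]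
    congr 1
    simp only [map_mul]
    linear_combination (l ^ (-W.t₃ : ℂ) * W.rotate.B (1 - l⁻¹) * conj (l ^ (-W.t₃ : ℂ)) *
      conj (W.rotate.A (1 - l⁻¹))) * normSq_exp_mul_I W.t₃

lemma y₂_pos (hl : 0 < l.im) : 0 < W.y₂ l := by
  obtain ⟨k, hk, -, h2, -⟩ := W.y_rotate hl
  obtain ⟨k', hk', -, -, h3⟩ := W.rotate.y_rotate (one_sub_inv_im_pos hl)
  rw [h2, h3]
  exact mul_pos hk (mul_pos hk' (y₁_pos _ (one_sub_inv_im_pos (one_sub_inv_im_pos hl))))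

lemma y₃_pos (hl : 0 < l.im) : 0 < W.y₃ l := by
  obtain ⟨k, hk, -, -, h3⟩ := W.y_rotate hl
  rw [h3]
  exact mul_pos hk (y₁_pos _ (one_sub_inv_im_pos hl))

/-! ### The barycentric coordinates in terms of two periods -/

lemma exp_pi_mul_I (t : ℝ) : Complex.exp (Real.pi * t * Complex.I) =
    Real.cos (Real.pi * t) + Real.sin (Real.pi * t) * Complex.I := by
  rw [← Complex.ofReal_mul, Complex.exp_mul_I, Complex.ofReal_cos, Complex.ofReal_sin]

lemma C_eq (hl : 0 < l.im) : W.C l = -(Complex.exp (Real.pi * (-(W.t₁ + W.t₂) : ℝ) * Complex.I) *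
    W.A l + Complex.exp (Real.pi * (-W.t₁ : ℝ) * Complex.I) * W.B l) := by
  have h := W.relation hl
  have e1 : Complex.exp (Real.pi * (-(W.t₁ + W.t₂) : ℝ) * Complex.I) *
      Complex.exp (Real.pi * (W.t₁ + W.t₂) * Complex.I) = 1 := by
    rw [← Complex.exp_add, ← Complex.exp_zero]
    congr 1
    push_cast
    ring
  have e2 : Complex.exp (Real.pi * (-(W.t₁ + W.t₂) : ℝ) * Complex.I) *
      Complex.exp (Real.pi * W.t₂ * Complex.I) = Complex.exp (Real.pi * (-W.t₁ : ℝ) * Complex.I) := by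
    rw [← Complex.exp_add]
    congr 1
    push_cast
    ring
  rw [← e2]
  linear_combination Complex.exp (Real.pi * (-(W.t₁ + W.t₂) : ℝ) * Complex.I) * h - W.C l * e1

/-- Eliminating `C` expresses the coordinate as a real Hermitian form in A and B. These forms give
the boundary limits and the comparison with fixed vectors in `comb_y`. -/
lemma y₂_eq (hl : 0 < l.im) : W.y₂ l = Real.sin (Real.pi * W.t₁) * Complex.normSq (W.B l) +
    Real.sin (Real.pi * (W.t₁ + W.t₂)) * (W.B l * conj (W.A l)).re +
    Real.cos (Real.pi * (W.t₁ + W.t₂)) * W.y₁ l := by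
  rw [y₂, y₁, W.C_eq hl, exp_pi_mul_I, exp_pi_mul_I, mul_neg, mul_neg, Real.cos_neg, Real.cos_neg,
    Real.sin_neg, Real.sin_neg]
  simp only [Complex.normSq_apply, Complex.mul_im, Complex.mul_re, Complex.add_re, Complex.add_im,
    Complex.neg_re, Complex.neg_im, Complex.ofReal_re, Complex.ofReal_im, Complex.I_re, Complex.I_im,
    Complex.conj_re, Complex.conj_im]
  ring

lemma y₃_eq (hl : 0 < l.im) : W.y₃ l = Real.sin (Real.pi * W.t₄) * Complex.normSq (W.A l) +
    Real.sin (Real.pi * (W.t₂ + W.t₄)) * (W.B l * conj (W.A l)).re +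
    Real.cos (Real.pi * (W.t₂ + W.t₄)) * W.y₁ l := by
  have e1 : Real.pi * W.t₃ = 2 * Real.pi - Real.pi * (W.t₁ + W.t₂) - Real.pi * W.t₄ := by
    rw [show W.t₃ = 2 - W.t₁ - W.t₂ - W.t₄ by linarith [W.sum]]; ring
  have e2 : Real.pi * (W.t₂ + W.t₄) = Real.pi * (W.t₁ + W.t₂) + Real.pi * W.t₄ - Real.pi * W.t₁ := by
    ring
  have c3 : Real.cos (Real.pi * W.t₃) = Real.cos (Real.pi * (W.t₁ + W.t₂) + Real.pi * W.t₄) := by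
    rw [e1, sub_sub, Real.cos_two_pi_sub]
  have s3 : Real.sin (Real.pi * W.t₃) = -Real.sin (Real.pi * (W.t₁ + W.t₂) + Real.pi * W.t₄) := by
    rw [e1, sub_sub, Real.sin_two_pi_sub]
  rw [y₃, y₁, W.C_eq hl, exp_pi_mul_I, exp_pi_mul_I, exp_pi_mul_I, mul_neg, mul_neg, Real.cos_neg,
    Real.cos_neg, Real.sin_neg, Real.sin_neg, e2, c3, s3, Real.sin_sub, Real.cos_sub, Real.sin_add,
    Real.cos_add]
  have q1 := Real.sin_sq_add_cos_sq (Real.pi * (W.t₁ + W.t₂))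
  simp only [Complex.normSq_apply, Complex.mul_im, Complex.mul_re, Complex.add_re, Complex.add_im,
    Complex.neg_re, Complex.neg_im, Complex.ofReal_re, Complex.ofReal_im, Complex.I_re, Complex.I_im,
    Complex.conj_re, Complex.conj_im]
  linear_combination (Real.sin (Real.pi * W.t₄) * ((W.A l).re * (W.A l).re +
    (W.A l).im * (W.A l).im)) * q1

end Weights

end AbelianCover

namespace AbelianCover

open Filter MeasureTheory

/-! ### Boundary behaviour of the periods -/

lemma eulerIntegral_ofReal_pos {p q : ℝ} (hp : p < 1) (hq : q < 1) (r : ℝ) {x : ℝ} (hx : x < 1) :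
    ∃ v : ℝ, 0 < v ∧ eulerIntegral p q r x = v := by
  have hmem : ∀ s ∈ Set.Icc (0 : ℝ) 1, 0 < 1 - s * x := fun s hs => by
    rcases hs.2.lt_or_eq with h | h
    · nlinarith [hs.1]
    · rw [h]; linarith
  refine ⟨∫ s in (0 : ℝ)..1, eulerWeight p q s * (1 - s * x) ^ (-r), ?_, ?_⟩
  · refine intervalIntegral.intervalIntegral_pos_of_pos_on ?_ (fun s hs => ?_) one_pos
    · refine (intervalIntegrable_eulerWeight hp hq).mul_continuousOn ?_
      rw [Set.uIcc_of_le zero_le_one]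
      exact ContinuousOn.rpow_const (by fun_prop) fun s hs => Or.inl (hmem s hs).ne'
    · exact mul_pos (eulerWeight_pos _ _ hs)
        (Real.rpow_pos_of_pos (hmem s (Set.Ioo_subset_Icc_self hs)) _)
  · rw [eulerIntegral, ← intervalIntegral.integral_ofReal]
    refine intervalIntegral.integral_congr fun s hs => ?_
    rw [Set.uIcc_of_le zero_le_one] at hs
    rw [Complex.ofReal_mul, Complex.ofReal_cpow (hmem s hs).le]
    push_cast
    rfl

lemma ofReal_mem_eulerDomain {x : ℝ} (hx : x < 1) : (x : ℂ) ∈ eulerDomain :=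
  Or.inl (by simpa using hx)

lemma tendsto_weighted_integral {w g : ℝ → ℝ} {K : ℂ → ℝ → ℂ} {F : Filter ℂ}
    [F.IsCountablyGenerated]
    (hK : ∀ᶠ l in F, IntervalIntegrable (fun s => (w s : ℂ) * K l s) volume 0 1)
    (hg : IntervalIntegrable (fun s => w s * g s) volume 0 1)
    (hw : ∀ s ∈ Set.Ioo (0 : ℝ) 1, 0 ≤ w s)
    (hb : ∀ᶠ l in F, ∀ s ∈ Set.Ioo (0 : ℝ) 1, ‖K l s‖ ≤ g s)
    (hl : ∀ s ∈ Set.Ioo (0 : ℝ) 1, Tendsto (fun l => K l s) F (𝓝 (g s))) :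
    Tendsto (fun l => ∫ s in (0 : ℝ)..1, (w s : ℂ) * K l s) F
      (𝓝 ((∫ s in (0 : ℝ)..1, w s * g s : ℝ) : ℂ)) := by
  have hae : ∀ᵐ s : ℝ, s ∈ Set.uIoc (0 : ℝ) 1 → s ∈ Set.Ioo (0 : ℝ) 1 := by
    have h : ∀ᵐ s : ℝ, s ≠ 1 := by
      filter_upwards [measure_eq_zero_iff_ae_notMem.1 (measure_singleton (μ := volume) (1 : ℝ))]
        with s hs using hs
    filter_upwards [h] with s hs hs'
    rw [Set.uIoc_of_le zero_le_one] at hs'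
    exact ⟨hs'.1, lt_of_le_of_ne hs'.2 hs⟩
  rw [← intervalIntegral.integral_ofReal]
  refine intervalIntegral.tendsto_integral_filter_of_dominated_convergence (fun s => w s * g s)
    ?_ ?_ hg ?_
  · filter_upwards [hK] with l hl
    rw [Set.uIoc_of_le zero_le_one]
    exact hl.1.aestronglyMeasurable
  · filter_upwards [hb] with l hb
    filter_upwards [hae] with s hs hs'
    rw [norm_mul, Complex.norm_real, Real.norm_of_nonneg (hw s (hs hs'))]
    exact mul_le_mul_of_nonneg_left (hb s (hs hs')) (hw s (hs hs'))
  · filter_upwards [hae] with s hs hs'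
    rw [Complex.ofReal_mul]
    exact (hl s (hs hs')).const_mul _

/-- The power has argument in (0, πt); turned back by πt/2 it lies within πt/2 of the positive real
axis. This excludes cancellation in integrals of such powers. -/
lemma re_exp_mul_cpow_ge {w : ℂ} (hw : w.im < 0) {t : ℝ} (h0 : 0 < t) (h1 : t < 1) :
    Real.cos (Real.pi * t / 2) * ‖w‖ ^ (-t) ≤
      (Complex.exp (-(Real.pi * t / 2 * Complex.I)) * w ^ (-t : ℂ)).re := by
  have hw0 : w ≠ 0 := fun h => by simp [h] at hw
  have ha := Complex.arg_neg_iff.2 hw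
  have hb := Complex.neg_pi_lt_arg w
  rw [Complex.cpow_def_of_ne_zero hw0, ← Complex.exp_add, Complex.exp_re]
  have e1 : (-(Real.pi * t / 2 * Complex.I) + Complex.log w * (-t : ℂ)) =
      ((-t * Real.log ‖w‖ : ℝ) : ℂ) + ((-(Real.pi * t / 2) - t * w.arg : ℝ) : ℂ) * Complex.I := by
    rw [Complex.log]
    push_cast
    ring
  rw [e1, Real.rpow_def_of_pos (norm_pos_iff.2 hw0)]
  simp only [Complex.add_re, Complex.ofReal_re, Complex.re_ofReal_mul, Complex.I_re, mul_zero,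
    add_zero, Complex.add_im, Complex.ofReal_im, Complex.im_ofReal_mul, Complex.I_im, mul_one,
    zero_add]
  rw [mul_comm (Real.log ‖w‖), mul_comm (Real.exp _)]
  refine mul_le_mul_of_nonneg_right ?_ (Real.exp_pos _).le
  rw [← Real.cos_abs (-(Real.pi * t / 2) - t * w.arg)]
  refine Real.cos_le_cos_of_nonneg_of_le_pi (abs_nonneg _) ?_ ?_
  · nlinarith [Real.pi_pos]
  · rw [abs_le]
    constructor <;> nlinarith

namespace Weights

variable (W : Weights)

local notation "H" => UpperHalfPlane.upperHalfPlaneSet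

lemma B_eq_integral {l : ℂ} (hl : 0 < l.im) : W.B l =
    ∫ s in (0 : ℝ)..1, (eulerWeight W.t₁ W.t₂ s : ℂ) * (s - l) ^ (-W.t₃ : ℂ) := by
  rw [B, eulerIntegral, ← intervalIntegral.integral_const_mul]
  refine intervalIntegral.integral_congr_ae ?_
  rw [Set.uIoc_of_le zero_le_one]
  filter_upwards with s hs
  rw [← cpow_mul_kernel hl hs.1]
  ring

lemma intervalIntegrable_B {l : ℂ} (hl : 0 < l.im) : IntervalIntegrable
    (fun s : ℝ => (eulerWeight W.t₁ W.t₂ s : ℂ) * (s - l) ^ (-W.t₃ : ℂ)) volume 0 1 := by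
  refine intervalIntegrable_weighted zero_le_one (intervalIntegrable_eulerWeight W.lt₁ W.lt₂) ?_
  exact ContinuousOn.cpow (by fun_prop) continuousOn_const
    fun s _ => Or.inr (by simpa using hl.ne')

lemma sin_pos {t : ℝ} (h0 : 0 < t) (h1 : t < 1) : 0 < Real.sin (Real.pi * t) :=
  Real.sin_pos_of_pos_of_lt_pi (by have := Real.pi_pos; positivity)
    (by nlinarith [Real.pi_pos])

lemma tendsto_A (x : ℝ) (hx : x < 1) : ∃ a : ℝ, 0 < a ∧ Tendsto W.A (𝓝 (x : ℂ)) (𝓝 (a : ℂ)) := by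
  obtain ⟨a, ha, h⟩ := eulerIntegral_ofReal_pos W.lt₄ W.lt₂ W.t₃ hx
  refine ⟨a, ha, ?_⟩
  rw [← h]
  exact (hasDerivAt_eulerIntegral W.lt₄ W.lt₂ W.t₃ (ofReal_mem_eulerDomain hx)).continuousAt

lemma tendsto_B {x : ℝ} (hx : x < 0) : ∃ b : ℝ, 0 < b ∧ Tendsto W.B (𝓝 (x : ℂ)) (𝓝 (b : ℂ)) := by
  have hxi : x⁻¹ < 1 := (inv_lt_zero.2 hx).trans one_pos
  obtain ⟨b, hb, h⟩ := eulerIntegral_ofReal_pos W.lt₁ W.lt₂ W.t₃ hxi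
  have hx0 : (x : ℂ) ≠ 0 := Complex.ofReal_ne_zero.2 hx.ne
  refine ⟨(-x) ^ (-W.t₃) * b, mul_pos (Real.rpow_pos_of_pos (by linarith) _) hb, ?_⟩
  have e1 : (((-x) ^ (-W.t₃) * b : ℝ) : ℂ) = W.B x := by
    rw [B, Complex.ofReal_mul, Complex.ofReal_cpow (by linarith), ← h]
    push_cast
    rfl
  rw [e1]
  unfold B
  refine Tendsto.mul ?_ ?_
  · exact ContinuousAt.cpow (by fun_prop) continuousAt_const (Or.inl (by simpa using hx))
  · have h2 := (hasDerivAt_eulerIntegral W.lt₁ W.lt₂ W.t₃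
      (ofReal_mem_eulerDomain hxi)).continuousAt
    rw [Complex.ofReal_inv] at h2
    exact ContinuousAt.comp (f := fun l : ℂ => l⁻¹) h2 (continuousAt_inv₀ hx0)

/-- The sum of the barycentric coordinates. -/
def total (l : ℂ) : ℝ := W.y₁ l + W.y₂ l + W.y₃ l

lemma total_pos {l : ℂ} (hl : 0 < l.im) : 0 < W.total l :=
  add_pos (add_pos (W.y₁_pos hl) (W.y₂_pos hl)) (W.y₃_pos hl)

lemma sin_identity : Real.sin (Real.pi * W.t₁) * Real.sin (Real.pi * W.t₄) -
    Real.sin (Real.pi * (W.t₂ + W.t₄)) * Real.sin (Real.pi * (W.t₁ + W.t₂)) =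
    Real.sin (Real.pi * W.t₂) * Real.sin (Real.pi * W.t₃) := by
  have e3 : Real.sin (Real.pi * W.t₃) =
      -Real.sin (Real.pi * W.t₁ + Real.pi * W.t₂ + Real.pi * W.t₄) := by
    rw [show Real.pi * W.t₃ = 2 * Real.pi - (Real.pi * W.t₁ + Real.pi * W.t₂ + Real.pi * W.t₄) by
      rw [show W.t₃ = 2 - W.t₁ - W.t₂ - W.t₄ by linarith [W.sum]]; ring, Real.sin_two_pi_sub]
  have q2 := Real.sin_sq_add_cos_sq (Real.pi * W.t₂)
  rw [e3, mul_add, mul_add, Real.sin_add, Real.sin_add, Real.sin_add, Real.sin_add, Real.cos_add]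
  linear_combination (-Real.sin (Real.pi * W.t₁) * Real.sin (Real.pi * W.t₄)) * q2

/-- The limits of the coordinates at a point where both periods have real limits. -/
lemma tendsto_y_of_real {F : Filter ℂ} (hF : ∀ᶠ l in F, l ∈ H) {a b : ℝ}
    (hA : Tendsto W.A F (𝓝 (a : ℂ))) (hB : Tendsto W.B F (𝓝 (b : ℂ))) :
    Tendsto W.y₁ F (𝓝 0) ∧
    Tendsto W.y₂ F (𝓝 (b * (Real.sin (Real.pi * W.t₁) * b +
      Real.sin (Real.pi * (W.t₁ + W.t₂)) * a))) ∧
    Tendsto W.y₃ F (𝓝 (a * (Real.sin (Real.pi * W.t₄) * a +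
      Real.sin (Real.pi * (W.t₂ + W.t₄)) * b))) := by
  have hc : Tendsto (fun l => conj (W.A l)) F (𝓝 (conj (a : ℂ))) :=
    (Complex.continuous_conj.tendsto _).comp hA
  have hm := hB.mul hc
  have him := (Complex.continuous_im.tendsto _).comp hm
  have hre := (Complex.continuous_re.tendsto _).comp hm
  have h1 : Tendsto W.y₁ F (𝓝 ((b : ℂ) * conj (a : ℂ)).im) := him
  rw [show ((b : ℂ) * conj (a : ℂ)).im = 0 by simp] at h1
  have hre' : Tendsto (fun l => (W.B l * conj (W.A l)).re) F (𝓝 ((b : ℂ) * conj (a : ℂ)).re) := hre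
  rw [show ((b : ℂ) * conj (a : ℂ)).re = b * a by simp] at hre'
  have hnA : Tendsto (fun l => Complex.normSq (W.A l)) F (𝓝 (Complex.normSq (a : ℂ))) :=
    (Complex.continuous_normSq.tendsto _).comp hA
  have hnB : Tendsto (fun l => Complex.normSq (W.B l)) F (𝓝 (Complex.normSq (b : ℂ))) :=
    (Complex.continuous_normSq.tendsto _).comp hB
  rw [Complex.normSq_ofReal] at hnA hnB
  refine ⟨h1, ?_, ?_⟩
  · have h2 := ((hnB.const_mul (Real.sin (Real.pi * W.t₁))).add
      (hre'.const_mul (Real.sin (Real.pi * (W.t₁ + W.t₂))))).add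
      (h1.const_mul (Real.cos (Real.pi * (W.t₁ + W.t₂))))
    refine (h2.congr' (hF.mono fun l hl => (W.y₂_eq hl).symm)).trans_eq ?_
    congr 1
    ring
  · have h2 := ((hnA.const_mul (Real.sin (Real.pi * W.t₄))).add
      (hre'.const_mul (Real.sin (Real.pi * (W.t₂ + W.t₄))))).add
      (h1.const_mul (Real.cos (Real.pi * (W.t₂ + W.t₄))))
    refine (h2.congr' (hF.mono fun l hl => (W.y₃_eq hl).symm)).trans_eq ?_
    congr 1
    ring

instance nhdsWithin_H_neBot (x : ℝ) : NeBot (𝓝[H] (x : ℂ)) := by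
  rw [← mem_closure_iff_nhdsWithin_neBot]
  refine mem_closure_of_tendsto (f := fun ε : ℝ => (x : ℂ) + ε * Complex.I) (b := 𝓝[>] 0) ?_ ?_
  · have : Continuous fun ε : ℝ => (x : ℂ) + ε * Complex.I := by fun_prop
    simpa using (this.tendsto 0).mono_left nhdsWithin_le_nhds
  · filter_upwards [self_mem_nhdsWithin] with ε hε
    simpa using hε

/-- On the negative axis A and B have positive real limits, so the first coordinate tends to zero.
The limits of the other two cannot both vanish: that would be a linear system in a, b whose
determinant is, by `sin_identity`, sin πt₂ sin πt₃ up to sign. -/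
lemma tendsto_total {x : ℝ} (hx : x < 0) : ∃ a b L₂ L₃ : ℝ, 0 < a ∧ 0 < b ∧ 0 < L₂ + L₃ ∧
    0 ≤ L₂ ∧ 0 ≤ L₃ ∧
    L₂ = b * (Real.sin (Real.pi * W.t₁) * b + Real.sin (Real.pi * (W.t₁ + W.t₂)) * a) ∧
    L₃ = a * (Real.sin (Real.pi * W.t₄) * a + Real.sin (Real.pi * (W.t₂ + W.t₄)) * b) ∧
    Tendsto W.A (𝓝 (x : ℂ)) (𝓝 (a : ℂ)) ∧ Tendsto W.B (𝓝 (x : ℂ)) (𝓝 (b : ℂ)) ∧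
    Tendsto W.y₁ (𝓝[H] (x : ℂ)) (𝓝 0) ∧ Tendsto W.y₂ (𝓝[H] (x : ℂ)) (𝓝 L₂) ∧
    Tendsto W.y₃ (𝓝[H] (x : ℂ)) (𝓝 L₃) := by
  obtain ⟨a, ha, hA⟩ := W.tendsto_A x (by linarith)
  obtain ⟨b, hb, hB⟩ := W.tendsto_B hx
  have hF : ∀ᶠ l in 𝓝[H] (x : ℂ), l ∈ H := self_mem_nhdsWithin
  obtain ⟨h1, h2, h3⟩ := W.tendsto_y_of_real hF (hA.mono_left nhdsWithin_le_nhds)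
    (hB.mono_left nhdsWithin_le_nhds)
  have p2 := ge_of_tendsto h2 (hF.mono fun l hl => (W.y₂_pos hl).le)
  have p3 := ge_of_tendsto h3 (hF.mono fun l hl => (W.y₃_pos hl).le)
  refine ⟨a, b, _, _, ha, hb, ?_, p2, p3, rfl, rfl, hA, hB, h1, h2, h3⟩
  by_contra! hcon
  have q2 := (mul_eq_zero.1 (le_antisymm (by linarith) p2)).resolve_left hb.ne'
  have q3 := (mul_eq_zero.1 (le_antisymm (by linarith) p3)).resolve_left ha.ne'
  have hid := W.sin_identity
  have s2 := sin_pos W.pos₂ W.lt₂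
  have s3 := sin_pos W.pos₃ W.lt₃
  have : a * (Real.sin (Real.pi * W.t₂) * Real.sin (Real.pi * W.t₃)) = 0 := by
    rw [← hid]
    linear_combination Real.sin (Real.pi * W.t₁) * q3 - Real.sin (Real.pi * (W.t₂ + W.t₄)) * q2
  have := mul_pos ha (mul_pos s2 s3)
  linarith

/-! ### The limit at the first branch point -/

/-- After a fixed rotation the integrand has nonnegative real part, so the piece over [0, |l|] may
be dropped. On [|l|, 1] the bound |s - l| ≤ 2s and t₁ + t₃ ≥ 1 give at least a multiple of 1/s,
hence a logarithm. -/
lemma norm_B_ge (h13 : 1 ≤ W.t₁ + W.t₃) {l : ℂ} (hl : 0 < l.im) (hl1 : ‖l‖ < 1) :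
    Real.cos (Real.pi * W.t₃ / 2) * 2 ^ (-W.t₃) * -Real.log ‖l‖ ≤ ‖W.B l‖ := by
  have hl0 : 0 < ‖l‖ := norm_pos_iff.2 (ne_zero_of_im hl)
  have hcos : 0 < Real.cos (Real.pi * W.t₃ / 2) :=
    Real.cos_pos_of_mem_Ioo ⟨by nlinarith [Real.pi_pos, W.pos₃], by nlinarith [Real.pi_pos, W.lt₃]⟩
  set c := Complex.exp (-(Real.pi * W.t₃ / 2 * Complex.I)) with hc
  have hcn : ‖c‖ = 1 := by
    rw [hc, show -(Real.pi * W.t₃ / 2 * Complex.I : ℂ) = ((-(Real.pi * W.t₃ / 2) : ℝ) : ℂ) * Complex.I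
      by push_cast; ring, Complex.norm_exp_ofReal_mul_I]
  set f : ℝ → ℂ := fun s => c * ((eulerWeight W.t₁ W.t₂ s : ℂ) * (s - l) ^ (-W.t₃ : ℂ)) with hf
  have hfi : IntervalIntegrable f volume 0 1 := (W.intervalIntegrable_B hl).const_mul c
  have hre : IntervalIntegrable (fun s => (f s).re) volume 0 1 := ⟨hfi.1.re, hfi.2.re⟩
  have hB : ∫ s in (0 : ℝ)..1, (f s).re ≤ ‖W.B l‖ := by
    have h1 : ∫ s in (0 : ℝ)..1, (f s).re = (∫ s in (0 : ℝ)..1, f s).re :=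
      Complex.reCLM.intervalIntegral_comp_comm hfi
    rw [h1, hf, intervalIntegral.integral_const_mul, ← W.B_eq_integral hl]
    refine (Complex.re_le_norm _).trans ?_
    rw [norm_mul, hcn, one_mul]
  have hlow : ∀ s ∈ Set.Ioo (0 : ℝ) 1, eulerWeight W.t₁ W.t₂ s *
      (Real.cos (Real.pi * W.t₃ / 2) * ‖(s : ℂ) - l‖ ^ (-W.t₃)) ≤ (f s).re := fun s hs => by
    have him : ((s : ℂ) - l).im < 0 := by simpa using hl
    have h1 : f s = (eulerWeight W.t₁ W.t₂ s : ℂ) * (c * (s - l) ^ (-W.t₃ : ℂ)) := by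
      rw [hf]; ring
    rw [h1, Complex.re_ofReal_mul]
    exact mul_le_mul_of_nonneg_left (re_exp_mul_cpow_ge him W.pos₃ W.lt₃) (eulerWeight_pos _ _ hs).le
  have hsub1 : IntervalIntegrable (fun s => (f s).re) volume 0 ‖l‖ :=
    hre.mono_set (by
      rw [Set.uIcc_of_le zero_le_one, Set.uIcc_of_le hl0.le]; exact Set.Icc_subset_Icc_right hl1.le)
  have hsub2 : IntervalIntegrable (fun s => (f s).re) volume ‖l‖ 1 :=
    hre.mono_set (by
      rw [Set.uIcc_of_le zero_le_one, Set.uIcc_of_le hl1.le]; exact Set.Icc_subset_Icc_left hl0.le)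
  have h0 : 0 ≤ ∫ s in (0 : ℝ)..‖l‖, (f s).re := by
    refine intervalIntegral.integral_nonneg_of_ae_restrict hl0.le ?_
    refine (ae_restrict_iff' measurableSet_Icc).2 ?_
    have h : ∀ᵐ s : ℝ, s ≠ 0 := by
      filter_upwards [measure_eq_zero_iff_ae_notMem.1 (measure_singleton (μ := volume) (0 : ℝ))]
        with s hs using hs
    filter_upwards [h] with s hs0 hs
    have hs' : s ∈ Set.Ioo (0 : ℝ) 1 :=
      ⟨lt_of_le_of_ne hs.1 (Ne.symm hs0), lt_of_le_of_lt hs.2 hl1⟩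
    exact (mul_nonneg (eulerWeight_pos _ _ hs').le (mul_nonneg hcos.le
      (Real.rpow_nonneg (norm_nonneg _) _))).trans (hlow s hs')
  have h1 : Real.cos (Real.pi * W.t₃ / 2) * 2 ^ (-W.t₃) * -Real.log ‖l‖ ≤
      ∫ s in ‖l‖..1, (f s).re := by
    have e1 : ∫ s in ‖l‖..1, Real.cos (Real.pi * W.t₃ / 2) * 2 ^ (-W.t₃) * s⁻¹ =
        Real.cos (Real.pi * W.t₃ / 2) * 2 ^ (-W.t₃) * -Real.log ‖l‖ := by
      rw [intervalIntegral.integral_const_mul, integral_inv_of_pos hl0 one_pos, one_div, Real.log_inv]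
    rw [← e1]
    refine intervalIntegral.integral_mono_on_of_le_Ioo hl1.le ?_ hsub2 fun s hs => ?_
    · refine ContinuousOn.intervalIntegrable ?_
      rw [Set.uIcc_of_le hl1.le]
      exact continuousOn_const.mul (continuousOn_inv₀.mono fun s hs => (hl0.trans_le hs.1).ne')
    · have hs0 : 0 < s := hl0.trans hs.1
      have hs1 : 0 < 1 - s := by linarith [hs.2]
      refine le_trans ?_ (hlow s ⟨hs0, hs.2⟩)
      have hn : ‖(s : ℂ) - l‖ ≤ 2 * s := by
        refine (norm_sub_le _ _).trans ?_
        rw [Complex.norm_real, Real.norm_of_nonneg hs0.le]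
        linarith [hs.1]
      have hn0 : 0 < ‖(s : ℂ) - l‖ := norm_pos_iff.2 fun h => by
        rw [← sub_eq_zero.1 h] at hl; simp at hl
      have k1 : (2 * s) ^ (-W.t₃) ≤ ‖(s : ℂ) - l‖ ^ (-W.t₃) :=
        Real.rpow_le_rpow_of_nonpos hn0 hn (by linarith [W.pos₃])
      have k2 : s ^ (-W.t₁) ≤ eulerWeight W.t₁ W.t₂ s := by
        rw [eulerWeight]
        refine le_mul_of_one_le_right (Real.rpow_pos_of_pos hs0 _).le ?_
        exact Real.one_le_rpow_of_pos_of_le_one_of_nonpos hs1 (by linarith) (by linarith [W.pos₂])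
      have k3 : s⁻¹ ≤ s ^ (-W.t₁) * s ^ (-W.t₃) := by
        rw [← Real.rpow_add hs0, ← Real.rpow_neg_one]
        exact Real.rpow_le_rpow_of_exponent_ge hs0 hs.2.le (by linarith)
      have p1 := Real.rpow_pos_of_pos hs0 (-W.t₁)
      have p3 := Real.rpow_pos_of_pos hs0 (-W.t₃)
      have p2 : (0 : ℝ) < 2 ^ (-W.t₃) := Real.rpow_pos_of_pos two_pos _
      rw [Real.mul_rpow two_pos.le hs0.le] at k1
      calc Real.cos (Real.pi * W.t₃ / 2) * 2 ^ (-W.t₃) * s⁻¹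
          ≤ Real.cos (Real.pi * W.t₃ / 2) * 2 ^ (-W.t₃) * (s ^ (-W.t₁) * s ^ (-W.t₃)) := by gcongr
        _ = s ^ (-W.t₁) * (Real.cos (Real.pi * W.t₃ / 2) * (2 ^ (-W.t₃) * s ^ (-W.t₃))) := by ring
        _ ≤ _ := by
          have := (eulerWeight_pos W.t₁ W.t₂ ⟨hs0, hs.2⟩).le
          gcongr
  refine le_trans ?_ hB
  rw [← intervalIntegral.integral_add_adjacent_intervals hsub1 hsub2]
  linarith

lemma tendsto_norm_B (h13 : 1 ≤ W.t₁ + W.t₃) :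
    Tendsto (fun l => ‖W.B l‖) (𝓝[H] 0) atTop := by
  have hcos : 0 < Real.cos (Real.pi * W.t₃ / 2) :=
    Real.cos_pos_of_mem_Ioo ⟨by nlinarith [Real.pi_pos, W.pos₃], by nlinarith [Real.pi_pos, W.lt₃]⟩
  have hpos : 0 < Real.cos (Real.pi * W.t₃ / 2) * 2 ^ (-W.t₃) :=
    mul_pos hcos (Real.rpow_pos_of_pos two_pos _)
  have h1 : Tendsto (fun l : ℂ => ‖l‖) (𝓝[H] 0) (𝓝[>] 0) := by
    refine tendsto_nhdsWithin_iff.2 ⟨?_, ?_⟩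
    · simpa using (continuous_norm.tendsto (0 : ℂ)).mono_left nhdsWithin_le_nhds
    · filter_upwards [self_mem_nhdsWithin] with l hl using norm_pos_iff.2 (ne_zero_of_im hl)
  have h2 := ((tendsto_neg_atBot_atTop.comp (Real.tendsto_log_nhdsGT_zero.comp h1)).const_mul_atTop
    hpos)
  refine tendsto_atTop_mono' _ ?_ h2
  have hb : ∀ᶠ l in 𝓝[H] (0 : ℂ), ‖l‖ < 1 := by
    filter_upwards [nhdsWithin_le_nhds (Metric.ball_mem_nhds (0 : ℂ) one_pos)] with l hl
    simpa using hl
  filter_upwards [self_mem_nhdsWithin, hb] with l hl hl1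
  exact W.norm_B_ge h13 hl hl1

end Weights

end AbelianCover

namespace AbelianCover

open Filter MeasureTheory

namespace Weights

variable (W : Weights)

local notation "H" => UpperHalfPlane.upperHalfPlaneSet

/-! ### Limits at 0 when t₁ + t₃ < 1. -/

lemma eulerWeight_mul_rpow_left (p q t : ℝ) {s : ℝ} (hs : s ∈ Set.Ioo (0 : ℝ) 1) :
    eulerWeight p q s * s ^ (-t) = eulerWeight (p + t) q s := by
  rw [eulerWeight, eulerWeight, neg_add, Real.rpow_add hs.1]
  ring

lemma eulerWeight_mul_rpow_right (p q t : ℝ) {s : ℝ} (hs : s ∈ Set.Ioo (0 : ℝ) 1) :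
    eulerWeight p q s * (1 - s) ^ (-t) = eulerWeight p (q + t) s := by
  rw [eulerWeight, eulerWeight, neg_add, Real.rpow_add (by linarith [hs.2])]
  ring

lemma intervalIntegrable_of_eq {f : ℝ → ℝ} {p q : ℝ} (hp : p < 1) (hq : q < 1)
    (h : ∀ s ∈ Set.Ioo (0 : ℝ) 1, f s = eulerWeight p q s) : IntervalIntegrable f volume 0 1 := by
  refine (intervalIntegrable_eulerWeight hp hq).congr_ae ?_
  rw [Set.uIoc_of_le zero_le_one, ← restrict_Ioo_eq_restrict_Ioc]
  exact (ae_restrict_iff' measurableSet_Ioo).2 (Eventually.of_forall fun s hs => (h s hs).symm)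

/-- For Re l ≤ 0 one has |s - l| ≥ s, which gives an integrable majorant. For Re l > 0 the
singularity at s = l approaches the segment and this bound fails. -/
lemma tendsto_B_zero (h13 : W.t₁ + W.t₃ < 1) : ∃ b : ℝ, 0 < b ∧
    Tendsto W.B (𝓝[{l | 0 < l.im ∧ l.re ≤ 0}] 0) (𝓝 (b : ℂ)) := by
  have hi : IntervalIntegrable (fun s => eulerWeight W.t₁ W.t₂ s * s ^ (-W.t₃)) volume 0 1 :=
    intervalIntegrable_of_eq h13 W.lt₂ fun s hs => eulerWeight_mul_rpow_left _ _ _ hs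
  refine ⟨∫ s in (0 : ℝ)..1, eulerWeight W.t₁ W.t₂ s * s ^ (-W.t₃),
    intervalIntegral.intervalIntegral_pos_of_pos_on hi (fun s hs =>
      mul_pos (eulerWeight_pos _ _ hs) (Real.rpow_pos_of_pos hs.1 _)) one_pos, ?_⟩
  have hm : ∀ᶠ l in 𝓝[{l : ℂ | 0 < l.im ∧ l.re ≤ 0}] 0, 0 < l.im ∧ l.re ≤ 0 := self_mem_nhdsWithin
  refine (tendsto_weighted_integral (K := fun l s => ((s : ℂ) - l) ^ (-W.t₃ : ℂ))
    (hm.mono fun l hl => W.intervalIntegrable_B hl.1) hi (fun s hs => (eulerWeight_pos _ _ hs).le)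
    (hm.mono fun l hl s hs => ?_) fun s hs => ?_).congr'
    (hm.mono fun l hl => (W.B_eq_integral hl.1).symm)
  · rw [norm_cpow_neg]
    refine Real.rpow_le_rpow_of_nonpos hs.1 ?_ (by linarith [W.pos₃])
    refine le_trans ?_ (Complex.re_le_norm _)
    simpa using hl.2
  · rw [Complex.ofReal_cpow hs.1.le, Complex.ofReal_neg]
    have : ContinuousAt (fun l : ℂ => ((s : ℂ) - l) ^ (-W.t₃ : ℂ)) 0 :=
      ContinuousAt.cpow (by fun_prop) continuousAt_const (Or.inl (by simpa using hs.1))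
    have h := this.tendsto.mono_left
      (nhdsWithin_le_nhds (s := {l : ℂ | 0 < l.im ∧ l.re ≤ 0}))
    simpa using h

/-- For Re l ≥ 0 one has |1 - s(1 - l)| ≥ 1 - s, which again gives an integrable majorant: the half
complementary to that of `tendsto_B_zero`. -/
lemma tendsto_C_zero (h13 : W.t₁ + W.t₃ < 1) : ∃ c : ℝ, 0 < c ∧
    Tendsto W.C (𝓝[{l | 0 < l.im ∧ 0 ≤ l.re}] 0)
      (𝓝 (Complex.exp (Real.pi * W.t₃ * Complex.I) * c)) := by
  have hi : IntervalIntegrable (fun s => eulerWeight W.t₄ W.t₁ s * (1 - s) ^ (-W.t₃)) volume 0 1 :=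
    intervalIntegrable_of_eq W.lt₄ h13 fun s hs => eulerWeight_mul_rpow_right _ _ _ hs
  refine ⟨∫ s in (0 : ℝ)..1, eulerWeight W.t₄ W.t₁ s * (1 - s) ^ (-W.t₃),
    intervalIntegral.intervalIntegral_pos_of_pos_on hi (fun s hs =>
      mul_pos (eulerWeight_pos _ _ hs) (Real.rpow_pos_of_pos (by linarith [hs.2]) _)) one_pos,
    Tendsto.const_mul _ ?_⟩
  have hm : ∀ᶠ l in 𝓝[{l : ℂ | 0 < l.im ∧ 0 ≤ l.re}] 0, 0 < l.im ∧ 0 ≤ l.re := self_mem_nhdsWithin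
  refine tendsto_weighted_integral (K := fun l s => (1 - (s : ℂ) * (1 - l)) ^ (-W.t₃ : ℂ))
    (hm.mono fun l hl => intervalIntegrable_eulerIntegrand W.lt₄ W.lt₁ _
      (mem_eulerDomain_of_im (by simpa using hl.1.ne'))) hi (fun s hs => (eulerWeight_pos _ _ hs).le)
    (hm.mono fun l hl s hs => ?_) fun s hs => ?_
  · rw [norm_cpow_neg]
    refine Real.rpow_le_rpow_of_nonpos (by linarith [hs.2]) ?_ (by linarith [W.pos₃])
    refine le_trans ?_ (Complex.re_le_norm _)
    simp only [Complex.sub_re, Complex.one_re, Complex.re_ofReal_mul]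
    nlinarith [hs.1, hl.2]
  · have hs1 : 0 < 1 - s := by linarith [hs.2]
    rw [Complex.ofReal_cpow hs1.le, Complex.ofReal_neg]
    have : ContinuousAt (fun l : ℂ => (1 - (s : ℂ) * (1 - l)) ^ (-W.t₃ : ℂ)) 0 :=
      ContinuousAt.cpow (by fun_prop) continuousAt_const (Or.inl (by simpa using hs1))
    have h := this.tendsto.mono_left
      (nhdsWithin_le_nhds (s := {l : ℂ | 0 < l.im ∧ 0 ≤ l.re}))
    simpa using h

/-- B converges on the left half and C on the right. As A is continuous at 0, the linear relation
gives convergence of each on the other half; the limits agree because the halves share the imaginary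
axis. -/
lemma tendsto_BC_zero (h13 : W.t₁ + W.t₃ < 1) : ∃ b c : ℝ, 0 < b ∧ 0 < c ∧
    Tendsto W.B (𝓝[H] 0) (𝓝 (b : ℂ)) ∧
    Tendsto W.C (𝓝[H] 0) (𝓝 (Complex.exp (Real.pi * W.t₃ * Complex.I) * c)) := by
  obtain ⟨a, ha, hA⟩ := W.tendsto_A 0 one_pos
  obtain ⟨b, hb, hB⟩ := W.tendsto_B_zero h13
  obtain ⟨c, hc, hC⟩ := W.tendsto_C_zero h13
  rw [Complex.ofReal_zero] at hA
  set F₁ := 𝓝[{l : ℂ | 0 < l.im ∧ l.re ≤ 0}] 0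
  set F₂ := 𝓝[{l : ℂ | 0 < l.im ∧ 0 ≤ l.re}] 0
  have hF : 𝓝[H] 0 = F₁ ⊔ F₂ := by
    rw [← nhdsWithin_union]
    congr 1
    ext l
    constructor
    · intro hl
      rcases le_total l.re 0 with h | h
      exacts [Or.inl ⟨hl, h⟩, Or.inr ⟨hl, h⟩]
    · rintro (h | h)
      exacts [h.1, h.1]
  have hpath : ∀ S : Set ℂ, (∀ ε : ℝ, 0 < ε → (ε : ℂ) * Complex.I ∈ S) →
      Tendsto (fun ε : ℝ => (ε : ℂ) * Complex.I) (𝓝[>] 0) (𝓝[S] 0) := fun S hS => by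
    refine tendsto_nhdsWithin_iff.2 ⟨?_, ?_⟩
    · have : Continuous fun ε : ℝ => (ε : ℂ) * Complex.I := by fun_prop
      simpa using (this.tendsto 0).mono_left nhdsWithin_le_nhds
    · filter_upwards [self_mem_nhdsWithin] with ε hε using hS ε hε
  have p1 := hpath {l : ℂ | 0 < l.im ∧ l.re ≤ 0} fun ε hε => by simpa using hε
  have p2 := hpath {l : ℂ | 0 < l.im ∧ 0 ≤ l.re} fun ε hε => by simpa using hε
  set e₂ := Complex.exp (Real.pi * W.t₂ * Complex.I)
  set e₁₂ := Complex.exp (Real.pi * (W.t₁ + W.t₂) * Complex.I)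
  set e₃ := Complex.exp (Real.pi * W.t₃ * Complex.I)
  have he₂ : e₂ ≠ 0 := Complex.exp_ne_zero _
  have he₁₂ : e₁₂ ≠ 0 := Complex.exp_ne_zero _
  have hB' : Tendsto W.B F₂ (𝓝 (-e₂⁻¹ * (a + e₁₂ * (e₃ * c)))) := by
    refine ((hA.mono_left nhdsWithin_le_nhds).add (hC.const_mul e₁₂)).const_mul (-e₂⁻¹) |>.congr' ?_
    filter_upwards [self_mem_nhdsWithin] with l hl
    have := W.relation hl.1
    rw [neg_mul, neg_eq_iff_eq_neg, inv_mul_eq_iff_eq_mul₀ he₂]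
    linear_combination this
  have hC' : Tendsto W.C F₁ (𝓝 (-e₁₂⁻¹ * (a + e₂ * b))) := by
    refine ((hA.mono_left nhdsWithin_le_nhds).add (hB.const_mul e₂)).const_mul (-e₁₂⁻¹) |>.congr' ?_
    filter_upwards [self_mem_nhdsWithin] with l hl
    have := W.relation hl.1
    rw [neg_mul, neg_eq_iff_eq_neg, inv_mul_eq_iff_eq_mul₀ he₁₂]
    linear_combination this
  rw [tendsto_nhds_unique (hB'.comp p2) (hB.comp p1)] at hB'
  rw [tendsto_nhds_unique (hC'.comp p1) (hC.comp p2)] at hC'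
  refine ⟨b, c, hb, hc, ?_, ?_⟩
  · rw [hF]; exact hB.sup hB'
  · rw [hF]; exact hC'.sup hC

/-! ### Normalized coordinates -/

/-- The first normalized barycentric coordinate. -/
def p₁ (l : ℂ) : ℝ := W.y₁ l / W.total l

/-- The second normalized barycentric coordinate. -/
def p₂ (l : ℂ) : ℝ := W.y₂ l / W.total l

/-- The third normalized barycentric coordinate. -/
def p₃ (l : ℂ) : ℝ := W.y₃ l / W.total l

lemma p_sum {l : ℂ} (hl : 0 < l.im) : W.p₁ l + W.p₂ l + W.p₃ l = 1 := by
  rw [p₁, p₂, p₃, ← add_div, ← add_div, total, div_self]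
  exact (W.total_pos hl).ne'

lemma p_rotate {l : ℂ} (hl : 0 < l.im) : W.p₁ l = W.rotate.p₂ (1 - l⁻¹) ∧
    W.p₂ l = W.rotate.p₃ (1 - l⁻¹) ∧ W.p₃ l = W.rotate.p₁ (1 - l⁻¹) := by
  obtain ⟨k, hk, h1, h2, h3⟩ := W.y_rotate hl
  have ht : W.total l = k * W.rotate.total (1 - l⁻¹) := by
    rw [total, total, h1, h2, h3]; ring
  simp only [p₁, p₂, p₃, h1, h2, h3, ht]
  refine ⟨?_, ?_, ?_⟩ <;> exact mul_div_mul_left _ _ hk.ne'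

lemma tendsto_p_of_ratio {F : Filter ℂ} {g : ℂ → ℝ} {L : ℝ} (hL : L ≠ 0)
    (hg : ∀ᶠ l in F, g l ≠ 0)
    (h1 : Tendsto (fun l => W.y₁ l / g l) F (𝓝 0)) (h2 : Tendsto (fun l => W.y₂ l / g l) F (𝓝 L))
    (h3 : Tendsto (fun l => W.y₃ l / g l) F (𝓝 0)) :
    Tendsto W.p₁ F (𝓝 0) ∧ Tendsto W.p₂ F (𝓝 1) ∧ Tendsto W.p₃ F (𝓝 0) := by
  have ht : Tendsto (fun l => W.total l / g l) F (𝓝 L) := by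
    have := (h1.add h2).add h3
    rw [zero_add, add_zero] at this
    refine this.congr fun l => ?_
    rw [total]
    ring
  have e : ∀ {y : ℂ → ℝ}, ∀ᶠ l in F, (y l / g l) / (W.total l / g l) = y l / W.total l := by
    intro y
    filter_upwards [hg] with l hl
    exact div_div_div_cancel_right₀ hl _ _
  refine ⟨?_, ?_, ?_⟩
  · have h := (h1.div ht hL).congr' e
    rwa [zero_div] at h
  · have h := (h2.div ht hL).congr' e
    rwa [div_self hL] at h
  · have h := (h3.div ht hL).congr' e
    rwa [zero_div] at h

/-- If t₁ + t₃ < 1, the limits of the three periods make y₁ and y₃ tend to 0 and y₂ to a positive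
number. Otherwise B tends to infinity while A stays bounded, so y₂ grows like sin(πt₁) |B|² and the
other two are of smaller order. -/
lemma tendsto_p_zero : Tendsto W.p₁ (𝓝[H] 0) (𝓝 0) ∧ Tendsto W.p₂ (𝓝[H] 0) (𝓝 1) ∧
    Tendsto W.p₃ (𝓝[H] 0) (𝓝 0) := by
  have hH : ∀ᶠ l in 𝓝[H] (0 : ℂ), l ∈ H := self_mem_nhdsWithin
  obtain ⟨a, ha, hA⟩ := W.tendsto_A 0 one_pos
  rw [Complex.ofReal_zero] at hA
  replace hA : Tendsto W.A (𝓝[H] 0) (𝓝 (a : ℂ)) := hA.mono_left nhdsWithin_le_nhds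
  rcases lt_or_ge (W.t₁ + W.t₃) 1 with h13 | h13
  · obtain ⟨b, c, hb, hc, hB, hC⟩ := W.tendsto_BC_zero h13
    have hs := sin_pos W.pos₃ W.lt₃
    have hconj : ∀ {f : ℂ → ℂ} {z : ℂ}, Tendsto f (𝓝[H] 0) (𝓝 z) →
        Tendsto (fun l => conj (f l)) (𝓝[H] 0) (𝓝 (conj z)) := fun h =>
      (Complex.continuous_conj.tendsto _).comp h
    have him : ∀ {f : ℂ → ℂ} {z : ℂ} {x : ℝ}, Tendsto f (𝓝[H] 0) (𝓝 z) → z.im = x →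
        Tendsto (fun l => (f l).im / 1) (𝓝[H] 0) (𝓝 x) := fun h hx => by
      rw [← hx]
      simp only [div_one]
      exact (Complex.continuous_im.tendsto _).comp h
    refine W.tendsto_p_of_ratio (g := fun _ => 1) (L := Real.sin (Real.pi * W.t₃) * c * b)
      (mul_pos (mul_pos hs hc) hb).ne' (Eventually.of_forall fun _ => one_ne_zero)
      (him (hB.mul (hconj hA)) (by simp)) (him (hC.mul (hconj hB)) ?_)
      (him ((hA.const_mul _).mul (hconj hC)) ?_)
    · rw [exp_pi_mul_I]
      simp [-Complex.ofReal_cos, -Complex.ofReal_sin]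
    · rw [map_mul, mul_mul_mul_comm, normSq_exp_mul_I]
      simp
  · have hB := W.tendsto_norm_B h13
    have hB0 : ∀ᶠ l in 𝓝[H] (0 : ℂ), ‖W.B l‖ ≠ 0 :=
      (hB.eventually_gt_atTop 0).mono fun l hl => hl.ne'
    have hBi : Tendsto (fun l => ‖W.B l‖⁻¹) (𝓝[H] 0) (𝓝 0) := tendsto_inv_atTop_zero.comp hB
    have hAB : Tendsto (fun l => ‖W.A l‖ * ‖W.B l‖⁻¹) (𝓝[H] 0) (𝓝 0) := by
      simpa using hA.norm.mul hBi
    have hle : ∀ l, ‖W.B l * conj (W.A l)‖ / ‖W.B l‖ ^ 2 ≤ ‖W.A l‖ * ‖W.B l‖⁻¹ := fun l => by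
      rw [norm_mul, RCLike.norm_conj]
      rcases eq_or_ne (‖W.B l‖) 0 with h | h
      · simp [h]
      · apply le_of_eq
        field_simp
    have hQ : Tendsto (fun l => W.y₁ l / ‖W.B l‖ ^ 2) (𝓝[H] 0) (𝓝 0) := by
      refine squeeze_zero_norm (fun l => le_trans ?_ (hle l)) hAB
      rw [norm_div, norm_pow, norm_norm]
      exact div_le_div_of_nonneg_right (Complex.abs_im_le_norm _) (by positivity)
    have hP : Tendsto (fun l => (W.B l * conj (W.A l)).re / ‖W.B l‖ ^ 2) (𝓝[H] 0) (𝓝 0) := by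
      refine squeeze_zero_norm (fun l => le_trans ?_ (hle l)) hAB
      rw [norm_div, norm_pow, norm_norm]
      exact div_le_div_of_nonneg_right (Complex.abs_re_le_norm _) (by positivity)
    have hA2 : Tendsto (fun l => Complex.normSq (W.A l) / ‖W.B l‖ ^ 2) (𝓝[H] 0) (𝓝 0) := by
      have := hAB.mul hAB
      rw [mul_zero] at this
      refine this.congr fun l => ?_
      rw [Complex.normSq_eq_norm_sq]
      ring
    have hB2 : Tendsto (fun l => Complex.normSq (W.B l) / ‖W.B l‖ ^ 2) (𝓝[H] 0) (𝓝 1) := by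
      refine tendsto_const_nhds.congr' (hB0.mono fun l hl => ?_)
      beta_reduce
      rw [Complex.normSq_eq_norm_sq, div_self (pow_ne_zero 2 hl)]
    refine W.tendsto_p_of_ratio (g := fun l => ‖W.B l‖ ^ 2) (L := Real.sin (Real.pi * W.t₁))
      (sin_pos W.pos₁ W.lt₁).ne' (hB0.mono fun l hl => pow_ne_zero 2 hl) hQ ?_ ?_
    · have h := ((hB2.const_mul (Real.sin (Real.pi * W.t₁))).add
        (hP.const_mul (Real.sin (Real.pi * (W.t₁ + W.t₂))))).add
        (hQ.const_mul (Real.cos (Real.pi * (W.t₁ + W.t₂))))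
      rw [mul_zero, mul_zero, mul_one, add_zero, add_zero] at h
      refine h.congr' (hH.mono fun l hl => ?_)
      beta_reduce
      rw [W.y₂_eq hl]
      ring
    · have h := ((hA2.const_mul (Real.sin (Real.pi * W.t₄))).add
        (hP.const_mul (Real.sin (Real.pi * (W.t₂ + W.t₄))))).add
        (hQ.const_mul (Real.cos (Real.pi * (W.t₂ + W.t₄))))
      rw [mul_zero, mul_zero, mul_zero, add_zero, add_zero] at h
      refine h.congr' (hH.mono fun l hl => ?_)
      beta_reduce
      rw [W.y₃_eq hl]
      ring

lemma tendsto_rotate_of_real {x : ℝ} (hx : x ≠ 0) :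
    Tendsto (fun l : ℂ => 1 - l⁻¹) (𝓝[H] (x : ℂ)) (𝓝[H] ((1 - x⁻¹ : ℝ) : ℂ)) := by
  refine tendsto_nhdsWithin_iff.2 ⟨?_, ?_⟩
  · have h := (continuousAt_inv₀ (Complex.ofReal_ne_zero.2 hx)).tendsto.const_sub (1 : ℂ)
    push_cast
    exact h.mono_left nhdsWithin_le_nhds
  · filter_upwards [self_mem_nhdsWithin] with l hl using one_sub_inv_im_pos hl

lemma tendsto_rotate_infty : Tendsto (fun l : ℂ => 1 - l⁻¹)
    (Bornology.cobounded ℂ ⊓ 𝓟 H) (𝓝[H] 1) := by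
  refine tendsto_nhdsWithin_iff.2 ⟨?_, ?_⟩
  · have h := (tendsto_inv₀_cobounded (α := ℂ)).const_sub (1 : ℂ)
    rw [sub_zero] at h
    exact h.mono_left inf_le_left
  · filter_upwards [mem_inf_of_right (mem_principal_self _)] with l hl using one_sub_inv_im_pos hl

/-- The rotation carries 1 to 0 and permutes the coordinates. Applied once more, it gives the limit
at ∞, which it carries to 1. -/
lemma tendsto_p_one : Tendsto W.p₁ (𝓝[H] 1) (𝓝 1) ∧ Tendsto W.p₂ (𝓝[H] 1) (𝓝 0) ∧
    Tendsto W.p₃ (𝓝[H] 1) (𝓝 0) := by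
  have hr := tendsto_rotate_of_real one_ne_zero
  rw [inv_one, sub_self, Complex.ofReal_zero, Complex.ofReal_one] at hr
  obtain ⟨h1, h2, h3⟩ := W.rotate.tendsto_p_zero
  have hH : ∀ᶠ l in 𝓝[H] (1 : ℂ), l ∈ H := self_mem_nhdsWithin
  exact ⟨(h2.comp hr).congr' (hH.mono fun l hl => (W.p_rotate hl).1.symm),
    (h3.comp hr).congr' (hH.mono fun l hl => (W.p_rotate hl).2.1.symm),
    (h1.comp hr).congr' (hH.mono fun l hl => (W.p_rotate hl).2.2.symm)⟩

lemma tendsto_p_infty : Tendsto W.p₁ (Bornology.cobounded ℂ ⊓ 𝓟 H) (𝓝 0) ∧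
    Tendsto W.p₂ (Bornology.cobounded ℂ ⊓ 𝓟 H) (𝓝 0) ∧
    Tendsto W.p₃ (Bornology.cobounded ℂ ⊓ 𝓟 H) (𝓝 1) := by
  have hr := tendsto_rotate_infty
  obtain ⟨h1, h2, h3⟩ := W.rotate.tendsto_p_one
  have hH : ∀ᶠ l in Bornology.cobounded ℂ ⊓ 𝓟 H, l ∈ H := mem_inf_of_right (mem_principal_self _)
  exact ⟨(h2.comp hr).congr' (hH.mono fun l hl => (W.p_rotate hl).1.symm),
    (h3.comp hr).congr' (hH.mono fun l hl => (W.p_rotate hl).2.1.symm),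
    (h1.comp hr).congr' (hH.mono fun l hl => (W.p_rotate hl).2.2.symm)⟩

lemma tendsto_p₁_of_neg {x : ℝ} (hx : x < 0) : Tendsto W.p₁ (𝓝[H] (x : ℂ)) (𝓝 0) := by
  obtain ⟨a, b, L₂, L₃, -, -, hL, -, -, -, -, -, -, h1, h2, h3⟩ := W.tendsto_total hx
  have ht : Tendsto W.total (𝓝[H] (x : ℂ)) (𝓝 (0 + L₂ + L₃)) := (h1.add h2).add h3
  have h := h1.div ht (by linarith)
  rwa [zero_div] at h

/-- At a real boundary point, the smallest barycentric coordinate tends to zero. -/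
lemma exists_tendsto_p_real (x : ℝ) : Tendsto W.p₁ (𝓝[H] (x : ℂ)) (𝓝 0) ∨
    Tendsto W.p₂ (𝓝[H] (x : ℂ)) (𝓝 0) ∨ Tendsto W.p₃ (𝓝[H] (x : ℂ)) (𝓝 0) := by
  have hH : ∀ x : ℝ, ∀ᶠ l in 𝓝[H] (x : ℂ), l ∈ H := fun x => self_mem_nhdsWithin
  -- The rotation maps (0, 1) to the negative axis and (1, ∞) to (0, 1), so the three intervals
  -- reduce to one.
  have hmid : ∀ (W : Weights) {x : ℝ}, 0 < x → x < 1 → Tendsto W.p₃ (𝓝[H] (x : ℂ)) (𝓝 0) := by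
    intro W x h0 h1
    have hx : 1 - x⁻¹ < 0 := by
      have := (one_lt_inv₀ h0).2 h1
      linarith
    exact ((W.rotate.tendsto_p₁_of_neg hx).comp (tendsto_rotate_of_real h0.ne')).congr'
      ((hH x).mono fun l hl => (W.p_rotate hl).2.2.symm)
  rcases lt_trichotomy x 0 with h | rfl | h
  · exact Or.inl (W.tendsto_p₁_of_neg h)
  · rw [Complex.ofReal_zero]
    exact Or.inl W.tendsto_p_zero.1
  · rcases lt_trichotomy x 1 with h' | rfl | h'
    · exact Or.inr (Or.inr (hmid W h h'))
    · rw [Complex.ofReal_one]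
      exact Or.inr (Or.inl W.tendsto_p_one.2.1)
    · have h1 : 0 < 1 - x⁻¹ := by
        have := inv_lt_one_of_one_lt₀ h'
        linarith
      have h2 : 1 - x⁻¹ < 1 := by
        have := inv_pos.2 h
        linarith
      exact Or.inr (Or.inl (((hmid W.rotate h1 h2).comp (tendsto_rotate_of_real h.ne')).congr'
        ((hH x).mono fun l hl => (W.p_rotate hl).2.1.symm)))

end Weights

end AbelianCover

namespace AbelianCover

open Filter

/-! ### Proper local biholomorphisms -/

lemma isLocalHomeomorphOn_of_deriv {f : ℂ → ℂ} {U : Set ℂ} (hU : IsOpen U)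
    (hf : DifferentiableOn ℂ f U) (hf' : ∀ x ∈ U, deriv f x ≠ 0) : IsLocalHomeomorphOn f U := by
  refine IsLocalHomeomorphOn.mk f U fun x hx => ?_
  have hs : HasStrictDerivAt f (deriv f x) x :=
    (hf.analyticAt (hU.mem_nhds hx)).hasStrictDerivAt
  have hs' := hs.hasStrictFDerivAt_equiv (hf' x hx)
  exact ⟨hs'.toOpenPartialHomeomorph f, hs'.mem_toOpenPartialHomeomorph_source, fun _ _ => rfl⟩

/-- A proper locally biholomorphic map from a connected open set to a simply connected open set is
biholomorphic. -/
theorem isBiholomorphic_of_proper {f : ℂ → ℂ} {U V : Set ℂ} (hU : IsOpen U) (hV : IsOpen V)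
    (hUc : IsPreconnected U) (hUne : U.Nonempty) [SimplyConnectedSpace V]
    (hf : DifferentiableOn ℂ f U) (hf' : ∀ x ∈ U, deriv f x ≠ 0) (hm : Set.MapsTo f U V)
    (hK : ∀ K ⊆ V, IsCompact K → IsCompact (U ∩ f ⁻¹' K)) : IsBiholomorphic f U V := by
  set g : U → V := hm.restrict f U V with hg
  have hgc : Continuous g := hf.continuousOn.mapsToRestrict hm
  have hlocU : IsLocalHomeomorph (fun x : U => f x) := by
    rw [isLocalHomeomorph_iff_isLocalHomeomorphOn_univ]
    exact (isLocalHomeomorphOn_of_deriv hU hf hf').comp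
      (isLocalHomeomorph_iff_isLocalHomeomorphOn_univ.1 hU.isOpenEmbedding_subtypeVal.isLocalHomeomorph)
      fun x _ => x.2
  have hloc : IsLocalHomeomorph g :=
    IsLocalHomeomorph.of_comp (g := (Subtype.val : V → ℂ)) (f := g) hlocU
      hV.isOpenEmbedding_subtypeVal.isLocalHomeomorph hgc
  have : LocallyCompactSpace V := hV.locallyCompactSpace
  have : LocallyPathConnectedSpace V := hV.locallyPathConnectedSpace
  have : PreconnectedSpace U := Subtype.preconnectedSpace hUc
  have hpre : ∀ K : Set V, IsCompact K → IsCompact (g ⁻¹' K) := fun K hKc => by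
    rw [Subtype.isCompact_iff]
    convert hK (Subtype.val '' K) (by rintro _ ⟨x, _, rfl⟩; exact x.2)
      (hKc.image continuous_subtype_val) using 1
    ext x
    constructor
    · rintro ⟨y, hy, rfl⟩
      exact ⟨y.2, g y, hy, rfl⟩
    · rintro ⟨hx, y, hy, hxy⟩
      refine ⟨⟨x, hx⟩, ?_, rfl⟩
      have : g ⟨x, hx⟩ = y := Subtype.ext hxy.symm
      rwa [Set.mem_preimage, this]
  have hproper : IsProperMap g := isProperMap_iff_isCompact_preimage.2 ⟨hgc, hpre⟩
  have hloc' : ∀ e, ∃ φ : OpenPartialHomeomorph U V, e ∈ φ.source ∧ (φ : U → V) = g := fun e => by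
    obtain ⟨φ, he, hφ⟩ := hloc e
    exact ⟨φ, he, hφ.symm⟩
  -- A closed local homeomorphism with finite fibres is a covering; properness gives closedness and
  -- compact fibres, and these are discrete.
  have hcov : IsCoveringMap g := by
    rw [isCoveringMap_iff_isCoveringMapOn_univ]
    refine hproper.isClosedMap.isCoveringMapOn_of_isLocalHomeomorphOn (fun x _ => ?_)
      (by rw [Set.preimage_univ]; exact isLocalHomeomorph_iff_isLocalHomeomorphOn_univ.1 hloc)
    exact (hpre {x} isCompact_singleton).finite
      (.of_openPartialHomeomorph g subset_rfl fun e _ => hloc' e)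
  obtain ⟨x₀, hx₀⟩ := hUne
  -- As V is simply connected, its identity lifts to a section. By uniqueness of lifts on the
  -- connected set U the section is a two-sided inverse.
  obtain ⟨F, ⟨hF0, hF⟩, -⟩ := hcov.existsUnique_continuousMap_lifts (ContinuousMap.id V)
    (g ⟨x₀, hx₀⟩) ⟨x₀, hx₀⟩ rfl
  have hFg : (F ∘ g : U → U) = id := by
    refine hcov.eq_of_comp_eq (F.continuous.comp hgc) continuous_id ?_ ⟨x₀, hx₀⟩ hF0
    rw [← Function.comp_assoc, hF]
    rfl
  have hgF : ∀ y, g (F y) = y := fun y => congrFun hF y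
  have hFg' : ∀ x, F (g x) = x := fun x => congrFun hFg x
  classical
  set G : ℂ → ℂ := fun y => if hy : y ∈ V then (F ⟨y, hy⟩ : ℂ) else 0 with hG
  have hGV : ∀ (y : ℂ) (hy : y ∈ V), G y = F ⟨y, hy⟩ := fun y hy => by rw [hG]; exact dif_pos hy
  have hfG : ∀ y ∈ V, f (G y) = y := fun y hy => by
    rw [hGV y hy]
    exact congrArg Subtype.val (hgF ⟨y, hy⟩)
  have hGU : ∀ y ∈ V, G y ∈ U := fun y hy => by rw [hGV y hy]; exact (F ⟨y, hy⟩).2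
  have hGf : ∀ x ∈ U, G (f x) = x := fun x hx => by
    rw [hGV _ (hm hx)]
    exact congrArg Subtype.val (hFg' ⟨x, hx⟩)
  refine ⟨hf, ⟨hm, fun x hx y hy h => ?_, fun y hy => ⟨G y, hGU y hy, hfG y hy⟩⟩, G, fun y hy => ?_,
    hGf, hfG⟩
  · rw [← hGf x hx, h, hGf y hy]
  · have hGc : ContinuousAt G y := by
      have h1 : ContinuousOn G V := by
        rw [continuousOn_iff_continuous_domRestrict]
        refine (continuous_subtype_val.comp F.continuous).congr fun y => ?_
        exact (hGV y y.2).symm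
      exact h1.continuousAt (hV.mem_nhds hy)
    have hd : HasDerivAt f (deriv f (G y)) (G y) :=
      (hf.differentiableAt (hU.mem_nhds (hGU y hy))).hasDerivAt
    exact (hd.of_local_left_inverse hGc (hf' _ (hGU y hy))
      (by filter_upwards [hV.mem_nhds hy] with z hz using hfG z hz)).differentiableAt.differentiableWithinAt

/-! ### Hyperbolic triangles are simply connected -/

lemma geodesicForm_eq (p q z : ℂ) : geodesicForm p q z =
    (p.re - q.re) * Complex.normSq z + (Complex.normSq q - Complex.normSq p) * z.re +
      (Complex.normSq p * q.re - Complex.normSq q * p.re) := by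
  rw [geodesicForm, Matrix.det_fin_three]
  simp only [Matrix.of_apply, Matrix.cons_val]
  ring

lemma continuous_geodesicForm (p q : ℂ) : Continuous (geodesicForm p q) := by
  rw [show geodesicForm p q = fun z => (p.re - q.re) * Complex.normSq z +
    (Complex.normSq q - Complex.normSq p) * z.re +
      (Complex.normSq p * q.re - Complex.normSq q * p.re) from funext (geodesicForm_eq p q)]
  have := Complex.continuous_normSq
  have := Complex.continuous_re
  fun_prop

lemma isOpen_hyperbolicTriangle (p q s : ℂ) : IsOpen (hyperbolicTriangle p q s) := by
  have h1 := continuous_geodesicForm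
  unfold hyperbolicTriangle
  refine (isOpen_lt continuous_const Complex.continuous_im).inter
    ((isOpen_lt continuous_const ((h1 _ _).mul continuous_const)).inter
    ((isOpen_lt continuous_const ((h1 _ _).mul continuous_const)).inter
    (isOpen_lt continuous_const ((h1 _ _).mul continuous_const))))

/-- The affine function on the Klein model given by a geodesic. -/
def kleinForm (p q : ℂ) (x : ℝ × ℝ) : ℝ := (p.re - q.re) * x.1 +
  (Complex.normSq q - Complex.normSq p) * x.2 + (Complex.normSq p * q.re - Complex.normSq q * p.re)

lemma convex_kleinForm (p q : ℂ) (k : ℝ) : Convex ℝ {x : ℝ × ℝ | 0 < kleinForm p q x * k} := by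
  intro x hx y hy a b ha hb hab
  have hx' : 0 < kleinForm p q x * k := hx
  have hy' : 0 < kleinForm p q y * k := hy
  have e : kleinForm p q (a • x + b • y) * k =
      a * (kleinForm p q x * k) + b * (kleinForm p q y * k) := by
    simp only [kleinForm, Prod.fst_add, Prod.snd_add, Prod.smul_fst, Prod.smul_snd, smul_eq_mul]
    obtain rfl : b = 1 - a := by linarith
    ring
  change 0 < kleinForm p q (a • x + b • y) * k
  rw [e]
  rcases ha.eq_or_lt with rfl | ha
  · rw [zero_add] at hab
    rw [hab]
    linarith
  · exact add_pos_of_pos_of_nonneg (mul_pos ha hx') (mul_nonneg hb hy'.le)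

lemma convex_klein : Convex ℝ {x : ℝ × ℝ | x.2 ^ 2 < x.1} := by
  intro x hx y hy a b ha hb hab
  have hx' : x.2 ^ 2 < x.1 := hx
  have hy' : y.2 ^ 2 < y.1 := hy
  change (a * x.2 + b * y.2) ^ 2 < a * x.1 + b * y.1
  obtain rfl : b = 1 - a := by linarith
  have h1 : (a * x.2 + (1 - a) * y.2) ^ 2 ≤ a * x.2 ^ 2 + (1 - a) * y.2 ^ 2 := by
    nlinarith [mul_nonneg (mul_nonneg ha hb) (sq_nonneg (x.2 - y.2))]
  rcases ha.eq_or_lt with rfl | ha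
  · linarith
  · nlinarith [mul_nonneg hb (sub_nonneg.2 hy'.le), mul_pos ha (sub_pos.2 hx')]

/-- A hyperbolic triangle in the Klein model. -/
def kleinTriangle (p q s : ℂ) : Set (ℝ × ℝ) := {x | x.2 ^ 2 < x.1} ∩
  ({x | 0 < kleinForm q s x * geodesicForm q s p} ∩ ({x | 0 < kleinForm s p x * geodesicForm s p q} ∩
    {x | 0 < kleinForm p q x * geodesicForm p q s}))

lemma convex_kleinTriangle (p q s : ℂ) : Convex ℝ (kleinTriangle p q s) :=
  convex_klein.inter ((convex_kleinForm _ _ _).inter ((convex_kleinForm _ _ _).inter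
    (convex_kleinForm _ _ _)))

/-- In the coordinates (|z|², Re z) geodesics become straight lines and the half-plane becomes the
interior of a parabola, so the triangle is convex there. -/
lemma mem_hyperbolicTriangle_iff {p q s z : ℂ} : z ∈ hyperbolicTriangle p q s ↔
    0 < z.im ∧ (Complex.normSq z, z.re) ∈ kleinTriangle p q s := by
  have e : ∀ p q, kleinForm p q (Complex.normSq z, z.re) = geodesicForm p q z := fun p q =>
    (geodesicForm_eq p q z).symm
  simp only [hyperbolicTriangle, kleinTriangle, Set.mem_inter_iff, Set.mem_ofPred_eq, e]
  constructor
  · rintro ⟨h0, h1⟩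
    refine ⟨h0, ?_, h1⟩
    rw [Complex.normSq_apply]
    nlinarith
  · rintro ⟨h0, -, h1⟩
    exact ⟨h0, h1⟩

/-- The passage from the upper half-plane to the Klein model. -/
def kleinHomeomorph (p q s : ℂ) : hyperbolicTriangle p q s ≃ₜ kleinTriangle p q s where
  toFun z := ⟨(Complex.normSq z, (z : ℂ).re), (mem_hyperbolicTriangle_iff.1 z.2).2⟩
  invFun x := ⟨⟨x.1.2, √(x.1.1 - x.1.2 ^ 2)⟩, by
    have hx : 0 < x.1.1 - x.1.2 ^ 2 := sub_pos.2 x.2.1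
    rw [mem_hyperbolicTriangle_iff]
    refine ⟨Real.sqrt_pos.2 hx, ?_⟩
    rw [Complex.normSq_mk, Real.mul_self_sqrt hx.le]
    convert x.2 using 1
    refine Prod.ext ?_ rfl
    ring⟩
  left_inv z := by
    have hz := (mem_hyperbolicTriangle_iff.1 z.2).1
    refine Subtype.ext (Complex.ext rfl ?_)
    change √(Complex.normSq z - (z : ℂ).re ^ 2) = (z : ℂ).im
    rw [Complex.normSq_apply, show (z : ℂ).re * (z : ℂ).re + (z : ℂ).im * (z : ℂ).im -
      (z : ℂ).re ^ 2 = (z : ℂ).im ^ 2 by ring, Real.sqrt_sq hz.le]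
  right_inv x := by
    have hx : 0 < x.1.1 - x.1.2 ^ 2 := sub_pos.2 x.2.1
    refine Subtype.ext (Prod.ext ?_ rfl)
    change Complex.normSq ⟨x.1.2, √(x.1.1 - x.1.2 ^ 2)⟩ = x.1.1
    rw [Complex.normSq_mk, Real.mul_self_sqrt hx.le]
    ring
  continuous_toFun := by
    refine Continuous.subtype_mk ?_ _
    exact (Complex.continuous_normSq.comp continuous_subtype_val).prodMk
      (Complex.continuous_re.comp continuous_subtype_val)
  continuous_invFun := by
    refine Continuous.subtype_mk ?_ _
    have h1 : Continuous fun x : kleinTriangle p q s =>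
        ((x.1.2 : ℝ) : ℂ) + ((√(x.1.1 - x.1.2 ^ 2) : ℝ) : ℂ) * Complex.I := by fun_prop
    refine h1.congr fun x => ?_
    apply Complex.ext <;> simp

lemma simplyConnectedSpace_hyperbolicTriangle {p q s : ℂ}
    (h : (hyperbolicTriangle p q s).Nonempty) : SimplyConnectedSpace (hyperbolicTriangle p q s) := by
  have h1 : (kleinTriangle p q s).Nonempty := by
    obtain ⟨z, hz⟩ := h
    exact ⟨_, (mem_hyperbolicTriangle_iff.1 hz).2⟩
  have : ContractibleSpace (kleinTriangle p q s) := (convex_kleinTriangle p q s).contractibleSpace h1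
  have : ContractibleSpace (hyperbolicTriangle p q s) := (kleinHomeomorph p q s).contractibleSpace
  infer_instance

end AbelianCover

namespace AbelianCover

open Filter

/-! ### The Klein model -/

/-- The Lorentz form on `ℝ³`, for which the upper half-plane is the cone of positive vectors. -/
def lorentz (x y : ℝ × ℝ × ℝ) : ℝ := x.1 * y.2.2 + x.2.2 * y.1 - 2 * x.2.1 * y.2.1

/-- The determinant of three vectors in `ℝ³`. -/
def tripleDet (x y z : ℝ × ℝ × ℝ) : ℝ := x.1 * (y.2.1 * z.2.2 - y.2.2 * z.2.1) -
  x.2.1 * (y.1 * z.2.2 - y.2.2 * z.1) + x.2.2 * (y.1 * z.2.1 - y.2.1 * z.1)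

/-- The point of the closed upper half-plane given by a vector of the closed forward cone. -/
def kleinPoint (x : ℝ × ℝ × ℝ) : ℂ := ⟨x.2.1 / x.2.2, √(x.1 * x.2.2 - x.2.1 ^ 2) / x.2.2⟩

lemma normSq_kleinPoint {x : ℝ × ℝ × ℝ} (hc : 0 < x.2.2) (hx : 0 ≤ lorentz x x) :
    Complex.normSq (kleinPoint x) = x.1 / x.2.2 := by
  have h : 0 ≤ x.1 * x.2.2 - x.2.1 ^ 2 := by unfold lorentz at hx; nlinarith
  rw [kleinPoint, Complex.normSq_mk, div_mul_div_comm, div_mul_div_comm, Real.mul_self_sqrt h]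
  field_simp
  ring

lemma kleinPoint_im_nonneg {x : ℝ × ℝ × ℝ} (hc : 0 < x.2.2) : 0 ≤ (kleinPoint x).im :=
  div_nonneg (Real.sqrt_nonneg _) hc.le

lemma continuousAt_kleinPoint {x : ℝ × ℝ × ℝ} (hc : x.2.2 ≠ 0) : ContinuousAt kleinPoint x := by
  have h : ContinuousAt (fun x : ℝ × ℝ × ℝ => ((x.2.1 / x.2.2 : ℝ) : ℂ) +
      ((√(x.1 * x.2.2 - x.2.1 ^ 2) / x.2.2 : ℝ) : ℂ) * Complex.I) x := by
    have h1 : ContinuousAt (fun x : ℝ × ℝ × ℝ => x.2.1 / x.2.2) x :=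
      ContinuousAt.div (by fun_prop) (by fun_prop) hc
    have h2 : ContinuousAt (fun x : ℝ × ℝ × ℝ => √(x.1 * x.2.2 - x.2.1 ^ 2) / x.2.2) x :=
      ContinuousAt.div (by fun_prop) (by fun_prop) hc
    exact (Complex.continuous_ofReal.continuousAt.comp h1).add
      ((Complex.continuous_ofReal.continuousAt.comp h2).mul continuousAt_const)
  refine h.congr (Eventually.of_forall fun x => ?_)
  apply Complex.ext <;> simp [kleinPoint, -Complex.ofReal_div]

/-- A point of the upper half-plane is recovered from the norms of its homogeneous coordinates. -/
lemma div_eq_kleinPoint {U V : ℂ} (hV : V ≠ 0) (h : 0 < (U * conj V).im) :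
    U / V = kleinPoint (Complex.normSq U, (U * conj V).re, Complex.normSq V) := by
  have hn := Complex.normSq_pos.2 hV
  have e : U / V = U * conj V / (Complex.normSq V : ℂ) := by
    rw [Complex.normSq_eq_conj_mul_self]
    have : conj V ≠ 0 := (map_ne_zero _).2 hV
    field_simp
  have h2 : Complex.normSq U * Complex.normSq V - (U * conj V).re ^ 2 = (U * conj V).im ^ 2 := by
    rw [← Complex.normSq_conj V, ← Complex.normSq_mul, Complex.normSq_apply]
    ring
  rw [e, kleinPoint]
  apply Complex.ext
  · exact Complex.div_ofReal_re _ _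
  · change _ = √(Complex.normSq U * Complex.normSq V - (U * conj V).re ^ 2) / Complex.normSq V
    rw [h2, Real.sqrt_sq h.le]
    exact Complex.div_ofReal_im _ _

/-- The determinant defining the geodesic form has rows (|z|², Re z, 1), which are the given vectors
scaled to last coordinate 1. -/
lemma geodesicForm_kleinPoint {x y z : ℝ × ℝ × ℝ} (hx : 0 < x.2.2) (hy : 0 < y.2.2)
    (hz : 0 < z.2.2) (hx' : 0 ≤ lorentz x x) (hy' : 0 ≤ lorentz y y) (hz' : 0 ≤ lorentz z z) :
    geodesicForm (kleinPoint y) (kleinPoint z) (kleinPoint x) =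
      tripleDet x y z / (x.2.2 * y.2.2 * z.2.2) := by
  rw [geodesicForm_eq, normSq_kleinPoint hx hx', normSq_kleinPoint hy hy', normSq_kleinPoint hz hz',
    tripleDet]
  simp only [kleinPoint]
  field_simp
  ring

/-! ### Hyperbolic angles -/

/-- The Lorentz form of the vectors that represent two points. -/
lemma lorentz_kleinPoint {x y : ℝ × ℝ × ℝ} (hx : 0 < x.2.2) (hy : 0 < y.2.2)
    (hx' : 0 ≤ lorentz x x) (hy' : 0 ≤ lorentz y y) :
    lorentz (Complex.normSq (kleinPoint x), (kleinPoint x).re, 1)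
      (Complex.normSq (kleinPoint y), (kleinPoint y).re, 1) = lorentz x y / (x.2.2 * y.2.2) := by
  rw [normSq_kleinPoint hx hx', normSq_kleinPoint hy hy', lorentz, lorentz]
  simp only [kleinPoint]
  field_simp

/-- The law of cosines in the Klein model: (q - p)(q̄ - p) is the tangent direction in
`hyperbolicAngle` with its denominator cleared, and inner products of such vectors are 2 × 2 minors
of the Lorentz Gram matrix. -/
lemma inner_tangent (p q s : ℂ) :
    inner ℝ ((q - p) * (conj q - p)) ((s - p) * (conj s - p)) =
      lorentz (Complex.normSq p, p.re, 1) (Complex.normSq q, q.re, 1) *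
        lorentz (Complex.normSq p, p.re, 1) (Complex.normSq s, s.re, 1) -
      lorentz (Complex.normSq p, p.re, 1) (Complex.normSq p, p.re, 1) *
        lorentz (Complex.normSq q, q.re, 1) (Complex.normSq s, s.re, 1) := by
  rw [Complex.inner]
  simp only [lorentz, Complex.normSq_apply, Complex.mul_re, Complex.mul_im, Complex.sub_re,
    Complex.sub_im, Complex.conj_re, Complex.conj_im]
  ring

lemma tangent_scale {p q : ℂ} (hp : 0 ≤ p.im) (hq : 0 ≤ q.im)
    (h : 0 < lorentz (Complex.normSq p, p.re, 1) (Complex.normSq q, q.re, 1)) :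
    ∃ k : ℝ, 0 < k ∧ (q - p) / (q - conj p) = k • ((q - p) * (conj q - p)) := by
  have hn : 0 < Complex.normSq (q - conj p) := by
    have : Complex.normSq (q - conj p) =
        lorentz (Complex.normSq p, p.re, 1) (Complex.normSq q, q.re, 1) + 2 * (p.im * q.im) := by
      simp only [lorentz, Complex.normSq_apply, Complex.sub_re, Complex.sub_im, Complex.conj_re,
        Complex.conj_im]
      ring
    rw [this]
    have := mul_nonneg hp hq
    linarith
  refine ⟨(Complex.normSq (q - conj p))⁻¹, inv_pos.2 hn, ?_⟩
  have h0 : q - conj p ≠ 0 := Complex.normSq_pos.1 hn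
  have h1 : conj q - p ≠ 0 := by
    have := (map_ne_zero (starRingEnd ℂ)).2 h0
    rwa [map_sub, Complex.conj_conj] at this
  rw [Complex.real_smul, Complex.ofReal_inv, Complex.normSq_eq_conj_mul_self, map_sub,
    Complex.conj_conj]
  field_simp

/-- Both tangent vectors have squared length w up to the scaling of the representatives, and their
inner product is k w with the same scaling. An ideal vertex is included. -/
lemma hyperbolicAngle_kleinPoint {x y z : ℝ × ℝ × ℝ} (hx : 0 < x.2.2) (hy : 0 < y.2.2)
    (hz : 0 < z.2.2) (hx' : 0 ≤ lorentz x x) (hy' : 0 ≤ lorentz y y) (hz' : 0 ≤ lorentz z z)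
    (hxy : 0 < lorentz x y) (hxz : 0 < lorentz x z) {w k : ℝ} (hw : 0 < w)
    (h1 : lorentz x y ^ 2 - lorentz x x * lorentz y y = w)
    (h2 : lorentz x z ^ 2 - lorentz x x * lorentz z z = w)
    (h3 : lorentz x y * lorentz x z - lorentz x x * lorentz y z = k * w) :
    hyperbolicAngle (kleinPoint x) (kleinPoint y) (kleinPoint z) = Real.arccos k := by
  set p := kleinPoint x
  set q := kleinPoint y
  set s := kleinPoint z
  have lxy := lorentz_kleinPoint hx hy hx' hy'
  have lxz := lorentz_kleinPoint hx hz hx' hz'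
  have lxx := lorentz_kleinPoint hx hx hx' hx'
  have lyz := lorentz_kleinPoint hy hz hy' hz'
  have lyy := lorentz_kleinPoint hy hy hy' hy'
  have lzz := lorentz_kleinPoint hz hz hz' hz'
  obtain ⟨k₁, hk₁, e₁⟩ := tangent_scale (p := p) (q := q) (kleinPoint_im_nonneg hx)
    (kleinPoint_im_nonneg hy) (by rw [lxy]; positivity)
  obtain ⟨k₂, hk₂, e₂⟩ := tangent_scale (p := p) (q := s) (kleinPoint_im_nonneg hx)
    (kleinPoint_im_nonneg hz) (by rw [lxz]; positivity)
  have n₁ : ‖(q - p) * (conj q - p)‖ = √w / (x.2.2 * y.2.2) := by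
    rw [norm_eq_sqrt_real_inner, inner_tangent, lxy, lxx, lyy, ← Real.sqrt_sq (mul_pos hx hy).le,
      ← Real.sqrt_div' _ (sq_nonneg _), Real.sqrt_sq (mul_pos hx hy).le, ← h1]
    congr 1
    field_simp
  have n₂ : ‖(s - p) * (conj s - p)‖ = √w / (x.2.2 * z.2.2) := by
    rw [norm_eq_sqrt_real_inner, inner_tangent, lxz, lxx, lzz, ← Real.sqrt_sq (mul_pos hx hz).le,
      ← Real.sqrt_div' _ (sq_nonneg _), Real.sqrt_sq (mul_pos hx hz).le, ← h2]
    congr 1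
    field_simp
  rw [hyperbolicAngle, e₁, e₂, InnerProductGeometry.angle_smul_left_of_pos _ _ hk₁,
    InnerProductGeometry.angle_smul_right_of_pos _ _ hk₂, InnerProductGeometry.angle, n₁, n₂,
    inner_tangent, lxy, lxz, lxx, lyz]
  have e : lorentz x y / (x.2.2 * y.2.2) * (lorentz x z / (x.2.2 * z.2.2)) -
      lorentz x x / (x.2.2 * x.2.2) * (lorentz y z / (y.2.2 * z.2.2)) =
      k * w / (x.2.2 * y.2.2 * (x.2.2 * z.2.2)) := by
    rw [← h3]
    field_simp
  rw [e, div_mul_div_comm, Real.mul_self_sqrt hw.le]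
  congr 1
  field_simp

/-! ### Triangles with a given Gram matrix -/

/-- Three vectors of the closed forward cone with the Gram matrix of the vertices of a triangle;
the numbers `k₁`, `k₂`, `k₃` are the cosines of its angles. -/
structure KleinFrame where
  (f₁ f₂ f₃ : ℝ × ℝ × ℝ)
  (k₁ k₂ k₃ scale : ℝ)
  pos₁ : 0 < f₁.2.2
  pos₂ : 0 < f₂.2.2
  pos₃ : 0 < f₃.2.2
  scale_pos : 0 < scale
  le₁ : k₁ ^ 2 ≤ 1
  le₂ : k₂ ^ 2 ≤ 1
  le₃ : k₃ ^ 2 ≤ 1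
  pos₁₂ : 0 < k₁ * k₂ + k₃
  pos₁₃ : 0 < k₁ * k₃ + k₂
  pos₂₃ : 0 < k₂ * k₃ + k₁
  pos_det : 0 < k₁ ^ 2 + k₂ ^ 2 + k₃ ^ 2 + 2 * k₁ * k₂ * k₃ - 1
  eq₁₁ : lorentz f₁ f₁ = scale * (1 - k₁ ^ 2)
  eq₂₂ : lorentz f₂ f₂ = scale * (1 - k₂ ^ 2)
  eq₃₃ : lorentz f₃ f₃ = scale * (1 - k₃ ^ 2)
  eq₁₂ : lorentz f₁ f₂ = scale * (k₁ * k₂ + k₃)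
  eq₁₃ : lorentz f₁ f₃ = scale * (k₁ * k₃ + k₂)
  eq₂₃ : lorentz f₂ f₃ = scale * (k₂ * k₃ + k₁)
  det_ne : tripleDet f₁ f₂ f₃ ≠ 0

lemma lorentz_comm (x y : ℝ × ℝ × ℝ) : lorentz x y = lorentz y x := by
  unfold lorentz; ring

namespace KleinFrame

variable (K : KleinFrame)

/-- Cyclic permutation of the vertices. -/
def rotate : KleinFrame where
  f₁ := K.f₂
  f₂ := K.f₃
  f₃ := K.f₁
  k₁ := K.k₂
  k₂ := K.k₃
  k₃ := K.k₁
  scale := K.scale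
  pos₁ := K.pos₂
  pos₂ := K.pos₃
  pos₃ := K.pos₁
  scale_pos := K.scale_pos
  le₁ := K.le₂
  le₂ := K.le₃
  le₃ := K.le₁
  pos₁₂ := K.pos₂₃
  pos₁₃ := by rw [mul_comm]; exact K.pos₁₂
  pos₂₃ := by rw [mul_comm]; exact K.pos₁₃
  pos_det := by have := K.pos_det; linarith
  eq₁₁ := K.eq₂₂
  eq₂₂ := K.eq₃₃
  eq₃₃ := K.eq₁₁
  eq₁₂ := K.eq₂₃
  eq₁₃ := by rw [lorentz_comm, K.eq₁₂, mul_comm K.k₁]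
  eq₂₃ := by rw [lorentz_comm, K.eq₁₃, mul_comm K.k₁]
  det_ne := by
    convert K.det_ne using 1
    unfold tripleDet
    ring

lemma nonneg₁ : 0 ≤ lorentz K.f₁ K.f₁ := by
  rw [K.eq₁₁]
  exact mul_nonneg K.scale_pos.le (sub_nonneg.2 K.le₁)

/-- In the Gram matrix of a frame both diagonal minors that belong to a vertex equal scale² times
the quantity in `pos_det`, and the mixed minor is k₁ times it. -/
lemma angle_eq : hyperbolicAngle (kleinPoint K.f₁) (kleinPoint K.f₂) (kleinPoint K.f₃) =
    Real.arccos K.k₁ := by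
  have hs := K.scale_pos
  refine hyperbolicAngle_kleinPoint K.pos₁ K.pos₂ K.pos₃ K.nonneg₁ K.rotate.nonneg₁
    K.rotate.rotate.nonneg₁ ?_ ?_ (mul_pos (pow_pos hs 2) K.pos_det) ?_ ?_ ?_
  · rw [K.eq₁₂]; exact mul_pos hs K.pos₁₂
  · rw [K.eq₁₃]; exact mul_pos hs K.pos₁₃
  · rw [K.eq₁₂, K.eq₁₁, K.eq₂₂]; ring
  · rw [K.eq₁₃, K.eq₁₁, K.eq₃₃]; ring
  · rw [K.eq₁₂, K.eq₁₃, K.eq₁₁, K.eq₂₃]; ring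

/-- The vector with barycentric coordinates `y`. -/
def comb (y : ℝ × ℝ × ℝ) : ℝ × ℝ × ℝ := y.1 • K.f₁ + y.2.1 • K.f₂ + y.2.2 • K.f₃

lemma comb_pos {y : ℝ × ℝ × ℝ} (h1 : 0 < y.1) (h2 : 0 < y.2.1) (h3 : 0 < y.2.2) :
    0 < (K.comb y).2.2 := by
  have := mul_pos h1 K.pos₁
  have := mul_pos h2 K.pos₂
  have := mul_pos h3 K.pos₃
  change 0 < y.1 * K.f₁.2.2 + y.2.1 * K.f₂.2.2 + y.2.2 * K.f₃.2.2
  linarith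

/-- All Gram entries are nonnegative and the off-diagonal ones positive, so positive combinations
lie inside the cone even if vertices are ideal. -/
lemma lorentz_comb_pos {y : ℝ × ℝ × ℝ} (h1 : 0 < y.1) (h2 : 0 < y.2.1) (h3 : 0 < y.2.2) :
    0 < lorentz (K.comb y) (K.comb y) := by
  have e : lorentz (K.comb y) (K.comb y) = y.1 ^ 2 * lorentz K.f₁ K.f₁ +
      y.2.1 ^ 2 * lorentz K.f₂ K.f₂ + y.2.2 ^ 2 * lorentz K.f₃ K.f₃ +
      2 * (y.1 * y.2.1 * lorentz K.f₁ K.f₂) + 2 * (y.1 * y.2.2 * lorentz K.f₁ K.f₃) +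
      2 * (y.2.1 * y.2.2 * lorentz K.f₂ K.f₃) := by
    simp only [lorentz, comb, Prod.fst_add, Prod.snd_add, Prod.smul_fst, Prod.smul_snd, smul_eq_mul]
    ring
  have a1 := mul_nonneg (sq_nonneg y.1) K.nonneg₁
  have a2 := mul_nonneg (sq_nonneg y.2.1) K.rotate.nonneg₁
  have a3 := mul_nonneg (sq_nonneg y.2.2) K.rotate.rotate.nonneg₁
  have a4 := mul_pos (mul_pos h1 h2) (mul_pos K.scale_pos K.pos₁₂)
  have a5 := mul_pos (mul_pos h1 h3) (mul_pos K.scale_pos K.pos₁₃)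
  have a6 := mul_pos (mul_pos h2 h3) (mul_pos K.scale_pos K.pos₂₃)
  rw [e, K.eq₁₂, K.eq₁₃, K.eq₂₃]
  change 0 ≤ y.2.1 ^ 2 * lorentz K.f₂ K.f₂ at a2
  change 0 ≤ y.2.2 ^ 2 * lorentz K.f₃ K.f₃ at a3
  linarith

/-- The barycentric coordinates of a point are given by its geodesic forms. -/
lemma geodesicForm_comb {y : ℝ × ℝ × ℝ} (h1 : 0 < y.1) (h2 : 0 < y.2.1) (h3 : 0 < y.2.2) :
    geodesicForm (kleinPoint K.f₂) (kleinPoint K.f₃) (kleinPoint (K.comb y)) =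
      y.1 / (K.comb y).2.2 * (tripleDet K.f₁ K.f₂ K.f₃ / (K.f₂.2.2 * K.f₃.2.2)) := by
  have hc := K.comb_pos h1 h2 h3
  have := K.pos₂
  have := K.pos₃
  rw [geodesicForm_kleinPoint hc K.pos₂ K.pos₃ (K.lorentz_comb_pos h1 h2 h3).le K.rotate.nonneg₁
    K.rotate.rotate.nonneg₁]
  have e : tripleDet (K.comb y) K.f₂ K.f₃ = y.1 * tripleDet K.f₁ K.f₂ K.f₃ := by
    simp only [tripleDet, comb, Prod.fst_add, Prod.snd_add, Prod.smul_fst, Prod.smul_snd,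
      smul_eq_mul]
    ring
  rw [e]
  field_simp

lemma geodesicForm_vertex : geodesicForm (kleinPoint K.f₂) (kleinPoint K.f₃) (kleinPoint K.f₁) =
    tripleDet K.f₁ K.f₂ K.f₃ / (K.f₁.2.2 * K.f₂.2.2 * K.f₃.2.2) :=
  geodesicForm_kleinPoint K.pos₁ K.pos₂ K.pos₃ K.nonneg₁ K.rotate.nonneg₁ K.rotate.rotate.nonneg₁

/-- A normalized geodesic form, whose value is a barycentric coordinate. -/
def side (z : ℂ) : ℝ := geodesicForm (kleinPoint K.f₂) (kleinPoint K.f₃) z *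
  (K.f₂.2.2 * K.f₃.2.2 / tripleDet K.f₁ K.f₂ K.f₃)

lemma continuous_side : Continuous K.side := (continuous_geodesicForm _ _).mul continuous_const

lemma side_comb {y : ℝ × ℝ × ℝ} (h1 : 0 < y.1) (h2 : 0 < y.2.1) (h3 : 0 < y.2.2) :
    K.side (kleinPoint (K.comb y)) = y.1 / (K.comb y).2.2 := by
  have := K.det_ne
  have := K.pos₂
  have := K.pos₃
  rw [side, K.geodesicForm_comb h1 h2 h3]
  field_simp

lemma side_pos_iff (z : ℂ) : 0 < K.side z ↔ 0 < geodesicForm (kleinPoint K.f₂) (kleinPoint K.f₃) z *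
    geodesicForm (kleinPoint K.f₂) (kleinPoint K.f₃) (kleinPoint K.f₁) := by
  have h1 := K.pos₁
  have h2 := K.pos₂
  have h3 := K.pos₃
  have hd := K.det_ne
  have e : K.side z = geodesicForm (kleinPoint K.f₂) (kleinPoint K.f₃) z *
      geodesicForm (kleinPoint K.f₂) (kleinPoint K.f₃) (kleinPoint K.f₁) *
      (K.f₁.2.2 * (K.f₂.2.2 * K.f₃.2.2) ^ 2 / tripleDet K.f₁ K.f₂ K.f₃ ^ 2) := by
    rw [side, K.geodesicForm_vertex]
    field_simp
  rw [e]
  exact mul_pos_iff_of_pos_right (by positivity)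

/-- The triangle of a frame, in terms of barycentric coordinates. -/
lemma mem_triangle_iff {z : ℂ} :
    z ∈ hyperbolicTriangle (kleinPoint K.f₂) (kleinPoint K.f₁) (kleinPoint K.f₃) ↔
      0 < z.im ∧ 0 < K.side z ∧ 0 < K.rotate.side z ∧ 0 < K.rotate.rotate.side z := by
  -- Exchanging the two points of a side changes the sign of both factors, so the orientation of the
  -- sides does not matter.
  have hs : ∀ p q z w, geodesicForm p q z * geodesicForm p q w =
      geodesicForm q p z * geodesicForm q p w := fun p q z w => by
    simp only [geodesicForm_eq]; ring
  rw [side_pos_iff, side_pos_iff, side_pos_iff]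
  simp only [rotate]
  rw [hyperbolicTriangle, Set.mem_ofPred_eq, hs (kleinPoint K.f₁) (kleinPoint K.f₃),
    hs (kleinPoint K.f₃) (kleinPoint K.f₂), hs (kleinPoint K.f₂) (kleinPoint K.f₁)]
  tauto

lemma kleinPoint_comb_mem {y : ℝ × ℝ × ℝ} (h1 : 0 < y.1) (h2 : 0 < y.2.1) (h3 : 0 < y.2.2) :
    kleinPoint (K.comb y) ∈
      hyperbolicTriangle (kleinPoint K.f₂) (kleinPoint K.f₁) (kleinPoint K.f₃) := by
  have hc := K.comb_pos h1 h2 h3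
  have e2 : K.comb y = K.rotate.comb (y.2.1, y.2.2, y.1) := by
    simp only [comb, rotate]; abel
  have e3 : K.comb y = K.rotate.rotate.comb (y.2.2, y.1, y.2.1) := by
    simp only [comb, rotate]; abel
  rw [mem_triangle_iff, K.side_comb h1 h2 h3]
  refine ⟨div_pos (Real.sqrt_pos.2 ?_) hc, div_pos h1 hc, ?_, ?_⟩
  · have := K.lorentz_comb_pos h1 h2 h3
    unfold lorentz at this
    nlinarith
  · rw [e2, side_comb]
    · exact div_pos h2 (e2 ▸ hc)
    all_goals assumption
  · rw [e3, side_comb]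
    · exact div_pos h3 (e3 ▸ hc)
    all_goals assumption

lemma vertex_ne : kleinPoint K.f₁ ≠ kleinPoint K.f₂ := fun h => by
  have h1 := K.geodesicForm_vertex
  rw [h] at h1
  have h2 : geodesicForm (kleinPoint K.f₂) (kleinPoint K.f₃) (kleinPoint K.f₂) = 0 := by
    rw [geodesicForm_eq]; ring
  rw [h2, eq_comm, div_eq_zero_iff] at h1
  have := K.pos₁
  have := K.pos₂
  have := K.pos₃
  exact h1.elim K.det_ne (by positivity)

/-- Where a point depends on barycentric coordinates with sum `1`, a positive lower bound on the
geodesic form gives a lower bound on the coordinate. -/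
lemma exists_coordinate_bound {S : Set ℂ} (hS : IsCompact S) (hpos : ∀ z ∈ S, 0 < K.side z) :
    ∃ ε : ℝ, 0 < ε ∧ ∀ y : ℝ × ℝ × ℝ, 0 < y.1 → 0 < y.2.1 → 0 < y.2.2 →
      y.1 + y.2.1 + y.2.2 = 1 → kleinPoint (K.comb y) ∈ S → ε ≤ y.1 := by
  obtain ⟨ε, hε, h⟩ : ∃ ε, 0 < ε ∧ ∀ z ∈ S, ε ≤ K.side z := by
    rcases S.eq_empty_or_nonempty with rfl | hne
    · exact ⟨1, one_pos, by simp⟩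
    · obtain ⟨z, hz, hm⟩ := hS.exists_isMinOn hne K.continuous_side.continuousOn
      exact ⟨_, hpos z hz, fun w hw => hm hw⟩
  -- As the coordinates have sum 1, the last entry of the combination is at least c; this bounds the
  -- denominator in `side_comb`.
  set c := min K.f₁.2.2 (min K.f₂.2.2 K.f₃.2.2)
  have hc : 0 < c := lt_min K.pos₁ (lt_min K.pos₂ K.pos₃)
  refine ⟨ε * c, mul_pos hε hc, fun y h1 h2 h3 hsum hy => ?_⟩
  have hc' := K.comb_pos h1 h2 h3
  have hle : c ≤ (K.comb y).2.2 := by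
    change _ ≤ y.1 * K.f₁.2.2 + y.2.1 * K.f₂.2.2 + y.2.2 * K.f₃.2.2
    have a1 : c ≤ K.f₁.2.2 := min_le_left _ _
    have a2 : c ≤ K.f₂.2.2 := (min_le_right _ _).trans (min_le_left _ _)
    have a3 : c ≤ K.f₃.2.2 := (min_le_right _ _).trans (min_le_right _ _)
    calc c = y.1 * c + y.2.1 * c + y.2.2 * c := by rw [← add_mul, ← add_mul, hsum, one_mul]
      _ ≤ _ := by gcongr
  have := h _ hy
  rw [K.side_comb h1 h2 h3, le_div_iff₀ hc'] at this
  exact (mul_le_mul_of_nonneg_left hle hε.le).trans this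

end KleinFrame

end AbelianCover

namespace AbelianCover

open Filter

/-! ### Trigonometric identities for the Gram matrix. -/

lemma cos_add_mul_cos_add (a b d : ℝ) : Real.cos (a + b) * Real.cos (a + d) - Real.cos (b + d) =
    Real.sin b * Real.sin d - Real.sin (a + b + d) * Real.sin a := by
  simp only [Real.cos_add, Real.sin_add]
  linear_combination (Real.cos b * Real.cos d) * Real.sin_sq_add_cos_sq a

lemma sin_add_mul_sin_add (a b d : ℝ) : Real.sin (a + b) * Real.sin (a + d) =
    Real.sin b * Real.sin d + Real.sin (a + b + d) * Real.sin a := by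
  simp only [Real.cos_add, Real.sin_add]
  linear_combination (Real.sin b * Real.sin d) * Real.sin_sq_add_cos_sq a

namespace Weights

variable (W : Weights)

local notation "H" => UpperHalfPlane.upperHalfPlaneSet

/-! ### The frame of the triangle -/

/-- The cosine of the angle at the image of `1`. -/
def k₁ : ℝ := -Real.cos (Real.pi * (W.t₂ + W.t₃))

/-- The cosine of the angle at the image of `0`. -/
def k₂ : ℝ := -Real.cos (Real.pi * (W.t₂ + W.t₄))

/-- The cosine of the angle at the image of `∞`. -/
def k₃ : ℝ := -Real.cos (Real.pi * (W.t₁ + W.t₂))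

/-- The sine `sin (π t₁)`. -/
def s₁ : ℝ := Real.sin (Real.pi * W.t₁)

/-- The sine `sin (π t₂)`. -/
def s₂ : ℝ := Real.sin (Real.pi * W.t₂)

/-- The sine `sin (π t₃)`. -/
def s₃ : ℝ := Real.sin (Real.pi * W.t₃)

/-- The sine `sin (π t₄)`. -/
def s₄ : ℝ := Real.sin (Real.pi * W.t₄)

lemma s₁_pos : 0 < W.s₁ := sin_pos W.pos₁ W.lt₁

lemma s₂_pos : 0 < W.s₂ := sin_pos W.pos₂ W.lt₂

lemma s₃_pos : 0 < W.s₃ := sin_pos W.pos₃ W.lt₃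

lemma s₄_pos : 0 < W.s₄ := sin_pos W.pos₄ W.lt₄

lemma cos_flip {x y : ℝ} (h : x + y = 2) : Real.cos (Real.pi * x) = Real.cos (Real.pi * y) := by
  rw [show Real.pi * x = 2 * Real.pi - Real.pi * y by rw [← h]; ring, Real.cos_two_pi_sub]

lemma sin_flip {x y : ℝ} (h : x + y = 2) : Real.sin (Real.pi * x) = -Real.sin (Real.pi * y) := by
  rw [show Real.pi * x = 2 * Real.pi - Real.pi * y by rw [← h]; ring, Real.sin_two_pi_sub]

/-- The addition formulas, folded by t₁ + t₂ + t₃ + t₄ = 2, turn this Gram entry into products of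
sines, which are visibly positive. -/
lemma k₁_mul_k₂ : W.k₁ * W.k₂ + W.k₃ = W.s₁ * W.s₂ + W.s₃ * W.s₄ := by
  have h := cos_add_mul_cos_add (Real.pi * W.t₂) (Real.pi * W.t₃) (Real.pi * W.t₄)
  have hs := W.sum
  simp only [← mul_add] at h
  rw [sin_flip (x := W.t₂ + W.t₃ + W.t₄) (y := W.t₁) (by linarith),
    cos_flip (x := W.t₃ + W.t₄) (y := W.t₁ + W.t₂) (by linarith)] at h
  unfold k₁ k₂ k₃ s₁ s₂ s₃ s₄
  linarith

lemma k₁_mul_k₃ : W.k₁ * W.k₃ + W.k₂ = W.s₁ * W.s₃ + W.s₂ * W.s₄ := by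
  have h := cos_add_mul_cos_add (Real.pi * W.t₂) (Real.pi * W.t₃) (Real.pi * W.t₁)
  have hs := W.sum
  simp only [← mul_add] at h
  rw [sin_flip (x := W.t₂ + W.t₃ + W.t₁) (y := W.t₄) (by linarith), cos_flip (x := W.t₃ + W.t₁) (y := W.t₂ + W.t₄)
    (by linarith), add_comm W.t₂ W.t₁] at h
  unfold k₁ k₂ k₃ s₁ s₂ s₃ s₄
  linarith

lemma k₂_mul_k₃ : W.k₂ * W.k₃ + W.k₁ = W.s₁ * W.s₄ + W.s₂ * W.s₃ := by
  have h := cos_add_mul_cos_add (Real.pi * W.t₂) (Real.pi * W.t₄) (Real.pi * W.t₁)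
  have hs := W.sum
  simp only [← mul_add] at h
  rw [sin_flip (x := W.t₂ + W.t₄ + W.t₁) (y := W.t₃) (by linarith), cos_flip (x := W.t₄ + W.t₁) (y := W.t₂ + W.t₃)
    (by linarith), add_comm W.t₂ W.t₁] at h
  unfold k₁ k₂ k₃ s₁ s₂ s₃ s₄
  linarith

/-- The left side is (k₁k₂ + k₃)² - (1 - k₁²)(1 - k₂²), that is (s₁s₂ + s₃s₄)² - (s₃s₄ - s₁s₂)². -/
lemma gram_det : W.k₁ ^ 2 + W.k₂ ^ 2 + W.k₃ ^ 2 + 2 * W.k₁ * W.k₂ * W.k₃ - 1 =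
    4 * (W.s₁ * W.s₂ * W.s₃ * W.s₄) := by
  have h := sin_add_mul_sin_add (Real.pi * W.t₂) (Real.pi * W.t₃) (Real.pi * W.t₄)
  have hs := W.sum
  simp only [← mul_add] at h
  rw [sin_flip (x := W.t₂ + W.t₃ + W.t₄) (y := W.t₁) (by linarith)] at h
  have e1 : Real.sin (Real.pi * (W.t₂ + W.t₃)) ^ 2 = 1 - W.k₁ ^ 2 := by
    rw [Real.sin_sq, k₁]; ring
  have e2 : Real.sin (Real.pi * (W.t₂ + W.t₄)) ^ 2 = 1 - W.k₂ ^ 2 := by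
    rw [Real.sin_sq, k₂]; ring
  have h2 : (1 - W.k₁ ^ 2) * (1 - W.k₂ ^ 2) = (W.s₃ * W.s₄ - W.s₁ * W.s₂) ^ 2 := by
    rw [← e1, ← e2, ← mul_pow, h]
    unfold s₁ s₂ s₃ s₄
    ring
  linear_combination -h2 + (W.k₁ * W.k₂ + W.k₃ + (W.s₁ * W.s₂ + W.s₃ * W.s₄)) * W.k₁_mul_k₂

/-! ### The constants of the normalized periods and the vectors of the vertices. -/

/-- The coefficient `s₁ sin (π (t₂ + t₄))` of the normalized periods. -/
def X : ℝ := W.s₁ * Real.sin (Real.pi * (W.t₂ + W.t₄))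

/-- The coefficient `s₄ sin (π (t₁ + t₂))` of the normalized periods. -/
def Z : ℝ := W.s₄ * Real.sin (Real.pi * (W.t₁ + W.t₂))

/-- The square root of the product of the four sines. -/
def D : ℝ := √(W.s₁ * W.s₂ * W.s₃ * W.s₄)

/-- The coefficient `s₁ s₄ + D` of the normalized periods. -/
def u : ℝ := W.s₁ * W.s₄ + W.D

lemma prod_pos : 0 < W.s₁ * W.s₂ * W.s₃ * W.s₄ :=
  mul_pos (mul_pos (mul_pos W.s₁_pos W.s₂_pos) W.s₃_pos) W.s₄_pos

lemma D_pos : 0 < W.D := Real.sqrt_pos.2 W.prod_pos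

lemma D_sq : W.D ^ 2 = W.s₁ * W.s₂ * W.s₃ * W.s₄ := Real.sq_sqrt W.prod_pos.le

lemma u_pos : 0 < W.u := add_pos (mul_pos W.s₁_pos W.s₄_pos) W.D_pos

lemma X_sq : W.X ^ 2 = W.s₁ ^ 2 * (1 - W.k₂ ^ 2) := by
  rw [X, mul_pow, Real.sin_sq, k₂]; ring

lemma Z_sq : W.Z ^ 2 = W.s₄ ^ 2 * (1 - W.k₃ ^ 2) := by
  rw [Z, mul_pow, Real.sin_sq, k₃]; ring

/-- The product is (s₁s₄)² - D², so the form `Φ` has determinant -D² and is indefinite, which allows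
a map to the half-plane. -/
lemma X_mul_Z : W.X * W.Z = W.u * (W.s₁ * W.s₄ - W.D) := by
  have h := W.sin_identity
  have h2 := W.D_sq
  simp only [X, Z, u]
  simp only [s₁, s₂, s₃, s₄] at *
  linear_combination h2 - Real.sin (Real.pi * W.t₁) * Real.sin (Real.pi * W.t₄) * h

/-- The image of the first coordinate vector, up to multiples of `g₂` and `g₃`. -/
def g₁ : ℝ × ℝ × ℝ := (-(4 * W.D * W.u * (W.s₁ * W.s₄)), 0, 4 * W.D * W.u * (W.s₁ * W.s₄))

/-- The vector of the image of `0`. -/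
def g₂ : ℝ × ℝ × ℝ :=
  (W.s₄ * (W.u ^ 2 + W.X ^ 2), W.s₄ * (W.X ^ 2 - W.u ^ 2), W.s₄ * (W.u ^ 2 + W.X ^ 2))

/-- The vector of the image of `∞`. -/
def g₃ : ℝ × ℝ × ℝ :=
  (W.s₁ * (W.u ^ 2 + W.Z ^ 2), W.s₁ * (W.u ^ 2 - W.Z ^ 2), W.s₁ * (W.u ^ 2 + W.Z ^ 2))

/-- The vector of the image of `1`. -/
def h₁ : ℝ × ℝ × ℝ := W.g₁ + W.k₃ • W.g₂ + W.k₂ • W.g₃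

/-- The scale of the Gram matrix. -/
def gramScale : ℝ := 8 * W.u ^ 2 * (W.s₁ * W.s₄) ^ 2

/-- A combination with coordinates y equals y₁ g₁ + (y₂ + k₃y₁) g₂ + (y₃ + k₂y₁) g₃. The last two
coefficients no longer contain Im(B Ā), so g₁ alone carries that term; it is orthogonal to g₂ and
g₃. -/
lemma gram₁₁ : lorentz W.g₁ W.g₁ = W.gramScale * -(4 * (W.s₁ * W.s₂ * W.s₃ * W.s₄)) := by
  simp only [lorentz, g₁, gramScale]
  linear_combination -(32 * W.u ^ 2 * (W.s₁ * W.s₄) ^ 2) * W.D_sq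

lemma gram₁₂ : lorentz W.g₁ W.g₂ = 0 := by
  simp only [lorentz, g₁, g₂]; ring

lemma gram₁₃ : lorentz W.g₁ W.g₃ = 0 := by
  simp only [lorentz, g₁, g₃]; ring

lemma gram₂₂ : lorentz W.g₂ W.g₂ = W.gramScale * (1 - W.k₂ ^ 2) := by
  simp only [lorentz, g₂, gramScale]
  linear_combination 8 * W.s₄ ^ 2 * W.u ^ 2 * W.X_sq

lemma gram₃₃ : lorentz W.g₃ W.g₃ = W.gramScale * (1 - W.k₃ ^ 2) := by
  simp only [lorentz, g₃, gramScale]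
  linear_combination 8 * W.s₁ ^ 2 * W.u ^ 2 * W.Z_sq

lemma gram₂₃ : lorentz W.g₂ W.g₃ = W.gramScale * (W.k₂ * W.k₃ + W.k₁) := by
  have e : lorentz W.g₂ W.g₃ = 4 * (W.s₁ * W.s₄) * (W.u ^ 4 + (W.X * W.Z) ^ 2) := by
    simp only [lorentz, g₂, g₃]; ring
  have h := W.D_sq
  rw [e, W.X_mul_Z, W.k₂_mul_k₃, gramScale]
  unfold u
  linear_combination 8 * (W.s₁ * W.s₄) * (W.s₁ * W.s₄ + W.D) ^ 2 * h

lemma lorentz_h₁ (x : ℝ × ℝ × ℝ) :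
    lorentz W.h₁ x = lorentz W.g₁ x + W.k₃ * lorentz W.g₂ x + W.k₂ * lorentz W.g₃ x := by
  simp only [lorentz, h₁, Prod.fst_add, Prod.snd_add, Prod.smul_fst, Prod.smul_snd, smul_eq_mul]
  ring

lemma lorentz_h₁_g₂ : lorentz W.h₁ W.g₂ = W.gramScale * (W.k₁ * W.k₂ + W.k₃) := by
  rw [lorentz_h₁, gram₁₂, gram₂₂, lorentz_comm W.g₃, gram₂₃]
  ring

lemma lorentz_h₁_g₃ : lorentz W.h₁ W.g₃ = W.gramScale * (W.k₁ * W.k₃ + W.k₂) := by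
  rw [lorentz_h₁, gram₁₃, gram₂₃, gram₃₃]
  ring

lemma lorentz_h₁_h₁ : lorentz W.h₁ W.h₁ = W.gramScale * (1 - W.k₁ ^ 2) := by
  rw [lorentz_h₁, lorentz_comm W.g₁, lorentz_comm W.g₂, lorentz_comm W.g₃, lorentz_h₁_g₂,
    lorentz_h₁_g₃, lorentz_h₁, gram₁₁, lorentz_comm W.g₂, gram₁₂, lorentz_comm W.g₃, gram₁₃,
    ← W.gram_det]
  ring

lemma gramScale_pos : 0 < W.gramScale := by
  have := W.u_pos
  have := W.s₁_pos
  have := W.s₄_pos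
  unfold gramScale
  positivity

lemma g₂_pos : 0 < W.g₂.2.2 :=
  mul_pos W.s₄_pos (add_pos_of_pos_of_nonneg (pow_pos W.u_pos 2) (sq_nonneg _))

lemma g₃_pos : 0 < W.g₃.2.2 :=
  mul_pos W.s₁_pos (add_pos_of_pos_of_nonneg (pow_pos W.u_pos 2) (sq_nonneg _))

lemma k₁_sq_le : W.k₁ ^ 2 ≤ 1 := by
  rw [k₁, neg_sq]; exact Real.cos_sq_le_one _

lemma k₂_sq_le : W.k₂ ^ 2 ≤ 1 := by
  rw [k₂, neg_sq]; exact Real.cos_sq_le_one _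

lemma k₃_sq_le : W.k₃ ^ 2 ≤ 1 := by
  rw [k₃, neg_sq]; exact Real.cos_sq_le_one _

lemma k₁₂_pos : 0 < W.k₁ * W.k₂ + W.k₃ := by
  rw [k₁_mul_k₂]
  exact add_pos (mul_pos W.s₁_pos W.s₂_pos) (mul_pos W.s₃_pos W.s₄_pos)

lemma k₁₃_pos : 0 < W.k₁ * W.k₃ + W.k₂ := by
  rw [k₁_mul_k₃]
  exact add_pos (mul_pos W.s₁_pos W.s₃_pos) (mul_pos W.s₂_pos W.s₄_pos)

lemma k₂₃_pos : 0 < W.k₂ * W.k₃ + W.k₁ := by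
  rw [k₂_mul_k₃]
  exact add_pos (mul_pos W.s₁_pos W.s₄_pos) (mul_pos W.s₂_pos W.s₃_pos)

/-- A vector in the closed cone that pairs positively with a vector of the forward cone lies in the
forward cone, unless it represents the point at infinity. -/
lemma forward_of_lorentz_pos {x y : ℝ × ℝ × ℝ} (hx : 0 ≤ lorentz x x) (hy : 0 ≤ lorentz y y)
    (hy1 : y.1 = y.2.2) (hy2 : 0 < y.2.2) (hxy : 0 < lorentz x y) (hlt : x.1 < x.2.2) :
    0 < x.2.2 := by
  by_contra! h
  simp only [lorentz] at hx hy hxy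
  rw [hy1] at hy hxy
  have h1 : |2 * x.2.1| ≤ -(x.1 + x.2.2) := by
    refine abs_le_of_sq_le_sq ?_ (by linarith)
    nlinarith [sq_nonneg (x.1 - x.2.2)]
  have h2 : |y.2.1| ≤ y.2.2 := abs_le_of_sq_le_sq (by nlinarith) hy2.le
  have h3 : |2 * x.2.1 * y.2.1| ≤ -(x.1 + x.2.2) * y.2.2 := by
    rw [abs_mul]
    exact mul_le_mul h1 h2 (abs_nonneg _) (by linarith)
  have := neg_le_abs (2 * x.2.1 * y.2.1)
  linarith

/-- The cosines may be negative, so the sign is not visible from the formula. It follows from the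
positive pairing with g₂, and from the first entry being smaller than the last: g₂ and g₃ have equal
outer entries and g₁ does not. -/
lemma h₁_pos : 0 < W.h₁.2.2 := by
  refine forward_of_lorentz_pos (y := W.g₂) ?_ ?_ rfl W.g₂_pos ?_ ?_
  · rw [lorentz_h₁_h₁]
    exact mul_nonneg W.gramScale_pos.le (sub_nonneg.2 W.k₁_sq_le)
  · rw [gram₂₂]
    exact mul_nonneg W.gramScale_pos.le (sub_nonneg.2 W.k₂_sq_le)
  · rw [lorentz_h₁_g₂]
    exact mul_pos W.gramScale_pos W.k₁₂_pos
  · have : 0 < 4 * W.D * W.u * (W.s₁ * W.s₄) :=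
      mul_pos (mul_pos (mul_pos four_pos W.D_pos) W.u_pos) (mul_pos W.s₁_pos W.s₄_pos)
    simp only [h₁, g₁, g₂, g₃, Prod.fst_add, Prod.snd_add, Prod.smul_fst, Prod.smul_snd, smul_eq_mul]
    linarith

lemma tripleDet_frame : tripleDet W.h₁ W.g₂ W.g₃ =
    64 * (W.D * W.u * (W.s₁ * W.s₄)) ^ 2 * (W.u * (W.s₁ * W.s₄)) := by
  have e : tripleDet W.h₁ W.g₂ W.g₃ =
      16 * W.D * W.u * (W.s₁ * W.s₄) ^ 2 * (W.u ^ 4 - (W.X * W.Z) ^ 2) := by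
    simp only [tripleDet, h₁, g₁, g₂, g₃, Prod.fst_add, Prod.snd_add, Prod.smul_fst, Prod.smul_snd,
      smul_eq_mul]
    ring
  rw [e, X_mul_Z]
  unfold u
  ring

/-- The frame of the triangle that is the image of the period map. -/
def frame : KleinFrame where
  f₁ := W.h₁
  f₂ := W.g₂
  f₃ := W.g₃
  k₁ := W.k₁
  k₂ := W.k₂
  k₃ := W.k₃
  scale := W.gramScale
  pos₁ := W.h₁_pos
  pos₂ := W.g₂_pos
  pos₃ := W.g₃_pos
  scale_pos := W.gramScale_pos
  le₁ := W.k₁_sq_le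
  le₂ := W.k₂_sq_le
  le₃ := W.k₃_sq_le
  pos₁₂ := W.k₁₂_pos
  pos₁₃ := W.k₁₃_pos
  pos₂₃ := W.k₂₃_pos
  pos_det := by rw [gram_det]; exact mul_pos four_pos W.prod_pos
  eq₁₁ := W.lorentz_h₁_h₁
  eq₂₂ := W.gram₂₂
  eq₃₃ := W.gram₃₃
  eq₁₂ := W.lorentz_h₁_g₂
  eq₁₃ := W.lorentz_h₁_g₃
  eq₂₃ := W.gram₂₃
  det_ne := by
    have := W.D_pos
    have := W.u_pos
    have := W.s₁_pos
    have := W.s₄_pos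
    rw [tripleDet_frame]
    positivity

lemma arccos_eq {x : ℝ} (h0 : 0 < x) (h2 : x < 2) :
    Real.arccos (-Real.cos (Real.pi * x)) = Real.pi * |1 - x| := by
  have e : -Real.cos (Real.pi * x) = Real.cos (Real.pi * |1 - x|) := by
    rw [← abs_of_pos Real.pi_pos, ← abs_mul, Real.cos_abs, abs_of_pos Real.pi_pos, mul_sub, mul_one,
      Real.cos_pi_sub]
  have h1 : |1 - x| ≤ 1 := abs_le.2 ⟨by linarith, by linarith⟩
  rw [e, Real.arccos_cos (mul_nonneg Real.pi_pos.le (abs_nonneg _))]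
  exact mul_le_of_le_one_right Real.pi_pos.le h1

lemma arccos_k₁ : Real.arccos W.k₁ = Real.pi * |1 - W.t₂ - W.t₃| := by
  have := W.pos₂
  have := W.lt₂
  have := W.pos₃
  have := W.lt₃
  rw [k₁, arccos_eq (by linarith) (by linarith), sub_sub]

lemma arccos_k₂ : Real.arccos W.k₂ = Real.pi * |1 - W.t₁ - W.t₃| := by
  have := W.pos₁
  have := W.lt₁
  have := W.pos₃
  have := W.lt₃
  have := W.sum
  rw [k₂, cos_flip (x := W.t₂ + W.t₄) (y := W.t₁ + W.t₃) (by linarith), arccos_eq (by linarith) (by linarith), sub_sub]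

lemma arccos_k₃ : Real.arccos W.k₃ = Real.pi * |1 - W.t₁ - W.t₂| := by
  have := W.pos₁
  have := W.lt₁
  have := W.pos₂
  have := W.lt₂
  rw [k₃, arccos_eq (by linarith) (by linarith), sub_sub]

end Weights

end AbelianCover

namespace AbelianCover

open Filter

local notation "H" => UpperHalfPlane.upperHalfPlaneSet

/-! ### The Wronskian -/

lemma isPreconnected_upperHalfPlaneSet : IsPreconnected H :=
  (convex_halfSpace_im_gt 0).isPreconnected

lemma IsHypergeometricSolution.hasDerivAt {a b c : ℝ} {f : ℂ → ℂ}
    (hf : IsHypergeometricSolution a b c f) {l : ℂ} (hl : l ∈ H) : HasDerivAt f (deriv f l) l :=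
  (hf.1.differentiableAt (UpperHalfPlane.isOpen_upperHalfPlaneSet.mem_nhds hl)).hasDerivAt

lemma IsHypergeometricSolution.hasDerivAt_deriv {a b c : ℝ} {f : ℂ → ℂ}
    (hf : IsHypergeometricSolution a b c f) {l : ℂ} (hl : l ∈ H) :
    HasDerivAt (deriv f) (deriv (deriv f) l) l :=
  ((hf.1.deriv UpperHalfPlane.isOpen_upperHalfPlaneSet).differentiableAt
    (UpperHalfPlane.isOpen_upperHalfPlaneSet.mem_nhds hl)).hasDerivAt

/-- By Abel's identity, the Wronskian of two solutions vanishes nowhere or everywhere. -/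
lemma IsHypergeometricSolution.wronskian_eq_zero {a b c : ℝ} {f g : ℂ → ℂ}
    (hf : IsHypergeometricSolution a b c f) (hg : IsHypergeometricSolution a b c g) {l₀ l : ℂ}
    (hl₀ : l₀ ∈ H) (hl : l ∈ H) (h : deriv f l₀ * g l₀ - f l₀ * deriv g l₀ = 0) :
    deriv f l * g l - f l * deriv g l = 0 := by
  -- The logarithmic derivative of E is the coefficient of f' in the equation with leading
  -- coefficient 1, so the Wronskian times E is constant.
  set E : ℂ → ℂ := fun l => Complex.exp (c * Complex.log l + (a + b + 1 - c) * Complex.log (1 - l))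
  have hd : ∀ l ∈ H, HasDerivAt (fun l => (deriv f l * g l - f l * deriv g l) * E l) 0 l := by
    intro l hl
    have him : 0 < l.im := hl
    have h0 : l ≠ 0 := ne_zero_of_im him
    have h1 : l - 1 ≠ 0 := fun h => by
      rw [sub_eq_zero.1 h] at him
      simp at him
    have h1' : 1 - l ≠ 0 := fun h => h1 (by linear_combination -h)
    have e1 := (Complex.hasDerivAt_log (Or.inr him.ne')).const_mul (c : ℂ)
    have e2 := (((hasDerivAt_id l).const_sub 1).clog (Or.inr
      (by simpa using him.ne'))).const_mul ((a : ℂ) + b + 1 - c)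
    have e3 := (e1.add e2).cexp
    have e4 := (((hf.hasDerivAt_deriv hl).mul (hg.hasDerivAt hl)).sub
      ((hf.hasDerivAt hl).mul (hg.hasDerivAt_deriv hl))).mul e3
    refine e4.congr_deriv ?_
    have q1 := hf.2 l hl
    have q2 := hg.2 l hl
    have r1 : deriv (deriv f) l =
        -(((a + b + 1) * l - c) * deriv f l + a * b * f l) / (l * (l - 1)) := by
      rw [eq_div_iff (mul_ne_zero h0 h1)]
      linear_combination q1
    have r2 : deriv (deriv g) l =
        -(((a + b + 1) * l - c) * deriv g l + a * b * g l) / (l * (l - 1)) := by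
      rw [eq_div_iff (mul_ne_zero h0 h1)]
      linear_combination q2
    have r3 : (c : ℂ) * l⁻¹ + ((a : ℂ) + b + 1 - c) * (-1 / (1 - l)) =
        ((a + b + 1) * l - c) / (l * (l - 1)) := by
      field_simp
      ring
    simp only [id, Pi.add_apply, Pi.mul_apply, Pi.sub_apply]
    rw [r3, r1, r2]
    ring
  have hc := UpperHalfPlane.isOpen_upperHalfPlaneSet.is_const_of_deriv_eq_zero
    isPreconnected_upperHalfPlaneSet
    (fun l hl => (hd l hl).differentiableAt.differentiableWithinAt) (fun l hl => (hd l hl).deriv)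
    hl hl₀
  simp only [h, zero_mul] at hc
  exact (mul_eq_zero.1 hc).resolve_right (Complex.exp_ne_zero _)

lemma kleinPoint_smul {k : ℝ} (hk : 0 < k) (x : ℝ × ℝ × ℝ) : kleinPoint (k • x) = kleinPoint x := by
  have e : k * x.1 * (k * x.2.2) - (k * x.2.1) ^ 2 = k ^ 2 * (x.1 * x.2.2 - x.2.1 ^ 2) := by ring
  rw [kleinPoint, kleinPoint]
  simp only [Prod.smul_fst, Prod.smul_snd, smul_eq_mul]
  rw [e, Real.sqrt_mul (sq_nonneg k), Real.sqrt_sq hk.le, mul_div_mul_left _ _ hk.ne',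
    mul_div_mul_left _ _ hk.ne']

lemma KleinFrame.continuous_comb (K : KleinFrame) : Continuous K.comb := by
  unfold comb
  fun_prop

lemma KleinFrame.comb_rotate (K : KleinFrame) (x y z : ℝ) :
    K.rotate.comb (y, z, x) = K.comb (x, y, z) := by
  simp only [comb, rotate]
  abel

namespace Weights

variable (W : Weights)

/-! ### The period map -/

/-- The numerator of the normalized period map. -/
def U₁ (l : ℂ) : ℂ := (W.u + W.Z * Complex.I) * W.A l + (W.X + W.u * Complex.I) * W.B l

/-- The denominator of the normalized period map. -/
def U₂ (l : ℂ) : ℂ := (W.u - W.Z * Complex.I) * W.A l + (W.X - W.u * Complex.I) * W.B l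

/-- The normalized period map. -/
def τ (l : ℂ) : ℂ := W.U₁ l / W.U₂ l

lemma isHypergeometricSolution_A :
    IsHypergeometricSolution (W.t₁ + W.t₂ + W.t₃ - 1) W.t₃ (W.t₁ + W.t₃) W.A := by
  have h := isHypergeometricSolution_eulerIntegral W.lt₄ W.lt₂ W.t₃
  have hs := W.sum
  rwa [show 1 - W.t₄ = W.t₁ + W.t₂ + W.t₃ - 1 by linarith,
    show 2 - W.t₄ - W.t₂ = W.t₁ + W.t₃ by linarith] at h

/-- The linear relation expresses B through A and C, and C is a reflected Euler integral. This
avoids differentiating the factor (-l)^(-t₃). -/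
lemma isHypergeometricSolution_B :
    IsHypergeometricSolution (W.t₁ + W.t₂ + W.t₃ - 1) W.t₃ (W.t₁ + W.t₃) W.B := by
  have h := isHypergeometricSolution_eulerIntegral_reflect W.lt₄ W.lt₁ W.t₃
  have hs := W.sum
  rw [show 1 - W.t₄ = W.t₁ + W.t₂ + W.t₃ - 1 by linarith, add_comm W.t₃] at h
  set e₂ := Complex.exp (Real.pi * W.t₂ * Complex.I) with he₂
  have he : e₂ ≠ 0 := Complex.exp_ne_zero _
  refine (W.isHypergeometricSolution_A.linear h (-e₂⁻¹)
    (-e₂⁻¹ * (Complex.exp (Real.pi * (W.t₁ + W.t₂) * Complex.I) *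
      Complex.exp (Real.pi * W.t₃ * Complex.I)))).congr fun l hl => ?_
  have h2 := W.relation hl
  rw [← he₂, C] at h2
  have : W.B l = e₂⁻¹ * (e₂ * W.B l) := by rw [inv_mul_cancel_left₀ he]
  rw [this]
  linear_combination e₂⁻¹ * h2

lemma isHypergeometricSolution_U₁ :
    IsHypergeometricSolution (W.t₁ + W.t₂ + W.t₃ - 1) W.t₃ (W.t₁ + W.t₃) W.U₁ :=
  W.isHypergeometricSolution_A.linear W.isHypergeometricSolution_B _ _

lemma isHypergeometricSolution_U₂ :
    IsHypergeometricSolution (W.t₁ + W.t₂ + W.t₃ - 1) W.t₃ (W.t₁ + W.t₃) W.U₂ :=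
  W.isHypergeometricSolution_A.linear W.isHypergeometricSolution_B _ _

lemma u_sub : W.u - W.s₁ * W.s₄ - W.D = 0 := by
  unfold u; ring

/-- The homogeneous coordinates of the period map in the Klein model. -/
lemma comb_y {l : ℂ} (hl : 0 < l.im) : W.frame.comb (W.y₁ l, W.y₂ l, W.y₃ l) = (W.s₁ * W.s₄) •
    (Complex.normSq (W.U₁ l), (W.U₁ l * conj (W.U₂ l)).re, Complex.normSq (W.U₂ l)) := by
  have hX := W.X_mul_Z
  have hu := W.u_sub
  -- These combinations eliminate Im(B Ā); the rest is a polynomial identity that needs only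
  -- `X_mul_Z` and the definition of u.
  have e2 : W.s₄ * (W.y₂ l + W.k₃ * W.y₁ l) = W.s₁ * W.s₄ * Complex.normSq (W.B l) +
      W.Z * (W.B l * conj (W.A l)).re := by
    rw [W.y₂_eq hl, k₃, Z, s₁]; ring
  have e3 : W.s₁ * (W.y₃ l + W.k₂ * W.y₁ l) = W.s₁ * W.s₄ * Complex.normSq (W.A l) +
      W.X * (W.B l * conj (W.A l)).re := by
    rw [W.y₃_eq hl, k₂, X, s₄]; ring
  have e1 : W.y₁ l = (W.B l * conj (W.A l)).im := rfl
  rw [e1] at e2 e3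
  simp only [KleinFrame.comb, frame, h₁, g₁, g₂, g₃, U₁, U₂, e1]
  simp only [Complex.normSq_apply, Complex.mul_re, Complex.mul_im, Complex.conj_re, Complex.conj_im,
    Complex.add_re, Complex.add_im, Complex.sub_re, Complex.sub_im, Complex.ofReal_re,
    Complex.ofReal_im, Complex.I_re, Complex.I_im] at *
  generalize (W.A l).re = a at *
  generalize (W.A l).im = a' at *
  generalize (W.B l).re = b at *
  generalize (W.B l).im = b' at *
  refine Prod.ext ?_ (Prod.ext ?_ ?_)
  · simp only [Prod.fst_add, Prod.smul_fst, smul_eq_mul]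
    linear_combination (W.u ^ 2 + W.X ^ 2) * e2 + (W.u ^ 2 + W.Z ^ 2) * e3 +
      ((b * a + b' * a') * (W.X + W.Z) - 2 * (W.s₁ * W.s₄) * (b' * a - b * a')) * hX +
      W.u * ((b * a + b' * a') * (W.X + W.Z) + 2 * (W.s₁ * W.s₄) * (b' * a - b * a')) * hu
  · simp only [Prod.fst_add, Prod.snd_add, Prod.smul_fst, Prod.smul_snd, smul_eq_mul]
    linear_combination (W.X ^ 2 - W.u ^ 2) * e2 + (W.u ^ 2 - W.Z ^ 2) * e3 +
      (b * a + b' * a') * (W.X - W.Z) * hX + W.u * (b * a + b' * a') * (W.X - W.Z) * hu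
  · simp only [Prod.snd_add, Prod.smul_snd, smul_eq_mul]
    linear_combination (W.u ^ 2 + W.X ^ 2) * e2 + (W.u ^ 2 + W.Z ^ 2) * e3 +
      ((b * a + b' * a') * (W.X + W.Z) + 2 * (W.s₁ * W.s₄) * (b' * a - b * a')) * hX +
      W.u * ((b * a + b' * a') * (W.X + W.Z) - 2 * (W.s₁ * W.s₄) * (b' * a - b * a')) * hu

/-- By `comb_y`, |U₂|² is up to a positive factor the last entry of a positive combination of
forward vectors. -/
lemma U₂_ne_zero {l : ℂ} (hl : 0 < l.im) : W.U₂ l ≠ 0 := by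
  have h := W.frame.comb_pos (y := (W.y₁ l, W.y₂ l, W.y₃ l)) (W.y₁_pos hl) (W.y₂_pos hl)
    (W.y₃_pos hl)
  rw [W.comb_y hl] at h
  exact Complex.normSq_pos.1 ((pos_iff_pos_of_mul_pos h).1 (mul_pos W.s₁_pos W.s₄_pos))

/-- The Hermitian form whose sign is that of the imaginary part of the period map. -/
def Φ (l : ℂ) : ℝ := W.X * Complex.normSq (W.B l) +
  2 * (W.s₁ * W.s₄) * (W.B l * conj (W.A l)).re + W.Z * Complex.normSq (W.A l)

lemma im_U (l : ℂ) : (W.U₁ l * conj (W.U₂ l)).im = 2 * W.u * W.Φ l := by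
  have hX := W.X_mul_Z
  have hu := W.u_sub
  simp only [U₁, U₂, Φ, Complex.normSq_apply, Complex.mul_re, Complex.mul_im, Complex.conj_re,
    Complex.conj_im, Complex.add_re, Complex.add_im, Complex.sub_re, Complex.sub_im,
    Complex.ofReal_re, Complex.ofReal_im, Complex.I_re, Complex.I_im]
  linear_combination 2 * ((W.B l).re * (W.A l).re + (W.B l).im * (W.A l).im) * hX +
    2 * W.u * ((W.B l).re * (W.A l).re + (W.B l).im * (W.A l).im) * hu

/-- The Lorentz square of the combination is positive, and it is a multiple of the square of Im(U₁
Ū₂), hence of Φ². -/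
lemma Φ_ne_zero {l : ℂ} (hl : 0 < l.im) : W.Φ l ≠ 0 := fun h => by
  have h1 := W.frame.lorentz_comb_pos (y := (W.y₁ l, W.y₂ l, W.y₃ l)) (W.y₁_pos hl) (W.y₂_pos hl)
    (W.y₃_pos hl)
  have h2 : lorentz (W.frame.comb (W.y₁ l, W.y₂ l, W.y₃ l))
      (W.frame.comb (W.y₁ l, W.y₂ l, W.y₃ l)) =
      2 * (W.s₁ * W.s₄) ^ 2 * (W.U₁ l * conj (W.U₂ l)).im ^ 2 := by
    rw [W.comb_y hl]
    simp only [lorentz, Prod.smul_fst, Prod.smul_snd, smul_eq_mul, Complex.normSq_apply,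
      Complex.mul_re, Complex.mul_im, Complex.conj_re, Complex.conj_im]
    ring
  rw [h2, im_U, h] at h1
  simp at h1

/-- Φ has no zero on the connected half-plane, so its sign can be read off near -1. There it tends
to a combination with positive coefficients of the limits of y₂ and y₃, which are nonnegative and
not both zero. -/
lemma Φ_pos {l : ℂ} (hl : 0 < l.im) : 0 < W.Φ l := by
  have hH : ∀ x : ℝ, ∀ᶠ l in 𝓝[H] (x : ℂ), l ∈ H := fun x => self_mem_nhdsWithin
  have hcont : ContinuousOn W.Φ H := by
    have hA := W.isHypergeometricSolution_A.1.continuousOn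
    have hB := W.isHypergeometricSolution_B.1.continuousOn
    have hn := Complex.continuous_normSq
    unfold Φ
    exact ((continuousOn_const.mul (hn.comp_continuousOn hB)).add (continuousOn_const.mul
      (Complex.continuous_re.comp_continuousOn
        (hB.mul (Complex.continuous_conj.comp_continuousOn hA))))).add
      (continuousOn_const.mul (hn.comp_continuousOn hA))
  obtain ⟨a, b, L₂, L₃, ha, hb, hL, hL₂, hL₃, e₂, e₃, hA, hB, -⟩ :=
    W.tendsto_total (x := -1) (by norm_num)
  have hlim : Tendsto W.Φ (𝓝 ((-1 : ℝ) : ℂ))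
      (𝓝 (W.X * b ^ 2 + 2 * (W.s₁ * W.s₄) * (b * a) + W.Z * a ^ 2)) := by
    have h1 := (Complex.continuous_normSq.tendsto _).comp hA
    have h2 := (Complex.continuous_normSq.tendsto _).comp hB
    have h3 := (Complex.continuous_re.tendsto _).comp
      (hB.mul ((Complex.continuous_conj.tendsto _).comp hA))
    have h4 := ((h2.const_mul W.X).add (h3.const_mul (2 * (W.s₁ * W.s₄)))).add (h1.const_mul W.Z)
    rw [Complex.normSq_ofReal, Complex.normSq_ofReal, Complex.conj_ofReal, ← Complex.ofReal_mul,
      Complex.ofReal_re, ← sq, ← sq] at h4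
    exact h4
  have hpos : 0 < W.X * b ^ 2 + 2 * (W.s₁ * W.s₄) * (b * a) + W.Z * a ^ 2 := by
    have e : W.X * b ^ 2 + 2 * (W.s₁ * W.s₄) * (b * a) + W.Z * a ^ 2 =
        W.s₁ * b / a * L₃ + W.s₄ * a / b * L₂ := by
      rw [e₂, e₃, X, Z, ← s₁, ← s₄]
      field_simp
      ring
    have c1 : 0 < W.s₁ * b / a := div_pos (mul_pos W.s₁_pos hb) ha
    have c2 : 0 < W.s₄ * a / b := div_pos (mul_pos W.s₄_pos ha) hb
    rw [e]
    rcases hL₂.eq_or_lt with h | h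
    · have : 0 < L₃ := by linarith
      exact add_pos_of_pos_of_nonneg (mul_pos c1 this) (mul_nonneg c2.le hL₂)
    · exact add_pos_of_nonneg_of_pos (mul_nonneg c1.le hL₃) (mul_pos c2 h)
  obtain ⟨l₁, hl₁, hΦ₁⟩ := ((hH (-1)).and
    ((hlim.mono_left nhdsWithin_le_nhds).eventually_const_lt hpos)).exists
  by_contra! hle
  obtain ⟨l₂, hl₂, h⟩ := isPreconnected_upperHalfPlaneSet.intermediate_value hl hl₁ hcont
    ⟨hle, hΦ₁.le⟩
  exact W.Φ_ne_zero hl₂ h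

/-- The period map in barycentric coordinates. -/
lemma τ_eq {l : ℂ} (hl : 0 < l.im) : W.τ l = kleinPoint (W.frame.comb (W.p₁ l, W.p₂ l, W.p₃ l)) := by
  have ht := W.total_pos hl
  have e : W.frame.comb (W.y₁ l, W.y₂ l, W.y₃ l) =
      W.total l • W.frame.comb (W.p₁ l, W.p₂ l, W.p₃ l) := by
    simp only [KleinFrame.comb, smul_add, smul_smul, p₁, p₂, p₃, mul_div_cancel₀ _ ht.ne']
  rw [← kleinPoint_smul ht, ← e, W.comb_y hl, kleinPoint_smul (mul_pos W.s₁_pos W.s₄_pos), τ,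
    div_eq_kleinPoint (W.U₂_ne_zero hl)]
  rw [im_U]
  exact mul_pos (mul_pos two_pos W.u_pos) (W.Φ_pos hl)

lemma p_pos {l : ℂ} (hl : 0 < l.im) : 0 < W.p₁ l ∧ 0 < W.p₂ l ∧ 0 < W.p₃ l :=
  ⟨div_pos (W.y₁_pos hl) (W.total_pos hl), div_pos (W.y₂_pos hl) (W.total_pos hl),
    div_pos (W.y₃_pos hl) (W.total_pos hl)⟩

/-- The vertex that is the image of `0`. -/
def v₀ : ℂ := kleinPoint W.g₂

/-- The vertex that is the image of `1`. -/
def v₁ : ℂ := kleinPoint W.h₁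

/-- The vertex that is the image of `∞`. -/
def v₂ : ℂ := kleinPoint W.g₃

lemma tendsto_τ {F : Filter ℂ} {x y z : ℝ} (hF : ∀ᶠ l in F, l ∈ H) (h1 : Tendsto W.p₁ F (𝓝 x))
    (h2 : Tendsto W.p₂ F (𝓝 y)) (h3 : Tendsto W.p₃ F (𝓝 z))
    (hc : (W.frame.comb (x, y, z)).2.2 ≠ 0) :
    Tendsto W.τ F (𝓝 (kleinPoint (W.frame.comb (x, y, z)))) := by
  have h := (continuousAt_kleinPoint hc).tendsto.comp
    ((W.frame.continuous_comb.tendsto (x, y, z)).comp (h1.prodMk_nhds (h2.prodMk_nhds h3)))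
  exact h.congr' (hF.mono fun l hl => (W.τ_eq hl).symm)

lemma tendsto_τ_zero : Tendsto W.τ (𝓝[H] 0) (𝓝 W.v₀) := by
  obtain ⟨h1, h2, h3⟩ := W.tendsto_p_zero
  have e : W.frame.comb (0, 1, 0) = W.g₂ := by simp [KleinFrame.comb, frame]
  rw [v₀, ← e]
  exact W.tendsto_τ self_mem_nhdsWithin h1 h2 h3 (by rw [e]; exact W.g₂_pos.ne')

lemma tendsto_τ_one : Tendsto W.τ (𝓝[H] 1) (𝓝 W.v₁) := by
  obtain ⟨h1, h2, h3⟩ := W.tendsto_p_one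
  have e : W.frame.comb (1, 0, 0) = W.h₁ := by simp [KleinFrame.comb, frame]
  rw [v₁, ← e]
  exact W.tendsto_τ self_mem_nhdsWithin h1 h2 h3 (by rw [e]; exact W.h₁_pos.ne')

lemma tendsto_τ_infty : Tendsto W.τ (Bornology.cobounded ℂ ⊓ 𝓟 H) (𝓝 W.v₂) := by
  obtain ⟨h1, h2, h3⟩ := W.tendsto_p_infty
  have e : W.frame.comb (0, 0, 1) = W.g₃ := by simp [KleinFrame.comb, frame]
  rw [v₂, ← e]
  exact W.tendsto_τ (mem_inf_of_right (mem_principal_self _)) h1 h2 h3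
    (by rw [e]; exact W.g₃_pos.ne')

/-- The period map is not constant. -/
lemma v₁_ne_v₀ : W.v₁ ≠ W.v₀ := W.frame.vertex_ne

/-- A linear dependence with nonzero coefficient of U₁ would make τ constant, but its limits at 0
and 1 are distinct vertices. -/
lemma isSchwarzMap_τ : IsSchwarzMap (W.t₁ + W.t₂ + W.t₃ - 1) W.t₃ (W.t₁ + W.t₃) W.τ := by
  refine ⟨W.U₁, W.U₂, W.isHypergeometricSolution_U₁, W.isHypergeometricSolution_U₂,
    fun x y h => ?_, fun l hl => ⟨W.U₂_ne_zero hl, rfl⟩⟩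
  have h1 : ∀ l ∈ H, x * W.τ l + y = 0 := fun l hl => by
    have := W.U₂_ne_zero hl
    rw [τ, mul_div_assoc', div_add' _ _ _ this, h l hl, zero_div]
  have h2 : ∀ {r : ℝ} {v : ℂ}, Tendsto W.τ (𝓝[H] (r : ℂ)) (𝓝 v) → x * v + y = 0 := fun {r} {v} hv =>
    tendsto_nhds_unique ((hv.const_mul x).add_const y) (tendsto_const_nhds.congr'
      (eventually_mem_nhdsWithin.mono fun l hl => (h1 l hl).symm))
  have e0 := h2 (r := 0) (by simpa using W.tendsto_τ_zero)
  have e1 := h2 (r := 1) (by simpa using W.tendsto_τ_one)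
  have hx : x * (W.v₁ - W.v₀) = 0 := by linear_combination e1 - e0
  have hx0 : x = 0 := (mul_eq_zero.1 hx).resolve_right (sub_ne_zero.2 W.v₁_ne_v₀)
  exact ⟨hx0, by simpa [hx0] using e0⟩

/-! ### The period map is a proper local biholomorphism onto the triangle. -/

lemma hasDerivAt_τ {l : ℂ} (hl : l ∈ H) : HasDerivAt W.τ
    ((deriv W.U₁ l * W.U₂ l - W.U₁ l * deriv W.U₂ l) / W.U₂ l ^ 2) l :=
  (W.isHypergeometricSolution_U₁.hasDerivAt hl).div (W.isHypergeometricSolution_U₂.hasDerivAt hl)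
    (W.U₂_ne_zero hl)

lemma differentiableOn_τ : DifferentiableOn ℂ W.τ H := fun _ hl =>
  (W.hasDerivAt_τ hl).differentiableAt.differentiableWithinAt

/-- The numerator of τ' is the Wronskian. If it vanished once, it would vanish everywhere and τ
would be constant, against the distinct limits at 0 and 1. -/
lemma deriv_τ_ne_zero {l : ℂ} (hl : l ∈ H) : deriv W.τ l ≠ 0 := fun h => by
  rw [(W.hasDerivAt_τ hl).deriv, div_eq_zero_iff] at h
  replace h := h.resolve_right (pow_ne_zero 2 (W.U₂_ne_zero hl))
  have h0 : ∀ l' ∈ H, deriv W.τ l' = 0 := fun l' hl' => by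
    rw [(W.hasDerivAt_τ hl').deriv, W.isHypergeometricSolution_U₁.wronskian_eq_zero
      W.isHypergeometricSolution_U₂ hl hl' h, zero_div]
  have hconst : ∀ l' ∈ H, W.τ l' = W.τ l := fun l' hl' =>
    UpperHalfPlane.isOpen_upperHalfPlaneSet.is_const_of_deriv_eq_zero
      isPreconnected_upperHalfPlaneSet W.differentiableOn_τ h0 hl' hl
  have h2 : ∀ {r : ℝ} {v : ℂ}, Tendsto W.τ (𝓝[H] (r : ℂ)) (𝓝 v) → v = W.τ l := fun {r} {v} hv =>
    tendsto_nhds_unique hv (tendsto_const_nhds.congr'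
      (eventually_mem_nhdsWithin.mono fun l' hl' => (hconst l' hl').symm))
  have e0 := h2 (r := 0) (by simpa using W.tendsto_τ_zero)
  have e1 := h2 (r := 1) (by simpa using W.tendsto_τ_one)
  exact W.v₁_ne_v₀ (e1.trans e0.symm)

lemma mapsTo_τ : Set.MapsTo W.τ H (hyperbolicTriangle W.v₀ W.v₁ W.v₂) := fun l hl => by
  obtain ⟨h1, h2, h3⟩ := W.p_pos hl
  rw [W.τ_eq hl]
  exact W.frame.kleinPoint_comb_mem h1 h2 h3

/-- On the preimage of a compact subset of the triangle the barycentric coordinates are bounded from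
below. -/
lemma exists_coordinate_bound {S : Set ℂ} (hS : S ⊆ hyperbolicTriangle W.v₀ W.v₁ W.v₂)
    (hc : IsCompact S) : ∃ ε : ℝ, 0 < ε ∧
      ∀ l ∈ H ∩ W.τ ⁻¹' S, ε ≤ W.p₁ l ∧ ε ≤ W.p₂ l ∧ ε ≤ W.p₃ l := by
  have hm : ∀ z ∈ S, _ := fun z hz => W.frame.mem_triangle_iff.1 (hS hz)
  obtain ⟨ε₁, h₁, H₁⟩ := W.frame.exists_coordinate_bound hc fun z hz => (hm z hz).2.1
  obtain ⟨ε₂, h₂, H₂⟩ := W.frame.rotate.exists_coordinate_bound hc fun z hz => (hm z hz).2.2.1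
  obtain ⟨ε₃, h₃, H₃⟩ := W.frame.rotate.rotate.exists_coordinate_bound hc fun z hz =>
    (hm z hz).2.2.2
  refine ⟨min ε₁ (min ε₂ ε₃), lt_min h₁ (lt_min h₂ h₃), fun l ⟨hl, hlS⟩ => ?_⟩
  obtain ⟨p1, p2, p3⟩ := W.p_pos hl
  have hs := W.p_sum hl
  rw [Set.mem_preimage, W.τ_eq hl] at hlS
  refine ⟨(min_le_left _ _).trans (H₁ _ p1 p2 p3 hs hlS),
    ((min_le_right _ _).trans (min_le_left _ _)).trans
      (H₂ (W.p₂ l, W.p₃ l, W.p₁ l) p2 p3 p1 (by rw [← hs]; ring) ?_),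
    ((min_le_right _ _).trans (min_le_right _ _)).trans
      (H₃ (W.p₃ l, W.p₁ l, W.p₂ l) p3 p1 p2 (by rw [← hs]; ring) ?_)⟩
  · rwa [KleinFrame.comb_rotate]
  · rwa [KleinFrame.comb_rotate, KleinFrame.comb_rotate]

/-- On the preimage the coordinates stay above some ε > 0. At every real boundary point some
coordinate tends to zero, and at infinity the first one does, so the preimage accumulates at
neither. -/
lemma isCompact_preimage_τ {S : Set ℂ} (hS : S ⊆ hyperbolicTriangle W.v₀ W.v₁ W.v₂)
    (hc : IsCompact S) : IsCompact (H ∩ W.τ ⁻¹' S) := by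
  obtain ⟨ε, hε, hb⟩ := W.exists_coordinate_bound hS hc
  refine Metric.isCompact_of_isClosed_isBounded (isClosed_of_closure_subset fun x hx => ?_) ?_
  · have hne : (𝓝[H ∩ W.τ ⁻¹' S] x).NeBot := mem_closure_iff_nhdsWithin_neBot.1 hx
    have hmem : ∀ᶠ l in 𝓝[H ∩ W.τ ⁻¹' S] x, l ∈ H ∩ W.τ ⁻¹' S := self_mem_nhdsWithin
    have hle : 𝓝[H ∩ W.τ ⁻¹' S] x ≤ 𝓝[H] x := nhdsWithin_mono _ Set.inter_subset_left
    have him : 0 ≤ x.im := ge_of_tendsto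
      ((Complex.continuous_im.tendsto x).mono_left nhdsWithin_le_nhds)
      (hmem.mono fun l hl => le_of_lt hl.1)
    rcases him.eq_or_lt with h0 | hpos
    · exfalso
      have ex : ((x.re : ℝ) : ℂ) = x := Complex.ext rfl h0
      rcases W.exists_tendsto_p_real x.re with h | h | h <;> rw [ex] at h
      · exact absurd (ge_of_tendsto (h.mono_left hle) (hmem.mono fun l hl => (hb l hl).1))
          (not_le.2 hε)
      · exact absurd (ge_of_tendsto (h.mono_left hle) (hmem.mono fun l hl => (hb l hl).2.1))
          (not_le.2 hε)
      · exact absurd (ge_of_tendsto (h.mono_left hle) (hmem.mono fun l hl => (hb l hl).2.2))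
          (not_le.2 hε)
    · exact ⟨hpos, hc.isClosed.mem_of_tendsto
        ((W.hasDerivAt_τ hpos).continuousAt.tendsto.mono_left nhdsWithin_le_nhds)
        (hmem.mono fun l hl => hl.2)⟩
  · have h := W.tendsto_p_infty.1.eventually_lt_const hε
    rw [eventually_inf_principal] at h
    rw [← Bornology.isCobounded_compl_iff]
    refine mem_of_superset h fun l hl hlS => ?_
    exact absurd (hl hlS.1) (not_lt.2 (hb l hlS).1)

theorem isBiholomorphic_τ : IsBiholomorphic W.τ H (hyperbolicTriangle W.v₀ W.v₁ W.v₂) := by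
  have hI : Complex.I ∈ H := by change 0 < Complex.I.im; simp
  have : SimplyConnectedSpace (hyperbolicTriangle W.v₀ W.v₁ W.v₂) :=
    simplyConnectedSpace_hyperbolicTriangle ⟨_, W.mapsTo_τ hI⟩
  exact isBiholomorphic_of_proper UpperHalfPlane.isOpen_upperHalfPlaneSet
    (isOpen_hyperbolicTriangle _ _ _) isPreconnected_upperHalfPlaneSet ⟨_, hI⟩ W.differentiableOn_τ
    (fun _ hl => W.deriv_τ_ne_zero hl) W.mapsTo_τ fun _ hS hc => W.isCompact_preimage_τ hS hc

lemma hyperbolicAngle_comm (p q s : ℂ) : hyperbolicAngle p q s = hyperbolicAngle p s q :=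
  InnerProductGeometry.angle_comm _ _

lemma hyperbolicAngle_v₀ : hyperbolicAngle W.v₀ W.v₁ W.v₂ = Real.pi * |1 - W.t₁ - W.t₃| := by
  rw [← W.arccos_k₂, hyperbolicAngle_comm]
  exact W.frame.rotate.angle_eq

lemma hyperbolicAngle_v₁ : hyperbolicAngle W.v₁ W.v₂ W.v₀ = Real.pi * |1 - W.t₂ - W.t₃| := by
  rw [← W.arccos_k₁, hyperbolicAngle_comm]
  exact W.frame.angle_eq

lemma hyperbolicAngle_v₂ : hyperbolicAngle W.v₂ W.v₀ W.v₁ = Real.pi * |1 - W.t₁ - W.t₂| := by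
  rw [← W.arccos_k₃, hyperbolicAngle_comm]
  exact W.frame.rotate.rotate.angle_eq

end Weights

end AbelianCover

end

/-! ### Assembly of the theorem. -/

theorem propositionP {N m : ℕ} [NeZero N] (A : Matrix (Fin m) (Fin 4) (ZMod N))
    (hA : ∀ i, ∑ j, A i j = 0)
    (r : Fin 4 → ZMod N) (hr : r ∈ rowSpan A) (hr0 : r ≠ 0)
    (htneg : tSum (-r) = 2) (htpos : tSum r = 2)
    (y₀ : ℂ × ℂ × (Fin m → ℂ)) (hy₀ : y₀ ∈ equationLocus A)
    (t₁ t₂ t₃ : ℝ) (ht₁ : t₁ = tPart (-r) 0) (ht₂ : t₂ = tPart (-r) 1)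
    (ht₃ : t₃ = tPart (-r) 2) :
    ∃ (α β : ∀ l : ℍ, H1 (cover A y₀ l)) (τ : ℂ → ℂ) (v₀ v₁ v₂ : ℂ),
      IsFlat α ∧ IsFlat β ∧ IsPeriodMap A y₀ r α β τ ∧
      IsSchwarzMap (t₁ + t₂ + t₃ - 1) t₃ (t₁ + t₃) τ ∧
      0 ≤ v₀.im ∧ 0 ≤ v₁.im ∧ 0 ≤ v₂.im ∧
      IsBiholomorphic τ UpperHalfPlane.upperHalfPlaneSet (hyperbolicTriangle v₀ v₁ v₂) ∧
      Filter.Tendsto τ (𝓝[UpperHalfPlane.upperHalfPlaneSet] 0) (𝓝 v₀) ∧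
      Filter.Tendsto τ (𝓝[UpperHalfPlane.upperHalfPlaneSet] 1) (𝓝 v₁) ∧
      Filter.Tendsto τ
        (Bornology.cobounded ℂ ⊓ Filter.principal UpperHalfPlane.upperHalfPlaneSet) (𝓝 v₂) ∧
      hyperbolicAngle v₀ v₁ v₂ = Real.pi * |1 - t₁ - t₃| ∧
      hyperbolicAngle v₁ v₂ v₀ = Real.pi * |1 - t₂ - t₃| ∧
      hyperbolicAngle v₂ v₀ v₁ = Real.pi * |1 - t₁ - t₂| := by
  subst ht₁ ht₂ ht₃
  obtain ⟨hpos, α, β, hα, hβ, hp⟩ := exists_flat_periods hr htneg htpos hy₀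
  set W : Weights :=
    { t₁ := tPart (-r) 0
      t₂ := tPart (-r) 1
      t₃ := tPart (-r) 2
      t₄ := tPart (-r) 3
      pos₁ := hpos 0
      pos₂ := hpos 1
      pos₃ := hpos 2
      pos₄ := hpos 3
      lt₁ := tPart_lt_one 0
      lt₂ := tPart_lt_one 1
      lt₃ := tPart_lt_one 2
      lt₄ := tPart_lt_one 3
      sum := by rw [← htneg, tSum, Fin.sum_univ_four] } with hW
  -- The two classes are combined with the coefficients of U₁ and U₂, so their periods are k U₁ and
  -- k U₂ with the same nonzero k, which cancels.
  refine ⟨fun l => (W.u + W.Z * Complex.I : ℂ) • α l + (W.X + W.u * Complex.I : ℂ) • β l,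
    fun l => (W.u - W.Z * Complex.I : ℂ) • α l + (W.X - W.u * Complex.I : ℂ) • β l, W.τ,
    W.v₀, W.v₁, W.v₂, hα.add_smul hβ _ _, hα.add_smul hβ _ _, fun l => ⟨(hp l).1, fun η hη h0 => ?_⟩,
    W.isSchwarzMap_τ, kleinPoint_im_nonneg W.g₂_pos, kleinPoint_im_nonneg W.h₁_pos,
    kleinPoint_im_nonneg W.g₃_pos, W.isBiholomorphic_τ, W.tendsto_τ_zero, W.tendsto_τ_one,
    W.tendsto_τ_infty, W.hyperbolicAngle_v₀, W.hyperbolicAngle_v₁, W.hyperbolicAngle_v₂⟩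
  obtain ⟨k, hk, h1, h2⟩ := (hp l).2 η hη h0
  have e : ∀ x y : ℂ, x * (k * W.A l) + y * (k * W.B l) = k * (x * W.A l + y * W.B l) :=
    fun x y => by ring
  refine ⟨_, _, h1.add_smul h2 _ _, h1.add_smul h2 _ _, ?_, ?_⟩
  · exact (e _ _).trans_ne (mul_ne_zero hk (W.U₂_ne_zero l.im_pos))
  · refine Eq.trans ?_ (congrArg₂ (· / ·) (e _ _) (e _ _)).symm
    exact (mul_div_mul_left _ _ hk).symm
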